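/- **Conventions.** 2-categories are strict. A strict monoidal 2-category $(\mathcal M,\otimes,I)$ is a 2-category with a strictly associative and strictly unital product 2-functor $\otimes$, written as juxtaposition; "." denotes composition of 1-cells and horizontal composition of 2-cells, and $1$ denotes identities. A symmetry is a 2-natural transformation $\sigma_{A,B}:AB\to BA$ with $\sigma_{B,A}.\sigma_{A,B}=1$ and $\sigma_{A,BC}=(1\sigma_{A,C}).(\sigma_{A,B}1)$. Let $\mathsf{sm}\text{-}\mathsf{2Cat}$ be the 2-category of small symmetric strict monoidal 2-categories, symmetric strict monoidal 2-functors and monoidal 2-natural transformations ($\Theta_{AB}=\Theta_A\Theta_B$, $\Theta_I=1$). Let $\mathcal M$ be an object of it. A pseudomonoid in $\mathcal M$ is $(A,m:AA\to A,u:I\to A,\alpha,\lambda,\varrho)$ with invertible 2-cells $\alpha:m.m1\to m.1m$, $\lambda:m.u1\to 1$, $\varrho:m.1u\to 1$ satisfying the pentagon and triangle conditions. An opmonoidal 1-cell $(f,\varphi^2,\varphi^0)$ from a pseudomonoid on $A$ to one on $A'$ is a 1-cell $f:A\to A'$ with 2-cells $\varphi^2:f.m\to m'.ff$ and $\varphi^0:f.u\to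 u'$ that satisfy the usual coassociativity and counitality conditions; an opmonoidal 2-cell is a 2-cell compatible with these. Monoidal 1-cells $(f,\varphi_2:m'.ff\to f.m,\varphi_0:u'\to f.u)$ and monoidal 2-cells are defined dually (reversing 2-cells). The 2-endofunctor $(-)_{01}$ of $\mathsf{sm}\text{-}\mathsf{2Cat}$ sends $\mathcal M$ to the 2-category $\mathcal M_{01}$ of pseudomonoids, opmonoidal 1-cells and opmonoidal 2-cells in $\mathcal M$. Its monoidal product sends pseudomonoids on $A$ and $A'$ to $(AA',mm'.1\sigma 1,uu',\alpha\alpha'.1,\lambda\lambda',\varrho\varrho')$, 1-cells to $(fg,\varphi^2\gamma^2.1\sigma1,\varphi^0\gamma^0)$ and 2-cells to their product in $\mathcal M$; its unit is $(I,1,1,1,1,1)$ and its symmetry is $(\sigma,1,1)$. A 2-functor $\mathsf F$ is sent to $\mathsf F_{01}$, which applies $\mathsf F$ to all the data, and $\Theta$ is sent to $\Theta_{01}$ with components $(\Theta_A,1,1)$. With $(-)^{co}$ denoting the reversal of 2-cells, put $\mathcal M_{10}=((\mathcal M^{co})_{01})^{co}$, and likewise on 2-functors and transformations. Its 0-cells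 are again the pseudomonoids in $\mathcal M$ (by inverting $\alpha,\lambda,\varrho$), and its 1- and 2-cells are the monoidal ones. A *duoidal object* of $\mathcal M$ consists of two pseudomonoids $v=(A,m_v,u_v,\alpha_v,\lambda_v,\varrho_v)$ and $h=(A,m_h,u_h,\alpha_h,\lambda_h,\varrho_h)$ on the same 0-cell $A$ and of 2-cells $\xi:m_v.m_hm_h\to m_h.m_vm_v.1\sigma1$, $\xi^0:u_v\to m_h.u_vu_v$, $\xi_0:m_v.u_hu_h\to u_h$ and $\xi^0_0:u_v\to u_h$, such that $(m_h,\xi,\xi^0):v\otimes v\to v$ and $(u_h,\xi_0,\xi^0_0):I\to v$ are monoidal 1-cells and $\alpha_h,\lambda_h,\varrho_h$ are monoidal 2-cells between the evident composites. A *$(1,1)$-oidal 1-cell* between duoidal objects on $A$ and $A'$ is a 1-cell $f:A\to A'$ with a monoidal structure $(\varphi_2,\varphi_0)$ with respect to $v,v'$ and an opmonoidal structure $(\varphi^2,\varphi^0)$ with respect to $h,h'$, such that $\varphi^2:(f,\varphi_2,\varphi_0).(m_h,\xi,\xi^0)\to(m_h',\xi',\xi^{0\prime}).(ff,\varphi_2\varphi_2.1\sigma1,\varphi_0\varphi_0)$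 and $\varphi^0:(f,\varphi_2,\varphi_0).(u_h,\xi_0,\xi^0_0)\to(u_h',\xi_0',\xi^{0\prime}_0)$ are monoidal 2-cells. A *$(1,1)$-oidal 2-cell* is a 2-cell of $\mathcal M$ that is both monoidal and opmonoidal. **Statement.** 1. There is a 2-natural isomorphism with components $(\mathcal M_{10})_{01}\cong(\mathcal M_{01})_{10}$ in $\mathsf{sm}\text{-}\mathsf{2Cat}$ (so the components are symmetric strict monoidal isomorphisms) between the two composites of $(-)_{10}$ and $(-)_{01}$. It preserves the underlying data in $\mathcal M$ of 0-, 1- and 2-cells, as described in item 2. 2. For every $\mathcal M$, reading off the underlying data in $\mathcal M$ gives, both for $(\mathcal M_{10})_{01}$ and for $(\mathcal M_{01})_{10}$, a bijection from the 0-cells to the duoidal objects of $\mathcal M$; for any two 0-cells, a bijection from the 1-cells between them to the $(1,1)$-oidal 1-cells; and for any two parallel 1-cells, a bijection from the 2-cells between them to the $(1,1)$-oidal 2-cells. Here, if a 0-cell of $(\mathcal M_{10})_{01}$ has underlying pseudomonoid $v$ in $\mathcal M$, then its multiplication and unit are $(m_h,\xi,\xi^0)$ and $(u_h,\xi_0,\xi^0_0)$;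 if a 0-cell of $(\mathcal M_{01})_{10}$ has underlying pseudomonoid $h$, then its multiplication and unit are $(m_v,\xi.1\sigma1,\xi_0)$ and $(u_v,\xi^0,\xi^0_0)$. 3. For $p,q\ge 0$ let $(-)_{pq}$ be obtained by applying $(-)_{10}$ $p$ times and then $(-)_{01}$ $q$ times; $(-)_{00}$ is the identity. Then applying $(-)_{10}$ $p$ times and $(-)_{01}$ $q$ times in any other order gives a 2-functor $\mathsf{sm}\text{-}\mathsf{2Cat}\to\mathsf{sm}\text{-}\mathsf{2Cat}$ that is 2-naturally isomorphic to $(-)_{pq}$, by an isomorphism that commutes with the forgetful 2-functors to $\mathcal M$ and preserves the $p+q$ pseudomonoid structures in $\mathcal M$ that underlie a 0-cell ($p$ of them from the letters $(-)_{10}$ and $q$ from the letters $(-)_{01}$). 4. For every $\mathcal N$ in $\mathsf{sm}\text{-}\mathsf{2Cat}$, the 0-cells of $\mathcal N_{10}$ and those of $\mathcal N_{01}$ are both in the canonical bijection (same $A,m,u$; and the same, respectively inverse, $\alpha,\lambda,\varrho$) with the pseudomonoids in $\mathcal N$. For all $p,q$, the 0-cells of $\mathcal M_{p+1,q}$ and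 those of $\mathcal M_{p,q+1}$ are both in bijection with the pseudomonoids in $\mathcal M_{pq}$. Hence the 0-cells of $\mathcal M_{pq}$ depend only on $p+q$: if $p+q=p'+q'$, then the 0-cells of $\mathcal M_{pq}$ and those of $\mathcal M_{p'q'}$ are in bijection. The last two kinds of bijections can be chosen natural with respect to symmetric strict monoidal 2-functors $\mathcal M\to\mathcal M'$, and such that they preserve the underlying 0-cell of $\mathcal M$ and the list of the underlying pseudomonoid structures in $\mathcal M$ (first those of the letters $(-)_{10}$ in the order of application, then those of the letters $(-)_{01}$ in the opposite order). -/

import Mathlib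

set_option linter.all false

universe u

namespace TwoDim

/-- A small (strict) 2-category, presented by its sets of 0-cells, 1-cells and 2-cells. The
horizontal composite `comp g f` (first `f`, then `g`) of 1-cells, the vertical composite
`vcomp b a` (first `a`, then `b`) and the horizontal composite `hcomp b a` of 2-cells are defined
exactly for composable pairs. -/
structure TwoCat where
  C0 : Type u
  C1 : Type u
  C2 : Type u
  dom : C1 → C0
  cod : C1 → C0
  src : C2 → C1
  tgt : C2 → C1
  dom_tgt : ∀ a, dom (tgt a) = dom (src a)
  cod_tgt : ∀ a, cod (tgt a) = cod (src a)
  id1 : C0 → C1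
  id2 : C1 → C2
  comp : ∀ g f : C1, cod f = dom g → C1
  vcomp : ∀ b a : C2, tgt a = src b → C2
  hcomp : ∀ b a : C2, cod (src a) = dom (src b) → C2
  dom_id1 : ∀ A, dom (id1 A) = A
  cod_id1 : ∀ A, cod (id1 A) = A
  dom_comp : ∀ g f h, dom (comp g f h) = dom f
  cod_comp : ∀ g f h, cod (comp g f h) = cod g
  comp_id1 : ∀ f, comp f (id1 (dom f)) (cod_id1 _) = f
  id1_comp : ∀ f, comp (id1 (cod f)) f (dom_id1 _).symm = f
  comp_assoc : ∀ k g f (h : cod f = dom g) (h' : cod g = dom k),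
    comp (comp k g h') f (h.trans (dom_comp _ _ _).symm) =
      comp k (comp g f h) ((cod_comp _ _ _).trans h')
  src_id2 : ∀ f, src (id2 f) = f
  tgt_id2 : ∀ f, tgt (id2 f) = f
  src_vcomp : ∀ b a h, src (vcomp b a h) = src a
  tgt_vcomp : ∀ b a h, tgt (vcomp b a h) = tgt b
  vcomp_id2 : ∀ a, vcomp a (id2 (src a)) (tgt_id2 _) = a
  id2_vcomp : ∀ a, vcomp (id2 (tgt a)) a (src_id2 _).symm = a
  vcomp_assoc : ∀ c b a (h : tgt a = src b) (h' : tgt b = src c),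
    vcomp (vcomp c b h') a (h.trans (src_vcomp _ _ _).symm) =
      vcomp c (vcomp b a h) ((tgt_vcomp _ _ _).trans h')
  src_hcomp : ∀ b a h, src (hcomp b a h) = comp (src b) (src a) h
  tgt_hcomp : ∀ b a h, tgt (hcomp b a h) =
    comp (tgt b) (tgt a) ((cod_tgt a).trans (h.trans (dom_tgt b).symm))
  hcomp_id2 : ∀ a, hcomp a (id2 (id1 (dom (src a)))) (by rw [src_id2, cod_id1]) = a
  id2_hcomp : ∀ a, hcomp (id2 (id1 (cod (src a)))) a (by rw [src_id2, dom_id1]) = a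
  hcomp_assoc : ∀ c b a (h : cod (src a) = dom (src b)) (h' : cod (src b) = dom (src c)),
    hcomp (hcomp c b h') a (by rw [src_hcomp, dom_comp, h]) =
      hcomp c (hcomp b a h) (by rw [src_hcomp, cod_comp, h'])
  id2_comp : ∀ g f (h : cod f = dom g),
    id2 (comp g f h) = hcomp (id2 g) (id2 f) (by rw [src_id2, src_id2, h])
  interchange : ∀ b' b a' a (hb : tgt b = src b') (ha : tgt a = src a')
    (h : cod (src a) = dom (src b)),
    hcomp (vcomp b' b hb) (vcomp a' a ha) (by rw [src_vcomp, src_vcomp, h]) =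
      vcomp (hcomp b' a' (by rw [← ha, ← hb, cod_tgt, dom_tgt, h])) (hcomp b a h)
        (by rw [tgt_hcomp, src_hcomp]; congr 1)

attribute [simp] TwoCat.dom_tgt TwoCat.cod_tgt TwoCat.dom_id1 TwoCat.cod_id1 TwoCat.dom_comp
  TwoCat.cod_comp TwoCat.src_id2 TwoCat.tgt_id2 TwoCat.src_vcomp TwoCat.tgt_vcomp
  TwoCat.src_hcomp TwoCat.tgt_hcomp

namespace TwoCat

variable (M : TwoCat.{u})

open Classical in
/-- Composition of 1-cells as a total operation, with a junk value on non-composable pairs. -/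
noncomputable def c (g f : M.C1) : M.C1 :=
  if h : M.cod f = M.dom g then M.comp g f h else g

open Classical in
/-- Vertical composition of 2-cells as a total operation, with a junk value on non-composable
pairs. -/
noncomputable def vc (b a : M.C2) : M.C2 :=
  if h : M.tgt a = M.src b then M.vcomp b a h else b

open Classical in
/-- Horizontal composition of 2-cells as a total operation, with a junk value on non-composable
pairs. -/
noncomputable def hc (b a : M.C2) : M.C2 :=
  if h : M.cod (M.src a) = M.dom (M.src b) then M.hcomp b a h else b

end TwoCat

/-- Horizontal composition of 1-cells. -/
notation:75 g:76 " ⬝₁ " f:75 => TwoCat.c _ g f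
/-- Horizontal composition of 2-cells. -/
notation:75 b:76 " ⬝ₕ " a:75 => TwoCat.hc _ b a
/-- Vertical composition of 2-cells. -/
notation:70 b:71 " ⬝ᵥ " a:70 => TwoCat.vc _ b a
/-- The identity 2-cell. -/
notation:max "𝟏" f:max => TwoCat.id2 _ f

namespace TwoCat

variable {M : TwoCat.{u}}

theorem c_def {g f : M.C1} (h : M.cod f = M.dom g) : g ⬝₁ f = M.comp g f h := dif_pos h
theorem vc_def {b a : M.C2} (h : M.tgt a = M.src b) : b ⬝ᵥ a = M.vcomp b a h := dif_pos h
theorem hc_def {b a : M.C2} (h : M.cod (M.src a) = M.dom (M.src b)) :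
    b ⬝ₕ a = M.hcomp b a h := dif_pos h

@[simp] theorem dom_c {g f : M.C1} (h : M.cod f = M.dom g) : M.dom (g ⬝₁ f) = M.dom f := by
  rw [c_def h, M.dom_comp]
@[simp] theorem cod_c {g f : M.C1} (h : M.cod f = M.dom g) : M.cod (g ⬝₁ f) = M.cod g := by
  rw [c_def h, M.cod_comp]
@[simp] theorem c_id {f : M.C1} {A : M.C0} (h : M.dom f = A) : f ⬝₁ M.id1 A = f := by
  subst h; rw [c_def (M.cod_id1 _), M.comp_id1]
@[simp] theorem id_c {f : M.C1} {A : M.C0} (h : M.cod f = A) : M.id1 A ⬝₁ f = f := by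
  subst h; rw [c_def (M.dom_id1 _).symm, M.id1_comp]
theorem c_assoc {k g f : M.C1} (h : M.cod f = M.dom g) (h' : M.cod g = M.dom k) :
    (k ⬝₁ g) ⬝₁ f = k ⬝₁ g ⬝₁ f := by
  rw [c_def (show M.cod f = M.dom (k ⬝₁ g) by rw [dom_c h', h]),
    c_def (show M.cod (g ⬝₁ f) = M.dom k by rw [cod_c h, h'])]
  simp only [c_def h, c_def h', M.comp_assoc k g f h h']
@[simp] theorem src_vc {b a : M.C2} (h : M.tgt a = M.src b) : M.src (b ⬝ᵥ a) = M.src a := by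
  rw [vc_def h, M.src_vcomp]
@[simp] theorem tgt_vc {b a : M.C2} (h : M.tgt a = M.src b) : M.tgt (b ⬝ᵥ a) = M.tgt b := by
  rw [vc_def h, M.tgt_vcomp]
@[simp] theorem vc_id {a : M.C2} {f : M.C1} (h : M.src a = f) : a ⬝ᵥ 𝟏 f = a := by
  subst h; rw [vc_def (M.tgt_id2 _), M.vcomp_id2]
@[simp] theorem id_vc {a : M.C2} {f : M.C1} (h : M.tgt a = f) : 𝟏 f ⬝ᵥ a = a := by
  subst h; rw [vc_def (M.src_id2 _).symm, M.id2_vcomp]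
theorem vc_assoc {c b a : M.C2} (h : M.tgt a = M.src b) (h' : M.tgt b = M.src c) :
    (c ⬝ᵥ b) ⬝ᵥ a = c ⬝ᵥ b ⬝ᵥ a := by
  rw [vc_def (show M.tgt a = M.src (c ⬝ᵥ b) by rw [src_vc h', h]),
    vc_def (show M.tgt (b ⬝ᵥ a) = M.src c by rw [tgt_vc h, h'])]
  simp only [vc_def h, vc_def h', M.vcomp_assoc c b a h h']
@[simp] theorem src_hc {b a : M.C2} (h : M.cod (M.src a) = M.dom (M.src b)) :
    M.src (b ⬝ₕ a) = M.src b ⬝₁ M.src a := by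
  rw [hc_def h, M.src_hcomp, c_def h]
@[simp] theorem tgt_hc {b a : M.C2} (h : M.cod (M.src a) = M.dom (M.src b)) :
    M.tgt (b ⬝ₕ a) = M.tgt b ⬝₁ M.tgt a := by
  rw [hc_def h, M.tgt_hcomp, c_def]
@[simp] theorem hc_id {a : M.C2} {A : M.C0} (h : M.dom (M.src a) = A) :
    a ⬝ₕ 𝟏(M.id1 A) = a := by
  subst h; rw [hc_def (by simp), M.hcomp_id2]
@[simp] theorem id_hc {a : M.C2} {A : M.C0} (h : M.cod (M.src a) = A) :
    𝟏(M.id1 A) ⬝ₕ a = a := by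
  subst h; rw [hc_def (by simp), M.id2_hcomp]
theorem hc_assoc {c b a : M.C2} (h : M.cod (M.src a) = M.dom (M.src b))
    (h' : M.cod (M.src b) = M.dom (M.src c)) : (c ⬝ₕ b) ⬝ₕ a = c ⬝ₕ b ⬝ₕ a := by
  rw [hc_def (show M.cod (M.src a) = M.dom (M.src (c ⬝ₕ b)) by rw [src_hc h', dom_c h', h]),
    hc_def (show M.cod (M.src (b ⬝ₕ a)) = M.dom (M.src c) by rw [src_hc h, cod_c h, h'])]
  simp only [hc_def h, hc_def h', M.hcomp_assoc c b a h h']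
theorem id2_c {g f : M.C1} (h : M.cod f = M.dom g) : 𝟏(g ⬝₁ f) = 𝟏g ⬝ₕ 𝟏f := by
  rw [c_def h, M.id2_comp, hc_def]
theorem hc_vc {b' b a' a : M.C2} (hb : M.tgt b = M.src b') (ha : M.tgt a = M.src a')
    (h : M.cod (M.src a) = M.dom (M.src b)) :
    (b' ⬝ᵥ b) ⬝ₕ (a' ⬝ᵥ a) = (b' ⬝ₕ a') ⬝ᵥ (b ⬝ₕ a) := by
  have h1 : M.cod (M.src a') = M.dom (M.src b') := by
    rw [← ha, ← hb, M.cod_tgt, M.dom_tgt, h]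
  rw [hc_def (show M.cod (M.src (a' ⬝ᵥ a)) = M.dom (M.src (b' ⬝ᵥ b)) by
      rw [src_vc ha, src_vc hb, h]),
    vc_def (show M.tgt (b ⬝ₕ a) = M.src (b' ⬝ₕ a') by
      rw [tgt_hc h, src_hc h1, ha, hb])]
  simp only [vc_def ha, vc_def hb, hc_def h, hc_def h1, M.interchange b' b a' a hb ha h]

/-- `b` is an inverse of the 2-cell `a` for vertical composition. -/
def IsInverse (a b : M.C2) : Prop :=
  M.src b = M.tgt a ∧ M.tgt b = M.src a ∧ b ⬝ᵥ a = 𝟏(M.src a) ∧ a ⬝ᵥ b = 𝟏(M.tgt a)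

end TwoCat
end TwoDim

namespace TwoDim

/-- A 2-functor. -/
@[ext]
structure TwoFunctor (M N : TwoCat.{u}) where
  map0 : M.C0 → N.C0
  map1 : M.C1 → N.C1
  map2 : M.C2 → N.C2
  dom_map : ∀ f, N.dom (map1 f) = map0 (M.dom f)
  cod_map : ∀ f, N.cod (map1 f) = map0 (M.cod f)
  src_map : ∀ a, N.src (map2 a) = map1 (M.src a)
  tgt_map : ∀ a, N.tgt (map2 a) = map1 (M.tgt a)
  map_id1 : ∀ A, map1 (M.id1 A) = N.id1 (map0 A)
  map_id2 : ∀ f, map2 (M.id2 f) = N.id2 (map1 f)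
  map_comp : ∀ g f (h : M.cod f = M.dom g),
    map1 (M.comp g f h) = N.comp (map1 g) (map1 f) (by rw [cod_map, dom_map, h])
  map_vcomp : ∀ b a (h : M.tgt a = M.src b),
    map2 (M.vcomp b a h) = N.vcomp (map2 b) (map2 a) (by rw [tgt_map, src_map, h])
  map_hcomp : ∀ b a (h : M.cod (M.src a) = M.dom (M.src b)),
    map2 (M.hcomp b a h) = N.hcomp (map2 b) (map2 a)
      (by rw [src_map, src_map, cod_map, dom_map, h])

attribute [simp] TwoFunctor.dom_map TwoFunctor.cod_map TwoFunctor.src_map TwoFunctor.tgt_map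
  TwoFunctor.map_id1 TwoFunctor.map_id2

namespace TwoFunctor

variable {M N K : TwoCat.{u}}

theorem map_c (F : TwoFunctor M N) {g f : M.C1} (h : M.cod f = M.dom g) :
    F.map1 (g ⬝₁ f) = F.map1 g ⬝₁ F.map1 f := by
  rw [TwoCat.c_def h, F.map_comp, TwoCat.c_def]
theorem map_vc (F : TwoFunctor M N) {b a : M.C2} (h : M.tgt a = M.src b) :
    F.map2 (b ⬝ᵥ a) = F.map2 b ⬝ᵥ F.map2 a := by
  rw [TwoCat.vc_def h, F.map_vcomp, TwoCat.vc_def]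
theorem map_hc (F : TwoFunctor M N) {b a : M.C2} (h : M.cod (M.src a) = M.dom (M.src b)) :
    F.map2 (b ⬝ₕ a) = F.map2 b ⬝ₕ F.map2 a := by
  rw [TwoCat.hc_def h, F.map_hcomp, TwoCat.hc_def]

/-- The identity 2-functor. -/
def id (M : TwoCat.{u}) : TwoFunctor M M where
  map0 A := A
  map1 f := f
  map2 a := a
  dom_map _ := rfl
  cod_map _ := rfl
  src_map _ := rfl
  tgt_map _ := rfl
  map_id1 _ := rfl
  map_id2 _ := rfl
  map_comp _ _ _ := rfl
  map_vcomp _ _ _ := rfl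
  map_hcomp _ _ _ := rfl

/-- The composite of 2-functors (first `F`, then `G`). -/
def comp (G : TwoFunctor N K) (F : TwoFunctor M N) : TwoFunctor M K where
  map0 A := G.map0 (F.map0 A)
  map1 f := G.map1 (F.map1 f)
  map2 a := G.map2 (F.map2 a)
  dom_map _ := by simp
  cod_map _ := by simp
  src_map _ := by simp
  tgt_map _ := by simp
  map_id1 _ := by simp
  map_id2 _ := by simp
  map_comp _ _ _ := by simp only [map_comp]
  map_vcomp _ _ _ := by simp only [map_vcomp]
  map_hcomp _ _ _ := by simp only [map_hcomp]

end TwoFunctor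

/-- The condition that a family of 1-cells `app A : F A → G A` is a 2-natural transformation. -/
structure IsTwoNat {M N : TwoCat.{u}} (F G : TwoFunctor M N) (app : M.C0 → N.C1) : Prop where
  dom_app : ∀ A, N.dom (app A) = F.map0 A
  cod_app : ∀ A, N.cod (app A) = G.map0 A
  nat1 : ∀ f, N.comp (app (M.cod f)) (F.map1 f) (by rw [F.cod_map, dom_app]) =
    N.comp (G.map1 f) (app (M.dom f)) (by rw [G.dom_map, cod_app])
  nat2 : ∀ a, N.hcomp (N.id2 (app (M.cod (M.src a)))) (F.map2 a)
      (by rw [N.src_id2, F.src_map, F.cod_map, dom_app]) =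
    N.hcomp (G.map2 a) (N.id2 (app (M.dom (M.src a))))
      (by rw [N.src_id2, G.src_map, G.dom_map, cod_app])

namespace IsTwoNat

variable {M N : TwoCat.{u}} {F G : TwoFunctor M N} {app : M.C0 → N.C1}

theorem c_nat (h : IsTwoNat F G app) (f : M.C1) :
    app (M.cod f) ⬝₁ F.map1 f = G.map1 f ⬝₁ app (M.dom f) := by
  rw [TwoCat.c_def (by rw [F.cod_map, h.dom_app]), TwoCat.c_def (by rw [G.dom_map, h.cod_app]),
    h.nat1]

theorem hc_nat (h : IsTwoNat F G app) (a : M.C2) :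
    𝟏(app (M.cod (M.src a))) ⬝ₕ F.map2 a = G.map2 a ⬝ₕ 𝟏(app (M.dom (M.src a))) := by
  rw [TwoCat.hc_def (by rw [N.src_id2, F.src_map, F.cod_map, h.dom_app]),
    TwoCat.hc_def (by rw [N.src_id2, G.src_map, G.dom_map, h.cod_app]), h.nat2]

end IsTwoNat

/-- A 2-natural transformation. -/
structure TwoNatTrans {M N : TwoCat.{u}} (F G : TwoFunctor M N) where
  app : M.C0 → N.C1
  isTwoNat : IsTwoNat F G app

/-- A 2-natural isomorphism: a 2-natural transformation all of whose components are invertible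
1-cells, with 2-natural inverse. -/
structure TwoNatIso {M N : TwoCat.{u}} (F G : TwoFunctor M N) extends TwoNatTrans F G where
  inv : TwoNatTrans G F
  inv_app : ∀ A, N.comp (inv.app A) (app A)
    ((isTwoNat.cod_app A).trans (inv.isTwoNat.dom_app A).symm) = N.id1 (F.map0 A)
  app_inv : ∀ A, N.comp (app A) (inv.app A)
    ((inv.isTwoNat.cod_app A).trans (isTwoNat.dom_app A).symm) = N.id1 (G.map0 A)

/-- The Cartesian product of 2-categories. -/
def TwoCat.prod (M N : TwoCat.{u}) : TwoCat.{u} where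
  C0 := M.C0 × N.C0
  C1 := M.C1 × N.C1
  C2 := M.C2 × N.C2
  dom f := (M.dom f.1, N.dom f.2)
  cod f := (M.cod f.1, N.cod f.2)
  src a := (M.src a.1, N.src a.2)
  tgt a := (M.tgt a.1, N.tgt a.2)
  dom_tgt a := by simp
  cod_tgt a := by simp
  id1 A := (M.id1 A.1, N.id1 A.2)
  id2 f := (M.id2 f.1, N.id2 f.2)
  comp g f h := (M.comp g.1 f.1 (congrArg Prod.fst h), N.comp g.2 f.2 (congrArg Prod.snd h))
  vcomp b a h := (M.vcomp b.1 a.1 (congrArg Prod.fst h), N.vcomp b.2 a.2 (congrArg Prod.snd h))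
  hcomp b a h := (M.hcomp b.1 a.1 (congrArg Prod.fst h), N.hcomp b.2 a.2 (congrArg Prod.snd h))
  dom_id1 A := by simp
  cod_id1 A := by simp
  dom_comp g f h := by simp
  cod_comp g f h := by simp
  comp_id1 f := by simp only [M.comp_id1, N.comp_id1]
  id1_comp f := by simp only [M.id1_comp, N.id1_comp]
  comp_assoc k g f h h' := Prod.ext
    (M.comp_assoc k.1 g.1 f.1 (congrArg Prod.fst h) (congrArg Prod.fst h'))
    (N.comp_assoc k.2 g.2 f.2 (congrArg Prod.snd h) (congrArg Prod.snd h'))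
  src_id2 f := by simp
  tgt_id2 f := by simp
  src_vcomp b a h := by simp
  tgt_vcomp b a h := by simp
  vcomp_id2 a := by simp only [M.vcomp_id2, N.vcomp_id2]
  id2_vcomp a := by simp only [M.id2_vcomp, N.id2_vcomp]
  vcomp_assoc c b a h h' := Prod.ext
    (M.vcomp_assoc c.1 b.1 a.1 (congrArg Prod.fst h) (congrArg Prod.fst h'))
    (N.vcomp_assoc c.2 b.2 a.2 (congrArg Prod.snd h) (congrArg Prod.snd h'))
  src_hcomp b a h := by simp
  tgt_hcomp b a h := by simp
  hcomp_id2 a := by simp only [M.hcomp_id2, N.hcomp_id2]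
  id2_hcomp a := by simp only [M.id2_hcomp, N.id2_hcomp]
  hcomp_assoc c b a h h' := Prod.ext
    (M.hcomp_assoc c.1 b.1 a.1 (congrArg Prod.fst h) (congrArg Prod.fst h'))
    (N.hcomp_assoc c.2 b.2 a.2 (congrArg Prod.snd h) (congrArg Prod.snd h'))
  id2_comp g f h := Prod.ext (M.id2_comp _ _ _) (N.id2_comp _ _ _)
  interchange b' b a' a hb ha h := Prod.ext
    (M.interchange b'.1 b.1 a'.1 a.1 (congrArg Prod.fst hb) (congrArg Prod.fst ha)
      (congrArg Prod.fst h))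
    (N.interchange b'.2 b.2 a'.2 a.2 (congrArg Prod.snd hb) (congrArg Prod.snd ha)
      (congrArg Prod.snd h))

/-- The 2-functor `flip : M × M → M × M`. -/
def TwoCat.flip (M : TwoCat.{u}) : TwoFunctor (M.prod M) (M.prod M) where
  map0 A := (A.2, A.1)
  map1 f := (f.2, f.1)
  map2 a := (a.2, a.1)
  dom_map _ := rfl
  cod_map _ := rfl
  src_map _ := rfl
  tgt_map _ := rfl
  map_id1 _ := rfl
  map_id2 _ := rfl
  map_comp _ _ _ := rfl
  map_vcomp _ _ _ := rfl
  map_hcomp _ _ _ := rfl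

/-- The vertically opposite 2-category: the directions of the 2-cells are reversed. -/
def TwoCat.co (M : TwoCat.{u}) : TwoCat.{u} where
  C0 := M.C0
  C1 := M.C1
  C2 := M.C2
  dom := M.dom
  cod := M.cod
  src := M.tgt
  tgt := M.src
  dom_tgt a := by simp
  cod_tgt a := by simp
  id1 := M.id1
  id2 := M.id2
  comp := M.comp
  vcomp b a h := M.vcomp a b h.symm
  hcomp b a h := M.hcomp b a (by rwa [M.cod_tgt, M.dom_tgt] at h)
  dom_id1 := M.dom_id1
  cod_id1 := M.cod_id1
  dom_comp := M.dom_comp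
  cod_comp := M.cod_comp
  comp_id1 := M.comp_id1
  id1_comp := M.id1_comp
  comp_assoc := M.comp_assoc
  src_id2 := M.tgt_id2
  tgt_id2 := M.src_id2
  src_vcomp b a h := by simp
  tgt_vcomp b a h := by simp
  vcomp_id2 a := M.id2_vcomp a
  id2_vcomp a := M.vcomp_id2 a
  vcomp_assoc c b a h h' := (M.vcomp_assoc a b c h'.symm h.symm).symm
  src_hcomp b a h := by simp
  tgt_hcomp b a h := by simp
  hcomp_id2 a := by simpa using M.hcomp_id2 a
  id2_hcomp a := by simpa using M.id2_hcomp a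
  hcomp_assoc c b a h h' := M.hcomp_assoc c b a _ _
  id2_comp := M.id2_comp
  interchange b' b a' a hb ha h := M.interchange b b' a a' hb.symm ha.symm
    (by rw [M.cod_tgt, M.dom_tgt] at h; rw [← M.cod_tgt, ← M.dom_tgt, ← ha, ← hb, h])

/-- The 2-functor between vertically opposite 2-categories induced by a 2-functor. -/
def TwoFunctor.co {M N : TwoCat.{u}} (F : TwoFunctor M N) : TwoFunctor M.co N.co where
  map0 := F.map0
  map1 := F.map1
  map2 := F.map2
  dom_map := F.dom_map
  cod_map := F.cod_map
  src_map := F.tgt_map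
  tgt_map := F.src_map
  map_id1 := F.map_id1
  map_id2 := F.map_id2
  map_comp := F.map_comp
  map_vcomp b a h := F.map_vcomp a b h.symm
  map_hcomp b a _ := F.map_hcomp b a _

theorem IsTwoNat.co {M N : TwoCat.{u}} {F G : TwoFunctor M N} {app : M.C0 → N.C1}
    (h : IsTwoNat F G app) : IsTwoNat F.co G.co app where
  dom_app := h.dom_app
  cod_app := h.cod_app
  nat1 := h.nat1
  nat2 a := by
    have e : ∀ A B (hA : A = M.cod (M.src a)) (hB : B = M.dom (M.src a)) h₁ h₂,
        N.hcomp (N.id2 (app A)) (F.map2 a) h₁ = N.hcomp (G.map2 a) (N.id2 (app B)) h₂ := by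
      rintro _ _ rfl rfl _ _
      exact h.nat2 a
    exact e _ _ (M.cod_tgt a) (M.dom_tgt a) _ _

/-- A strict monoidal 2-category: a 2-category with a strictly associative and strictly unital
monoidal product 2-functor. -/
structure MonTwoCat extends TwoCat.{u} where
  unit : C0
  tensor : TwoFunctor (toTwoCat.prod toTwoCat) toTwoCat
  assoc0 : ∀ A B C, tensor.map0 (tensor.map0 (A, B), C) = tensor.map0 (A, tensor.map0 (B, C))
  assoc1 : ∀ f g k, tensor.map1 (tensor.map1 (f, g), k) = tensor.map1 (f, tensor.map1 (g, k))
  assoc2 : ∀ a b c, tensor.map2 (tensor.map2 (a, b), c) = tensor.map2 (a, tensor.map2 (b, c))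
  unit_tensor0 : ∀ A, tensor.map0 (unit, A) = A
  unit_tensor1 : ∀ f, tensor.map1 (id1 unit, f) = f
  unit_tensor2 : ∀ a, tensor.map2 (id2 (id1 unit), a) = a
  tensor_unit0 : ∀ A, tensor.map0 (A, unit) = A
  tensor_unit1 : ∀ f, tensor.map1 (f, id1 unit) = f
  tensor_unit2 : ∀ a, tensor.map2 (a, id2 (id1 unit)) = a

namespace MonTwoCat

variable (M : MonTwoCat.{u})

/-- The monoidal product of 0-cells. -/
def t0 (A B : M.C0) : M.C0 := M.tensor.map0 (A, B)
/-- The monoidal product of 1-cells. -/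
def t1 (f g : M.C1) : M.C1 := M.tensor.map1 (f, g)
/-- The monoidal product of 2-cells. -/
def t2 (a b : M.C2) : M.C2 := M.tensor.map2 (a, b)

end MonTwoCat

/-- The monoidal product of 0-cells. -/
notation:80 A:81 " ⊗₀ " B:80 => MonTwoCat.t0 _ A B
/-- The monoidal product of 1-cells. -/
notation:80 f:81 " ⊗₁ " g:80 => MonTwoCat.t1 _ f g
/-- The monoidal product of 2-cells. -/
notation:80 a:81 " ⊗₂ " b:80 => MonTwoCat.t2 _ a b

namespace MonTwoCat

open TwoCat

variable {M : MonTwoCat.{u}}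

@[simp] theorem dom_t (f g : M.C1) : M.dom (f ⊗₁ g) = M.dom f ⊗₀ M.dom g :=
  M.tensor.dom_map (f, g)
@[simp] theorem cod_t (f g : M.C1) : M.cod (f ⊗₁ g) = M.cod f ⊗₀ M.cod g :=
  M.tensor.cod_map (f, g)
@[simp] theorem src_t (a b : M.C2) : M.src (a ⊗₂ b) = M.src a ⊗₁ M.src b :=
  M.tensor.src_map (a, b)
@[simp] theorem tgt_t (a b : M.C2) : M.tgt (a ⊗₂ b) = M.tgt a ⊗₁ M.tgt b :=
  M.tensor.tgt_map (a, b)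
@[simp] theorem t_id1 (A B : M.C0) : M.id1 A ⊗₁ M.id1 B = M.id1 (A ⊗₀ B) :=
  M.tensor.map_id1 (A, B)
@[simp] theorem t_id2 (f g : M.C1) : 𝟏f ⊗₂ 𝟏g = 𝟏(f ⊗₁ g) :=
  M.tensor.map_id2 (f, g)
@[simp] theorem t0_assoc (A B C : M.C0) : (A ⊗₀ B) ⊗₀ C = A ⊗₀ B ⊗₀ C := M.assoc0 A B C
@[simp] theorem t1_assoc (f g k : M.C1) : (f ⊗₁ g) ⊗₁ k = f ⊗₁ g ⊗₁ k := M.assoc1 f g k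
@[simp] theorem t2_assoc (a b c : M.C2) : (a ⊗₂ b) ⊗₂ c = a ⊗₂ b ⊗₂ c := M.assoc2 a b c
@[simp] theorem unit_t0 (A : M.C0) : M.unit ⊗₀ A = A := M.unit_tensor0 A
@[simp] theorem unit_t1 (f : M.C1) : M.id1 M.unit ⊗₁ f = f := M.unit_tensor1 f
@[simp] theorem unit_t2 (a : M.C2) : 𝟏(M.id1 M.unit) ⊗₂ a = a := M.unit_tensor2 a
@[simp] theorem t0_unit (A : M.C0) : A ⊗₀ M.unit = A := M.tensor_unit0 A
@[simp] theorem t1_unit (f : M.C1) : f ⊗₁ M.id1 M.unit = f := M.tensor_unit1 f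
@[simp] theorem t2_unit (a : M.C2) : a ⊗₂ 𝟏(M.id1 M.unit) = a := M.tensor_unit2 a

theorem t_c {g f g' f' : M.C1} (h : M.cod f = M.dom g) (h' : M.cod f' = M.dom g') :
    (g ⬝₁ f) ⊗₁ (g' ⬝₁ f') = (g ⊗₁ g') ⬝₁ (f ⊗₁ f') := by
  rw [c_def h, c_def h', c_def (by simp [h, h'])]
  exact M.tensor.map_comp (g, g') (f, f') (Prod.ext h h')
theorem t_vc {b a b' a' : M.C2} (h : M.tgt a = M.src b) (h' : M.tgt a' = M.src b') :
    (b ⬝ᵥ a) ⊗₂ (b' ⬝ᵥ a') = (b ⊗₂ b') ⬝ᵥ (a ⊗₂ a') := by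
  rw [vc_def h, vc_def h', vc_def (by simp [h, h'])]
  exact M.tensor.map_vcomp (b, b') (a, a') (Prod.ext h h')
theorem t_hc {b a b' a' : M.C2} (h : M.cod (M.src a) = M.dom (M.src b))
    (h' : M.cod (M.src a') = M.dom (M.src b')) :
    (b ⬝ₕ a) ⊗₂ (b' ⬝ₕ a') = (b ⊗₂ b') ⬝ₕ (a ⊗₂ a') := by
  rw [hc_def h, hc_def h', hc_def (by simp [h, h'])]
  exact M.tensor.map_hcomp (b, b') (a, a') (Prod.ext h h')

/-- The vertically opposite strict monoidal 2-category. -/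
def co (M : MonTwoCat.{u}) : MonTwoCat.{u} where
  toTwoCat := M.toTwoCat.co
  unit := M.unit
  tensor := M.tensor.co
  assoc0 := M.assoc0
  assoc1 := M.assoc1
  assoc2 := M.assoc2
  unit_tensor0 := M.unit_tensor0
  unit_tensor1 := M.unit_tensor1
  unit_tensor2 := M.unit_tensor2
  tensor_unit0 := M.tensor_unit0
  tensor_unit1 := M.tensor_unit1
  tensor_unit2 := M.tensor_unit2

end MonTwoCat

/-- The condition that `σ` is a symmetry on a strict monoidal 2-category: a 2-natural transformation
`⊗ → ⊗ ∘ flip` with `σ ∘ σ = 1` and `σ_{A, BC} = (B σ_{A, C}) ∘ (σ_{A, B} C)`. -/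
structure IsSymmetry (M : MonTwoCat.{u}) (σ : M.C0 → M.C0 → M.C1) : Prop where
  isTwoNat : IsTwoNat M.tensor (M.tensor.comp M.flip) fun A => σ A.1 A.2
  σ_σ : ∀ A B, σ B A ⬝₁ σ A B = M.id1 (A ⊗₀ B)
  hexagon : ∀ A B C, σ A (B ⊗₀ C) = (M.id1 B ⊗₁ σ A C) ⬝₁ (σ A B ⊗₁ M.id1 C)

/-- A symmetric strict monoidal 2-category. -/
structure SymMonTwoCat extends MonTwoCat.{u} where
  σ : C0 → C0 → C1
  isSymmetry : IsSymmetry toMonTwoCat σ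

end TwoDim

namespace TwoDim

/-- The data of a pseudomonoid `(A, m, u, α, λ, ϱ)`, without any condition. -/
@[ext]
structure PsmData (M : TwoCat.{u}) where
  A : M.C0
  m : M.C1
  u : M.C1
  α : M.C2
  lam : M.C2
  rho : M.C2

/-- The data of an (op)monoidal 1-cell: a 1-cell `f` with a binary part and a nullary part, without
any condition. -/
@[ext]
structure CellData (M : TwoCat.{u}) where
  f : M.C1
  φ2 : M.C2
  φ0 : M.C2

/-- A 2-cell is invertible if it has an inverse for vertical composition. -/
def TwoCat.IsInvertible {M : TwoCat.{u}} (a : M.C2) : Prop :=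
  ∃ b, TwoCat.IsInverse a b

/-- `(A, m, u, α, λ, ϱ)` is a pseudomonoid in the strict monoidal 2-category `M`. -/
structure IsPseudomonoid (M : MonTwoCat.{u}) (d : PsmData M.toTwoCat) : Prop where
  dom_m : M.dom d.m = d.A ⊗₀ d.A
  cod_m : M.cod d.m = d.A
  dom_u : M.dom d.u = M.unit
  cod_u : M.cod d.u = d.A
  src_α : M.src d.α = d.m ⬝₁ (d.m ⊗₁ M.id1 d.A)
  tgt_α : M.tgt d.α = d.m ⬝₁ (M.id1 d.A ⊗₁ d.m)
  src_lam : M.src d.lam = d.m ⬝₁ (d.u ⊗₁ M.id1 d.A)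
  tgt_lam : M.tgt d.lam = M.id1 d.A
  src_rho : M.src d.rho = d.m ⬝₁ (M.id1 d.A ⊗₁ d.u)
  tgt_rho : M.tgt d.rho = M.id1 d.A
  inv_α : TwoCat.IsInvertible d.α
  inv_lam : TwoCat.IsInvertible d.lam
  inv_rho : TwoCat.IsInvertible d.rho
  pentagon :
    (𝟏(d.m) ⬝ₕ (𝟏(M.id1 d.A) ⊗₂ d.α)) ⬝ᵥ
      (d.α ⬝ₕ 𝟏(M.id1 d.A ⊗₁ d.m ⊗₁ M.id1 d.A)) ⬝ᵥ
        (𝟏(d.m) ⬝ₕ (d.α ⊗₂ 𝟏(M.id1 d.A))) =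
    (d.α ⬝ₕ 𝟏(M.id1 d.A ⊗₁ M.id1 d.A ⊗₁ d.m)) ⬝ᵥ
      (d.α ⬝ₕ 𝟏(d.m ⊗₁ M.id1 d.A ⊗₁ M.id1 d.A))
  triangle :
    (𝟏(d.m) ⬝ₕ (𝟏(M.id1 d.A) ⊗₂ d.lam)) ⬝ᵥ
      (d.α ⬝ₕ 𝟏(M.id1 d.A ⊗₁ d.u ⊗₁ M.id1 d.A)) =
    𝟏(d.m) ⬝ₕ (d.rho ⊗₂ 𝟏(M.id1 d.A))

/-- `(f, φ², φ⁰)` is an opmonoidal 1-cell from `d` to `d'`, with binary part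
`φ² : f ∘ m → m' ∘ (f ⊗ f)` and nullary part `φ⁰ : f ∘ u → u'`. -/
structure IsOpmonoidal1 (M : MonTwoCat.{u}) (d d' : PsmData M.toTwoCat)
    (c : CellData M.toTwoCat) : Prop where
  dom_f : M.dom c.f = d.A
  cod_f : M.cod c.f = d'.A
  src_φ2 : M.src c.φ2 = c.f ⬝₁ d.m
  tgt_φ2 : M.tgt c.φ2 = d'.m ⬝₁ (c.f ⊗₁ c.f)
  src_φ0 : M.src c.φ0 = c.f ⬝₁ d.u
  tgt_φ0 : M.tgt c.φ0 = d'.u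
  coassoc :
    (d'.α ⬝ₕ 𝟏(c.f ⊗₁ c.f ⊗₁ c.f)) ⬝ᵥ
      (𝟏(d'.m) ⬝ₕ (c.φ2 ⊗₂ 𝟏(c.f))) ⬝ᵥ
        (c.φ2 ⬝ₕ 𝟏(d.m ⊗₁ M.id1 d.A)) =
    (𝟏(d'.m) ⬝ₕ (𝟏(c.f) ⊗₂ c.φ2)) ⬝ᵥ
      (c.φ2 ⬝ₕ 𝟏(M.id1 d.A ⊗₁ d.m)) ⬝ᵥ
        (𝟏(c.f) ⬝ₕ d.α)
  counit_left :
    (d'.lam ⬝ₕ 𝟏(c.f)) ⬝ᵥ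
      (𝟏(d'.m) ⬝ₕ (c.φ0 ⊗₂ 𝟏(c.f))) ⬝ᵥ
        (c.φ2 ⬝ₕ 𝟏(d.u ⊗₁ M.id1 d.A)) =
    𝟏(c.f) ⬝ₕ d.lam
  counit_right :
    (d'.rho ⬝ₕ 𝟏(c.f)) ⬝ᵥ
      (𝟏(d'.m) ⬝ₕ (𝟏(c.f) ⊗₂ c.φ0)) ⬝ᵥ
        (c.φ2 ⬝ₕ 𝟏(M.id1 d.A ⊗₁ d.u)) =
    𝟏(c.f) ⬝ₕ d.rho

/-- `ω : (f, φ², φ⁰) → (g, γ², γ⁰)` is an opmonoidal 2-cell between 1-cells from `d` to `d'`. -/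
structure IsOpmonoidal2 (M : MonTwoCat.{u}) (d d' : PsmData M.toTwoCat)
    (c c' : CellData M.toTwoCat) (ω : M.C2) : Prop where
  src_ω : M.src ω = c.f
  tgt_ω : M.tgt ω = c'.f
  binary : (𝟏(d'.m) ⬝ₕ (ω ⊗₂ ω)) ⬝ᵥ c.φ2 = c'.φ2 ⬝ᵥ (ω ⬝ₕ 𝟏(d.m))
  nullary : c.φ0 = c'.φ0 ⬝ᵥ (ω ⬝ₕ 𝟏(d.u))

/-- The composite of opmonoidal 1-cells (first `f`, then `g`), on the level of data. -/
noncomputable def CellData.opComp {M : MonTwoCat.{u}} (g f : CellData M.toTwoCat) :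
    CellData M.toTwoCat where
  f := g.f ⬝₁ f.f
  φ2 := (g.φ2 ⬝ₕ 𝟏(f.f ⊗₁ f.f)) ⬝ᵥ (𝟏(g.f) ⬝ₕ f.φ2)
  φ0 := g.φ0 ⬝ᵥ (𝟏(g.f) ⬝ₕ f.φ0)

/-- The identity (op)monoidal 1-cell, on the level of data. -/
def PsmData.idCell {M : TwoCat.{u}} (d : PsmData M) : CellData M where
  f := M.id1 d.A
  φ2 := M.id2 d.m
  φ0 := M.id2 d.u

/-- A pseudomonoid in `M`; these are the 0-cells of `M₀₁`. -/
@[ext]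
structure Pseudomonoid (M : MonTwoCat.{u}) where
  data : PsmData M.toTwoCat
  law : IsPseudomonoid M data

/-- An opmonoidal 1-cell in `M`; these are the 1-cells of `M₀₁`. -/
@[ext]
structure Opmonoidal1 (M : MonTwoCat.{u}) where
  dom : Pseudomonoid M
  cod : Pseudomonoid M
  data : CellData M.toTwoCat
  law : IsOpmonoidal1 M dom.data cod.data data

/-- An opmonoidal 2-cell in `M`; these are the 2-cells of `M₀₁`. -/
@[ext]
structure Opmonoidal2 (M : MonTwoCat.{u}) where
  src : Opmonoidal1 M
  tgt : Opmonoidal1 M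
  dom_eq : tgt.dom = src.dom
  cod_eq : tgt.cod = src.cod
  ω : M.C2
  law : IsOpmonoidal2 M src.dom.data src.cod.data src.data tgt.data ω

section

open TwoCat MonTwoCat

variable {M : TwoCat.{u}}

attribute [simp] IsPseudomonoid.dom_m IsPseudomonoid.cod_m IsPseudomonoid.dom_u
  IsPseudomonoid.cod_u IsOpmonoidal1.dom_f IsOpmonoidal1.cod_f

theorem hc_id_id {f : M.C1} {g : M.C1} (h : M.cod f = M.dom g) : 𝟏g ⬝ₕ 𝟏f = 𝟏(g ⬝₁ f) :=
  (id2_c h).symm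

/-- Whiskering distributes over vertical composition. -/
theorem whisk_vc {b a : M.C2} {f : M.C1} (h : M.tgt a = M.src b)
    (hf : M.cod f = M.dom (M.src a)) : (b ⬝ᵥ a) ⬝ₕ 𝟏f = (b ⬝ₕ 𝟏f) ⬝ᵥ (a ⬝ₕ 𝟏f) := by
  rw [← hc_vc h (by simp) (by simpa using hf), vc_id (by simp)]

theorem vc_whisk {b a : M.C2} {f : M.C1} (h : M.tgt a = M.src b)
    (hf : M.cod (M.src a) = M.dom f) : 𝟏f ⬝ₕ (b ⬝ᵥ a) = (𝟏f ⬝ₕ b) ⬝ᵥ (𝟏f ⬝ₕ a) := by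
  rw [← hc_vc (by simp) h (by simpa using hf), vc_id (by simp)]

/-- The interchange of two whiskerings. -/
theorem whisk_swap {b a : M.C2} (h : M.cod (M.src a) = M.dom (M.src b)) :
    (b ⬝ₕ 𝟏(M.tgt a)) ⬝ᵥ (𝟏(M.src b) ⬝ₕ a) = (𝟏(M.tgt b) ⬝ₕ a) ⬝ᵥ (b ⬝ₕ 𝟏(M.src a)) := by
  rw [← hc_vc (by simp) (by simp) (by simpa using h), ← hc_vc (by simp) (by simp) (by simpa using h)]
  simp

end

end TwoDim

namespace TwoDim

open TwoCat MonTwoCat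

section

variable {M : TwoCat.{u}}

theorem paste_aux {f g m m' m'' p q x y z : M.C1} {φ γ ψ δ : M.C2} {X Y P Q R A B C : M.C0}
    (φs : M.src φ = f ⬝₁ m) (φt : M.tgt φ = m' ⬝₁ p)
    (γs : M.src γ = g ⬝₁ m') (γt : M.tgt γ = m'' ⬝₁ q)
    (ψs : M.src ψ = p ⬝₁ x) (ψt : M.tgt ψ = y ⬝₁ z) (δs : M.src δ = q ⬝₁ y)
    (hx : M.dom x = X) (hx' : M.cod x = P) (hp : M.dom p = P) (hp' : M.cod p = Q)
    (hm : M.dom m = P) (hm' : M.cod m = A) (hf : M.dom f = A) (hf' : M.cod f = B)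
    (hn : M.dom m' = Q) (hn' : M.cod m' = B) (hg : M.dom g = B) (hg' : M.cod g = C)
    (hk : M.dom m'' = R) (hk' : M.cod m'' = C) (hq : M.dom q = Q) (hq' : M.cod q = R)
    (hy : M.dom y = Y) (hy' : M.cod y = Q) (hz : M.dom z = X) (hz' : M.cod z = Y) :
    (𝟏m'' ⬝ₕ ((δ ⬝ₕ 𝟏z) ⬝ᵥ (𝟏q ⬝ₕ ψ))) ⬝ᵥ (((γ ⬝ₕ 𝟏p) ⬝ᵥ (𝟏g ⬝ₕ φ)) ⬝ₕ 𝟏x) =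
      (((𝟏m'' ⬝ₕ δ) ⬝ᵥ (γ ⬝ₕ 𝟏y)) ⬝ₕ 𝟏z) ⬝ᵥ (𝟏g ⬝ₕ ((𝟏m' ⬝ₕ ψ) ⬝ᵥ (φ ⬝ₕ 𝟏x))) := by
  have e1 : 𝟏m'' ⬝ₕ ((δ ⬝ₕ 𝟏z) ⬝ᵥ (𝟏q ⬝ₕ ψ)) =
      ((𝟏m'' ⬝ₕ δ) ⬝ₕ 𝟏z) ⬝ᵥ (𝟏(m'' ⬝₁ q) ⬝ₕ ψ) := by
    rw [vc_whisk, hc_assoc, id2_c, hc_assoc] <;> simp (maxDischargeDepth := 9) [*, c_assoc]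
  have e2 : ((γ ⬝ₕ 𝟏p) ⬝ᵥ (𝟏g ⬝ₕ φ)) ⬝ₕ 𝟏x =
      (γ ⬝ₕ 𝟏(p ⬝₁ x)) ⬝ᵥ (𝟏g ⬝ₕ (φ ⬝ₕ 𝟏x)) := by
    rw [whisk_vc, hc_assoc, id2_c, hc_assoc] <;> simp (maxDischargeDepth := 9) [*, c_assoc]
  have e3 : ((𝟏m'' ⬝ₕ δ) ⬝ᵥ (γ ⬝ₕ 𝟏y)) ⬝ₕ 𝟏z =
      ((𝟏m'' ⬝ₕ δ) ⬝ₕ 𝟏z) ⬝ᵥ (γ ⬝ₕ 𝟏(y ⬝₁ z)) := by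
    rw [whisk_vc, id2_c, hc_assoc (b := 𝟏y)] <;> simp (maxDischargeDepth := 9) [*, c_assoc]
  have e4 : 𝟏g ⬝ₕ ((𝟏m' ⬝ₕ ψ) ⬝ᵥ (φ ⬝ₕ 𝟏x)) =
      (𝟏(g ⬝₁ m') ⬝ₕ ψ) ⬝ᵥ (𝟏g ⬝ₕ (φ ⬝ₕ 𝟏x)) := by
    rw [vc_whisk, id2_c, hc_assoc] <;> simp (maxDischargeDepth := 9) [*, c_assoc]
  have e5 : (𝟏(m'' ⬝₁ q) ⬝ₕ ψ) ⬝ᵥ (γ ⬝ₕ 𝟏(p ⬝₁ x)) = (γ ⬝ₕ 𝟏(y ⬝₁ z)) ⬝ᵥ (𝟏(g ⬝₁ m') ⬝ₕ ψ) := by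
    have := whisk_swap (M := M) (b := γ) (a := ψ) (by simp [*])
    rw [γs, γt, ψs, ψt] at this
    exact this.symm
  rw [e1, e2, e3, e4, vc_assoc, ← vc_assoc (b := γ ⬝ₕ 𝟏(p ⬝₁ x)), e5, vc_assoc, vc_assoc] <;>
    (clear e1 e2 e3 e4 e5; simp (maxDischargeDepth := 9) [*, c_assoc])

theorem paste_counit {f g m m' m'' p q x y y' z k : M.C1} {φ γ ψ δ a a' a'' : M.C2}
    {X Y Y' P Q R A B C : M.C0}
    (φs : M.src φ = f ⬝₁ m) (φt : M.tgt φ = m' ⬝₁ p)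
    (γs : M.src γ = g ⬝₁ m') (γt : M.tgt γ = m'' ⬝₁ q)
    (ψs : M.src ψ = p ⬝₁ x) (ψt : M.tgt ψ = y ⬝₁ z)
    (δs : M.src δ = q ⬝₁ y) (δt : M.tgt δ = y' ⬝₁ k)
    (as : M.src a = m ⬝₁ x) (as' : M.src a' = m' ⬝₁ y) (as'' : M.src a'' = m'' ⬝₁ y')
    (hx : M.dom x = X) (hx' : M.cod x = P) (hp : M.dom p = P) (hp' : M.cod p = Q)
    (hm : M.dom m = P) (hm' : M.cod m = A) (hf : M.dom f = A) (hf' : M.cod f = B)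
    (hn : M.dom m' = Q) (hn' : M.cod m' = B) (hg : M.dom g = B) (hg' : M.cod g = C)
    (hk : M.dom m'' = R) (hk' : M.cod m'' = C) (hq : M.dom q = Q) (hq' : M.cod q = R)
    (hy : M.dom y = Y) (hy' : M.cod y = Q) (hz : M.dom z = X) (hz' : M.cod z = Y)
    (hu : M.dom y' = Y') (hu' : M.cod y' = R) (hj : M.dom k = Y) (hj' : M.cod k = Y')
    (ef : (a' ⬝ₕ 𝟏z) ⬝ᵥ (𝟏m' ⬝ₕ ψ) ⬝ᵥ (φ ⬝ₕ 𝟏x) = 𝟏f ⬝ₕ a)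
    (eg : (a'' ⬝ₕ 𝟏k) ⬝ᵥ (𝟏m'' ⬝ₕ δ) ⬝ᵥ (γ ⬝ₕ 𝟏y) = 𝟏g ⬝ₕ a') :
    (a'' ⬝ₕ 𝟏(k ⬝₁ z)) ⬝ᵥ (𝟏m'' ⬝ₕ ((δ ⬝ₕ 𝟏z) ⬝ᵥ (𝟏q ⬝ₕ ψ))) ⬝ᵥ
      (((γ ⬝ₕ 𝟏p) ⬝ᵥ (𝟏g ⬝ₕ φ)) ⬝ₕ 𝟏x) = 𝟏(g ⬝₁ f) ⬝ₕ a := by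
  rw [paste_aux φs φt γs γt ψs ψt δs hx hx' hp hp' hm hm' hf hf' hn hn' hg hg' hk hk' hq hq' hy hy'
    hz hz', id2_c, ← hc_assoc (c := a''), ← vc_assoc, ← whisk_vc, eg, hc_assoc, ← vc_whisk, ef,
    id2_c, hc_assoc]
  all_goals clear ef eg
  all_goals simp (maxDischargeDepth := 9) [*, c_assoc]

theorem paste_coassoc {f g m m' m'' p q x y y' z k v w w' : M.C1}
    {φ γ ψ δ χ ε a a' a'' : M.C2} {X Y Y' P Q R A B C : M.C0}
    (φs : M.src φ = f ⬝₁ m) (φt : M.tgt φ = m' ⬝₁ p)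
    (γs : M.src γ = g ⬝₁ m') (γt : M.tgt γ = m'' ⬝₁ q)
    (ψs : M.src ψ = p ⬝₁ x) (ψt : M.tgt ψ = y ⬝₁ z)
    (δs : M.src δ = q ⬝₁ y) (δt : M.tgt δ = y' ⬝₁ k)
    (χs : M.src χ = p ⬝₁ v) (χt : M.tgt χ = w ⬝₁ z)
    (εs : M.src ε = q ⬝₁ w) (εt : M.tgt ε = w' ⬝₁ k)
    (as : M.src a = m ⬝₁ x) (as' : M.src a' = m' ⬝₁ y) (as'' : M.src a'' = m'' ⬝₁ y')
    (at_ : M.tgt a = m ⬝₁ v) (at' : M.tgt a' = m' ⬝₁ w) (at'' : M.tgt a'' = m'' ⬝₁ w')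
    (hx : M.dom x = X) (hx' : M.cod x = P) (hp : M.dom p = P) (hp' : M.cod p = Q)
    (hm : M.dom m = P) (hm' : M.cod m = A) (hf : M.dom f = A) (hf' : M.cod f = B)
    (hn : M.dom m' = Q) (hn' : M.cod m' = B) (hg : M.dom g = B) (hg' : M.cod g = C)
    (hk : M.dom m'' = R) (hk' : M.cod m'' = C) (hq : M.dom q = Q) (hq' : M.cod q = R)
    (hy : M.dom y = Y) (hy' : M.cod y = Q) (hz : M.dom z = X) (hz' : M.cod z = Y)
    (hu : M.dom y' = Y') (hu' : M.cod y' = R) (hj : M.dom k = Y) (hj' : M.cod k = Y')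
    (hv : M.dom v = X) (hv' : M.cod v = P) (hw : M.dom w = Y) (hw' : M.cod w = Q)
    (ht : M.dom w' = Y') (ht' : M.cod w' = R)
    (ef : (a' ⬝ₕ 𝟏z) ⬝ᵥ (𝟏m' ⬝ₕ ψ) ⬝ᵥ (φ ⬝ₕ 𝟏x) =
      (𝟏m' ⬝ₕ χ) ⬝ᵥ (φ ⬝ₕ 𝟏v) ⬝ᵥ (𝟏f ⬝ₕ a))
    (eg : (a'' ⬝ₕ 𝟏k) ⬝ᵥ (𝟏m'' ⬝ₕ δ) ⬝ᵥ (γ ⬝ₕ 𝟏y) =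
      (𝟏m'' ⬝ₕ ε) ⬝ᵥ (γ ⬝ₕ 𝟏w) ⬝ᵥ (𝟏g ⬝ₕ a')) :
    (a'' ⬝ₕ 𝟏(k ⬝₁ z)) ⬝ᵥ (𝟏m'' ⬝ₕ ((δ ⬝ₕ 𝟏z) ⬝ᵥ (𝟏q ⬝ₕ ψ))) ⬝ᵥ
      (((γ ⬝ₕ 𝟏p) ⬝ᵥ (𝟏g ⬝ₕ φ)) ⬝ₕ 𝟏x) =
    (𝟏m'' ⬝ₕ ((ε ⬝ₕ 𝟏z) ⬝ᵥ (𝟏q ⬝ₕ χ))) ⬝ᵥ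
      (((γ ⬝ₕ 𝟏p) ⬝ᵥ (𝟏g ⬝ₕ φ)) ⬝ₕ 𝟏v) ⬝ᵥ (𝟏(g ⬝₁ f) ⬝ₕ a) := by
  have e1 := paste_aux φs φt γs γt ψs ψt δs hx hx' hp hp' hm hm' hf hf' hn hn' hg hg' hk hk' hq hq'
    hy hy' hz hz'
  have e2 := paste_aux φs φt γs γt χs χt εs hv hv' hp hp' hm hm' hf hf' hn hn' hg hg' hk hk' hq hq'
    hw hw' hz hz'
  rw [← vc_assoc (a := 𝟏(g ⬝₁ f) ⬝ₕ a), e1, e2]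
  · rw [id2_c, ← hc_assoc (c := a''), ← vc_assoc, ← whisk_vc, eg, id2_c (f := f),
      hc_assoc (a := a), vc_assoc (a := 𝟏g ⬝ₕ 𝟏f ⬝ₕ a), ← vc_whisk, vc_assoc (a := 𝟏f ⬝ₕ a),
      ← ef, ← vc_assoc (a := 𝟏g ⬝ₕ a'), whisk_vc, hc_assoc (b := a'), vc_assoc, ← vc_whisk]
    all_goals clear ef eg e1 e2
    all_goals simp (maxDischargeDepth := 9) [*, c_assoc]
  all_goals clear ef eg e1 e2
  all_goals simp (maxDischargeDepth := 9) [*, c_assoc]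

end

end TwoDim

namespace TwoDim

open TwoCat MonTwoCat

section

variable {M : MonTwoCat.{u}}

theorem t_vc_id {b a : M.C2} {f : M.C1} (h : M.tgt a = M.src b) :
    (b ⬝ᵥ a) ⊗₂ 𝟏f = (b ⊗₂ 𝟏f) ⬝ᵥ (a ⊗₂ 𝟏f) := by
  rw [← t_vc h (by simp), vc_id (by simp)]

theorem t_id_vc {b a : M.C2} {f : M.C1} (h : M.tgt a = M.src b) :
    𝟏f ⊗₂ (b ⬝ᵥ a) = (𝟏f ⊗₂ b) ⬝ᵥ (𝟏f ⊗₂ a) := by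
  rw [← t_vc (by simp) h, vc_id (by simp)]

theorem IsOpmonoidal1.comp {d d' d'' : PsmData M.toTwoCat} {g f : CellData M.toTwoCat}
    (hd : IsPseudomonoid M d) (hd' : IsPseudomonoid M d') (hd'' : IsPseudomonoid M d'')
    (hg : IsOpmonoidal1 M d' d'' g) (hf : IsOpmonoidal1 M d d' f) :
    IsOpmonoidal1 M d d'' (g.opComp f) := by
  obtain ⟨df, cf, s2, t2', s0, t0', ca, cl, cr⟩ := hf
  obtain ⟨dg, cg, gs2, gt2, gs0, gt0, ga, gl, gr⟩ := hg
  obtain ⟨dm, cm, du, cu, sα, tα, sl, tl, sr, tr, -, -, -, -, -⟩ := hd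
  obtain ⟨dm', cm', du', cu', sα', tα', sl', tl', sr', tr', -, -, -, -, -⟩ := hd'
  obtain ⟨dm'', cm'', du'', cu'', sα'', tα'', sl'', tl'', sr'', tr'', -, -, -, -, -⟩ := hd''
  have T1 : ((g.φ2 ⬝ₕ 𝟏(f.f ⊗₁ f.f)) ⬝ᵥ (𝟏(g.f) ⬝ₕ f.φ2)) ⊗₂ 𝟏(g.f ⬝₁ f.f) =
      ((g.φ2 ⊗₂ 𝟏(g.f)) ⬝ₕ 𝟏(f.f ⊗₁ f.f ⊗₁ f.f)) ⬝ᵥ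
        (𝟏(g.f ⊗₁ g.f) ⬝ₕ (f.φ2 ⊗₂ 𝟏(f.f))) := by
    rw [t_vc_id, id2_c, t_hc, t_hc] <;> simp (maxDischargeDepth := 9) [*, c_assoc]
  have T2 : 𝟏(g.f ⬝₁ f.f) ⊗₂ ((g.φ2 ⬝ₕ 𝟏(f.f ⊗₁ f.f)) ⬝ᵥ (𝟏(g.f) ⬝ₕ f.φ2)) =
      ((𝟏(g.f) ⊗₂ g.φ2) ⬝ₕ 𝟏(f.f ⊗₁ f.f ⊗₁ f.f)) ⬝ᵥ
        (𝟏(g.f ⊗₁ g.f) ⬝ₕ (𝟏(f.f) ⊗₂ f.φ2)) := by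
    rw [t_id_vc, id2_c, t_hc, t_hc] <;> simp (maxDischargeDepth := 9) [*, c_assoc]
  have T3 : (g.φ0 ⬝ᵥ (𝟏(g.f) ⬝ₕ f.φ0)) ⊗₂ 𝟏(g.f ⬝₁ f.f) =
      ((g.φ0 ⊗₂ 𝟏(g.f)) ⬝ₕ 𝟏(f.f)) ⬝ᵥ (𝟏(g.f ⊗₁ g.f) ⬝ₕ (f.φ0 ⊗₂ 𝟏(f.f))) := by
    have e : (g.φ0 ⊗₂ 𝟏(g.f)) ⬝ₕ 𝟏(f.f) = g.φ0 ⊗₂ 𝟏(g.f ⬝₁ f.f) := by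
      conv_lhs => rw [← unit_t2 (𝟏(f.f))]
      rw [id2_c, ← t_hc, hc_id] <;> simp (maxDischargeDepth := 9) [*, c_assoc]
    rw [t_vc_id, e, id2_c, t_hc] <;> simp (maxDischargeDepth := 9) [*, c_assoc]
  have T4 : 𝟏(g.f ⬝₁ f.f) ⊗₂ (g.φ0 ⬝ᵥ (𝟏(g.f) ⬝ₕ f.φ0)) =
      ((𝟏(g.f) ⊗₂ g.φ0) ⬝ₕ 𝟏(f.f)) ⬝ᵥ (𝟏(g.f ⊗₁ g.f) ⬝ₕ (𝟏(f.f) ⊗₂ f.φ0)) := by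
    have e : (𝟏(g.f) ⊗₂ g.φ0) ⬝ₕ 𝟏(f.f) = 𝟏(g.f ⬝₁ f.f) ⊗₂ g.φ0 := by
      conv_lhs => rw [← t2_unit (𝟏(f.f))]
      rw [id2_c, ← t_hc, hc_id] <;> simp (maxDischargeDepth := 9) [*, c_assoc]
    rw [t_id_vc, e, id2_c, t_hc] <;> simp (maxDischargeDepth := 9) [*, c_assoc]
  have C0 : (g.f ⬝₁ f.f) ⊗₁ (g.f ⬝₁ f.f) = (g.f ⊗₁ g.f) ⬝₁ (f.f ⊗₁ f.f) := by
    rw [← t_c] <;> simp [*]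
  have C1 : (f.f ⬝₁ d.m) ⊗₁ f.f = (f.f ⊗₁ f.f) ⬝₁ (d.m ⊗₁ M.id1 d.A) := by
    rw [← t_c] <;> simp [*]
  have C2 : f.f ⊗₁ (f.f ⬝₁ d.m) = (f.f ⊗₁ f.f) ⬝₁ (M.id1 d.A ⊗₁ d.m) := by
    rw [← t_c] <;> simp [*]
  have C3 : ∀ k : CellData M.toTwoCat, ∀ e : PsmData M.toTwoCat, M.cod k.f = e.A →
      M.dom e.m = e.A ⊗₀ e.A → M.cod e.m = e.A → (e.m ⬝₁ (k.f ⊗₁ k.f)) ⊗₁ k.f =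
      (e.m ⊗₁ M.id1 e.A) ⬝₁ (k.f ⊗₁ k.f ⊗₁ k.f) := by
    intro k e h1 h2 h3
    rw [← t1_assoc, ← t_c] <;> simp [*]
  have C4 : ∀ k : CellData M.toTwoCat, ∀ e : PsmData M.toTwoCat, M.cod k.f = e.A →
      M.dom e.m = e.A ⊗₀ e.A → M.cod e.m = e.A → k.f ⊗₁ (e.m ⬝₁ (k.f ⊗₁ k.f)) =
      (M.id1 e.A ⊗₁ e.m) ⬝₁ (k.f ⊗₁ k.f ⊗₁ k.f) := by
    intro k e h1 h2 h3
    rw [← t_c] <;> simp [*]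
  have C5 : (g.f ⬝₁ d'.m) ⊗₁ g.f = (g.f ⊗₁ g.f) ⬝₁ (d'.m ⊗₁ M.id1 d'.A) := by
    rw [← t_c] <;> simp [*]
  have C6 : g.f ⊗₁ (g.f ⬝₁ d'.m) = (g.f ⊗₁ g.f) ⬝₁ (M.id1 d'.A ⊗₁ d'.m) := by
    rw [← t_c] <;> simp [*]
  have C7 : (f.f ⬝₁ d.u) ⊗₁ f.f = (f.f ⊗₁ f.f) ⬝₁ (d.u ⊗₁ M.id1 d.A) := by
    rw [← t_c] <;> simp [*]
  have C8 : f.f ⊗₁ (f.f ⬝₁ d.u) = (f.f ⊗₁ f.f) ⬝₁ (M.id1 d.A ⊗₁ d.u) := by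
    rw [← t_c] <;> simp [*]
  have C9 : ∀ k : CellData M.toTwoCat, ∀ e : PsmData M.toTwoCat, M.cod k.f = e.A →
      M.dom e.u = M.unit → M.cod e.u = e.A → e.u ⊗₁ k.f = (e.u ⊗₁ M.id1 e.A) ⬝₁ k.f := by
    intro k e h1 h2 h3
    conv_rhs => rw [← unit_t1 k.f, ← t_c (by simp [*]) (by simp [*])]
    simp [*]
  have C10 : ∀ k : CellData M.toTwoCat, ∀ e : PsmData M.toTwoCat, M.cod k.f = e.A →
      M.dom e.u = M.unit → M.cod e.u = e.A → k.f ⊗₁ e.u = (M.id1 e.A ⊗₁ e.u) ⬝₁ k.f := by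
    intro k e h1 h2 h3
    conv_rhs => rw [← t1_unit k.f, ← t_c (by simp [*]) (by simp [*])]
    simp [*]
  have C11 : (g.f ⬝₁ d'.u) ⊗₁ g.f = (g.f ⊗₁ g.f) ⬝₁ (d'.u ⊗₁ M.id1 d'.A) := by
    rw [← t_c] <;> simp [*]
  have C12 : g.f ⊗₁ (g.f ⬝₁ d'.u) = (g.f ⊗₁ g.f) ⬝₁ (M.id1 d'.A ⊗₁ d'.u) := by
    rw [← t_c] <;> simp [*]
  refine ⟨?_, ?_, ?_, ?_, ?_, ?_, ?_, ?_, ?_⟩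
  · simp (maxDischargeDepth := 9) [CellData.opComp, *]
  · simp (maxDischargeDepth := 9) [CellData.opComp, *]
  · simp (maxDischargeDepth := 9) [CellData.opComp, *, c_assoc]
  · clear ca cl cr ga gl gr T1 T2 T3 T4 C3 C4 C9 C10
    simp (maxDischargeDepth := 9) [CellData.opComp, *, c_assoc]
  · simp (maxDischargeDepth := 9) [CellData.opComp, *, c_assoc]
  · simp (maxDischargeDepth := 9) [CellData.opComp, *, c_assoc]
  · have E : (g.f ⬝₁ f.f) ⊗₁ (g.f ⬝₁ f.f) ⊗₁ (g.f ⬝₁ f.f) =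
        (g.f ⊗₁ g.f ⊗₁ g.f) ⬝₁ (f.f ⊗₁ f.f ⊗₁ f.f) := by
      rw [C0, t_c] <;> simp [*]
    simp only [CellData.opComp, T1, T2, E]
    clear T1 T2 T3 T4
    apply paste_coassoc (ef := ca) (eg := ga) (m := d.m) (m' := d'.m) (x := d.m ⊗₁ M.id1 d.A)
      (y := d'.m ⊗₁ M.id1 d'.A) (y' := d''.m ⊗₁ M.id1 d''.A) (v := M.id1 d.A ⊗₁ d.m)
      (w := M.id1 d'.A ⊗₁ d'.m) (w' := M.id1 d''.A ⊗₁ d''.m) <;>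
      first
      | simp [*]; done
      | rfl
  · simp only [CellData.opComp, T3]
    clear T1 T2 T3 T4
    apply paste_counit (ef := cl) (eg := gl) (m := d.m) (m' := d'.m) (x := d.u ⊗₁ M.id1 d.A)
      (y := d'.u ⊗₁ M.id1 d'.A) (y' := d''.u ⊗₁ M.id1 d''.A) <;>
      first
      | simp [*]; done
      | rfl
  · simp only [CellData.opComp, T4]
    clear T1 T2 T3 T4
    apply paste_counit (ef := cr) (eg := gr) (m := d.m) (m' := d'.m) (x := M.id1 d.A ⊗₁ d.u)
      (y := M.id1 d'.A ⊗₁ d'.u) (y' := M.id1 d''.A ⊗₁ d''.u) <;>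
      first
      | simp [*]; done
      | rfl

end

end TwoDim

namespace TwoDim

open TwoCat MonTwoCat

section

variable {M : MonTwoCat.{u}}

theorem IsPseudomonoid.idCell {d : PsmData M.toTwoCat} (hd : IsPseudomonoid M d) :
    IsOpmonoidal1 M d d d.idCell := by
  obtain ⟨dm, cm, du, cu, sα, tα, sl, tl, sr, tr, -, -, -, -, -⟩ := hd
  refine ⟨?_, ?_, ?_, ?_, ?_, ?_, ?_, ?_, ?_⟩ <;> simp only [PsmData.idCell]
  all_goals simp (maxDischargeDepth := 9) [*, hc_id_id]

theorem IsOpmonoidal2.id {d d' : PsmData M.toTwoCat} {c : CellData M.toTwoCat}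
    (hd : IsPseudomonoid M d) (hd' : IsPseudomonoid M d') (h : IsOpmonoidal1 M d d' c) :
    IsOpmonoidal2 M d d' c c (𝟏(c.f)) := by
  obtain ⟨df, cf, s2, t2', s0, t0', -, -, -⟩ := h
  obtain ⟨dm, cm, du, cu, sα, tα, sl, tl, sr, tr, -, -, -, -, -⟩ := hd
  obtain ⟨dm', cm', du', cu', sα', tα', sl', tl', sr', tr', -, -, -, -, -⟩ := hd'
  refine ⟨by simp, by simp, ?_, ?_⟩
  all_goals simp (maxDischargeDepth := 9) [*, hc_id_id]

theorem IsOpmonoidal2.vcomp {d d' : PsmData M.toTwoCat} {c c' c'' : CellData M.toTwoCat}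
    {b a : M.C2}
    (hd : IsPseudomonoid M d) (hd' : IsPseudomonoid M d') (h : IsOpmonoidal1 M d d' c)
    (h' : IsOpmonoidal1 M d d' c') (h'' : IsOpmonoidal1 M d d' c'')
    (hb : IsOpmonoidal2 M d d' c' c'' b) (ha : IsOpmonoidal2 M d d' c c' a) :
    IsOpmonoidal2 M d d' c c'' (b ⬝ᵥ a) := by
  obtain ⟨df, cf, s2, t2', s0, t0', -, -, -⟩ := h
  obtain ⟨df', cf', s2', t2'', s0', t0'', -, -, -⟩ := h'
  obtain ⟨df'', cf'', s2'', t2''', s0'', t0''', -, -, -⟩ := h''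
  obtain ⟨dm, cm, du, cu, sα, tα, sl, tl, sr, tr, -, -, -, -, -⟩ := hd
  obtain ⟨dm', cm', du', cu', sα', tα', sl', tl', sr', tr', -, -, -, -, -⟩ := hd'
  obtain ⟨sa, ta, a2, a0⟩ := ha
  obtain ⟨sb, tb, b2, b0⟩ := hb
  have hba : M.tgt a = M.src b := by rw [ta, sb]
  refine ⟨by simp [*], by simp [*], ?_, ?_⟩
  · rw [t_vc hba hba, vc_whisk, vc_assoc, a2, ← vc_assoc, b2, vc_assoc, whisk_vc]
    all_goals clear a2 b2 a0 b0
    all_goals simp (maxDischargeDepth := 9) [*, hc_id_id]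
  · rw [a0, b0, whisk_vc, vc_assoc]
    all_goals clear a2 b2 a0 b0
    all_goals simp (maxDischargeDepth := 9) [*, hc_id_id]

theorem IsOpmonoidal2.hcomp {d d' d'' : PsmData M.toTwoCat} {c c' k k' : CellData M.toTwoCat}
    {b a : M.C2}
    (hd : IsPseudomonoid M d) (hd' : IsPseudomonoid M d') (hd'' : IsPseudomonoid M d'')
    (h : IsOpmonoidal1 M d d' c) (h' : IsOpmonoidal1 M d d' c')
    (hk : IsOpmonoidal1 M d' d'' k) (hk' : IsOpmonoidal1 M d' d'' k')
    (hb : IsOpmonoidal2 M d' d'' k k' b) (ha : IsOpmonoidal2 M d d' c c' a) :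
    IsOpmonoidal2 M d d'' (k.opComp c) (k'.opComp c') (b ⬝ₕ a) := by
  obtain ⟨df, cf, s2, t2', s0, t0', -, -, -⟩ := h
  obtain ⟨df', cf', s2', t2'', s0', t0'', -, -, -⟩ := h'
  obtain ⟨kdf, kcf, ks2, kt2', ks0, kt0', -, -, -⟩ := hk
  obtain ⟨kdf', kcf', ks2', kt2'', ks0', kt0'', -, -, -⟩ := hk'
  obtain ⟨dm, cm, du, cu, sα, tα, sl, tl, sr, tr, -, -, -, -, -⟩ := hd
  obtain ⟨dm', cm', du', cu', sα', tα', sl', tl', sr', tr', -, -, -, -, -⟩ := hd'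
  obtain ⟨dm'', cm'', du'', cu'', sα'', tα'', sl'', tl'', sr'', tr'', -, -, -, -, -⟩ := hd''
  obtain ⟨sa, ta, a2, a0⟩ := ha
  obtain ⟨sb, tb, b2, b0⟩ := hb
  have hba : M.cod (M.src a) = M.dom (M.src b) := by rw [sa, sb, cf, kdf]
  have C0 : (k.f ⬝₁ c.f) ⊗₁ (k.f ⬝₁ c.f) = (k.f ⊗₁ k.f) ⬝₁ (c.f ⊗₁ c.f) := by
    rw [← t_c] <;> simp [*]
  have e1 : (𝟏(d''.m) ⬝ₕ ((b ⬝ₕ a) ⊗₂ (b ⬝ₕ a))) ⬝ᵥ (k.φ2 ⬝ₕ 𝟏(c.f ⊗₁ c.f)) =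
      ((𝟏(d''.m) ⬝ₕ (b ⊗₂ b)) ⬝ᵥ k.φ2) ⬝ₕ (a ⊗₂ a) := by
    rw [t_hc hba hba, ← hc_assoc, ← hc_vc, vc_id]
    all_goals clear a2 b2 a0 b0
    all_goals simp (maxDischargeDepth := 9) [*, c_assoc]
  have e2 : (k'.φ2 ⬝ᵥ (b ⬝ₕ 𝟏(d'.m))) ⬝ₕ (a ⊗₂ a) =
      (k'.φ2 ⬝ₕ 𝟏(c'.f ⊗₁ c'.f)) ⬝ᵥ (b ⬝ₕ (𝟏(d'.m) ⬝ₕ (a ⊗₂ a))) := by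
    rw [← hc_assoc, ← hc_vc, id_vc]
    all_goals clear a2 b2 a0 b0
    all_goals simp (maxDischargeDepth := 9) [*, c_assoc]
  have e3 : (b ⬝ₕ (𝟏(d'.m) ⬝ₕ (a ⊗₂ a))) ⬝ᵥ (𝟏(k.f) ⬝ₕ c.φ2) =
      b ⬝ₕ ((𝟏(d'.m) ⬝ₕ (a ⊗₂ a)) ⬝ᵥ c.φ2) := by
    rw [← hc_vc, vc_id]
    all_goals clear a2 b2 a0 b0
    all_goals simp (maxDischargeDepth := 9) [*, c_assoc]
  have e4 : b ⬝ₕ (c'.φ2 ⬝ᵥ (a ⬝ₕ 𝟏(d.m))) =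
      (𝟏(k'.f) ⬝ₕ c'.φ2) ⬝ᵥ ((b ⬝ₕ a) ⬝ₕ 𝟏(d.m)) := by
    rw [hc_assoc, ← hc_vc, id_vc]
    all_goals clear a2 b2 a0 b0
    all_goals simp (maxDischargeDepth := 9) [*, c_assoc]
  refine ⟨?_, ?_, ?_, ?_⟩
  · simp [CellData.opComp, *]
  · simp [CellData.opComp, *]
  · simp only [CellData.opComp]
    rw [← vc_assoc, e1, b2, e2, vc_assoc, e3, a2, e4, vc_assoc]
    all_goals clear a2 b2 a0 b0 e1 e2 e3 e4
    all_goals simp (maxDischargeDepth := 9) [*, c_assoc]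
  · simp only [CellData.opComp]
    have e6 : (b ⬝ₕ 𝟏(d'.u)) ⬝ᵥ (𝟏(k.f) ⬝ₕ (c'.φ0 ⬝ᵥ (a ⬝ₕ 𝟏(d.u)))) =
        (𝟏(k'.f) ⬝ₕ c'.φ0) ⬝ᵥ ((b ⬝ₕ a) ⬝ₕ 𝟏(d.u)) := by
      rw [← hc_vc, vc_id, hc_assoc, ← hc_vc, id_vc, id_vc]
      all_goals clear a2 b2 a0 b0 e1 e2 e3 e4
      all_goals simp (maxDischargeDepth := 9) [*, c_assoc]
    rw [b0, a0, vc_assoc, e6, vc_assoc]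
    all_goals clear a2 b2 a0 b0 e1 e2 e3 e4 e6
    all_goals simp (maxDischargeDepth := 9) [*, c_assoc]

end

end TwoDim

namespace TwoDim

open TwoCat MonTwoCat

/-- The composite of opmonoidal 1-cells. -/
noncomputable def Opmonoidal1.comp {M : MonTwoCat.{u}} (g f : Opmonoidal1 M) (h : f.cod = g.dom) :
    Opmonoidal1 M where
  dom := f.dom
  cod := g.cod
  data := g.data.opComp f.data
  law := IsOpmonoidal1.comp f.dom.law g.dom.law g.cod.law g.law (h ▸ f.law)

/-- The identity opmonoidal 1-cell. -/
def Opmonoidal1.id {M : MonTwoCat.{u}} (A : Pseudomonoid M) : Opmonoidal1 M where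
  dom := A
  cod := A
  data := A.data.idCell
  law := A.law.idCell

theorem Opmonoidal1.comp_id {M : MonTwoCat.{u}} (f : Opmonoidal1 M) (A : Pseudomonoid M)
    (h : (Opmonoidal1.id A).cod = f.dom) : f.comp (Opmonoidal1.id A) h = f := by
  obtain rfl : A = f.dom := h
  obtain ⟨A, B, c, hc⟩ := f
  obtain ⟨df, cf, s2, t2', s0, t0', -, -, -⟩ := hc
  have := A.law.dom_m
  have := A.law.cod_m
  have := A.law.dom_u
  have := A.law.cod_u
  refine Opmonoidal1.ext rfl rfl (CellData.ext ?_ ?_ ?_) <;>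
    simp (maxDischargeDepth := 9) [Opmonoidal1.comp, Opmonoidal1.id, CellData.opComp,
      PsmData.idCell, hc_id_id, *]

theorem Opmonoidal1.id_comp {M : MonTwoCat.{u}} (f : Opmonoidal1 M) (A : Pseudomonoid M)
    (h : f.cod = (Opmonoidal1.id A).dom) : (Opmonoidal1.id A).comp f h = f := by
  obtain rfl : f.cod = A := h
  obtain ⟨A, B, c, hc⟩ := f
  obtain ⟨df, cf, s2, t2', s0, t0', -, -, -⟩ := hc
  have := B.law.dom_m
  have := B.law.cod_m
  have := B.law.dom_u
  have := B.law.cod_u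
  have := A.law.cod_m
  have := A.law.cod_u
  refine Opmonoidal1.ext rfl rfl (CellData.ext ?_ ?_ ?_) <;>
    simp (maxDischargeDepth := 9) [Opmonoidal1.comp, Opmonoidal1.id, CellData.opComp,
      PsmData.idCell, hc_id_id, *]

theorem Opmonoidal1.comp_assoc {M : MonTwoCat.{u}} (k g f : Opmonoidal1 M) (h : f.cod = g.dom)
    (h' : g.cod = k.dom) : (k.comp g h').comp f h = k.comp (g.comp f h) h' := by
  obtain ⟨A, B, c, hc⟩ := f
  obtain ⟨B', C, c', hc'⟩ := g
  obtain ⟨C', D, c'', hc''⟩ := k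
  obtain rfl : B = B' := h
  obtain rfl : C = C' := h'
  obtain ⟨df, cf, s2, t2', s0, t0', -, -, -⟩ := hc
  obtain ⟨df', cf', s2', t2'', s0', t0'', -, -, -⟩ := hc'
  obtain ⟨df'', cf'', s2'', t2''', s0'', t0''', -, -, -⟩ := hc''
  obtain ⟨dA, mA, uA, _⟩ := A.law
  obtain ⟨dB, mB, uB, _⟩ := B.law
  obtain ⟨dC, mC, uC, _⟩ := C.law
  obtain ⟨dD, mD, uD, _⟩ := D.law
  have C0 : (c'.f ⬝₁ c.f) ⊗₁ (c'.f ⬝₁ c.f) = (c'.f ⊗₁ c'.f) ⬝₁ (c.f ⊗₁ c.f) := by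
    rw [← t_c] <;> simp [*]
  refine Opmonoidal1.ext rfl rfl (CellData.ext ?_ ?_ ?_) <;>
    simp (maxDischargeDepth := 9) [Opmonoidal1.comp, CellData.opComp, id2_c, whisk_vc, vc_whisk,
      vc_assoc, hc_assoc, c_assoc, *]

theorem Opmonoidal2.law_tgt {M : MonTwoCat.{u}} (a : Opmonoidal2 M) :
    IsOpmonoidal1 M a.src.dom.data a.src.cod.data a.tgt.data := by
  have := a.tgt.law
  rwa [a.dom_eq, a.cod_eq] at this

/-- The 2-category `M₀₁` of pseudomonoids, opmonoidal 1-cells and opmonoidal 2-cells in a strict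
monoidal 2-category `M`. -/
noncomputable def MonTwoCat.opm (M : MonTwoCat.{u}) : TwoCat.{u} where
  C0 := Pseudomonoid M
  C1 := Opmonoidal1 M
  C2 := Opmonoidal2 M
  dom f := f.dom
  cod f := f.cod
  src a := a.src
  tgt a := a.tgt
  dom_tgt a := a.dom_eq
  cod_tgt a := a.cod_eq
  id1 A := Opmonoidal1.id A
  id2 f :=
    { src := f
      tgt := f
      dom_eq := rfl
      cod_eq := rfl
      ω := 𝟏(f.data.f)
      law := IsOpmonoidal2.id f.dom.law f.cod.law f.law }
  comp g f h := g.comp f h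
  vcomp b a h :=
    { src := a.src
      tgt := b.tgt
      dom_eq := by rw [b.dom_eq, ← h, a.dom_eq]
      cod_eq := by rw [b.cod_eq, ← h, a.cod_eq]
      ω := b.ω ⬝ᵥ a.ω
      law := by
        have hb := b.law
        have hb' := b.law_tgt
        rw [← h, a.dom_eq, a.cod_eq] at hb hb'
        exact IsOpmonoidal2.vcomp a.src.dom.law a.src.cod.law a.src.law a.law_tgt hb' hb a.law }
  hcomp b a h :=
    { src := b.src.comp a.src h
      tgt := b.tgt.comp a.tgt (by rw [a.cod_eq, b.dom_eq, h])
      dom_eq := a.dom_eq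
      cod_eq := b.cod_eq
      ω := b.ω ⬝ₕ a.ω
      law := by
        have h1 := a.law
        have h2 := a.law_tgt
        have h3 := a.src.law
        rw [h] at h1 h2 h3
        exact IsOpmonoidal2.hcomp a.src.dom.law b.src.dom.law b.src.cod.law h3 h2 b.src.law
          b.law_tgt b.law h1 }
  dom_id1 A := rfl
  cod_id1 A := rfl
  dom_comp g f h := rfl
  cod_comp g f h := rfl
  comp_id1 f := f.comp_id _ rfl
  id1_comp f := f.id_comp _ rfl
  comp_assoc k g f h h' := k.comp_assoc g f h h'
  src_id2 f := rfl
  tgt_id2 f := rfl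
  src_vcomp b a h := rfl
  tgt_vcomp b a h := rfl
  vcomp_id2 a := by
    refine Opmonoidal2.ext rfl rfl ?_
    exact vc_id a.law.src_ω
  id2_vcomp a := by
    refine Opmonoidal2.ext rfl rfl ?_
    exact id_vc a.law.tgt_ω
  vcomp_assoc c b a h h' := by
    refine Opmonoidal2.ext rfl rfl ?_
    exact vc_assoc (by rw [a.law.tgt_ω, b.law.src_ω, h]) (by rw [b.law.tgt_ω, c.law.src_ω, h'])
  src_hcomp b a h := rfl
  tgt_hcomp b a h := rfl
  hcomp_id2 a := by
    refine Opmonoidal2.ext ?_ ?_ ?_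
    · exact a.src.comp_id _ rfl
    · exact a.tgt.comp_id _ a.dom_eq.symm
    exact hc_id (by rw [a.law.src_ω, a.src.law.dom_f])
  id2_hcomp a := by
    refine Opmonoidal2.ext ?_ ?_ ?_
    · exact a.src.id_comp _ rfl
    · exact a.tgt.id_comp _ a.cod_eq
    exact id_hc (by rw [a.law.src_ω, a.src.law.cod_f])
  hcomp_assoc c b a h h' := by
    refine Opmonoidal2.ext ?_ ?_ ?_
    · exact c.src.comp_assoc b.src a.src h h'
    · exact c.tgt.comp_assoc b.tgt a.tgt (by rw [a.cod_eq, b.dom_eq]; exact h)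
        (by rw [b.cod_eq, c.dom_eq]; exact h')
    exact hc_assoc (by rw [a.law.src_ω, b.law.src_ω, a.src.law.cod_f, b.src.law.dom_f, h])
      (by rw [b.law.src_ω, c.law.src_ω, b.src.law.cod_f, c.src.law.dom_f, h'])
  id2_comp g f h := by
    refine Opmonoidal2.ext rfl rfl ?_
    exact id2_c (by rw [f.law.cod_f, g.law.dom_f, h])
  interchange b' b a' a hb ha h := by
    refine Opmonoidal2.ext rfl rfl ?_
    exact hc_vc (by rw [b.law.tgt_ω, b'.law.src_ω, hb]) (by rw [a.law.tgt_ω, a'.law.src_ω, ha])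
      (by rw [a.law.src_ω, b.law.src_ω, a.src.law.cod_f, b.src.law.dom_f, h])

end TwoDim

namespace TwoDim

open TwoCat MonTwoCat

/-- A 2-functor `F` between strict monoidal 2-categories, equipped with strictly coherent 2-natural
1-cells `μ : F A ⊗ F B → F (A ⊗ B)`, and strictly preserving the unit. It is an auxiliary notion:
the examples needed are the strict monoidal 2-functors, with `μ = 1`, and the monoidal product
2-functor itself, with `μ` given by the symmetry. -/
structure LaxFunctor (M N : MonTwoCat.{u}) extends TwoFunctor M.toTwoCat N.toTwoCat where
  μ : M.C0 → M.C0 → N.C1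
  map_unit : map0 M.unit = N.unit
  dom_μ : ∀ A B, N.dom (μ A B) = map0 A ⊗₀ map0 B
  cod_μ : ∀ A B, N.cod (μ A B) = map0 (A ⊗₀ B)
  μ_nat1 : ∀ f g : M.C1, map1 (f ⊗₁ g) ⬝₁ μ (M.dom f) (M.dom g) =
    μ (M.cod f) (M.cod g) ⬝₁ (map1 f ⊗₁ map1 g)
  μ_nat2 : ∀ a b : M.C2, map2 (a ⊗₂ b) ⬝ₕ 𝟏(μ (M.dom (M.src a)) (M.dom (M.src b))) =
    𝟏(μ (M.cod (M.src a)) (M.cod (M.src b))) ⬝ₕ (map2 a ⊗₂ map2 b)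
  μ_assoc : ∀ A B C, μ (A ⊗₀ B) C ⬝₁ (μ A B ⊗₁ N.id1 (map0 C)) =
    μ A (B ⊗₀ C) ⬝₁ (N.id1 (map0 A) ⊗₁ μ B C)
  μ_unit_left : ∀ A, μ M.unit A = N.id1 (map0 A)
  μ_unit_right : ∀ A, μ A M.unit = N.id1 (map0 A)

attribute [simp] LaxFunctor.dom_μ LaxFunctor.cod_μ LaxFunctor.μ_unit_left LaxFunctor.μ_unit_right
  LaxFunctor.map_unit

namespace LaxFunctor

variable {M N : MonTwoCat.{u}} (F : LaxFunctor M N)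

/-- The image of pseudomonoid data. -/
noncomputable def psm (d : PsmData M.toTwoCat) : PsmData N.toTwoCat where
  A := F.map0 d.A
  m := F.map1 d.m ⬝₁ F.μ d.A d.A
  u := F.map1 d.u
  α := F.map2 d.α ⬝ₕ 𝟏(F.μ (d.A ⊗₀ d.A) d.A ⬝₁ (F.μ d.A d.A ⊗₁ N.id1 (F.map0 d.A)))
  lam := F.map2 d.lam
  rho := F.map2 d.rho

/-- The image of the data of an (op)monoidal 1-cell. -/
noncomputable def cell (c : CellData M.toTwoCat) : CellData N.toTwoCat where
  f := F.map1 c.f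
  φ2 := F.map2 c.φ2 ⬝ₕ 𝟏(F.μ (M.dom c.f) (M.dom c.f))
  φ0 := F.map2 c.φ0

theorem map_inv {a : M.C2} (h : IsInvertible a) : IsInvertible (F.map2 a) := by
  obtain ⟨b, hs, ht, h1, h2⟩ := h
  refine ⟨F.map2 b, by simp [hs], by simp [ht], ?_, ?_⟩
  · rw [← F.map_vc hs.symm, h1]; simp
  · rw [← F.map_vc ht, h2]; simp

theorem hc_inv {M : TwoCat.{u}} {a : M.C2} {f : M.C1} (h : IsInvertible a)
    (hf : M.cod f = M.dom (M.src a)) : IsInvertible (a ⬝ₕ 𝟏f) := by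
  obtain ⟨b, hs, ht, h1, h2⟩ := h
  refine ⟨b ⬝ₕ 𝟏f, ?_, ?_, ?_, ?_⟩
  · simp [hs, hf]
  · simp [ht, hs, hf]
  · rw [← whisk_vc hs.symm hf, h1, hc_id_id (by simpa using hf)]; simp [hf]
  · rw [← whisk_vc ht (by simpa [hs] using hf), h2, hc_id_id (by simpa using hf)]; simp [hf]


theorem n1 {f g : M.C1} {A B A' B' : M.C0} (h1 : M.dom f = A) (h2 : M.dom g = B)
    (h3 : M.cod f = A') (h4 : M.cod g = B') :
    F.μ A' B' ⬝₁ (F.map1 f ⊗₁ F.map1 g) = F.map1 (f ⊗₁ g) ⬝₁ F.μ A B := by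
  subst h1 h2 h3 h4; exact (F.μ_nat1 f g).symm

theorem n2 {a b : M.C2} {A B A' B' : M.C0} (h1 : M.dom (M.src a) = A) (h2 : M.dom (M.src b) = B)
    (h3 : M.cod (M.src a) = A') (h4 : M.cod (M.src b) = B') :
    𝟏(F.μ A' B') ⬝ₕ (F.map2 a ⊗₂ F.map2 b) = F.map2 (a ⊗₂ b) ⬝ₕ 𝟏(F.μ A B) := by
  subst h1 h2 h3 h4; exact (F.μ_nat2 a b).symm

theorem norm1 {m f g : M.C1} {w w' : N.C1} {A B A' B' : M.C0} (hm : M.dom m = A' ⊗₀ B')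
    (h1 : M.dom f = A) (h2 : M.dom g = B) (h3 : M.cod f = A') (h4 : M.cod g = B')
    (hw : N.cod w = F.map0 A) (hw' : N.cod w' = F.map0 B) :
    (F.map1 m ⬝₁ F.μ A' B') ⬝₁ ((F.map1 f ⬝₁ w) ⊗₁ (F.map1 g ⬝₁ w')) =
      F.map1 (m ⬝₁ (f ⊗₁ g)) ⬝₁ F.μ A B ⬝₁ (w ⊗₁ w') := by
  rw [t_c, c_assoc, ← c_assoc (k := F.μ A' B'), F.n1 h1 h2 h3 h4, F.map_c, c_assoc, c_assoc] <;>
    simp (maxDischargeDepth := 9) [*]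

theorem norm2 {m : M.C1} {a b : M.C2} {w w' : N.C1} {A B A' B' : M.C0} (hm : M.dom m = A' ⊗₀ B')
    (h1 : M.dom (M.src a) = A) (h2 : M.dom (M.src b) = B) (h3 : M.cod (M.src a) = A')
    (h4 : M.cod (M.src b) = B') (hw : N.cod w = F.map0 A) (hw' : N.cod w' = F.map0 B) :
    𝟏(F.map1 m ⬝₁ F.μ A' B') ⬝ₕ ((F.map2 a ⬝ₕ 𝟏w) ⊗₂ (F.map2 b ⬝ₕ 𝟏w')) =
      F.map2 (𝟏m ⬝ₕ (a ⊗₂ b)) ⬝ₕ 𝟏(F.μ A B ⬝₁ (w ⊗₁ w')) := by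
  rw [t_hc, id2_c, hc_assoc, ← hc_assoc (b := F.map2 a ⊗₂ F.map2 b), F.n2 h1 h2 h3 h4, F.map_hc,
    F.map_id2, hc_assoc, hc_assoc, t_id2, hc_id_id] <;>
    simp (maxDischargeDepth := 9) [*]

theorem norm_hc {a : M.C2} {k : M.C1} {w w' k' : N.C1} {A : M.C0}
    (ha : M.dom (M.src a) = M.cod k) (hk : M.dom k = A) (hw : N.cod w = F.map0 (M.cod k))
    (hk' : N.cod k' = N.dom w) (hw' : N.cod w' = F.map0 A)
    (h : w ⬝₁ k' = F.map1 k ⬝₁ w') :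
    (F.map2 a ⬝ₕ 𝟏w) ⬝ₕ 𝟏k' = F.map2 (a ⬝ₕ 𝟏k) ⬝ₕ 𝟏w' := by
  rw [hc_assoc, hc_id_id, h, F.map_hc, F.map_id2, hc_assoc, hc_id_id] <;>
    simp (maxDischargeDepth := 9) [*]

theorem normW {f g k : M.C1} {w w' w'' : N.C1} {A B C A' B' C' : M.C0}
    (h1 : M.dom f = A) (h2 : M.dom g = B) (h5 : M.dom k = C) (h3 : M.cod f = A')
    (h4 : M.cod g = B') (h6 : M.cod k = C')
    (hw : N.cod w = F.map0 A) (hw' : N.cod w' = F.map0 B) (hw'' : N.cod w'' = F.map0 C) :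
    (F.μ (A' ⊗₀ B') C' ⬝₁ (F.μ A' B' ⊗₁ N.id1 (F.map0 C'))) ⬝₁
      ((F.map1 f ⬝₁ w) ⊗₁ (F.map1 g ⬝₁ w') ⊗₁ (F.map1 k ⬝₁ w'')) =
    F.map1 (f ⊗₁ g ⊗₁ k) ⬝₁ F.μ (A ⊗₀ B) C ⬝₁ ((F.μ A B ⬝₁ (w ⊗₁ w')) ⊗₁ w'') := by
  have e : (F.μ A' B' ⬝₁ ((F.map1 f ⬝₁ w) ⊗₁ (F.map1 g ⬝₁ w'))) ⊗₁ (F.map1 k ⬝₁ w'') =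
      (F.map1 (f ⊗₁ g) ⊗₁ F.map1 k) ⬝₁ ((F.μ A B ⬝₁ (w ⊗₁ w')) ⊗₁ w'') := by
    rw [t_c (f' := w'), ← c_assoc, F.n1 h1 h2 h3 h4, c_assoc, t_c] <;>
      simp (maxDischargeDepth := 9) [*]
  rw [c_assoc, ← t1_assoc (F.map1 f ⬝₁ w), ← t_c, id_c, e, ← c_assoc,
    F.n1 (f := f ⊗₁ g) (A := A ⊗₀ B) (B := C), c_assoc, t1_assoc] <;>
    (clear e; simp (maxDischargeDepth := 9) [*])

theorem μ_four (A B C D : M.C0) : F.μ A (B ⊗₀ C ⊗₀ D) ⬝₁ (N.id1 (F.map0 A) ⊗₁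
      (F.μ (B ⊗₀ C) D ⬝₁ (F.μ B C ⊗₁ N.id1 (F.map0 D)))) =
    F.μ (A ⊗₀ B ⊗₀ C) D ⬝₁ ((F.μ (A ⊗₀ B) C ⬝₁
      (F.μ A B ⊗₁ N.id1 (F.map0 C))) ⊗₁ N.id1 (F.map0 D)) := by
  have e : N.id1 (F.map0 A) ⊗₁ (F.μ (B ⊗₀ C) D ⬝₁ (F.μ B C ⊗₁ N.id1 (F.map0 D))) =
      (N.id1 (F.map0 A) ⊗₁ F.μ (B ⊗₀ C) D) ⬝₁
        ((N.id1 (F.map0 A) ⊗₁ F.μ B C) ⊗₁ N.id1 (F.map0 D)) := by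
    rw [t1_assoc, ← t_c, id_c] <;> simp
  have e' := F.μ_assoc A (B ⊗₀ C) D
  rw [t0_assoc] at e'
  rw [F.μ_assoc A B C, e, ← c_assoc, ← e', c_assoc, ← t_c, id_c]
  all_goals clear e e'
  all_goals simp

theorem μ_two (A B C D : M.C0) : F.μ (A ⊗₀ B) (C ⊗₀ D) ⬝₁ (F.μ A B ⊗₁ F.μ C D) =
    F.μ (A ⊗₀ B ⊗₀ C) D ⬝₁ ((F.μ (A ⊗₀ B) C ⬝₁
      (F.μ A B ⊗₁ N.id1 (F.map0 C))) ⊗₁ N.id1 (F.map0 D)) := by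
  have e : F.μ A B ⊗₁ F.μ C D = (N.id1 (F.map0 (A ⊗₀ B)) ⊗₁ F.μ C D) ⬝₁
      (F.μ A B ⊗₁ N.id1 (F.map0 C ⊗₀ F.map0 D)) := by
    rw [← t_c, c_id, id_c] <;> simp
  have e' : (F.μ (A ⊗₀ B) C ⬝₁ (F.μ A B ⊗₁ N.id1 (F.map0 C))) ⊗₁ N.id1 (F.map0 D) =
      (F.μ (A ⊗₀ B) C ⊗₁ N.id1 (F.map0 D)) ⬝₁ (F.μ A B ⊗₁ N.id1 (F.map0 C ⊗₀ F.map0 D)) := by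
    rw [← t_id1, ← t1_assoc, ← t_c, id_c] <;> simp
  have e'' := F.μ_assoc (A ⊗₀ B) C D
  rw [e, e', ← c_assoc, ← e'', ← c_assoc, t0_assoc]
  all_goals clear e e' e''
  all_goals simp

theorem psm_law {d : PsmData M.toTwoCat} (hd : IsPseudomonoid M d) :
    IsPseudomonoid N (F.psm d) := by
  obtain ⟨dm, cm, du, cu, sα, tα, sl, tl, sr, tr, iα, il, ir, pen, tri⟩ := hd
  have S1 := F.norm1 (m := d.m) (f := d.m) (g := M.id1 d.A) (w := F.μ d.A d.A)
    (w' := N.id1 (F.map0 d.A)) dm dm (M.dom_id1 _) cm (M.cod_id1 _) (by simp) (by simp)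
  have S2 := F.norm1 (m := d.m) (g := d.m) (f := M.id1 d.A) (w' := F.μ d.A d.A)
    (w := N.id1 (F.map0 d.A)) dm (M.dom_id1 _) dm (M.cod_id1 _) cm (by simp) (by simp)
  have S3 := F.norm1 (m := d.m) (f := d.u) (g := M.id1 d.A) (w := N.id1 (F.map0 M.unit))
    (w' := N.id1 (F.map0 d.A)) dm du (M.dom_id1 _) cu (M.cod_id1 _) (by simp) (by simp)
  have S4 := F.norm1 (m := d.m) (g := d.u) (f := M.id1 d.A) (w' := N.id1 (F.map0 M.unit))
    (w := N.id1 (F.map0 d.A)) dm (M.dom_id1 _) du (M.cod_id1 _) cu (by simp) (by simp)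
  rw [← F.μ_assoc] at S2
  simp (maxDischargeDepth := 9) [*] at S1 S2 S3 S4
  -- all cells of the pentagon are images of cells of `M`, whiskered with the same 1-cell
  have P1 := F.norm2 (m := d.m) (a := d.α) (b := 𝟏(M.id1 d.A))
    (w := F.μ (d.A ⊗₀ d.A) d.A ⬝₁ (F.μ d.A d.A ⊗₁ N.id1 (F.map0 d.A)))
    (w' := N.id1 (F.map0 d.A)) dm rfl rfl (by simp [*]) (by simp)
    (by simp [*]) (by simp)
  have P2 := F.norm2 (m := d.m) (b := d.α) (a := 𝟏(M.id1 d.A))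
    (w' := F.μ (d.A ⊗₀ d.A) d.A ⬝₁ (F.μ d.A d.A ⊗₁ N.id1 (F.map0 d.A)))
    (w := N.id1 (F.map0 d.A)) dm rfl rfl (by simp) (by simp [*])
    (by simp) (by simp [*])
  have W3 := F.normW (f := M.id1 d.A) (g := d.m) (k := M.id1 d.A) (w := N.id1 (F.map0 d.A))
    (w' := F.μ d.A d.A) (w'' := N.id1 (F.map0 d.A)) (M.dom_id1 _) dm (M.dom_id1 _) (M.cod_id1 _) cm
    (M.cod_id1 _) (by simp) (by simp) (by simp)
  have W4 := F.normW (f := M.id1 d.A) (k := d.m) (g := M.id1 d.A) (w := N.id1 (F.map0 d.A))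
    (w'' := F.μ d.A d.A) (w' := N.id1 (F.map0 d.A)) (M.dom_id1 _) (M.dom_id1 _) dm (M.cod_id1 _)
    (M.cod_id1 _) cm (by simp) (by simp) (by simp)
  have W5 := F.normW (g := M.id1 d.A) (f := d.m) (k := M.id1 d.A) (w' := N.id1 (F.map0 d.A))
    (w := F.μ d.A d.A) (w'' := N.id1 (F.map0 d.A)) dm (M.dom_id1 _) (M.dom_id1 _) cm (M.cod_id1 _)
    (M.cod_id1 _) (by simp) (by simp) (by simp)
  have W6 := F.normW (f := M.id1 d.A) (g := d.u) (k := M.id1 d.A) (w := N.id1 (F.map0 d.A))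
    (w' := N.id1 (F.map0 M.unit)) (w'' := N.id1 (F.map0 d.A)) (M.dom_id1 _) du (M.dom_id1 _)
    (M.cod_id1 _) cu (M.cod_id1 _) (by simp) (by simp) (by simp)
  have V2 : F.μ d.A (d.A ⊗₀ d.A ⊗₀ d.A) ⬝₁ (N.id1 (F.map0 d.A) ⊗₁
      (F.μ (d.A ⊗₀ d.A) d.A ⬝₁ (F.μ d.A d.A ⊗₁ N.id1 (F.map0 d.A)))) =
      F.μ (d.A ⊗₀ d.A ⊗₀ d.A) d.A ⬝₁ ((F.μ (d.A ⊗₀ d.A) d.A ⬝₁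
        (F.μ d.A d.A ⊗₁ N.id1 (F.map0 d.A))) ⊗₁ N.id1 (F.map0 d.A)) := F.μ_four _ _ _ _
  have V3 : F.μ (d.A ⊗₀ d.A) d.A ⬝₁ (F.μ d.A d.A ⊗₁ N.id1 (F.map0 d.A)) =
    F.μ d.A (d.A ⊗₀ d.A) ⬝₁ (N.id1 (F.map0 d.A) ⊗₁ F.μ d.A d.A) := F.μ_assoc d.A d.A d.A
  have V4 : F.μ (d.A ⊗₀ d.A) (d.A ⊗₀ d.A) ⬝₁ (F.μ d.A d.A ⊗₁ F.μ d.A d.A) =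
      F.μ (d.A ⊗₀ d.A ⊗₀ d.A) d.A ⬝₁ ((F.μ (d.A ⊗₀ d.A) d.A ⬝₁
        (F.μ d.A d.A ⊗₁ N.id1 (F.map0 d.A))) ⊗₁ N.id1 (F.map0 d.A)) := F.μ_two _ _ _ _
  set W := F.μ (d.A ⊗₀ d.A) d.A ⬝₁ (F.μ d.A d.A ⊗₁ N.id1 (F.map0 d.A)) with hW
  set V := F.μ (d.A ⊗₀ d.A ⊗₀ d.A) d.A ⬝₁ (W ⊗₁ N.id1 (F.map0 d.A)) with hV
  have WV : N.cod W = F.map0 (d.A ⊗₀ d.A ⊗₀ d.A) := by simp [W]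
  have dW : N.dom W = F.map0 d.A ⊗₀ F.map0 d.A ⊗₀ F.map0 d.A := by simp [W]
  have cV : N.cod V = F.map0 (d.A ⊗₀ d.A ⊗₀ d.A ⊗₀ d.A) := by simp [V, WV]
  have dV : N.dom V = F.map0 d.A ⊗₀ F.map0 d.A ⊗₀ F.map0 d.A ⊗₀ F.map0 d.A := by
    simp [V, WV, dW]
  clear_value V
  clear_value W
  simp (maxDischargeDepth := 9) [dm, cm, du, cu, sα, tα, ← V3, ← hW, V2, WV, V4, ← hV] at P1 P2 W3 W4 W5 W6
  have E1 : (d.m ⬝₁ (M.id1 d.A ⊗₁ d.m)) ⊗₁ M.id1 d.A =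
      (d.m ⊗₁ M.id1 d.A) ⬝₁ (M.id1 d.A ⊗₁ d.m ⊗₁ M.id1 d.A) := by
    rw [← t1_assoc, ← t_c] <;> simp [*]
  have E2 : M.id1 d.A ⊗₁ (d.m ⬝₁ (d.m ⊗₁ M.id1 d.A)) =
      (M.id1 d.A ⊗₁ d.m) ⬝₁ (M.id1 d.A ⊗₁ d.m ⊗₁ M.id1 d.A) := by
    rw [← t_c] <;> simp [*]
  have E3 : (d.m ⊗₁ M.id1 d.A) ⬝₁ (M.id1 d.A ⊗₁ M.id1 d.A ⊗₁ d.m) =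
      (M.id1 d.A ⊗₁ d.m) ⬝₁ (d.m ⊗₁ M.id1 (d.A ⊗₀ d.A)) := by
    rw [← t_id1, ← t1_assoc, ← t1_assoc, ← t_c, t1_assoc, ← t1_assoc d.m, t1_assoc d.m, ← t_c] <;>
      simp [*]
  have E4 : (M.id1 d.A ⊗₁ d.m) ⬝₁ (M.id1 d.A ⊗₁ d.u ⊗₁ M.id1 d.A) =
      M.id1 d.A ⊗₁ (d.m ⬝₁ (d.u ⊗₁ M.id1 d.A)) := by
    rw [← t_c] <;> simp [*]
  refine ⟨?_, ?_, ?_, ?_, ?_, ?_, ?_, ?_, ?_, ?_, ?_, ?_, ?_, ?_, ?_⟩ <;> simp only [psm]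
  all_goals try rw [← hW]
  · simp [*]
  · simp [*]
  · simp [*]
  · simp [*]
  · rw [S1]; simp [*]
  · rw [S2]; simp [*]
  · rw [S3]; simp [*]
  · simp [*]
  · rw [S4]; simp [*]
  · simp [*]
  · apply hc_inv (F.map_inv iα); simp [*]
  · exact F.map_inv il
  · exact F.map_inv ir
  · rw [P1, P2, F.norm_hc (k := M.id1 d.A ⊗₁ d.m ⊗₁ M.id1 d.A)
      (A := d.A ⊗₀ d.A ⊗₀ d.A ⊗₀ d.A) (h := W3),
      F.norm_hc (k := M.id1 d.A ⊗₁ M.id1 d.A ⊗₁ d.m)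
      (A := d.A ⊗₀ d.A ⊗₀ d.A ⊗₀ d.A) (h := W4),
      F.norm_hc (k := d.m ⊗₁ M.id1 d.A ⊗₁ M.id1 d.A)
      (A := d.A ⊗₀ d.A ⊗₀ d.A ⊗₀ d.A) (w' := V), ← whisk_vc, ← whisk_vc, ← whisk_vc, ← F.map_vc,
      ← F.map_vc, ← F.map_vc, pen]
    all_goals clear S1 S2 S3 S4 P1 P2 W3 W4 pen tri hW hV V2 V3 V4
    all_goals simp (maxDischargeDepth := 9) [*, hc_id_id, c_assoc]
  · have Q1 := F.norm2 (m := d.m) (a := 𝟏(M.id1 d.A)) (b := d.lam) (w := N.id1 (F.map0 d.A))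
      (w' := N.id1 (F.map0 d.A)) dm rfl rfl (by simp) (by simp [*]) (by simp) (by simp [*])
    have Q2 := F.norm2 (m := d.m) (b := 𝟏(M.id1 d.A)) (a := d.rho) (w := N.id1 (F.map0 d.A))
      (w' := N.id1 (F.map0 d.A)) dm rfl rfl (by simp [*]) (by simp) (by simp [*]) (by simp)
    simp [*] at Q1 Q2
    rw [Q1, Q2, F.norm_hc (k := M.id1 d.A ⊗₁ d.u ⊗₁ M.id1 d.A) (A := d.A ⊗₀ d.A) (h := W6),
      ← whisk_vc, ← F.map_vc, tri]
    all_goals clear S1 S2 S3 S4 P1 P2 W3 W4 W5 W6 Q1 Q2 pen tri hW hV V2 V3 V4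
    all_goals simp (maxDischargeDepth := 9) [*, hc_id_id, c_assoc]

end LaxFunctor

end TwoDim

namespace TwoDim

open TwoCat MonTwoCat

namespace LaxFunctor

variable {M N : MonTwoCat.{u}} (F : LaxFunctor M N)

theorem norm0 {f g : M.C1} {w w' : N.C1} {A B A' B' : M.C0}
    (h1 : M.dom f = A) (h2 : M.dom g = B) (h3 : M.cod f = A') (h4 : M.cod g = B')
    (hw : N.cod w = F.map0 A) (hw' : N.cod w' = F.map0 B) :
    F.μ A' B' ⬝₁ ((F.map1 f ⬝₁ w) ⊗₁ (F.map1 g ⬝₁ w')) =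
      F.map1 (f ⊗₁ g) ⬝₁ F.μ A B ⬝₁ (w ⊗₁ w') := by
  rw [t_c, ← c_assoc (k := F.μ A' B'), F.n1 h1 h2 h3 h4, c_assoc] <;>
    simp (maxDischargeDepth := 9) [*]

theorem cell_law {d d' : PsmData M.toTwoCat} {c : CellData M.toTwoCat} (hd : IsPseudomonoid M d)
    (hd' : IsPseudomonoid M d') (h : IsOpmonoidal1 M d d' c) :
    IsOpmonoidal1 N (F.psm d) (F.psm d') (F.cell c) := by
  obtain ⟨dm, cm, du, cu, sα, tα, sl, tl, sr, tr, -, -, -, -, -⟩ := hd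
  obtain ⟨dm', cm', du', cu', sα', tα', sl', tl', sr', tr', -, -, -, -, -⟩ := hd'
  obtain ⟨df, cf, s2, t2', s0, t0', ca, cl, cr⟩ := h
  have S1 := F.norm1 (m := d'.m) (f := c.f) (g := c.f) (w := N.id1 (F.map0 d.A))
    (w' := N.id1 (F.map0 d.A)) dm' df df cf cf (by simp) (by simp)
  simp (maxDischargeDepth := 9) [*] at S1
  have P1 := F.norm2 (m := d'.m) (a := c.φ2) (b := 𝟏(c.f)) (w := F.μ d.A d.A)
    (w' := N.id1 (F.map0 d.A)) (A := d.A ⊗₀ d.A) (B := d.A) (A' := d'.A) (B' := d'.A)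
    dm' (by simp [*]) (by simp [*]) (by simp [*]) (by simp [*]) (by simp [*]) (by simp [*])
  have P2 := F.norm2 (m := d'.m) (b := c.φ2) (a := 𝟏(c.f)) (w' := F.μ d.A d.A)
    (w := N.id1 (F.map0 d.A)) (A := d.A) (B := d.A ⊗₀ d.A) (A' := d'.A) (B' := d'.A)
    dm' (by simp [*]) (by simp [*]) (by simp [*]) (by simp [*]) (by simp [*]) (by simp [*])
  have P3 := F.norm2 (m := d'.m) (a := c.φ0) (b := 𝟏(c.f)) (w := N.id1 N.unit)
    (w' := N.id1 (F.map0 d.A)) (A := M.unit) (B := d.A) (A' := d'.A) (B' := d'.A)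
    dm' (by simp [*]) (by simp [*]) (by simp [*]) (by simp [*]) (by simp [*]) (by simp [*])
  have P4 := F.norm2 (m := d'.m) (b := c.φ0) (a := 𝟏(c.f)) (w' := N.id1 N.unit)
    (w := N.id1 (F.map0 d.A)) (A := d.A) (B := M.unit) (A' := d'.A) (B' := d'.A)
    dm' (by simp [*]) (by simp [*]) (by simp [*]) (by simp [*]) (by simp [*]) (by simp [*])
  have Z1 := F.norm0 (f := d.m) (g := M.id1 d.A) (w := F.μ d.A d.A)
    (w' := N.id1 (F.map0 d.A)) dm (M.dom_id1 _) cm (M.cod_id1 _) (by simp [*]) (by simp [*])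
  have Z2 := F.norm0 (g := d.m) (f := M.id1 d.A) (w' := F.μ d.A d.A)
    (w := N.id1 (F.map0 d.A)) (M.dom_id1 _) dm (M.cod_id1 _) cm (by simp [*]) (by simp [*])
  have Z3 := F.norm0 (f := d.u) (g := M.id1 d.A) (w := N.id1 N.unit)
    (w' := N.id1 (F.map0 d.A)) du (M.dom_id1 _) cu (M.cod_id1 _) (by simp [*]) (by simp [*])
  have Z4 := F.norm0 (g := d.u) (f := M.id1 d.A) (w' := N.id1 N.unit)
    (w := N.id1 (F.map0 d.A)) (M.dom_id1 _) du (M.cod_id1 _) cu (by simp [*]) (by simp [*])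
  have W3 := F.normW (f := c.f) (g := c.f) (k := c.f) (w := N.id1 (F.map0 d.A))
    (w' := N.id1 (F.map0 d.A)) (w'' := N.id1 (F.map0 d.A)) df df df cf cf cf
    (by simp) (by simp) (by simp)
  rw [← F.μ_assoc] at P2 Z2
  have cW : N.cod (F.μ (d.A ⊗₀ d.A) d.A ⬝₁ (F.μ d.A d.A ⊗₁ N.id1 (F.map0 d.A))) =
    F.map0 (d.A ⊗₀ d.A ⊗₀ d.A) := by simp
  simp (maxDischargeDepth := 9) [dm, cm, df, cf, du, cu, s0] at P1 P2 P3 P4 Z1 Z2 Z3 Z4 W3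
  have E1 : (c.f ⬝₁ d.m) ⊗₁ c.f = (c.f ⊗₁ c.f) ⬝₁ (d.m ⊗₁ M.id1 d.A) := by
    rw [← t_c] <;> simp [*]
  have E2 : c.f ⊗₁ (c.f ⬝₁ d.m) = (c.f ⊗₁ c.f) ⬝₁ (M.id1 d.A ⊗₁ d.m) := by
    rw [← t_c] <;> simp [*]
  have E3 : (d'.m ⬝₁ (c.f ⊗₁ c.f)) ⊗₁ c.f = (d'.m ⊗₁ M.id1 d'.A) ⬝₁ (c.f ⊗₁ c.f ⊗₁ c.f) := by
    rw [← t1_assoc c.f, ← t_c] <;> simp [*]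
  have E4 : c.f ⊗₁ (d'.m ⬝₁ (c.f ⊗₁ c.f)) = (M.id1 d'.A ⊗₁ d'.m) ⬝₁ (c.f ⊗₁ c.f ⊗₁ c.f) := by
    rw [← t_c] <;> simp [*]
  have E5 : (c.f ⬝₁ d.u) ⊗₁ c.f = (c.f ⊗₁ c.f) ⬝₁ (d.u ⊗₁ M.id1 d.A) := by
    rw [← t_c] <;> simp [*]
  have E6 : c.f ⊗₁ (c.f ⬝₁ d.u) = (c.f ⊗₁ c.f) ⬝₁ (M.id1 d.A ⊗₁ d.u) := by
    rw [← t_c] <;> simp [*]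
  have E7 : (d'.u ⊗₁ M.id1 d'.A) ⬝₁ c.f = d'.u ⊗₁ c.f := by
    conv_lhs => rw [← unit_t1 c.f, ← t_c (by simp [*]) (by simp [*])]
    simp [*]
  have E8 : (M.id1 d'.A ⊗₁ d'.u) ⬝₁ c.f = c.f ⊗₁ d'.u := by
    conv_lhs => rw [← t1_unit c.f, ← t_c (by simp [*]) (by simp [*])]
    simp [*]
  refine ⟨?_, ?_, ?_, ?_, ?_, ?_, ?_, ?_, ?_⟩ <;> simp only [psm, cell, df]
  · simp [*]
  · simp [*]
  · clear P1 P2 P3 P4 ca cl cr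
    simp (maxDischargeDepth := 9) [*, F.map_c, c_assoc]
  · clear P1 P2 P3 P4 ca cl cr
    simp (maxDischargeDepth := 9) [*]
  · simp (maxDischargeDepth := 9) [*, F.map_c]
  · simp [*]
  · rw [P1, P2, F.norm_hc (A := d.A ⊗₀ d.A ⊗₀ d.A) (h := W3),
      F.norm_hc (A := d.A ⊗₀ d.A ⊗₀ d.A) (h := Z1), F.norm_hc (A := d.A ⊗₀ d.A ⊗₀ d.A) (h := Z2),
      ← hc_assoc, ← F.map_id2, ← F.map_hc]
    rw [← whisk_vc, ← whisk_vc, ← whisk_vc, ← whisk_vc, ← F.map_vc,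
      ← F.map_vc, ← F.map_vc, ← F.map_vc, ca]
    all_goals clear P1 P2 P3 P4 ca cl cr W3 Z1 Z2 Z3 Z4
    all_goals simp (maxDischargeDepth := 9) [*, hc_id_id, c_assoc]
  · rw [P3, F.norm_hc (A := d.A) (w' := N.id1 (F.map0 d.A)) (k := d.u ⊗₁ M.id1 d.A),
      ← F.map_id2, ← F.map_hc, ← F.map_hc, hc_id, hc_id,
      ← F.map_vc, ← F.map_vc, cl]
    all_goals clear P1 P2 P3 P4 ca cl cr
    all_goals simp (maxDischargeDepth := 9) [*, hc_id_id, c_assoc]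
  · rw [P4, F.norm_hc (A := d.A) (w' := N.id1 (F.map0 d.A)) (k := M.id1 d.A ⊗₁ d.u),
      ← F.map_id2, ← F.map_hc, ← F.map_hc, hc_id, hc_id,
      ← F.map_vc, ← F.map_vc, cr]
    all_goals clear P1 P2 P3 P4 ca cl cr
    all_goals simp (maxDischargeDepth := 9) [*, hc_id_id, c_assoc]

theorem cell2_law {d d' : PsmData M.toTwoCat} {c c' : CellData M.toTwoCat} {ω : M.C2}
    (hd : IsPseudomonoid M d) (hd' : IsPseudomonoid M d') (hc : IsOpmonoidal1 M d d' c)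
    (hc' : IsOpmonoidal1 M d d' c') (h : IsOpmonoidal2 M d d' c c' ω) :
    IsOpmonoidal2 N (F.psm d) (F.psm d') (F.cell c) (F.cell c') (F.map2 ω) := by
  obtain ⟨dm, cm, du, cu, sα, tα, sl, tl, sr, tr, -, -, -, -, -⟩ := hd
  obtain ⟨dm', cm', du', cu', sα', tα', sl', tl', sr', tr', -, -, -, -, -⟩ := hd'
  obtain ⟨df, cf, s2, t2', s0, t0', ca, cl, cr⟩ := hc
  obtain ⟨df', cf', s2', t2'', s0', t0'', -, -, -⟩ := hc'
  obtain ⟨sω, tω, h2, h0⟩ := h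
  have P1 := F.norm2 (m := d'.m) (a := ω) (b := ω) (w := N.id1 (F.map0 d.A))
    (w' := N.id1 (F.map0 d.A)) (A := d.A) (B := d.A) (A' := d'.A) (B' := d'.A)
    dm' (by simp [*]) (by simp [*]) (by simp [*]) (by simp [*]) (by simp [*]) (by simp [*])
  simp (maxDischargeDepth := 9) [*] at P1
  refine ⟨?_, ?_, ?_, ?_⟩ <;> simp only [psm, cell, df, df']
  · simp [*]
  · simp [*]
  · rw [P1, ← whisk_vc, ← F.map_vc, h2, F.map_vc, whisk_vc, F.map_hc, hc_assoc, F.map_id2,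
      hc_id_id]
    all_goals clear P1 h2 h0 ca cl cr
    all_goals simp (maxDischargeDepth := 9) [*, hc_id_id, c_assoc]
  · rw [h0, F.map_vc, F.map_hc, F.map_id2]
    all_goals clear P1 h2 h0 ca cl cr
    all_goals simp (maxDischargeDepth := 9) [*, hc_id_id, c_assoc]

theorem cell_comp {d d' d'' : PsmData M.toTwoCat} {g f : CellData M.toTwoCat}
    (hd : IsPseudomonoid M d) (hd' : IsPseudomonoid M d') (hg : IsOpmonoidal1 M d' d'' g)
    (hf : IsOpmonoidal1 M d d' f) : F.cell (g.opComp f) = (F.cell g).opComp (F.cell f) := by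
  obtain ⟨dm, cm, du, cu, -⟩ := hd
  obtain ⟨dm', cm', du', cu', -⟩ := hd'
  obtain ⟨df, cf, s2, t2', s0, t0', -⟩ := hf
  obtain ⟨df', cf', s2', t2'', s0', t0'', -⟩ := hg
  have e := F.norm0 (f := f.f) (g := f.f) (w := N.id1 (F.map0 d.A)) (w' := N.id1 (F.map0 d.A))
    df df cf cf (by simp) (by simp)
  simp [*] at e
  refine CellData.ext ?_ ?_ ?_ <;> simp only [cell, CellData.opComp]
  · rw [F.map_c]; simp [*]
  · rw [dom_c, df, df', F.map_vc, whisk_vc, F.map_hc, hc_assoc, F.map_hc, F.map_id2, hc_assoc,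
      hc_id_id, F.map_id2, hc_assoc (a := 𝟏(F.map1 f.f ⊗₁ F.map1 f.f)), hc_id_id, e]
    all_goals clear e
    all_goals simp (maxDischargeDepth := 9) [*, hc_id_id, c_assoc]
  · rw [F.map_vc, F.map_hc, F.map_id2]
    all_goals clear e
    all_goals simp (maxDischargeDepth := 9) [*, hc_id_id, c_assoc]

theorem cell_id {d : PsmData M.toTwoCat} (hd : IsPseudomonoid M d) :
    F.cell d.idCell = (F.psm d).idCell := by
  obtain ⟨dm, cm, du, cu, -⟩ := hd
  refine CellData.ext ?_ ?_ ?_ <;> simp only [cell, psm, PsmData.idCell]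
  · simp
  · rw [F.map_id2, hc_id_id] <;> simp [*]
  · simp

/-- The 2-functor `F₀₁ : M₀₁ → N₀₁`. -/
noncomputable def opm : TwoFunctor M.opm N.opm where
  map0 A := ⟨F.psm A.data, F.psm_law A.law⟩
  map1 f := ⟨⟨F.psm f.dom.data, F.psm_law f.dom.law⟩, ⟨F.psm f.cod.data, F.psm_law f.cod.law⟩,
    F.cell f.data, F.cell_law f.dom.law f.cod.law f.law⟩
  map2 a :=
    { src := ⟨⟨F.psm a.src.dom.data, F.psm_law a.src.dom.law⟩,
        ⟨F.psm a.src.cod.data, F.psm_law a.src.cod.law⟩,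
        F.cell a.src.data, F.cell_law a.src.dom.law a.src.cod.law a.src.law⟩
      tgt := ⟨⟨F.psm a.tgt.dom.data, F.psm_law a.tgt.dom.law⟩,
        ⟨F.psm a.tgt.cod.data, F.psm_law a.tgt.cod.law⟩,
        F.cell a.tgt.data, F.cell_law a.tgt.dom.law a.tgt.cod.law a.tgt.law⟩
      dom_eq := by simp only [a.dom_eq]
      cod_eq := by simp only [a.cod_eq]
      ω := F.map2 a.ω
      law := F.cell2_law a.src.dom.law a.src.cod.law a.src.law a.law_tgt a.law }
  dom_map _ := rfl
  cod_map _ := rfl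
  src_map _ := rfl
  tgt_map _ := rfl
  map_id1 A := Opmonoidal1.ext rfl rfl (F.cell_id A.law)
  map_id2 f := Opmonoidal2.ext rfl rfl (F.map_id2 _)
  map_comp g f h := Opmonoidal1.ext rfl rfl (by
    have hg := g.law
    rw [show g.dom = f.cod from h.symm] at hg
    exact F.cell_comp f.dom.law f.cod.law hg f.law)
  map_vcomp b a h := Opmonoidal2.ext rfl rfl
    (F.map_vc (by rw [a.law.tgt_ω, b.law.src_ω]; rw [show a.tgt = b.src from h]))
  map_hcomp b a h := by
    have h' : a.src.cod = b.src.dom := h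
    refine Opmonoidal2.ext (Opmonoidal1.ext rfl rfl ?_) (Opmonoidal1.ext rfl rfl ?_)
      (F.map_hc ?_)
    · have hg := b.src.law
      rw [← h'] at hg
      exact F.cell_comp a.src.dom.law a.src.cod.law hg a.src.law
    · have hg := b.law_tgt
      rw [← h'] at hg
      exact F.cell_comp a.src.dom.law a.src.cod.law hg a.law_tgt
    · rw [a.law.src_ω, b.law.src_ω, a.src.law.cod_f, b.src.law.dom_f, h']

end LaxFunctor

end TwoDim

namespace TwoDim

open TwoCat MonTwoCat

/-- The Cartesian product of strict monoidal 2-categories, with the componentwise monoidal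
structure. -/
def MonTwoCat.prod (M N : MonTwoCat.{u}) : MonTwoCat.{u} where
  toTwoCat := M.toTwoCat.prod N.toTwoCat
  unit := (M.unit, N.unit)
  tensor :=
    { map0 := fun A => (A.1.1 ⊗₀ A.2.1, A.1.2 ⊗₀ A.2.2)
      map1 := fun A => (A.1.1 ⊗₁ A.2.1, A.1.2 ⊗₁ A.2.2)
      map2 := fun A => (A.1.1 ⊗₂ A.2.1, A.1.2 ⊗₂ A.2.2)
      dom_map := fun f => Prod.ext (dom_t _ _) (dom_t _ _)
      cod_map := fun f => Prod.ext (cod_t _ _) (cod_t _ _)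
      src_map := fun f => Prod.ext (src_t _ _) (src_t _ _)
      tgt_map := fun f => Prod.ext (tgt_t _ _) (tgt_t _ _)
      map_id1 := fun A => Prod.ext (t_id1 _ _) (t_id1 _ _)
      map_id2 := fun A => Prod.ext (t_id2 _ _) (t_id2 _ _)
      map_comp := fun g f h => Prod.ext
        (M.tensor.map_comp (g.1.1, g.2.1) (f.1.1, f.2.1) (Prod.ext
          (congrArg (fun x => x.1.1) h) (congrArg (fun x => x.2.1) h)))
        (N.tensor.map_comp (g.1.2, g.2.2) (f.1.2, f.2.2) (Prod.ext
          (congrArg (fun x => x.1.2) h) (congrArg (fun x => x.2.2) h)))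
      map_vcomp := fun g f h => Prod.ext
        (M.tensor.map_vcomp (g.1.1, g.2.1) (f.1.1, f.2.1) (Prod.ext
          (congrArg (fun x => x.1.1) h) (congrArg (fun x => x.2.1) h)))
        (N.tensor.map_vcomp (g.1.2, g.2.2) (f.1.2, f.2.2) (Prod.ext
          (congrArg (fun x => x.1.2) h) (congrArg (fun x => x.2.2) h)))
      map_hcomp := fun g f h => Prod.ext
        (M.tensor.map_hcomp (g.1.1, g.2.1) (f.1.1, f.2.1) (Prod.ext
          (congrArg (fun x => x.1.1) h) (congrArg (fun x => x.2.1) h)))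
        (N.tensor.map_hcomp (g.1.2, g.2.2) (f.1.2, f.2.2) (Prod.ext
          (congrArg (fun x => x.1.2) h) (congrArg (fun x => x.2.2) h))) }
  assoc0 _ _ _ := Prod.ext (t0_assoc _ _ _) (t0_assoc _ _ _)
  assoc1 _ _ _ := Prod.ext (t1_assoc _ _ _) (t1_assoc _ _ _)
  assoc2 _ _ _ := Prod.ext (t2_assoc _ _ _) (t2_assoc _ _ _)
  unit_tensor0 _ := Prod.ext (unit_t0 _) (unit_t0 _)
  unit_tensor1 _ := Prod.ext (unit_t1 _) (unit_t1 _)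
  unit_tensor2 _ := Prod.ext (unit_t2 _) (unit_t2 _)
  tensor_unit0 _ := Prod.ext (t0_unit _) (t0_unit _)
  tensor_unit1 _ := Prod.ext (t1_unit _) (t1_unit _)
  tensor_unit2 _ := Prod.ext (t2_unit _) (t2_unit _)

section

variable {M N : MonTwoCat.{u}}

/-- The pair of two pseudomonoids, on the level of data. -/
def PsmData.pair (d : PsmData M.toTwoCat) (e : PsmData N.toTwoCat) :
    PsmData (M.prod N).toTwoCat where
  A := (d.A, e.A)
  m := (d.m, e.m)
  u := (d.u, e.u)
  α := (d.α, e.α)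
  lam := (d.lam, e.lam)
  rho := (d.rho, e.rho)

/-- The pair of two (op)monoidal 1-cells, on the level of data. -/
def CellData.pair (d : CellData M.toTwoCat) (e : CellData N.toTwoCat) :
    CellData (M.prod N).toTwoCat where
  f := (d.f, e.f)
  φ2 := (d.φ2, e.φ2)
  φ0 := (d.φ0, e.φ0)

theorem prod_id1 (A : M.C0) (B : N.C0) : (M.prod N).id1 (A, B) = (M.id1 A, N.id1 B) := rfl
theorem prod_id2 (f : M.C1) (g : N.C1) :
    (M.prod N).id2 (f, g) = (M.id2 f, N.id2 g) := rfl
theorem prod_t0 (A A' : M.C0) (B B' : N.C0) :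
    MonTwoCat.t0 (M.prod N) (A, B) (A', B') = (A ⊗₀ A', B ⊗₀ B') := rfl
theorem prod_t1 (A A' : M.C1) (B B' : N.C1) :
    MonTwoCat.t1 (M.prod N) (A, B) (A', B') = (A ⊗₁ A', B ⊗₁ B') := rfl
theorem prod_t2 (A A' : M.C2) (B B' : N.C2) :
    MonTwoCat.t2 (M.prod N) (A, B) (A', B') = (A ⊗₂ A', B ⊗₂ B') := rfl
theorem prod_dom (A : M.C1) (B : N.C1) : (M.prod N).dom (A, B) = (M.dom A, N.dom B) := rfl
theorem prod_cod (A : M.C1) (B : N.C1) : (M.prod N).cod (A, B) = (M.cod A, N.cod B) := rfl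
theorem prod_src (A : M.C2) (B : N.C2) : (M.prod N).src (A, B) = (M.src A, N.src B) := rfl
theorem prod_tgt (A : M.C2) (B : N.C2) : (M.prod N).tgt (A, B) = (M.tgt A, N.tgt B) := rfl

theorem prod_c {g f : M.C1} {g' f' : N.C1} (h : M.cod f = M.dom g) (h' : N.cod f' = N.dom g') :
    TwoCat.c (M.prod N).toTwoCat (g, g') (f, f') = (g ⬝₁ f, g' ⬝₁ f') := by
  rw [c_def h, c_def h', c_def (M := (M.prod N).toTwoCat) (g := (g, g')) (f := (f, f')) (Prod.ext h h')]; rfl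
theorem prod_vc {g f : M.C2} {g' f' : N.C2} (h : M.tgt f = M.src g) (h' : N.tgt f' = N.src g') :
    TwoCat.vc (M.prod N).toTwoCat (g, g') (f, f') = (g ⬝ᵥ f, g' ⬝ᵥ f') := by
  rw [vc_def h, vc_def h', vc_def (M := (M.prod N).toTwoCat) (b := (g, g')) (a := (f, f')) (Prod.ext h h')]; rfl
theorem prod_hc {g f : M.C2} {g' f' : N.C2} (h : M.cod (M.src f) = M.dom (M.src g))
    (h' : N.cod (N.src f') = N.dom (N.src g')) :
    TwoCat.hc (M.prod N).toTwoCat (g, g') (f, f') = (g ⬝ₕ f, g' ⬝ₕ f') := by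
  rw [hc_def h, hc_def h', hc_def (M := (M.prod N).toTwoCat) (b := (g, g')) (a := (f, f')) (Prod.ext h h')]; rfl

theorem pair_inv {a : M.C2} {b : N.C2} (ha : IsInvertible a) (hb : IsInvertible b) :
    IsInvertible (M := (M.prod N).toTwoCat) (a, b) := by
  obtain ⟨a', h1, h2, h3, h4⟩ := ha
  obtain ⟨b', k1, k2, k3, k4⟩ := hb
  refine ⟨(a', b'), Prod.ext h1 k1, Prod.ext h2 k2, ?_, ?_⟩
  · refine (prod_vc h1.symm k1.symm).trans (Prod.ext h3 k3)
  · refine (prod_vc h2 k2).trans (Prod.ext h4 k4)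

theorem psm_eqs {d : PsmData M.toTwoCat} (hd : IsPseudomonoid M d) :
    (d.m ⬝₁ (M.id1 d.A ⊗₁ d.m)) ⊗₁ M.id1 d.A =
      (d.m ⊗₁ M.id1 d.A) ⬝₁ (M.id1 d.A ⊗₁ d.m ⊗₁ M.id1 d.A) ∧
    M.id1 d.A ⊗₁ (d.m ⬝₁ (d.m ⊗₁ M.id1 d.A)) =
      (M.id1 d.A ⊗₁ d.m) ⬝₁ (M.id1 d.A ⊗₁ d.m ⊗₁ M.id1 d.A) ∧
    (d.m ⊗₁ M.id1 d.A) ⬝₁ (M.id1 d.A ⊗₁ M.id1 d.A ⊗₁ d.m) =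
      (M.id1 d.A ⊗₁ d.m) ⬝₁ (d.m ⊗₁ M.id1 (d.A ⊗₀ d.A)) ∧
    (M.id1 d.A ⊗₁ d.m) ⬝₁ (M.id1 d.A ⊗₁ d.u ⊗₁ M.id1 d.A) =
      M.id1 d.A ⊗₁ (d.m ⬝₁ (d.u ⊗₁ M.id1 d.A)) ∧
    (M.id1 d.A ⊗₁ d.m) ⬝₁ (M.id1 (d.A ⊗₀ d.A) ⊗₁ d.m) =
      M.id1 d.A ⊗₁ (d.m ⬝₁ (M.id1 d.A ⊗₁ d.m)) := by
  obtain ⟨dm, cm, du, cu, -⟩ := hd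
  refine ⟨?_, ?_, ?_, ?_, ?_⟩
  · rw [← t1_assoc, ← t_c] <;> simp [*]
  · rw [← t_c] <;> simp [*]
  · rw [← t_id1, ← t1_assoc, ← t1_assoc, ← t_c, t1_assoc, ← t1_assoc d.m, t1_assoc d.m,
      ← t_c] <;> simp [*]
  · rw [← t_c] <;> simp [*]
  · rw [← t_id1, t1_assoc, ← t_c] <;> simp [*]

theorem IsPseudomonoid.pair {d : PsmData M.toTwoCat} {e : PsmData N.toTwoCat}
    (hd : IsPseudomonoid M d) (he : IsPseudomonoid N e) : IsPseudomonoid (M.prod N) (d.pair e) := by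
  obtain ⟨X1, X2, X3, X4, X5⟩ := psm_eqs hd
  obtain ⟨Y1, Y2, Y3, Y4, Y5⟩ := psm_eqs he
  obtain ⟨dm, cm, du, cu, sα, tα, sl, tl, sr, tr, iα, il, ir, pen, tri⟩ := hd
  obtain ⟨dm', cm', du', cu', sα', tα', sl', tl', sr', tr', iα', il', ir', pen', tri'⟩ := he
  refine ⟨Prod.ext dm dm', Prod.ext cm cm', Prod.ext du du', Prod.ext cu cu',
    ?_, ?_, ?_, Prod.ext tl tl', ?_, Prod.ext tr tr', pair_inv iα iα', pair_inv il il',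
    pair_inv ir ir', ?_, ?_⟩
  all_goals simp only [PsmData.pair, prod_id1, prod_id2, prod_t1, prod_t2]
  · rw [prod_c] <;> first | exact Prod.ext sα sα' | simp [*]
  · rw [prod_c] <;> first | exact Prod.ext tα tα' | simp [*]
  · rw [prod_c] <;> first | exact Prod.ext sl sl' | simp [*]
  · rw [prod_c] <;> first | exact Prod.ext sr sr' | simp [*]
  · repeat (first | rw [prod_hc] | rw [prod_vc])
    · exact Prod.ext pen pen'
    all_goals clear pen pen' tri tri'
    all_goals simp (maxDischargeDepth := 9) [*, c_assoc]
  · repeat (first | rw [prod_hc] | rw [prod_vc])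
    · exact Prod.ext tri tri'
    all_goals clear pen pen' tri tri'
    all_goals simp (maxDischargeDepth := 9) [*, c_assoc]

theorem cell_eqs {d d' : PsmData M.toTwoCat} {c : CellData M.toTwoCat} (hd : IsPseudomonoid M d)
    (hd' : IsPseudomonoid M d') (h : IsOpmonoidal1 M d d' c) :
    (c.f ⬝₁ d.m) ⊗₁ c.f = (c.f ⊗₁ c.f) ⬝₁ (d.m ⊗₁ M.id1 d.A) ∧
    c.f ⊗₁ (c.f ⬝₁ d.m) = (c.f ⊗₁ c.f) ⬝₁ (M.id1 d.A ⊗₁ d.m) ∧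
    (d'.m ⬝₁ (c.f ⊗₁ c.f)) ⊗₁ c.f = (d'.m ⊗₁ M.id1 d'.A) ⬝₁ (c.f ⊗₁ c.f ⊗₁ c.f) ∧
    c.f ⊗₁ (d'.m ⬝₁ (c.f ⊗₁ c.f)) = (M.id1 d'.A ⊗₁ d'.m) ⬝₁ (c.f ⊗₁ c.f ⊗₁ c.f) ∧
    (c.f ⬝₁ d.u) ⊗₁ c.f = (c.f ⊗₁ c.f) ⬝₁ (d.u ⊗₁ M.id1 d.A) ∧
    c.f ⊗₁ (c.f ⬝₁ d.u) = (c.f ⊗₁ c.f) ⬝₁ (M.id1 d.A ⊗₁ d.u) ∧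
    (d'.u ⊗₁ M.id1 d'.A) ⬝₁ c.f = d'.u ⊗₁ c.f ∧
    (M.id1 d'.A ⊗₁ d'.u) ⬝₁ c.f = c.f ⊗₁ d'.u := by
  obtain ⟨dm, cm, du, cu, -⟩ := hd
  obtain ⟨dm', cm', du', cu', -⟩ := hd'
  obtain ⟨df, cf, -⟩ := h
  refine ⟨?_, ?_, ?_, ?_, ?_, ?_, ?_, ?_⟩
  · rw [← t_c] <;> simp [*]
  · rw [← t_c] <;> simp [*]
  · rw [← t1_assoc c.f, ← t_c] <;> simp [*]
  · rw [← t_c] <;> simp [*]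
  · rw [← t_c] <;> simp [*]
  · rw [← t_c] <;> simp [*]
  · conv_lhs => rw [← unit_t1 c.f, ← t_c (by simp [*]) (by simp [*])]
    simp [*]
  · conv_lhs => rw [← t1_unit c.f, ← t_c (by simp [*]) (by simp [*])]
    simp [*]

theorem IsOpmonoidal1.pair {d d' : PsmData M.toTwoCat} {e e' : PsmData N.toTwoCat}
    {c : CellData M.toTwoCat} {k : CellData N.toTwoCat}
    (hd : IsPseudomonoid M d) (hd' : IsPseudomonoid M d')
    (he : IsPseudomonoid N e) (he' : IsPseudomonoid N e') (hc : IsOpmonoidal1 M d d' c)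
    (hk : IsOpmonoidal1 N e e' k) :
    IsOpmonoidal1 (M.prod N) (d.pair e) (d'.pair e') (c.pair k) := by
  obtain ⟨X1, X2, X3, X4, X5, X6, X7, X8⟩ := cell_eqs hd hd' hc
  obtain ⟨Y1, Y2, Y3, Y4, Y5, Y6, Y7, Y8⟩ := cell_eqs he he' hk
  obtain ⟨dm, cm, du, cu, sα, tα, sl, tl, sr, tr, -, -, -, -, -⟩ := hd
  obtain ⟨dm', cm', du', cu', sα', tα', sl', tl', sr', tr', -, -, -, -, -⟩ := hd'
  obtain ⟨em, fm, eu, fu, sβ, tβ, sk, tk, sp, tp, -, -, -, -, -⟩ := he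
  obtain ⟨em', fm', eu', fu', sβ', tβ', sk', tk', sp', tp', -, -, -, -, -⟩ := he'
  obtain ⟨df, cf, s2, t2', s0, t0', ca, cl, cr⟩ := hc
  obtain ⟨kf, lf, ks2, kt2, ks0, kt0, ka, kl, kr⟩ := hk
  refine ⟨Prod.ext df kf, Prod.ext cf lf, ?_, ?_, ?_, Prod.ext t0' kt0, ?_, ?_, ?_⟩
  all_goals simp only [PsmData.pair, CellData.pair, prod_id1, prod_id2, prod_t1, prod_t2]
  · rw [prod_c] <;> first | exact Prod.ext s2 ks2 | simp [*]
  · rw [prod_c] <;> first | exact Prod.ext t2' kt2 | simp [*]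
  · rw [prod_c] <;> first | exact Prod.ext s0 ks0 | simp [*]
  · repeat (first | rw [prod_hc] | rw [prod_vc])
    · exact Prod.ext ca ka
    all_goals clear ca ka cl kl cr kr
    all_goals simp (maxDischargeDepth := 9) [*, c_assoc]
  · repeat (first | rw [prod_hc] | rw [prod_vc])
    · exact Prod.ext cl kl
    all_goals clear ca ka cl kl cr kr
    all_goals simp (maxDischargeDepth := 9) [*, c_assoc]
  · repeat (first | rw [prod_hc] | rw [prod_vc])
    · exact Prod.ext cr kr
    all_goals clear ca ka cl kl cr kr
    all_goals simp (maxDischargeDepth := 9) [*, c_assoc]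

theorem IsOpmonoidal2.pair {d d' : PsmData M.toTwoCat} {e e' : PsmData N.toTwoCat}
    {c c' : CellData M.toTwoCat} {k k' : CellData N.toTwoCat} {a : M.C2} {b : N.C2}
    (hd : IsPseudomonoid M d) (hd' : IsPseudomonoid M d')
    (he : IsPseudomonoid N e) (he' : IsPseudomonoid N e') (hc : IsOpmonoidal1 M d d' c)
    (hk : IsOpmonoidal1 N e e' k) (hc' : IsOpmonoidal1 M d d' c')
    (hk' : IsOpmonoidal1 N e e' k') (ha : IsOpmonoidal2 M d d' c c' a)
    (hb : IsOpmonoidal2 N e e' k k' b) :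
    IsOpmonoidal2 (M.prod N) (d.pair e) (d'.pair e') (c.pair k) (c'.pair k') (a, b) := by
  obtain ⟨dm, cm, du, cu, -⟩ := hd
  obtain ⟨dm', cm', du', cu', -⟩ := hd'
  obtain ⟨em, fm, eu, fu, -⟩ := he
  obtain ⟨em', fm', eu', fu', -⟩ := he'
  obtain ⟨df, cf, s2, t2', s0, t0', -⟩ := hc
  obtain ⟨kf, lf, ks2, kt2, ks0, kt0, -⟩ := hk
  obtain ⟨df', cf', s2', t2'', s0', t0'', -⟩ := hc'
  obtain ⟨kf', lf', ks2', kt2', ks0', kt0', -⟩ := hk'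
  obtain ⟨sa, ta, a2, a0⟩ := ha
  obtain ⟨sb, tb, b2, b0⟩ := hb
  refine ⟨Prod.ext sa sb, Prod.ext ta tb, ?_, ?_⟩
  all_goals simp only [PsmData.pair, CellData.pair, prod_id1, prod_id2, prod_t1, prod_t2]
  · repeat (first | rw [prod_hc] | rw [prod_vc])
    · exact Prod.ext a2 b2
    all_goals clear a2 b2 a0 b0
    all_goals simp (maxDischargeDepth := 9) [*, c_assoc]
  · repeat (first | rw [prod_hc] | rw [prod_vc])
    · exact Prod.ext a0 b0
    all_goals clear a2 b2 a0 b0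
    all_goals simp (maxDischargeDepth := 9) [*, c_assoc]

theorem CellData.pair_comp {d d' d'' : PsmData M.toTwoCat} {e e' e'' : PsmData N.toTwoCat}
    {g f : CellData M.toTwoCat} {g' f' : CellData N.toTwoCat}
    (hd : IsPseudomonoid M d) (he : IsPseudomonoid N e)
    (hd' : IsPseudomonoid M d') (he' : IsPseudomonoid N e')
    (hf : IsOpmonoidal1 M d d' f) (hg : IsOpmonoidal1 M d' d'' g)
    (hf' : IsOpmonoidal1 N e e' f') (hg' : IsOpmonoidal1 N e' e'' g') :
    (g.opComp f).pair (g'.opComp f') = (g.pair g').opComp (f.pair f') := by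
  obtain ⟨dm, cm, du, cu, -⟩ := hd
  obtain ⟨em, fm, eu, fu, -⟩ := he
  obtain ⟨dm', cm', du', cu', -⟩ := hd'
  obtain ⟨em', fm', eu', fu', -⟩ := he'
  obtain ⟨df, cf, s2, t2', s0, t0', -⟩ := hf
  obtain ⟨kf, lf, ks2, kt2, ks0, kt0, -⟩ := hf'
  obtain ⟨df', cf', s2', t2'', s0', t0'', -⟩ := hg
  obtain ⟨kf', lf', ks2', kt2', ks0', kt0', -⟩ := hg'
  refine CellData.ext ?_ ?_ ?_ <;>
    simp only [CellData.pair, CellData.opComp, prod_id1, prod_id2, prod_t1, prod_t2]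
  · rw [prod_c] <;> simp [*]
  · repeat (first | rw [prod_hc] | rw [prod_vc])
    all_goals simp (maxDischargeDepth := 9) [*, c_assoc]
  · repeat (first | rw [prod_hc] | rw [prod_vc])
    all_goals simp (maxDischargeDepth := 9) [*, c_assoc]

/-- The 2-functor `M₀₁ × N₀₁ → (M × N)₀₁`. -/
noncomputable def opmPair (M N : MonTwoCat.{u}) :
    TwoFunctor (M.opm.prod N.opm) (M.prod N).opm where
  map0 A := ⟨A.1.data.pair A.2.data, A.1.law.pair A.2.law⟩
  map1 f := ⟨⟨f.1.dom.data.pair f.2.dom.data, f.1.dom.law.pair f.2.dom.law⟩,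
    ⟨f.1.cod.data.pair f.2.cod.data, f.1.cod.law.pair f.2.cod.law⟩,
    f.1.data.pair f.2.data,
    IsOpmonoidal1.pair f.1.dom.law f.1.cod.law f.2.dom.law f.2.cod.law f.1.law f.2.law⟩
  map2 a :=
    { src := ⟨⟨a.1.src.dom.data.pair a.2.src.dom.data, a.1.src.dom.law.pair a.2.src.dom.law⟩,
        ⟨a.1.src.cod.data.pair a.2.src.cod.data, a.1.src.cod.law.pair a.2.src.cod.law⟩,
        a.1.src.data.pair a.2.src.data, IsOpmonoidal1.pair a.1.src.dom.law a.1.src.cod.law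
          a.2.src.dom.law a.2.src.cod.law a.1.src.law a.2.src.law⟩
      tgt := ⟨⟨a.1.tgt.dom.data.pair a.2.tgt.dom.data, a.1.tgt.dom.law.pair a.2.tgt.dom.law⟩,
        ⟨a.1.tgt.cod.data.pair a.2.tgt.cod.data, a.1.tgt.cod.law.pair a.2.tgt.cod.law⟩,
        a.1.tgt.data.pair a.2.tgt.data, IsOpmonoidal1.pair a.1.tgt.dom.law a.1.tgt.cod.law
          a.2.tgt.dom.law a.2.tgt.cod.law a.1.tgt.law a.2.tgt.law⟩
      dom_eq := by simp only [a.1.dom_eq, a.2.dom_eq]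
      cod_eq := by simp only [a.1.cod_eq, a.2.cod_eq]
      ω := (a.1.ω, a.2.ω)
      law := IsOpmonoidal2.pair a.1.src.dom.law a.1.src.cod.law a.2.src.dom.law a.2.src.cod.law
        a.1.src.law a.2.src.law a.1.law_tgt a.2.law_tgt a.1.law a.2.law }
  dom_map _ := rfl
  cod_map _ := rfl
  src_map _ := rfl
  tgt_map _ := rfl
  map_id1 A := rfl
  map_id2 f := rfl
  map_comp g f h := by
    have h1 : f.1.cod = g.1.dom := congrArg Prod.fst h
    have h2 : f.2.cod = g.2.dom := congrArg Prod.snd h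
    have g1 := g.1.law
    have g2 := g.2.law
    rw [← h1] at g1
    rw [← h2] at g2
    exact Opmonoidal1.ext rfl rfl
      (CellData.pair_comp f.1.dom.law f.2.dom.law f.1.cod.law f.2.cod.law f.1.law g1 f.2.law g2)
  map_vcomp b a h := by
    have h1 : a.1.tgt = b.1.src := congrArg Prod.fst h
    have h2 : a.2.tgt = b.2.src := congrArg Prod.snd h
    exact Opmonoidal2.ext rfl rfl (prod_vc (by rw [a.1.law.tgt_ω, b.1.law.src_ω, h1])
      (by rw [a.2.law.tgt_ω, b.2.law.src_ω, h2])).symm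
  map_hcomp b a h := by
    have h1 : a.1.src.cod = b.1.src.dom := congrArg Prod.fst h
    have h2 : a.2.src.cod = b.2.src.dom := congrArg Prod.snd h
    have g1 := b.1.src.law
    have g2 := b.2.src.law
    have k1 := b.1.law_tgt
    have k2 := b.2.law_tgt
    rw [← h1] at g1 k1
    rw [← h2] at g2 k2
    refine Opmonoidal2.ext (Opmonoidal1.ext rfl rfl ?_) (Opmonoidal1.ext rfl rfl ?_)
      (prod_hc ?_ ?_).symm
    · exact CellData.pair_comp a.1.src.dom.law a.2.src.dom.law a.1.src.cod.law a.2.src.cod.law a.1.src.law g1 a.2.src.law g2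
    · exact CellData.pair_comp a.1.src.dom.law a.2.src.dom.law a.1.src.cod.law a.2.src.cod.law a.1.law_tgt k1 a.2.law_tgt k2
    · rw [a.1.law.src_ω, b.1.law.src_ω, a.1.src.law.cod_f, g1.dom_f]
    · rw [a.2.law.src_ω, b.2.law.src_ω, a.2.src.law.cod_f, g2.dom_f]

end

end TwoDim

namespace TwoDim

open TwoCat MonTwoCat

/-- The condition that a 2-functor between strict monoidal 2-categories strictly preserves the
monoidal structure. -/
structure IsStrictMonoidal {M N : MonTwoCat.{u}} (F : TwoFunctor M.toTwoCat N.toTwoCat) :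
    Prop where
  map_unit : F.map0 M.unit = N.unit
  map_t0 : ∀ A B, F.map0 (A ⊗₀ B) = F.map0 A ⊗₀ F.map0 B
  map_t1 : ∀ f g, F.map1 (f ⊗₁ g) = F.map1 f ⊗₁ F.map1 g
  map_t2 : ∀ a b, F.map2 (a ⊗₂ b) = F.map2 a ⊗₂ F.map2 b

namespace LaxFunctor

variable {M N K L : MonTwoCat.{u}}

theorem ext' {F G : LaxFunctor M N} (h0 : F.map0 = G.map0) (h1 : F.map1 = G.map1)
    (h2 : F.map2 = G.map2) (h : F.μ = G.μ) : F = G := by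
  obtain ⟨⟨⟩, _⟩ := F
  obtain ⟨⟨⟩, _⟩ := G
  simp only at h0 h1 h2 h
  subst h0 h1 h2 h
  rfl

/-- A strict monoidal 2-functor, seen as a lax one with `μ = 1`. -/
def ofStrict (F : TwoFunctor M.toTwoCat N.toTwoCat) (h : IsStrictMonoidal F) :
    LaxFunctor M N where
  toTwoFunctor := F
  μ A B := N.id1 (F.map0 A ⊗₀ F.map0 B)
  map_unit := h.map_unit
  dom_μ A B := by simp
  cod_μ A B := by simp [h.map_t0]
  μ_nat1 f g := by simp [h.map_t1]
  μ_nat2 a b := by simp [h.map_t2]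
  μ_assoc A B C := by simp [h.map_t0]
  μ_unit_left A := by simp [h.map_unit]
  μ_unit_right A := by simp [h.map_unit]

theorem ofStrict_psm (F : TwoFunctor M.toTwoCat N.toTwoCat) (h : IsStrictMonoidal F)
    {d : PsmData M.toTwoCat} (hd : IsPseudomonoid M d) : (ofStrict F h).psm d =
      ⟨F.map0 d.A, F.map1 d.m, F.map1 d.u, F.map2 d.α, F.map2 d.lam, F.map2 d.rho⟩ := by
  obtain ⟨dm, cm, du, cu, sα, -⟩ := hd
  simp [psm, ofStrict, h.map_t0, dm, sα, cm]

theorem ofStrict_cell (F : TwoFunctor M.toTwoCat N.toTwoCat) (h : IsStrictMonoidal F)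
    {d d' : PsmData M.toTwoCat} {c : CellData M.toTwoCat} (hd : IsPseudomonoid M d)
    (hc : IsOpmonoidal1 M d d' c) : (ofStrict F h).cell c =
      ⟨F.map1 c.f, F.map2 c.φ2, F.map2 c.φ0⟩ := by
  obtain ⟨df, cf, s2, -⟩ := hc
  simp [cell, ofStrict, h.map_t0, df, s2, hd.dom_m, hd.cod_m]

/-- The composite of lax functors (first `F`, then `G`). -/
noncomputable def comp (G : LaxFunctor N K) (F : LaxFunctor M N) : LaxFunctor M K where
  toTwoFunctor := G.toTwoFunctor.comp F.toTwoFunctor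
  μ A B := G.map1 (F.μ A B) ⬝₁ G.μ (F.map0 A) (F.map0 B)
  map_unit := by simp [TwoFunctor.comp]
  dom_μ A B := by simp [TwoFunctor.comp]
  cod_μ A B := by simp [TwoFunctor.comp]
  μ_nat1 f g := by
    simp only [TwoFunctor.comp]
    rw [← c_assoc, ← G.map_c, F.μ_nat1, G.map_c, c_assoc, c_assoc,
      ← G.n1 (f := F.map1 f) (g := F.map1 g) (A := F.map0 (M.dom f)) (B := F.map0 (M.dom g))
        (A' := F.map0 (M.cod f)) (B' := F.map0 (M.cod g))] <;> simp
  μ_nat2 a b := by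
    simp only [TwoFunctor.comp]
    rw [id2_c, ← hc_assoc, ← G.map_id2, ← G.map_hc, F.μ_nat2, G.map_hc, hc_assoc, id2_c, hc_assoc,
      ← G.n2 (a := F.map2 a) (b := F.map2 b) (A := F.map0 (M.dom (M.src a)))
      (B := F.map0 (M.dom (M.src b)))
      (A' := F.map0 (M.cod (M.src a))) (B' := F.map0 (M.cod (M.src b)))] <;> simp
  μ_assoc A B C := by
    simp only [TwoFunctor.comp]
    have e1 := G.norm0 (f := F.μ A B) (g := N.id1 (F.map0 C)) (w := G.μ (F.map0 A) (F.map0 B))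
      (w' := K.id1 (G.map0 (F.map0 C))) (A := F.map0 A ⊗₀ F.map0 B) (B := F.map0 C)
      (A' := F.map0 (A ⊗₀ B)) (B' := F.map0 C) (by simp) (by simp) (by simp) (by simp) (by simp)
      (by simp)
    have e2 := G.norm0 (g := F.μ B C) (f := N.id1 (F.map0 A)) (w' := G.μ (F.map0 B) (F.map0 C))
      (w := K.id1 (G.map0 (F.map0 A))) (B := F.map0 B ⊗₀ F.map0 C) (A := F.map0 A)
      (B' := F.map0 (B ⊗₀ C)) (A' := F.map0 A) (by simp) (by simp) (by simp) (by simp) (by simp)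
      (by simp)
    have e3 := G.μ_assoc (F.map0 A) (F.map0 B) (F.map0 C)
    have e4 := F.μ_assoc A B C
    rw [TwoFunctor.map_id1, id_c (by simp)] at e1 e2
    rw [c_assoc, e1, c_assoc, e2, ← e3, ← c_assoc (k := G.map1 (F.μ (A ⊗₀ B) C)), ← G.map_c, e4,
      G.map_c, c_assoc]
    all_goals clear e1 e2 e3 e4
    all_goals simp
  μ_unit_left A := by simp [TwoFunctor.comp]
  μ_unit_right A := by simp [TwoFunctor.comp]

theorem comp_psm (G : LaxFunctor N K) (F : LaxFunctor M N) {d : PsmData M.toTwoCat}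
    (hd : IsPseudomonoid M d) : (G.comp F).psm d = G.psm (F.psm d) := by
  obtain ⟨dm, cm, du, cu, sα, -⟩ := hd
  have e1 := G.norm0 (f := F.μ d.A d.A) (g := N.id1 (F.map0 d.A))
    (w := G.μ (F.map0 d.A) (F.map0 d.A))
    (w' := K.id1 (G.map0 (F.map0 d.A))) (A := F.map0 d.A ⊗₀ F.map0 d.A) (B := F.map0 d.A)
    (A' := F.map0 (d.A ⊗₀ d.A)) (B' := F.map0 d.A) (by simp) (by simp) (by simp) (by simp)
    (by simp) (by simp)
  rw [TwoFunctor.map_id1, id_c (by simp)] at e1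
  refine PsmData.ext rfl ?_ rfl ?_ rfl rfl
  · simp only [psm, comp, TwoFunctor.comp]
    rw [G.map_c, c_assoc] <;> simp [*]
  · simp only [psm, comp, TwoFunctor.comp]
    rw [c_assoc, e1, G.map_hc, G.map_id2, hc_assoc, hc_id_id, G.map_c, c_assoc]
    all_goals clear e1
    all_goals simp [*]

theorem comp_cell (G : LaxFunctor N K) (F : LaxFunctor M N) {d d' : PsmData M.toTwoCat}
    {c : CellData M.toTwoCat}
    (hd : IsPseudomonoid M d) (hc : IsOpmonoidal1 M d d' c) :
    (G.comp F).cell c = G.cell (F.cell c) := by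
  obtain ⟨dm, cm, -⟩ := hd
  obtain ⟨df, cf, s2, -⟩ := hc
  refine CellData.ext rfl ?_ rfl
  simp only [cell, comp, TwoFunctor.comp]
  rw [G.map_hc, G.map_id2, hc_assoc, hc_id_id] <;> simp [*]

theorem typ1 (F : LaxFunctor M N) (f g : M.C1) :
    N.cod (F.μ (M.dom f) (M.dom g)) = N.dom (F.map1 (f ⊗₁ g)) := by simp
theorem typ2 (F : LaxFunctor M N) (f g : M.C1) :
    N.cod (F.map1 f ⊗₁ F.map1 g) = N.dom (F.μ (M.cod f) (M.cod g)) := by simp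
theorem typ3 (F : LaxFunctor M N) (a b : M.C2) :
    N.cod (N.src (𝟏(F.μ (M.dom (M.src a)) (M.dom (M.src b))))) =
      N.dom (N.src (F.map2 (a ⊗₂ b))) := by simp
theorem typ4 (F : LaxFunctor M N) (a b : M.C2) :
    N.cod (N.src (F.map2 a ⊗₂ F.map2 b)) =
      N.dom (N.src (𝟏(F.μ (M.cod (M.src a)) (M.cod (M.src b))))) := by simp
theorem typ5 (F : LaxFunctor M N) (A B C : M.C0) :
    N.cod (F.μ A B ⊗₁ N.id1 (F.map0 C)) = N.dom (F.μ (A ⊗₀ B) C) := by simp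
theorem typ6 (F : LaxFunctor M N) (A B C : M.C0) :
    N.cod (N.id1 (F.map0 A) ⊗₁ F.μ B C) = N.dom (F.μ A (B ⊗₀ C)) := by simp

/-- The product of lax functors. -/
noncomputable def prod (F : LaxFunctor M N) (G : LaxFunctor K L) :
    LaxFunctor (M.prod K) (N.prod L) where
  map0 A := (F.map0 A.1, G.map0 A.2)
  map1 A := (F.map1 A.1, G.map1 A.2)
  map2 A := (F.map2 A.1, G.map2 A.2)
  dom_map f := Prod.ext (F.dom_map _) (G.dom_map _)
  cod_map f := Prod.ext (F.cod_map _) (G.cod_map _)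
  src_map f := Prod.ext (F.src_map _) (G.src_map _)
  tgt_map f := Prod.ext (F.tgt_map _) (G.tgt_map _)
  map_id1 f := Prod.ext (F.map_id1 _) (G.map_id1 _)
  map_id2 f := Prod.ext (F.map_id2 _) (G.map_id2 _)
  map_comp g f h := Prod.ext (F.map_comp _ _ (congrArg Prod.fst h))
    (G.map_comp _ _ (congrArg Prod.snd h))
  map_vcomp g f h := Prod.ext (F.map_vcomp _ _ (congrArg Prod.fst h))
    (G.map_vcomp _ _ (congrArg Prod.snd h))
  map_hcomp g f h := Prod.ext (F.map_hcomp _ _ (congrArg Prod.fst h))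
    (G.map_hcomp _ _ (congrArg Prod.snd h))
  μ A B := (F.μ A.1 B.1, G.μ A.2 B.2)
  map_unit := Prod.ext F.map_unit G.map_unit
  dom_μ A B := Prod.ext (F.dom_μ _ _) (G.dom_μ _ _)
  cod_μ A B := Prod.ext (F.cod_μ _ _) (G.cod_μ _ _)
  μ_nat1 f g := (prod_c (F.typ1 f.1 g.1) (G.typ1 f.2 g.2)).trans <|
    (Prod.ext (F.μ_nat1 _ _) (G.μ_nat1 _ _)).trans
      (prod_c (F.typ2 f.1 g.1) (G.typ2 f.2 g.2)).symm
  μ_nat2 f g := (prod_hc (F.typ3 f.1 g.1) (G.typ3 f.2 g.2)).trans <|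
    (Prod.ext (F.μ_nat2 _ _) (G.μ_nat2 _ _)).trans
      (prod_hc (F.typ4 f.1 g.1) (G.typ4 f.2 g.2)).symm
  μ_assoc A B C := (prod_c (F.typ5 A.1 B.1 C.1) (G.typ5 A.2 B.2 C.2)).trans <|
    (Prod.ext (F.μ_assoc _ _ _) (G.μ_assoc _ _ _)).trans
      (prod_c (F.typ6 A.1 B.1 C.1) (G.typ6 A.2 B.2 C.2)).symm
  μ_unit_left A := Prod.ext (F.μ_unit_left _) (G.μ_unit_left _)
  μ_unit_right A := Prod.ext (F.μ_unit_right _) (G.μ_unit_right _)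

theorem prod_psm (F : LaxFunctor M N) (G : LaxFunctor K L) {d : PsmData M.toTwoCat}
    {e : PsmData K.toTwoCat} (hd : IsPseudomonoid M d) (he : IsPseudomonoid K e) :
    (F.prod G).psm (d.pair e) = (F.psm d).pair (G.psm e) := by
  obtain ⟨dm, cm, du, cu, sα, -⟩ := hd
  obtain ⟨dm', cm', du', cu', sα', -⟩ := he
  refine PsmData.ext rfl ?_ rfl ?_ rfl rfl
  · exact prod_c (M := N) (N := L) (g := F.map1 d.m) (g' := G.map1 e.m) (f := F.μ d.A d.A)
      (f' := G.μ e.A e.A) (by simp [*]) (by simp [*])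
  · refine Eq.trans ?_ (prod_hc (M := N) (N := L) ?_ ?_)
    · simp only [psm, PsmData.pair, prod, prod_t0, prod_t1, prod_id1]
      rw [prod_c (by simp [*]) (by simp [*])]
      rfl
    all_goals simp [*]

theorem prod_cell (F : LaxFunctor M N) (G : LaxFunctor K L) {d d' : PsmData M.toTwoCat}
    {e e' : PsmData K.toTwoCat} {c : CellData M.toTwoCat} {k : CellData K.toTwoCat}
    (hd : IsPseudomonoid M d) (he : IsPseudomonoid K e) (hc : IsOpmonoidal1 M d d' c)
    (hk : IsOpmonoidal1 K e e' k) :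
    (F.prod G).cell (c.pair k) = (F.cell c).pair (G.cell k) := by
  obtain ⟨dm, cm, -⟩ := hd
  obtain ⟨df, cf, s2, -⟩ := hc
  obtain ⟨dm', cm', -⟩ := he
  obtain ⟨df', cf', s2', -⟩ := hk
  refine CellData.ext rfl ?_ rfl
  exact prod_hc (M := N) (N := L) (g := F.map2 c.φ2) (f := 𝟏(F.μ (M.dom c.f) (M.dom c.f)))
    (g' := G.map2 k.φ2) (f' := 𝟏(G.μ (K.dom k.f) (K.dom k.f))) (by simp [*]) (by simp [*])

end LaxFunctor

end TwoDim

namespace TwoDim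

open TwoCat MonTwoCat

/-- The data of the 1-cell `(f, 1, 1)`, where `f` strictly preserves the structure of `d`. -/
noncomputable def PsmData.strictCell {M : TwoCat.{u}} (d : PsmData M) (f : M.C1) : CellData M where
  f := f
  φ2 := 𝟏(f ⬝₁ d.m)
  φ0 := 𝟏(f ⬝₁ d.u)

theorem IsPseudomonoid.strictCell {M : MonTwoCat.{u}} {d d' : PsmData M.toTwoCat} {f : M.C1}
    (hd : IsPseudomonoid M d) (hd' : IsPseudomonoid M d') (hf : M.dom f = d.A)
    (hf' : M.cod f = d'.A) (hm : f ⬝₁ d.m = d'.m ⬝₁ (f ⊗₁ f)) (hu : f ⬝₁ d.u = d'.u)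
    (hα : d'.α ⬝ₕ 𝟏(f ⊗₁ f ⊗₁ f) = 𝟏f ⬝ₕ d.α) (hl : d'.lam ⬝ₕ 𝟏f = 𝟏f ⬝ₕ d.lam)
    (hr : d'.rho ⬝ₕ 𝟏f = 𝟏f ⬝ₕ d.rho) : IsOpmonoidal1 M d d' (d.strictCell f) := by
  obtain ⟨dm, cm, du, cu, sα, tα, sl, tl, sr, tr, -⟩ := hd
  obtain ⟨dm', cm', du', cu', sα', tα', sl', tl', sr', tr', -⟩ := hd'
  have D1 : f ⬝₁ d.m ⬝₁ (d.m ⊗₁ M.id1 d.A) =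
      d'.m ⬝₁ (d'.m ⊗₁ M.id1 d'.A) ⬝₁ (f ⊗₁ f ⊗₁ f) := by
    rw [← c_assoc, hm, c_assoc, ← t_c, hm, ← t1_assoc f, ← t_c] <;> simp [*]
  have D2 : f ⬝₁ d.m ⬝₁ (M.id1 d.A ⊗₁ d.m) =
      d'.m ⬝₁ (M.id1 d'.A ⊗₁ d'.m) ⬝₁ (f ⊗₁ f ⊗₁ f) := by
    rw [← c_assoc, hm, c_assoc, ← t_c, hm, ← t_c] <;> simp [*]
  have D3 : f ⬝₁ d.m ⬝₁ (d.u ⊗₁ M.id1 d.A) = d'.m ⬝₁ (d'.u ⊗₁ f) := by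
    rw [← c_assoc, hm, c_assoc, ← t_c, hu] <;> simp [*]
  have D4 : f ⬝₁ d.m ⬝₁ (M.id1 d.A ⊗₁ d.u) = d'.m ⬝₁ (f ⊗₁ d'.u) := by
    rw [← c_assoc, hm, c_assoc, ← t_c, hu] <;> simp [*]
  have D5 : (d'.u ⊗₁ M.id1 d'.A) ⬝₁ f = d'.u ⊗₁ f := by
    conv_lhs => rw [← unit_t1 f, ← t_c (by simp [*]) (by simp [*])]
    simp [*]
  have D6 : (M.id1 d'.A ⊗₁ d'.u) ⬝₁ f = f ⊗₁ d'.u := by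
    conv_lhs => rw [← t1_unit f, ← t_c (by simp [*]) (by simp [*])]
    simp [*]
  have D7 : (d'.m ⬝₁ (f ⊗₁ f)) ⊗₁ f = (d'.m ⊗₁ M.id1 d'.A) ⬝₁ (f ⊗₁ f ⊗₁ f) := by
    rw [← t1_assoc f, ← t_c] <;> simp [*]
  have D8 : f ⊗₁ (d'.m ⬝₁ (f ⊗₁ f)) = (M.id1 d'.A ⊗₁ d'.m) ⬝₁ (f ⊗₁ f ⊗₁ f) := by
    rw [← t_c] <;> simp [*]
  have D9 : (f ⊗₁ f) ⬝₁ (d.m ⊗₁ M.id1 d.A) = (d'.m ⊗₁ M.id1 d'.A) ⬝₁ (f ⊗₁ f ⊗₁ f) := by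
    rw [← t_c, hm, c_id, D7] <;> simp [*]
  have D10 : (f ⊗₁ f) ⬝₁ (M.id1 d.A ⊗₁ d.m) = (M.id1 d'.A ⊗₁ d'.m) ⬝₁ (f ⊗₁ f ⊗₁ f) := by
    rw [← t_c, hm, c_id, D8] <;> simp [*]
  have D11 : (f ⊗₁ f) ⬝₁ (d.u ⊗₁ M.id1 d.A) = d'.u ⊗₁ f := by
    rw [← t_c, hu] <;> simp [*]
  have D12 : (f ⊗₁ f) ⬝₁ (M.id1 d.A ⊗₁ d.u) = f ⊗₁ d'.u := by
    rw [← t_c, hu] <;> simp [*]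
  refine ⟨hf, hf', ?_, ?_, ?_, ?_, ?_, ?_, ?_⟩ <;> simp only [PsmData.strictCell]
  · simp
  · simp [*]
  · simp
  · simp [*]
  · rw [← hα]
    clear hα hl hr
    simp (maxDischargeDepth := 9) [*, hc_id_id, c_assoc]
  · rw [← hl]
    clear hα hl hr
    simp (maxDischargeDepth := 9) [*, hc_id_id, c_assoc]
  · rw [← hr]
    clear hα hl hr
    simp (maxDischargeDepth := 9) [*, hc_id_id, c_assoc]

theorem strictCell_comp {M : MonTwoCat.{u}} {d d' d'' : PsmData M.toTwoCat} {f g : M.C1}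
    (hd : IsPseudomonoid M d) (hd' : IsPseudomonoid M d')
    (hf : IsOpmonoidal1 M d d' (d.strictCell f)) (hg : IsOpmonoidal1 M d' d'' (d'.strictCell g)) :
    (d'.strictCell g).opComp (d.strictCell f) = d.strictCell (g ⬝₁ f) := by
  obtain ⟨dm, cm, du, cu, -⟩ := hd
  obtain ⟨dm', cm', du', cu', -⟩ := hd'
  obtain ⟨df, cf, -, t2, -, t0, -⟩ := hf
  obtain ⟨dg, cg, -, gt2, -, gt0, -⟩ := hg
  simp only [PsmData.strictCell, tgt_id2] at df cf t2 t0 dg cg gt2 gt0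
  refine CellData.ext rfl ?_ ?_ <;> simp only [PsmData.strictCell, CellData.opComp]
  · clear gt2
    simp (maxDischargeDepth := 9) [*, hc_id_id, c_assoc]
  · simp (maxDischargeDepth := 9) [*, hc_id_id, c_assoc]

/-- The condition that `θ` is a monoidal 2-natural transformation between lax functors. -/
structure IsLaxMonNat {M N : MonTwoCat.{u}} (F G : LaxFunctor M N) (θ : M.C0 → N.C1) : Prop where
  isTwoNat : IsTwoNat F.toTwoFunctor G.toTwoFunctor θ
  tensor : ∀ A B, θ (A ⊗₀ B) ⬝₁ F.μ A B = G.μ A B ⬝₁ (θ A ⊗₁ θ B)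
  unit : θ M.unit = N.id1 N.unit

@[simp] theorem LaxFunctor.psm_A {M N : MonTwoCat.{u}} (F : LaxFunctor M N)
    (d : PsmData M.toTwoCat) : (F.psm d).A = F.map0 d.A := rfl
@[simp] theorem LaxFunctor.psm_u {M N : MonTwoCat.{u}} (F : LaxFunctor M N)
    (d : PsmData M.toTwoCat) : (F.psm d).u = F.map1 d.u := rfl
@[simp] theorem LaxFunctor.cell_f {M N : MonTwoCat.{u}} (F : LaxFunctor M N)
    (c : CellData M.toTwoCat) : (F.cell c).f = F.map1 c.f := rfl
@[simp] theorem LaxFunctor.cell_φ0 {M N : MonTwoCat.{u}} (F : LaxFunctor M N)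
    (c : CellData M.toTwoCat) : (F.cell c).φ0 = F.map2 c.φ0 := rfl

namespace IsLaxMonNat

variable {M N : MonTwoCat.{u}} {F G : LaxFunctor M N} {θ : M.C0 → N.C1}

theorem nat1 (h : IsLaxMonNat F G θ) {f : M.C1} {A B : M.C0} (hA : M.dom f = A)
    (hB : M.cod f = B) : θ B ⬝₁ F.map1 f = G.map1 f ⬝₁ θ A := by
  subst hA hB; exact h.isTwoNat.c_nat f

theorem nat2 (h : IsLaxMonNat F G θ) {a : M.C2} {A B : M.C0} (hA : M.dom (M.src a) = A)
    (hB : M.cod (M.src a) = B) : 𝟏(θ B) ⬝ₕ F.map2 a = G.map2 a ⬝ₕ 𝟏(θ A) := by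
  subst hA hB; exact h.isTwoNat.hc_nat a

theorem cell_law (h : IsLaxMonNat F G θ) {d : PsmData M.toTwoCat} (hd : IsPseudomonoid M d) :
    IsOpmonoidal1 N (F.psm d) (G.psm d) ((F.psm d).strictCell (θ d.A)) := by
  have hF := F.psm_law hd
  have hG := G.psm_law hd
  obtain ⟨dm, cm, du, cu, sα, tα, sl, tl, sr, tr, -⟩ := hd
  have hdθ := h.isTwoNat.dom_app
  have hcθ := h.isTwoNat.cod_app
  have n1 := h.nat1 dm cm
  have n2 := h.nat1 du cu
  have e1 := h.tensor d.A d.A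
  have e2 := h.tensor (d.A ⊗₀ d.A) d.A
  have n3 := h.nat2 (a := d.α) (A := d.A ⊗₀ d.A ⊗₀ d.A) (B := d.A) (by simp [*]) (by simp [*])
  have n4 := h.nat2 (a := d.lam) (A := d.A) (B := d.A) (by simp [*]) (by simp [*])
  have n5 := h.nat2 (a := d.rho) (A := d.A) (B := d.A) (by simp [*]) (by simp [*])
  rw [h.unit] at n2
  refine hF.strictCell hG (hdθ _) (hcθ _) ?_ ?_ ?_ n4.symm n5.symm <;> simp only [LaxFunctor.psm]
  · rw [← c_assoc, n1, c_assoc, e1, c_assoc] <;> (clear n1 n2 n3 n4 n5 e1 e2; simp [*])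
  · rw [n2] ; simp [du]
  · have e3 : (G.μ (d.A ⊗₀ d.A) d.A ⬝₁ (G.μ d.A d.A ⊗₁ N.id1 (G.map0 d.A))) ⬝₁
        (θ d.A ⊗₁ θ d.A ⊗₁ θ d.A) = θ (d.A ⊗₀ d.A ⊗₀ d.A) ⬝₁
        F.μ (d.A ⊗₀ d.A) d.A ⬝₁ (F.μ d.A d.A ⊗₁ N.id1 (F.map0 d.A)) := by
      rw [c_assoc, ← t1_assoc (θ d.A), ← t_c, ← e1, ← c_assoc (k := θ _), ← t0_assoc, e2,
        c_assoc, ← t_c]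
      all_goals clear n1 n2 n3 n4 n5 e1 e2
      all_goals simp [*]
    rw [hc_assoc, hc_id_id, e3, ← hc_assoc, n3, hc_assoc, hc_id_id]
    all_goals clear n1 n2 n3 n4 n5 e1 e2 e3
    all_goals simp [*]

theorem cell_nat (h : IsLaxMonNat F G θ) {d d' : PsmData M.toTwoCat} {c : CellData M.toTwoCat}
    (hd : IsPseudomonoid M d) (hd' : IsPseudomonoid M d') (hc : IsOpmonoidal1 M d d' c) :
    ((F.psm d').strictCell (θ d'.A)).opComp (F.cell c) =
      (G.cell c).opComp ((F.psm d).strictCell (θ d.A)) := by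
  obtain ⟨dF, cF, duF, cuF, -⟩ := F.psm_law hd
  obtain ⟨dG, cG, duG, cuG, -⟩ := G.psm_law hd
  obtain ⟨dF', cF', duF', cuF', -⟩ := F.psm_law hd'
  obtain ⟨dG', cG', duG', cuG', -⟩ := G.psm_law hd'
  obtain ⟨dFc, cFc, s2F, t2F, s0F, t0F, -⟩ := F.cell_law hd hd' hc
  obtain ⟨dGc, cGc, s2G, t2G, s0G, t0G, -⟩ := G.cell_law hd hd' hc
  obtain ⟨dθ, cθ, -, t2, -, t0, -⟩ := h.cell_law hd
  obtain ⟨dθ', cθ', -, t2', -, t0', -⟩ := h.cell_law hd'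
  obtain ⟨dm, cm, du, cu, -⟩ := hd
  obtain ⟨df, cf, s2, t2c, s0, t0c, -⟩ := hc
  have n1 := h.nat1 df cf
  have n2 := h.nat2 (a := c.φ2) (A := d.A ⊗₀ d.A) (B := d'.A) (by simp [*]) (by simp [*])
  have n3 := h.nat2 (a := c.φ0) (A := M.unit) (B := d'.A) (by simp [*]) (by simp [*])
  have hdθ := h.isTwoNat.dom_app
  have hcθ := h.isTwoNat.cod_app
  have e1 := h.tensor d.A d.A
  simp only [PsmData.strictCell, tgt_id2] at dθ cθ t2 t0 dθ' cθ' t2' t0'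
  simp only [LaxFunctor.psm_A, LaxFunctor.psm_u, LaxFunctor.cell_f, LaxFunctor.cell_φ0] at *
  refine CellData.ext n1 ?_ ?_
  · have L : ((F.psm d').strictCell (θ d'.A)).φ2 ⬝ₕ 𝟏((F.cell c).f ⊗₁ (F.cell c).f) ⬝ᵥ
        (𝟏(θ d'.A) ⬝ₕ (F.cell c).φ2) = 𝟏(θ d'.A) ⬝ₕ (F.cell c).φ2 := by
      simp only [PsmData.strictCell]
      rw [hc_id_id, id_vc]
      all_goals clear t2' t0'
      all_goals clear n1 n2 n3 e1
      all_goals simp (maxDischargeDepth := 9) [*, c_assoc]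
    have R : (G.cell c).φ2 ⬝ₕ 𝟏(θ d.A ⊗₁ θ d.A) ⬝ᵥ
        (𝟏((G.cell c).f) ⬝ₕ ((F.psm d).strictCell (θ d.A)).φ2) =
          (G.cell c).φ2 ⬝ₕ 𝟏(θ d.A ⊗₁ θ d.A) := by
      simp only [PsmData.strictCell]
      rw [hc_id_id, vc_id]
      all_goals clear n1 n2 n3 e1
      all_goals simp (maxDischargeDepth := 9) [*, c_assoc]
    refine L.trans (Eq.trans ?_ R.symm)
    simp only [LaxFunctor.cell]
    rw [← hc_assoc, n2, hc_assoc, hc_assoc, hc_id_id, hc_id_id, df, e1]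
    all_goals clear n1 n2 n3 e1 L R
    all_goals simp [*]
  · have L : ((F.psm d').strictCell (θ d'.A)).φ0 ⬝ᵥ (𝟏(θ d'.A) ⬝ₕ (F.cell c).φ0) =
        𝟏(θ d'.A) ⬝ₕ (F.cell c).φ0 := by
      simp only [PsmData.strictCell]
      rw [id_vc]
      all_goals clear n1 n2 n3 e1
      all_goals simp (maxDischargeDepth := 9) [*, c_assoc]
    have R : (G.cell c).φ0 ⬝ᵥ (𝟏((G.cell c).f) ⬝ₕ ((F.psm d).strictCell (θ d.A)).φ0) =
        (G.cell c).φ0 := by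
      simp only [PsmData.strictCell]
      rw [hc_id_id, vc_id]
      all_goals clear n1 n2 n3 e1
      all_goals simp (maxDischargeDepth := 9) [*, c_assoc]
    refine L.trans (Eq.trans ?_ R.symm)
    simp only [LaxFunctor.cell]
    rw [n3, h.unit, hc_id]
    all_goals clear n1 n2 n3 e1 L R
    all_goals simp [*]

/-- The components of the 2-natural transformation `θ₀₁ : F₀₁ → G₀₁`. -/
noncomputable def opmApp (h : IsLaxMonNat F G θ) (A : Pseudomonoid M) : Opmonoidal1 N where
  dom := F.opm.map0 A
  cod := G.opm.map0 A
  data := (F.psm A.data).strictCell (θ A.data.A)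
  law := h.cell_law A.law

theorem opm (h : IsLaxMonNat F G θ) : IsTwoNat F.opm G.opm h.opmApp where
  dom_app _ := rfl
  cod_app _ := rfl
  nat1 f := Opmonoidal1.ext rfl rfl (h.cell_nat f.dom.law f.cod.law f.law)
  nat2 a := by
    refine Opmonoidal2.ext (Opmonoidal1.ext rfl rfl ?_) (Opmonoidal1.ext
      (congrArg F.opm.map0 a.dom_eq) (congrArg G.opm.map0 a.cod_eq.symm) ?_) ?_
    · exact h.cell_nat a.src.dom.law a.src.cod.law a.src.law
    · exact h.cell_nat a.src.dom.law a.src.cod.law a.law_tgt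
    · exact h.nat2 (by rw [a.law.src_ω, a.src.law.dom_f]; rfl)
        (by rw [a.law.src_ω, a.src.law.cod_f]; rfl)

end IsLaxMonNat

end TwoDim

namespace TwoDim

open TwoCat MonTwoCat

namespace SymMonTwoCat

variable {M : SymMonTwoCat.{u}}

@[simp] theorem dom_σ (A B : M.C0) : M.dom (M.σ A B) = A ⊗₀ B :=
  M.isSymmetry.isTwoNat.dom_app (A, B)
@[simp] theorem cod_σ (A B : M.C0) : M.cod (M.σ A B) = B ⊗₀ A :=
  M.isSymmetry.isTwoNat.cod_app (A, B)
theorem σ_nat1 {f g : M.C1} {A B A' B' : M.C0} (hA : M.dom f = A) (hB : M.dom g = B)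
    (hA' : M.cod f = A') (hB' : M.cod g = B') :
    M.σ A' B' ⬝₁ (f ⊗₁ g) = (g ⊗₁ f) ⬝₁ M.σ A B := by
  subst hA hB hA' hB'; exact M.isSymmetry.isTwoNat.c_nat (f, g)
theorem σ_nat2 {a b : M.C2} {A B A' B' : M.C0} (hA : M.dom (M.src a) = A)
    (hB : M.dom (M.src b) = B) (hA' : M.cod (M.src a) = A') (hB' : M.cod (M.src b) = B') :
    𝟏(M.σ A' B') ⬝ₕ (a ⊗₂ b) = (b ⊗₂ a) ⬝ₕ 𝟏(M.σ A B) := by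
  subst hA hB hA' hB'; exact M.isSymmetry.isTwoNat.hc_nat (a, b)
theorem σ_σ (A B : M.C0) : M.σ B A ⬝₁ M.σ A B = M.id1 (A ⊗₀ B) := M.isSymmetry.σ_σ A B
theorem hexagon (A B C : M.C0) :
    M.σ A (B ⊗₀ C) = (M.id1 B ⊗₁ M.σ A C) ⬝₁ (M.σ A B ⊗₁ M.id1 C) := M.isSymmetry.hexagon A B C

/-- An inverse of a 1-cell is unique. -/
theorem inv_unique {N : TwoCat.{u}} {f g g' : N.C1} {A B : N.C0} (hf : N.dom f = A)
    (hf' : N.cod f = B) (hg : N.dom g = B) (hg' : N.cod g = A)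
    (hk : N.dom g' = B) (hk' : N.cod g' = A) (h1 : g ⬝₁ f = N.id1 A) (h2 : f ⬝₁ g' = N.id1 B) :
    g = g' := by
  have : (g ⬝₁ f) ⬝₁ g' = g ⬝₁ f ⬝₁ g' := c_assoc (by simp [*]) (by simp [*])
  rw [h1, h2, id_c hk', c_id hg] at this
  exact this.symm

@[simp] theorem σ_unit_right (A : M.C0) : M.σ A M.unit = M.id1 A := by
  have h := M.hexagon A M.unit M.unit
  simp only [t1_unit, unit_t0, unit_t1] at h
  have h1 := M.σ_σ A M.unit
  have e : (M.σ M.unit A ⬝₁ M.σ A M.unit) ⬝₁ M.σ A M.unit =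
      M.σ M.unit A ⬝₁ M.σ A M.unit ⬝₁ M.σ A M.unit := c_assoc (by simp) (by simp)
  rw [← h, h1, id_c (by simp)] at e
  simpa using e

@[simp] theorem σ_unit_left (A : M.C0) : M.σ M.unit A = M.id1 A := by
  have h1 := M.σ_σ A M.unit
  rw [σ_unit_right, c_id (by simp)] at h1
  simpa using h1

theorem hexagon' (A B C : M.C0) :
    M.σ (A ⊗₀ B) C = (M.σ A C ⊗₁ M.id1 B) ⬝₁ (M.id1 A ⊗₁ M.σ B C) := by
  refine inv_unique (f := M.σ C (A ⊗₀ B)) (A := C ⊗₀ A ⊗₀ B) (B := A ⊗₀ B ⊗₀ C) (by simp) (by simp)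
    (by simp) (by simp) (by simp) (by simp) (M.σ_σ _ _) ?_
  have e1 : (M.σ C A ⊗₁ M.id1 B) ⬝₁ (M.σ A C ⊗₁ M.id1 B) = M.id1 (A ⊗₀ C ⊗₀ B) := by
    rw [← t_c, σ_σ] <;> simp
  have e2 : (M.id1 A ⊗₁ M.σ C B) ⬝₁ (M.id1 A ⊗₁ M.σ B C) = M.id1 (A ⊗₀ B ⊗₀ C) := by
    rw [← t_c, σ_σ] <;> simp
  rw [hexagon, c_assoc, ← c_assoc (k := M.σ C A ⊗₁ M.id1 B), e1, id_c, e2] <;> simp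

/-- Horizontal composites of tensor products of independent 1-cells. -/
theorem t_swap {f g : M.C1} {A B A' B' : M.C0} (hA : M.dom f = A) (hB : M.dom g = B)
    (hA' : M.cod f = A') (hB' : M.cod g = B') :
    (f ⊗₁ M.id1 B') ⬝₁ (M.id1 A ⊗₁ g) = (M.id1 A' ⊗₁ g) ⬝₁ (f ⊗₁ M.id1 B) := by
  rw [← t_c, ← t_c] <;> simp [*]

theorem middle_assoc (A B C A' B' C' : M.C0) :
    (M.id1 A ⊗₁ M.σ B A' ⊗₁ M.id1 (B' ⊗₀ C ⊗₀ C')) ⬝₁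
      (M.id1 (A ⊗₀ B) ⊗₁ M.σ C (A' ⊗₀ B') ⊗₁ M.id1 C') =
    (M.id1 (A ⊗₀ A' ⊗₀ B) ⊗₁ M.σ C B' ⊗₁ M.id1 C') ⬝₁
      (M.id1 A ⊗₁ M.σ (B ⊗₀ C) A' ⊗₁ M.id1 (B' ⊗₀ C')) := by
  have core : (M.σ B A' ⊗₁ M.id1 (B' ⊗₀ C)) ⬝₁ (M.id1 B ⊗₁ M.σ C (A' ⊗₀ B')) =
      (M.id1 (A' ⊗₀ B) ⊗₁ M.σ C B') ⬝₁ (M.σ (B ⊗₀ C) A' ⊗₁ M.id1 B') := by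
    have e1 : M.id1 B ⊗₁ M.σ C (A' ⊗₀ B') = (M.id1 (B ⊗₀ A') ⊗₁ M.σ C B') ⬝₁
        (M.id1 B ⊗₁ M.σ C A' ⊗₁ M.id1 B') := by
      rw [hexagon, ← t_id1 B, t1_assoc, ← t_c (g := M.id1 B) (f := M.id1 B)] <;> simp
    have e2 : M.σ (B ⊗₀ C) A' ⊗₁ M.id1 B' = (M.σ B A' ⊗₁ M.id1 (C ⊗₀ B')) ⬝₁
        (M.id1 B ⊗₁ M.σ C A' ⊗₁ M.id1 B') := by
      rw [hexagon', ← t_id1 C, ← t1_assoc, ← t1_assoc (M.id1 B),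
        ← t_c (g' := M.id1 B') (f' := M.id1 B')] <;> simp
    rw [e1, e2, ← c_assoc, ← c_assoc,
      t_swap (f := M.σ B A') (g := M.σ C B') (A := B ⊗₀ A') (B := C ⊗₀ B')] <;> simp
  have e1 : M.id1 A ⊗₁ M.σ B A' ⊗₁ M.id1 (B' ⊗₀ C ⊗₀ C') =
      M.id1 A ⊗₁ (M.σ B A' ⊗₁ M.id1 (B' ⊗₀ C)) ⊗₁ M.id1 C' := by
    rw [t1_assoc, t_id1, t0_assoc]
  have e2 : M.id1 (A ⊗₀ B) ⊗₁ M.σ C (A' ⊗₀ B') ⊗₁ M.id1 C' =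
      M.id1 A ⊗₁ (M.id1 B ⊗₁ M.σ C (A' ⊗₀ B')) ⊗₁ M.id1 C' := by
    rw [← t_id1, t1_assoc, t1_assoc]
  have e3 : M.id1 (A ⊗₀ A' ⊗₀ B) ⊗₁ M.σ C B' ⊗₁ M.id1 C' =
      M.id1 A ⊗₁ (M.id1 (A' ⊗₀ B) ⊗₁ M.σ C B') ⊗₁ M.id1 C' := by
    rw [← t_id1 A, t1_assoc, t1_assoc]
  have e4 : M.id1 A ⊗₁ M.σ (B ⊗₀ C) A' ⊗₁ M.id1 (B' ⊗₀ C') =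
      M.id1 A ⊗₁ (M.σ (B ⊗₀ C) A' ⊗₁ M.id1 B') ⊗₁ M.id1 C' := by
    rw [t1_assoc, t_id1]
  rw [e1, e2, e3, e4, ← t_c, ← t_c, core, t_c, t_c] <;> simp

theorem middle_coherence (A A' B B' C C' : M.C0) :
    (M.id1 (A ⊗₀ B) ⊗₁ M.σ (A' ⊗₀ B') C ⊗₁ M.id1 C') ⬝₁
      ((M.id1 A ⊗₁ M.σ A' B ⊗₁ M.id1 B') ⊗₁ M.id1 (C ⊗₀ C')) =
    (M.id1 A ⊗₁ M.σ A' (B ⊗₀ C) ⊗₁ M.id1 (B' ⊗₀ C')) ⬝₁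
      (M.id1 (A ⊗₀ A') ⊗₁ (M.id1 B ⊗₁ M.σ B' C ⊗₁ M.id1 C')) := by
  have core : (M.id1 B ⊗₁ M.σ (A' ⊗₀ B') C) ⬝₁ (M.σ A' B ⊗₁ M.id1 (B' ⊗₀ C)) =
      (M.σ A' (B ⊗₀ C) ⊗₁ M.id1 B') ⬝₁ (M.id1 (A' ⊗₀ B) ⊗₁ M.σ B' C) := by
    have e1 : M.id1 B ⊗₁ M.σ (A' ⊗₀ B') C = (M.id1 B ⊗₁ M.σ A' C ⊗₁ M.id1 B') ⬝₁
        (M.id1 (B ⊗₀ A') ⊗₁ M.σ B' C) := by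
      rw [hexagon', ← t_id1 B, t1_assoc, ← t_c (g := M.id1 B) (f := M.id1 B)] <;> simp
    have e2 : M.σ A' (B ⊗₀ C) ⊗₁ M.id1 B' = (M.id1 B ⊗₁ M.σ A' C ⊗₁ M.id1 B') ⬝₁
        (M.σ A' B ⊗₁ M.id1 (C ⊗₀ B')) := by
      rw [hexagon, ← t_id1 C, ← t1_assoc, ← t1_assoc (M.σ A' B),
        ← t_c (g' := M.id1 B') (f' := M.id1 B')] <;> simp
    rw [e1, e2, c_assoc, c_assoc,
      t_swap (f := M.σ A' B) (g := M.σ B' C) (A := A' ⊗₀ B) (B := B' ⊗₀ C)] <;> simp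
  have e1 : (M.id1 A ⊗₁ M.σ A' B ⊗₁ M.id1 B') ⊗₁ M.id1 (C ⊗₀ C') =
      M.id1 A ⊗₁ (M.σ A' B ⊗₁ M.id1 (B' ⊗₀ C)) ⊗₁ M.id1 C' := by
    simp only [t1_assoc, t_id1, t0_assoc]
  have e2 : M.id1 (A ⊗₀ B) ⊗₁ M.σ (A' ⊗₀ B') C ⊗₁ M.id1 C' =
      M.id1 A ⊗₁ (M.id1 B ⊗₁ M.σ (A' ⊗₀ B') C) ⊗₁ M.id1 C' := by
    rw [← t_id1, t1_assoc, t1_assoc]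
  have e3 : M.id1 (A ⊗₀ A') ⊗₁ (M.id1 B ⊗₁ M.σ B' C ⊗₁ M.id1 C') =
      M.id1 A ⊗₁ (M.id1 (A' ⊗₀ B) ⊗₁ M.σ B' C) ⊗₁ M.id1 C' := by
    rw [← t_id1 A, ← t_id1 A']; simp only [t1_assoc]
  have e4 : M.id1 A ⊗₁ M.σ A' (B ⊗₀ C) ⊗₁ M.id1 (B' ⊗₀ C') =
      M.id1 A ⊗₁ (M.σ A' (B ⊗₀ C) ⊗₁ M.id1 B') ⊗₁ M.id1 C' := by
    rw [t1_assoc, t_id1]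
  rw [e1, e2, e3, e4, ← t_c (g := M.id1 A) (f := M.id1 A),
    ← t_c (g := M.id1 A) (f := M.id1 A), ← t_c (g' := M.id1 C') (f' := M.id1 C'),
    ← t_c (g' := M.id1 C') (f' := M.id1 C'), core] <;> simp

theorem σ_middle (A B A' B' : M.C0) :
    M.σ (A ⊗₀ B) (A' ⊗₀ B') ⬝₁ (M.id1 A ⊗₁ M.σ A' B ⊗₁ M.id1 B') =
      (M.id1 A' ⊗₁ M.σ A B' ⊗₁ M.id1 B) ⬝₁ (M.σ A A' ⊗₁ M.σ B B') := by
  have e1 : (M.σ (A ⊗₀ B) A' ⊗₁ M.id1 B') ⬝₁ (M.id1 A ⊗₁ M.σ A' B ⊗₁ M.id1 B') =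
      M.σ A A' ⊗₁ M.id1 (B ⊗₀ B') := by
    have e : M.σ (A ⊗₀ B) A' ⬝₁ (M.id1 A ⊗₁ M.σ A' B) = M.σ A A' ⊗₁ M.id1 B := by
      rw [hexagon', c_assoc, ← t_c, σ_σ] <;> simp
    rw [← t1_assoc, ← t_c, e, id_c] <;> simp
  have e2 : M.id1 A' ⊗₁ M.σ (A ⊗₀ B) B' = (M.id1 A' ⊗₁ M.σ A B' ⊗₁ M.id1 B) ⬝₁
      (M.id1 (A' ⊗₀ A) ⊗₁ M.σ B B') := by
    rw [hexagon', ← t_id1 A' A, t1_assoc, ← t_c (g := M.id1 A') (f := M.id1 A')] <;> simp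
  rw [hexagon, c_assoc, e1, e2, c_assoc, ← t_c] <;> simp

end SymMonTwoCat

/-- The monoidal product `⊗ : M × M → M` is a lax functor, with the 1-cells
`1 ⊗ σ ⊗ 1 : (A ⊗ A') ⊗ (B ⊗ B') → (A ⊗ B) ⊗ (A' ⊗ B')`. -/
noncomputable def SymMonTwoCat.tensorLax (M : SymMonTwoCat.{u}) :
    LaxFunctor (M.toMonTwoCat.prod M.toMonTwoCat) M.toMonTwoCat where
  toTwoFunctor := M.tensor
  μ X Y := M.id1 X.1 ⊗₁ M.σ X.2 Y.1 ⊗₁ M.id1 Y.2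
  map_unit := M.unit_tensor0 _
  dom_μ X Y := by
    simp only [dom_t, M.dom_id1, dom_σ, t0_assoc]; change _ = (_ ⊗₀ _) ⊗₀ (_ ⊗₀ _); simp
  cod_μ X Y := by
    simp only [cod_t, M.cod_id1, cod_σ, t0_assoc]; change _ = (_ ⊗₀ _) ⊗₀ (_ ⊗₀ _); simp
  μ_nat1 f g := by
    change ((f.1 ⊗₁ g.1) ⊗₁ (f.2 ⊗₁ g.2)) ⬝₁
      (M.id1 (M.dom f.1) ⊗₁ M.σ (M.dom f.2) (M.dom g.1) ⊗₁ M.id1 (M.dom g.2)) =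
      (M.id1 (M.cod f.1) ⊗₁ M.σ (M.cod f.2) (M.cod g.1) ⊗₁ M.id1 (M.cod g.2)) ⬝₁
      ((f.1 ⊗₁ f.2) ⊗₁ (g.1 ⊗₁ g.2))
    have e1 := M.σ_nat1 (f := f.2) (g := g.1) rfl rfl rfl rfl
    rw [t1_assoc, t1_assoc, ← t1_assoc g.1, ← t1_assoc f.2, ← t_c, ← t_c, ← t_c, ← t_c, e1]
    all_goals clear e1
    all_goals simp
  μ_nat2 f g := by
    change ((f.1 ⊗₂ g.1) ⊗₂ (f.2 ⊗₂ g.2)) ⬝ₕ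
      𝟏(M.id1 (M.dom (M.src f.1)) ⊗₁ M.σ (M.dom (M.src f.2)) (M.dom (M.src g.1)) ⊗₁
        M.id1 (M.dom (M.src g.2))) =
      𝟏(M.id1 (M.cod (M.src f.1)) ⊗₁ M.σ (M.cod (M.src f.2)) (M.cod (M.src g.1)) ⊗₁
        M.id1 (M.cod (M.src g.2))) ⬝ₕ
      ((f.1 ⊗₂ f.2) ⊗₂ (g.1 ⊗₂ g.2))
    have e1 := M.σ_nat2 (a := f.2) (b := g.1) rfl rfl rfl rfl
    rw [t2_assoc, t2_assoc, ← t2_assoc g.1, ← t2_assoc f.2, ← t_id2, ← t_id2, ← t_id2, ← t_id2,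
      ← t_hc, ← t_hc, ← t_hc, ← t_hc, e1]
    all_goals clear e1
    all_goals simp
  μ_assoc X Y Z := by
    change (M.id1 (X.1 ⊗₀ Y.1) ⊗₁ M.σ (X.2 ⊗₀ Y.2) Z.1 ⊗₁ M.id1 Z.2) ⬝₁
        ((M.id1 X.1 ⊗₁ M.σ X.2 Y.1 ⊗₁ M.id1 Y.2) ⊗₁ M.id1 (Z.1 ⊗₀ Z.2)) =
      (M.id1 X.1 ⊗₁ M.σ X.2 (Y.1 ⊗₀ Z.1) ⊗₁ M.id1 (Y.2 ⊗₀ Z.2)) ⬝₁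
        (M.id1 (X.1 ⊗₀ X.2) ⊗₁ (M.id1 Y.1 ⊗₁ M.σ Y.2 Z.1 ⊗₁ M.id1 Z.2))
    exact M.middle_coherence X.1 X.2 Y.1 Y.2 Z.1 Z.2
  μ_unit_left A := by
    change M.id1 M.unit ⊗₁ M.σ M.unit A.1 ⊗₁ M.id1 A.2 = M.id1 (A.1 ⊗₀ A.2)
    simp
  μ_unit_right A := by
    change M.id1 A.1 ⊗₁ M.σ A.2 M.unit ⊗₁ M.id1 M.unit = M.id1 (A.1 ⊗₀ A.2)
    simp

end TwoDim

namespace TwoDim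

open TwoCat MonTwoCat

theorem TwoFunctor.opm_ext {C : TwoCat.{u}} {N : MonTwoCat.{u}} {P Q : TwoFunctor C N.opm}
    (h0 : ∀ A, (P.map0 A).data = (Q.map0 A).data) (h1 : ∀ f, (P.map1 f).data = (Q.map1 f).data)
    (h2 : ∀ a, (P.map2 a).ω = (Q.map2 a).ω) : P = Q := by
  have e0 : P.map0 = Q.map0 := funext fun A => Pseudomonoid.ext (h0 A)
  have e1 : P.map1 = Q.map1 := funext fun f => Opmonoidal1.ext
    ((P.dom_map f).trans ((congrFun e0 _).trans (Q.dom_map f).symm))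
    ((P.cod_map f).trans ((congrFun e0 _).trans (Q.cod_map f).symm)) (h1 f)
  have e2 : P.map2 = Q.map2 := funext fun a => Opmonoidal2.ext
    ((P.src_map a).trans ((congrFun e1 _).trans (Q.src_map a).symm))
    ((P.tgt_map a).trans ((congrFun e1 _).trans (Q.tgt_map a).symm)) (h2 a)
  exact TwoFunctor.ext e0 e1 e2

section

variable {M N K : MonTwoCat.{u}}

/-- The identity lax functor. -/
def LaxFunctor.id (M : MonTwoCat.{u}) : LaxFunctor M M :=
  LaxFunctor.ofStrict (TwoFunctor.id M.toTwoCat) ⟨rfl, fun _ _ => rfl, fun _ _ => rfl,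
    fun _ _ => rfl⟩

theorem LaxFunctor.id_psm {d : PsmData M.toTwoCat} (hd : IsPseudomonoid M d) :
    (LaxFunctor.id M).psm d = d := LaxFunctor.ofStrict_psm _ _ hd

theorem LaxFunctor.id_cell {d d' : PsmData M.toTwoCat} {c : CellData M.toTwoCat}
    (hd : IsPseudomonoid M d) (hc : IsOpmonoidal1 M d d' c) :
    (LaxFunctor.id M).cell c = c := LaxFunctor.ofStrict_cell _ _ hd hc

/-- The 2-functor `(M × N) × K → M × (N × K)`. -/
def assocFunctor (M N K : TwoCat.{u}) :
    TwoFunctor ((M.prod N).prod K) (M.prod (N.prod K)) where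
  map0 A := (A.1.1, A.1.2, A.2)
  map1 f := (f.1.1, f.1.2, f.2)
  map2 a := (a.1.1, a.1.2, a.2)
  dom_map _ := rfl
  cod_map _ := rfl
  src_map _ := rfl
  tgt_map _ := rfl
  map_id1 _ := rfl
  map_id2 _ := rfl
  map_comp _ _ _ := rfl
  map_vcomp _ _ _ := rfl
  map_hcomp _ _ _ := rfl

/-- The lax functor `(M × N) × K → M × (N × K)`. -/
def assocLax (M N K : MonTwoCat.{u}) : LaxFunctor ((M.prod N).prod K) (M.prod (N.prod K)) :=
  LaxFunctor.ofStrict (assocFunctor _ _ _) ⟨rfl, fun _ _ => rfl, fun _ _ => rfl, fun _ _ => rfl⟩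

theorem assoc_psm {d : PsmData M.toTwoCat} {e : PsmData N.toTwoCat} {k : PsmData K.toTwoCat}
    (hd : IsPseudomonoid M d) (he : IsPseudomonoid N e) (hk : IsPseudomonoid K k) :
    (assocLax M N K).psm ((d.pair e).pair k) = d.pair (e.pair k) :=
  LaxFunctor.ofStrict_psm _ _ ((hd.pair he).pair hk)

/-- The lax functor `flip`. -/
def flipLax (M : MonTwoCat.{u}) : LaxFunctor (M.prod M) (M.prod M) :=
  LaxFunctor.ofStrict (M.toTwoCat.flip) ⟨rfl, fun _ _ => rfl, fun _ _ => rfl, fun _ _ => rfl⟩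

end

namespace SymMonTwoCat

variable {M : SymMonTwoCat.{u}}

theorem tensorLax_assoc : M.tensorLax.comp (M.tensorLax.prod (LaxFunctor.id M.toMonTwoCat)) =
    (M.tensorLax.comp ((LaxFunctor.id M.toMonTwoCat).prod M.tensorLax)).comp
      (assocLax M.toMonTwoCat M.toMonTwoCat M.toMonTwoCat) := by
  refine LaxFunctor.ext' ?_ ?_ ?_ ?_
  · funext A; exact t0_assoc _ _ _
  · funext A; exact t1_assoc _ _ _
  · funext A; exact t2_assoc _ _ _
  · funext ⟨⟨A, B⟩, C⟩ ⟨⟨A', B'⟩, C'⟩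
    change ((M.id1 A ⊗₁ M.σ B A' ⊗₁ M.id1 B') ⊗₁ M.id1 (C ⊗₀ C')) ⬝₁
        (M.id1 (A ⊗₀ B) ⊗₁ M.σ C (A' ⊗₀ B') ⊗₁ M.id1 C') =
      (M.tensor.map1 (M.id1 (A ⊗₀ A'), M.tensor.map1 (M.id1 (B ⊗₀ B'), M.id1 (C ⊗₀ C')))) ⬝₁
      ((M.id1 (A ⊗₀ A') ⊗₁ (M.id1 B ⊗₁ M.σ C B' ⊗₁ M.id1 C')) ⬝₁
        (M.id1 A ⊗₁ M.σ (B ⊗₀ C) A' ⊗₁ M.id1 (B' ⊗₀ C')))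
    change _ = ((M.id1 (A ⊗₀ A') ⊗₁ (M.id1 (B ⊗₀ B') ⊗₁ M.id1 (C ⊗₀ C')))) ⬝₁ _
    have e := M.middle_assoc A B C A' B' C'
    have e1 : (M.id1 A ⊗₁ M.σ B A' ⊗₁ M.id1 B') ⊗₁ M.id1 (C ⊗₀ C') =
        M.id1 A ⊗₁ M.σ B A' ⊗₁ M.id1 (B' ⊗₀ C ⊗₀ C') := by simp only [t1_assoc, t_id1]
    have e2 : M.id1 (A ⊗₀ A') ⊗₁ (M.id1 B ⊗₁ M.σ C B' ⊗₁ M.id1 C') =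
        M.id1 (A ⊗₀ A' ⊗₀ B) ⊗₁ M.σ C B' ⊗₁ M.id1 C' := by
      simp only [← t1_assoc, t_id1, t0_assoc]
    rw [e1, e, e2, t_id1, t_id1, id_c]
    simp

theorem tensor_psm_assoc {d e k : PsmData M.toTwoCat} (hd : IsPseudomonoid M.toMonTwoCat d)
    (he : IsPseudomonoid M.toMonTwoCat e) (hk : IsPseudomonoid M.toMonTwoCat k) :
    M.tensorLax.psm ((M.tensorLax.psm (d.pair e)).pair k) =
      M.tensorLax.psm (d.pair (M.tensorLax.psm (e.pair k))) := by
  have h := congrArg (fun F => F.psm ((d.pair e).pair k)) M.tensorLax_assoc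
  rw [LaxFunctor.comp_psm _ _ ((hd.pair he).pair hk), LaxFunctor.prod_psm _ _ (hd.pair he) hk,
    LaxFunctor.id_psm hk, LaxFunctor.comp_psm _ _ ((hd.pair he).pair hk), assoc_psm hd he hk,
    LaxFunctor.comp_psm _ _ (hd.pair (he.pair hk)), LaxFunctor.prod_psm _ _ hd (he.pair hk),
    LaxFunctor.id_psm hd] at h
  exact h

theorem tensor_cell_assoc {d e k d' e' k' : PsmData M.toTwoCat} {x y z : CellData M.toTwoCat}
    (hd : IsPseudomonoid M.toMonTwoCat d)
    (he : IsPseudomonoid M.toMonTwoCat e) (hk : IsPseudomonoid M.toMonTwoCat k)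
    (hd' : IsPseudomonoid M.toMonTwoCat d')
    (he' : IsPseudomonoid M.toMonTwoCat e') (hk' : IsPseudomonoid M.toMonTwoCat k')
    (hx : IsOpmonoidal1 M.toMonTwoCat d d' x) (hy : IsOpmonoidal1 M.toMonTwoCat e e' y)
    (hz : IsOpmonoidal1 M.toMonTwoCat k k' z) :
    M.tensorLax.cell ((M.tensorLax.cell (x.pair y)).pair z) =
      M.tensorLax.cell (x.pair (M.tensorLax.cell (y.pair z))) := by
  have h := congrArg (fun F => F.cell ((x.pair y).pair z)) M.tensorLax_assoc
  have hxy := IsOpmonoidal1.pair hd hd' he he' hx hy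
  have hyz := IsOpmonoidal1.pair he he' hk hk' hy hz
  have h1 := IsOpmonoidal1.pair (hd.pair he) (hd'.pair he') hk hk' hxy hz
  have h2 := IsOpmonoidal1.pair hd hd' (he.pair hk) (he'.pair hk') hx hyz
  rw [LaxFunctor.comp_cell _ _ ((hd.pair he).pair hk) h1,
    LaxFunctor.prod_cell _ _ (hd.pair he) hk hxy hz,
    LaxFunctor.id_cell hk hz, LaxFunctor.comp_cell _ _ ((hd.pair he).pair hk) h1,
    show (assocLax M.toMonTwoCat M.toMonTwoCat M.toMonTwoCat).cell ((x.pair y).pair z) =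
      x.pair (y.pair z) from LaxFunctor.ofStrict_cell _ _ ((hd.pair he).pair hk) h1,
    LaxFunctor.comp_cell _ _ (hd.pair (he.pair hk)) h2,
    LaxFunctor.prod_cell _ _ hd (he.pair hk) hx hyz,
    LaxFunctor.id_cell hd hx] at h
  exact h

/-- The monoidal product of pseudomonoids, on the level of data:
`(A A', m m' ∘ 1 σ 1, u u', …)`. -/
noncomputable def tensorPsm (M : SymMonTwoCat.{u}) (d e : PsmData M.toTwoCat) :
    PsmData M.toTwoCat := M.tensorLax.psm (d.pair e)

/-- The monoidal product of opmonoidal 1-cells, on the level of data: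
`(f g, φ² γ² ∘ 1 σ 1, φ⁰ γ⁰)`. -/
noncomputable def tensorCell (M : SymMonTwoCat.{u}) (x y : CellData M.toTwoCat) :
    CellData M.toTwoCat := M.tensorLax.cell (x.pair y)

/-- The unit pseudomonoid `(I, 1, 1, 1, 1, 1)`, on the level of data. -/
def unitPsm (M : MonTwoCat.{u}) : PsmData M.toTwoCat where
  A := M.unit
  m := M.id1 M.unit
  u := M.id1 M.unit
  α := M.id2 (M.id1 M.unit)
  lam := M.id2 (M.id1 M.unit)
  rho := M.id2 (M.id1 M.unit)

theorem id2_inv {M : TwoCat.{u}} (f : M.C1) : IsInvertible (M := M) (𝟏f) :=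
  ⟨𝟏f, by simp, by simp, by simp, by simp⟩

theorem unitPsm_law (M : MonTwoCat.{u}) : IsPseudomonoid M (unitPsm M) := by
  refine ⟨?_, ?_, ?_, ?_, ?_, ?_, ?_, ?_, ?_, ?_, id2_inv _, id2_inv _, id2_inv _, ?_, ?_⟩ <;>
    simp [unitPsm]

theorem tensorPsm_unit_left {d : PsmData M.toTwoCat} (hd : IsPseudomonoid M.toMonTwoCat d) :
    M.tensorPsm (unitPsm M.toMonTwoCat) d = d := by
  obtain ⟨dm, cm, du, cu, sα, -⟩ := hd
  refine PsmData.ext ?_ ?_ ?_ ?_ ?_ ?_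
  · exact unit_t0 _
  · change (M.id1 M.unit ⊗₁ d.m) ⬝₁ (M.id1 M.unit ⊗₁ M.σ d.A M.unit ⊗₁ M.id1 d.A) = d.m
    simp [*]
  · exact unit_t1 _
  · change (𝟏(M.id1 M.unit) ⊗₂ d.α) ⬝ₕ
      𝟏((M.id1 (M.unit ⊗₀ M.unit) ⊗₁ M.σ (d.A ⊗₀ d.A) M.unit ⊗₁ M.id1 d.A) ⬝₁
      ((M.id1 M.unit ⊗₁ M.σ d.A M.unit ⊗₁ M.id1 d.A) ⊗₁ M.id1 (M.unit ⊗₀ d.A))) = d.α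
    simp [*]
  · exact unit_t2 _
  · exact unit_t2 _

theorem tensorPsm_unit_right {d : PsmData M.toTwoCat} (hd : IsPseudomonoid M.toMonTwoCat d) :
    M.tensorPsm d (unitPsm M.toMonTwoCat) = d := by
  obtain ⟨dm, cm, du, cu, sα, -⟩ := hd
  refine PsmData.ext ?_ ?_ ?_ ?_ ?_ ?_
  · exact t0_unit _
  · change (d.m ⊗₁ M.id1 M.unit) ⬝₁ (M.id1 d.A ⊗₁ M.σ M.unit d.A ⊗₁ M.id1 M.unit) = d.m
    simp [*]
  · exact t1_unit _
  · change (d.α ⊗₂ 𝟏(M.id1 M.unit)) ⬝ₕ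
      𝟏((M.id1 (d.A ⊗₀ d.A) ⊗₁ M.σ (M.unit ⊗₀ M.unit) d.A ⊗₁ M.id1 M.unit) ⬝₁
      ((M.id1 d.A ⊗₁ M.σ M.unit d.A ⊗₁ M.id1 M.unit) ⊗₁ M.id1 (d.A ⊗₀ M.unit))) = d.α
    simp [*]
  · exact t2_unit _
  · exact t2_unit _

theorem tensorCell_unit_left {d d' : PsmData M.toTwoCat} {c : CellData M.toTwoCat}
    (hd : IsPseudomonoid M.toMonTwoCat d) (hc : IsOpmonoidal1 M.toMonTwoCat d d' c) :
    M.tensorCell (unitPsm M.toMonTwoCat).idCell c = c := by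
  obtain ⟨dm, cm, -⟩ := hd
  obtain ⟨df, cf, s2, -⟩ := hc
  refine CellData.ext ?_ ?_ ?_
  · exact unit_t1 _
  · change (𝟏(M.id1 M.unit) ⊗₂ c.φ2) ⬝ₕ 𝟏(M.id1 (M.dom (M.id1 M.unit)) ⊗₁
      M.σ (M.dom c.f) (M.dom (M.id1 M.unit)) ⊗₁ M.id1 (M.dom c.f)) = _
    simp [*]
  · exact unit_t2 _

theorem tensorCell_unit_right {d d' : PsmData M.toTwoCat} {c : CellData M.toTwoCat}
    (hd : IsPseudomonoid M.toMonTwoCat d) (hc : IsOpmonoidal1 M.toMonTwoCat d d' c) :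
    M.tensorCell c (unitPsm M.toMonTwoCat).idCell = c := by
  obtain ⟨dm, cm, -⟩ := hd
  obtain ⟨df, cf, s2, -⟩ := hc
  refine CellData.ext ?_ ?_ ?_
  · exact t1_unit _
  · change (c.φ2 ⊗₂ 𝟏(M.id1 M.unit)) ⬝ₕ 𝟏(M.id1 (M.dom c.f) ⊗₁
      M.σ (M.dom (M.id1 M.unit)) (M.dom c.f) ⊗₁ M.id1 (M.dom (M.id1 M.unit))) = _
    simp [*]
  · exact t2_unit _

/-- The monoidal product 2-functor of `M₀₁`. -/
noncomputable def opmTensor (M : SymMonTwoCat.{u}) :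
    TwoFunctor (M.toMonTwoCat.opm.prod M.toMonTwoCat.opm) M.toMonTwoCat.opm :=
  M.tensorLax.opm.comp (opmPair M.toMonTwoCat M.toMonTwoCat)

/-- The strict monoidal 2-category `M₀₁`. -/
noncomputable def opmMon (M : SymMonTwoCat.{u}) : MonTwoCat.{u} where
  toTwoCat := M.toMonTwoCat.opm
  unit := ⟨unitPsm M.toMonTwoCat, unitPsm_law M.toMonTwoCat⟩
  tensor := M.opmTensor
  assoc0 A B C := Pseudomonoid.ext (tensor_psm_assoc A.law B.law C.law)
  assoc1 f g k := Opmonoidal1.ext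
    (Pseudomonoid.ext (tensor_psm_assoc f.dom.law g.dom.law k.dom.law))
    (Pseudomonoid.ext (tensor_psm_assoc f.cod.law g.cod.law k.cod.law))
    (tensor_cell_assoc f.dom.law g.dom.law k.dom.law f.cod.law g.cod.law k.cod.law
      f.law g.law k.law)
  assoc2 f g k := Opmonoidal2.ext
    (Opmonoidal1.ext
      (Pseudomonoid.ext (tensor_psm_assoc f.src.dom.law g.src.dom.law k.src.dom.law))
      (Pseudomonoid.ext (tensor_psm_assoc f.src.cod.law g.src.cod.law k.src.cod.law))
      (tensor_cell_assoc f.src.dom.law g.src.dom.law k.src.dom.law f.src.cod.law g.src.cod.law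
        k.src.cod.law f.src.law g.src.law k.src.law))
    (Opmonoidal1.ext
      (Pseudomonoid.ext (tensor_psm_assoc f.tgt.dom.law g.tgt.dom.law k.tgt.dom.law))
      (Pseudomonoid.ext (tensor_psm_assoc f.tgt.cod.law g.tgt.cod.law k.tgt.cod.law))
      (tensor_cell_assoc f.tgt.dom.law g.tgt.dom.law k.tgt.dom.law f.tgt.cod.law g.tgt.cod.law
        k.tgt.cod.law f.tgt.law g.tgt.law k.tgt.law))
    (t2_assoc _ _ _)
  unit_tensor0 A := Pseudomonoid.ext (tensorPsm_unit_left A.law)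
  unit_tensor1 f := Opmonoidal1.ext (Pseudomonoid.ext (tensorPsm_unit_left f.dom.law))
    (Pseudomonoid.ext (tensorPsm_unit_left f.cod.law)) (tensorCell_unit_left f.dom.law f.law)
  unit_tensor2 a := Opmonoidal2.ext
    (Opmonoidal1.ext (Pseudomonoid.ext (tensorPsm_unit_left a.src.dom.law))
      (Pseudomonoid.ext (tensorPsm_unit_left a.src.cod.law))
      (tensorCell_unit_left a.src.dom.law a.src.law))
    (Opmonoidal1.ext (Pseudomonoid.ext (tensorPsm_unit_left a.tgt.dom.law))
      (Pseudomonoid.ext (tensorPsm_unit_left a.tgt.cod.law))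
      (tensorCell_unit_left a.tgt.dom.law a.tgt.law))
    (unit_t2 _)
  tensor_unit0 A := Pseudomonoid.ext (tensorPsm_unit_right A.law)
  tensor_unit1 f := Opmonoidal1.ext (Pseudomonoid.ext (tensorPsm_unit_right f.dom.law))
    (Pseudomonoid.ext (tensorPsm_unit_right f.cod.law)) (tensorCell_unit_right f.dom.law f.law)
  tensor_unit2 a := Opmonoidal2.ext
    (Opmonoidal1.ext (Pseudomonoid.ext (tensorPsm_unit_right a.src.dom.law))
      (Pseudomonoid.ext (tensorPsm_unit_right a.src.cod.law))
      (tensorCell_unit_right a.src.dom.law a.src.law))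
    (Opmonoidal1.ext (Pseudomonoid.ext (tensorPsm_unit_right a.tgt.dom.law))
      (Pseudomonoid.ext (tensorPsm_unit_right a.tgt.cod.law))
      (tensorCell_unit_right a.tgt.dom.law a.tgt.law))
    (t2_unit _)

end SymMonTwoCat

end TwoDim

namespace TwoDim

open TwoCat MonTwoCat

theorem IsTwoNat.whisker {L M N : TwoCat.{u}} {F G : TwoFunctor M N} {app : M.C0 → N.C1}
    (h : IsTwoNat F G app) (H : TwoFunctor L M) :
    IsTwoNat (F.comp H) (G.comp H) fun A => app (H.map0 A) where
  dom_app A := h.dom_app _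
  cod_app A := h.cod_app _
  nat1 f := by
    have e : ∀ A B (hA : M.cod (H.map1 f) = A) (hB : M.dom (H.map1 f) = B) h₁ h₂,
        N.comp (app A) (F.map1 (H.map1 f)) h₁ = N.comp (G.map1 (H.map1 f)) (app B) h₂ := by
      rintro _ _ rfl rfl _ _
      exact h.nat1 _
    exact e _ _ (H.cod_map f) (H.dom_map f) _ _
  nat2 a := by
    have e : ∀ A B (hA : M.cod (M.src (H.map2 a)) = A) (hB : M.dom (M.src (H.map2 a)) = B) h₁ h₂,
        N.hcomp (N.id2 (app A)) (F.map2 (H.map2 a)) h₁ =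
          N.hcomp (G.map2 (H.map2 a)) (N.id2 (app B)) h₂ := by
      rintro _ _ rfl rfl _ _
      exact h.nat2 _
    exact e _ _ (by simp) (by simp) _ _

namespace SymMonTwoCat

variable {M : SymMonTwoCat.{u}}

theorem flip_psm {N : MonTwoCat.{u}} {d e : PsmData N.toTwoCat} (hd : IsPseudomonoid N d)
    (he : IsPseudomonoid N e) : (flipLax N).psm (d.pair e) = e.pair d :=
  LaxFunctor.ofStrict_psm _ _ (hd.pair he)

theorem flip_cell {N : MonTwoCat.{u}} {d e d' e' : PsmData N.toTwoCat} {x y : CellData N.toTwoCat}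
    (hd : IsPseudomonoid N d) (he : IsPseudomonoid N e) (hd' : IsPseudomonoid N d')
    (he' : IsPseudomonoid N e') (hx : IsOpmonoidal1 N d d' x) (hy : IsOpmonoidal1 N e e' y) :
    (flipLax N).cell (x.pair y) = y.pair x :=
  LaxFunctor.ofStrict_cell _ _ (hd.pair he) (IsOpmonoidal1.pair hd hd' he he' hx hy)

theorem σ_lax (M : SymMonTwoCat.{u}) :
    IsLaxMonNat M.tensorLax (M.tensorLax.comp (flipLax M.toMonTwoCat))
      (fun A => M.σ A.1 A.2) where
  isTwoNat := M.isSymmetry.isTwoNat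
  tensor X Y := by
    have e := M.σ_middle X.1 Y.1 X.2 Y.2
    refine e.trans ?_
    change _ = (M.tensor.map1 (M.id1 (X.2 ⊗₀ Y.2), M.id1 (X.1 ⊗₀ Y.1)) ⬝₁
      (M.id1 X.2 ⊗₁ M.σ X.1 Y.2 ⊗₁ M.id1 Y.1)) ⬝₁ (M.σ X.1 X.2 ⊗₁ M.σ Y.1 Y.2)
    change _ = ((M.id1 (X.2 ⊗₀ Y.2) ⊗₁ M.id1 (X.1 ⊗₀ Y.1)) ⬝₁ _) ⬝₁ _
    rw [t_id1, id_c]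
    simp
  unit := (M.σ_unit_left _)

/-- The symmetry `(σ, 1, 1)` of `M₀₁`. -/
noncomputable def opmσ (M : SymMonTwoCat.{u}) (A B : Pseudomonoid M.toMonTwoCat) :
    Opmonoidal1 M.toMonTwoCat :=
  M.σ_lax.opmApp ⟨A.data.pair B.data, A.law.pair B.law⟩

theorem comp_flip_psm {d e : PsmData M.toTwoCat} (hd : IsPseudomonoid M.toMonTwoCat d)
    (he : IsPseudomonoid M.toMonTwoCat e) :
    (M.tensorLax.comp (flipLax M.toMonTwoCat)).psm (d.pair e) = M.tensorPsm e d := by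
  rw [LaxFunctor.comp_psm _ _ (hd.pair he), flip_psm hd he]; rfl

theorem opm_flip : (M.tensorLax.comp (flipLax M.toMonTwoCat)).opm.comp
    (opmPair M.toMonTwoCat M.toMonTwoCat) = M.opmTensor.comp (TwoCat.flip _) := by
  refine TwoFunctor.opm_ext ?_ ?_ ?_
  · rintro ⟨A, B⟩
    exact comp_flip_psm A.law B.law
  · rintro ⟨f, g⟩
    refine (LaxFunctor.comp_cell _ _ (f.dom.law.pair g.dom.law) (IsOpmonoidal1.pair f.dom.law
      f.cod.law g.dom.law g.cod.law f.law g.law)).trans ?_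
    rw [flip_cell f.dom.law g.dom.law f.cod.law g.cod.law f.law g.law]
    rfl
  · rintro ⟨a, b⟩
    rfl

theorem opmσ_cod (A B : Pseudomonoid M.toMonTwoCat) :
    (M.opmσ A B).cod.data = M.tensorPsm B.data A.data := comp_flip_psm A.law B.law

theorem tensorCell_strict {d e : PsmData M.toTwoCat} {f g : M.C1}
    (hd : IsPseudomonoid M.toMonTwoCat d) (he : IsPseudomonoid M.toMonTwoCat e)
    (hf : M.dom f = d.A) (hg : M.dom g = e.A) :
    M.tensorCell (d.strictCell f) (e.strictCell g) = (M.tensorPsm d e).strictCell (f ⊗₁ g) := by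
  obtain ⟨dm, cm, du, cu, -⟩ := hd
  obtain ⟨dm', cm', du', cu', -⟩ := he
  refine CellData.ext rfl ?_ ?_
  · change (𝟏(f ⬝₁ d.m) ⊗₂ 𝟏(g ⬝₁ e.m)) ⬝ₕ
      𝟏(M.id1 (M.dom f) ⊗₁ M.σ (M.dom g) (M.dom f) ⊗₁ M.id1 (M.dom g)) =
      𝟏((f ⊗₁ g) ⬝₁ (d.m ⊗₁ e.m) ⬝₁ (M.id1 d.A ⊗₁ M.σ e.A d.A ⊗₁ M.id1 e.A))
    rw [t_id2, hc_id_id, hf, hg, t_c, c_assoc] <;> simp [*]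
  · change 𝟏(f ⬝₁ d.u) ⊗₂ 𝟏(g ⬝₁ e.u) = 𝟏((f ⊗₁ g) ⬝₁ (d.u ⊗₁ e.u))
    rw [t_id2, t_c] <;> simp [*]

theorem strictCell_id {d : PsmData M.toTwoCat} (hd : IsPseudomonoid M.toMonTwoCat d) :
    d.strictCell (M.id1 d.A) = d.idCell :=
  CellData.ext rfl (congrArg M.id2 (id_c hd.cod_m)) (congrArg M.id2 (id_c hd.cod_u))

theorem opmσ_isSymmetry (M : SymMonTwoCat.{u}) : IsSymmetry M.opmMon M.opmσ where
  isTwoNat := by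
    have h := M.σ_lax.opm.whisker (opmPair M.toMonTwoCat M.toMonTwoCat)
    rw [opm_flip] at h
    exact h
  σ_σ A B := by
    have hc : (M.opmσ A B).cod = (M.opmσ B A).dom := Pseudomonoid.ext (opmσ_cod A B)
    refine (c_def (M := M.opmMon.toTwoCat) (f := M.opmσ A B) (g := M.opmσ B A) hc).trans ?_
    refine Opmonoidal1.ext rfl (Pseudomonoid.ext (opmσ_cod B A)) ?_
    have h := (M.opmσ A B).law
    have h' := (M.opmσ B A).law
    rw [hc] at h
    refine (strictCell_comp (M.opmσ A B).dom.law (M.opmσ B A).dom.law h h').trans ?_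
    change (M.tensorPsm A.data B.data).strictCell (M.σ B.data.A A.data.A ⬝₁ M.σ A.data.A B.data.A)
      = (M.tensorPsm A.data B.data).idCell
    have hl := (M.opmσ A B).dom.law
    change IsPseudomonoid M.toMonTwoCat (M.tensorPsm A.data B.data) at hl
    rw [σ_σ]
    refine CellData.ext rfl ?_ ?_
    · exact congrArg M.id2 (id_c hl.cod_m)
    · exact congrArg M.id2 (id_c hl.cod_u)
  hexagon A B C := by
    let f1 : Opmonoidal1 M.toMonTwoCat := MonTwoCat.t1 M.opmMon (M.opmMon.id1 B) (M.opmσ A C)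
    let f2 : Opmonoidal1 M.toMonTwoCat := MonTwoCat.t1 M.opmMon (M.opmσ A B) (M.opmMon.id1 C)
    have h1 : f1.data = (M.tensorPsm B.data (M.tensorPsm A.data C.data)).strictCell
        (M.id1 B.data.A ⊗₁ M.σ A.data.A C.data.A) := by
      refine Eq.trans ?_ (tensorCell_strict B.law (M.opmσ A C).dom.law (M.dom_id1 _) (M.dom_σ _ _))
      rw [strictCell_id B.law]
      rfl
    have h2 : f2.data = (M.tensorPsm (M.tensorPsm A.data B.data) C.data).strictCell
        (M.σ A.data.A B.data.A ⊗₁ M.id1 C.data.A) := by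
      refine Eq.trans ?_ (tensorCell_strict (M.opmσ A B).dom.law C.law (M.dom_σ _ _) (M.dom_id1 _))
      rw [strictCell_id C.law]
      rfl
    have hc : f2.cod = f1.dom := by
      refine Pseudomonoid.ext ?_
      refine Eq.trans (congrArg (fun X => M.tensorPsm X C.data) (opmσ_cod A B)) ?_
      exact tensor_psm_assoc B.law A.law C.law
    refine Eq.trans ?_ (c_def (M := M.opmMon.toTwoCat) (f := f2) (g := f1) hc).symm
    have l1 := f1.law
    have l2 := f2.law
    rw [hc, h2] at l2
    rw [h1] at l1
    refine Opmonoidal1.ext (Pseudomonoid.ext (tensor_psm_assoc A.law B.law C.law).symm)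
      (Pseudomonoid.ext ?_) ?_
    · refine (opmσ_cod A (M.opmMon.t0 B C)).trans ?_
      refine (tensor_psm_assoc B.law C.law A.law).trans ?_
      exact congrArg (fun X => M.tensorPsm B.data X) (opmσ_cod A C).symm
    · change (M.tensorPsm A.data (M.tensorPsm B.data C.data)).strictCell
        (M.σ A.data.A (B.data.A ⊗₀ C.data.A)) = f1.data.opComp f2.data
      rw [h1, h2]
      refine Eq.trans ?_ (strictCell_comp f2.dom.law f1.dom.law l2 l1).symm
      rw [hexagon]
      exact congrArg (fun X => PsmData.strictCell X _) (tensor_psm_assoc A.law B.law C.law).symm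

/-- The symmetric strict monoidal 2-category `M₀₁`. -/
noncomputable def opmSym (M : SymMonTwoCat.{u}) : SymMonTwoCat.{u} where
  toMonTwoCat := M.opmMon
  σ := M.opmσ
  isSymmetry := M.opmσ_isSymmetry

end SymMonTwoCat

end TwoDim

namespace TwoDim

open TwoCat MonTwoCat

/-- A symmetric strict monoidal 2-functor. -/
structure SymFunctor (M N : SymMonTwoCat.{u}) extends TwoFunctor M.toTwoCat N.toTwoCat where
  isStrict : IsStrictMonoidal (M := M.toMonTwoCat) (N := N.toMonTwoCat) toTwoFunctor
  map_σ : ∀ A B, map1 (M.σ A B) = N.σ (map0 A) (map0 B)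

theorem SymFunctor.ext' {M N : SymMonTwoCat.{u}} {F G : SymFunctor M N}
    (h : F.toTwoFunctor = G.toTwoFunctor) : F = G := by
  cases F; cases G; cases h; rfl

/-- The identity symmetric strict monoidal 2-functor. -/
def SymFunctor.id (M : SymMonTwoCat.{u}) : SymFunctor M M where
  toTwoFunctor := TwoFunctor.id M.toTwoCat
  isStrict := ⟨rfl, fun _ _ => rfl, fun _ _ => rfl, fun _ _ => rfl⟩
  map_σ _ _ := rfl

/-- The composite of symmetric strict monoidal 2-functors (first `F`, then `G`). -/
def SymFunctor.comp {M N K : SymMonTwoCat.{u}} (G : SymFunctor N K) (F : SymFunctor M N) :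
    SymFunctor M K where
  toTwoFunctor := G.toTwoFunctor.comp F.toTwoFunctor
  isStrict :=
    { map_unit := (congrArg G.map0 F.isStrict.map_unit).trans G.isStrict.map_unit
      map_t0 := fun A B => (congrArg G.map0 (F.isStrict.map_t0 A B)).trans
        (G.isStrict.map_t0 _ _)
      map_t1 := fun A B => (congrArg G.map1 (F.isStrict.map_t1 A B)).trans
        (G.isStrict.map_t1 _ _)
      map_t2 := fun A B => (congrArg G.map2 (F.isStrict.map_t2 A B)).trans
        (G.isStrict.map_t2 _ _) }
  map_σ A B := (congrArg G.map1 (F.map_σ A B)).trans (G.map_σ _ _)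

/-- The condition that `app` is a monoidal 2-natural transformation from `F` to `G`. -/
structure IsMonNat {M N : SymMonTwoCat.{u}} (F G : SymFunctor M N) (app : M.C0 → N.C1) :
    Prop where
  isTwoNat : IsTwoNat F.toTwoFunctor G.toTwoFunctor app
  tensor : ∀ A B, app (A ⊗₀ B) = app A ⊗₁ app B
  unit : app M.unit = N.id1 N.unit

theorem IsMonNat.interchange_aux {M N L : SymMonTwoCat.{u}} {F G H : SymFunctor M N}
    {P Q R : SymFunctor N L} {a a' : M.C0 → N.C1} {b b' : N.C0 → L.C1} (pa : IsMonNat F G a)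
    (pa' : IsMonNat G H a') (pb : IsMonNat P Q b) (pb' : IsMonNat Q R b') (A : M.C0) :
    (b' (H.map0 A) ⬝₁ b (H.map0 A)) ⬝₁ P.map1 (a' A ⬝₁ a A) =
      (b' (H.map0 A) ⬝₁ Q.map1 (a' A)) ⬝₁ b (G.map0 A) ⬝₁ P.map1 (a A) := by
  have da := pa.isTwoNat.dom_app
  have ca := pa.isTwoNat.cod_app
  have da' := pa'.isTwoNat.dom_app
  have ca' := pa'.isTwoNat.cod_app
  have db := pb.isTwoNat.dom_app
  have cb := pb.isTwoNat.cod_app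
  have db' := pb'.isTwoNat.dom_app
  have cb' := pb'.isTwoNat.cod_app
  have e := pb.isTwoNat.c_nat (a' A)
  rw [da', ca'] at e
  rw [P.map_c, c_assoc, c_assoc, ← c_assoc (k := b (H.map0 A)), e, c_assoc]
  all_goals clear e
  all_goals simp [*]

/-- A 1-cell of `sm-2Cat`: a symmetric strict monoidal 2-functor together with its domain and
codomain. -/
structure SMArrow where
  dom : SymMonTwoCat.{u}
  cod : SymMonTwoCat.{u}
  fn : SymFunctor dom cod

/-- A 2-cell of `sm-2Cat`: a monoidal 2-natural transformation together with its boundary. -/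
structure SMTrans where
  dom : SymMonTwoCat.{u}
  cod : SymMonTwoCat.{u}
  src : SymFunctor dom cod
  tgt : SymFunctor dom cod
  app : dom.C0 → cod.C1
  isMonNat : IsMonNat src tgt app

theorem SMTrans.ext' {M N : SymMonTwoCat.{u}} {F F' G G' : SymFunctor M N} {a b : M.C0 → N.C1}
    {h : IsMonNat F G a} {h' : IsMonNat F' G' b} (h1 : F = F') (h2 : G = G') (h3 : a = b) :
    SMTrans.mk M N F G a h = SMTrans.mk M N F' G' b h' := by
  subst h1 h2 h3; rfl

theorem IsMonNat.id {M N : SymMonTwoCat.{u}} (F : SymFunctor M N) :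
    IsMonNat F F (fun A => N.id1 (F.map0 A)) where
  isTwoNat :=
    { dom_app := fun A => by simp
      cod_app := fun A => by simp
      nat1 := fun f => by
        rw [← c_def, ← c_def, id_c, c_id] <;> simp
      nat2 := fun a => by
        rw [← hc_def, ← hc_def, id_hc, hc_id] <;> simp }
  tensor A B := by rw [t_id1, ← F.isStrict.map_t0]
  unit := congrArg _ F.isStrict.map_unit

theorem IsMonNat.vcomp {M N : SymMonTwoCat.{u}} {F G H : SymFunctor M N}
    {b a : M.C0 → N.C1} (hb : IsMonNat G H b) (ha : IsMonNat F G a) :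
    IsMonNat F H (fun A => b A ⬝₁ a A) where
  isTwoNat := by
    have da := ha.isTwoNat.dom_app
    have ca := ha.isTwoNat.cod_app
    have db := hb.isTwoNat.dom_app
    have cb := hb.isTwoNat.cod_app
    refine ⟨fun A => by simp [*], fun A => by simp [*], fun f => ?_, fun x => ?_⟩
    · have h1 := ha.isTwoNat.c_nat f
      have h2 := hb.isTwoNat.c_nat f
      rw [← c_def, ← c_def, c_assoc, h1, ← c_assoc, h2, c_assoc] <;> (clear h1 h2; simp [*])
    · have h1 := ha.isTwoNat.hc_nat x
      have h2 := hb.isTwoNat.hc_nat x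
      rw [← hc_def, ← hc_def, id2_c, hc_assoc, h1, ← hc_assoc, h2, id2_c, hc_assoc] <;>
        (clear h1 h2; simp [*])
  tensor A B := by
    have ca := ha.isTwoNat.cod_app
    have db := hb.isTwoNat.dom_app
    rw [ha.tensor, hb.tensor, t_c] <;> simp [*]
  unit := by
    rw [ha.unit, hb.unit]; simp

theorem IsMonNat.hcomp {M N K : SymMonTwoCat.{u}} {F G : SymFunctor M N}
    {H L : SymFunctor N K} {b : N.C0 → K.C1} {a : M.C0 → N.C1} (hb : IsMonNat H L b)
    (ha : IsMonNat F G a) :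
    IsMonNat (H.comp F) (L.comp G) (fun A => b (G.map0 A) ⬝₁ H.map1 (a A)) where
  isTwoNat := by
    have da := ha.isTwoNat.dom_app
    have ca := ha.isTwoNat.cod_app
    have db := hb.isTwoNat.dom_app
    have cb := hb.isTwoNat.cod_app
    refine ⟨fun A => ?_, fun A => ?_, fun f => ?_, fun x => ?_⟩
    · simp [SymFunctor.comp, TwoFunctor.comp, *]
    · simp [SymFunctor.comp, TwoFunctor.comp, *]
    · have h1 := ha.isTwoNat.c_nat f
      have h2 := hb.isTwoNat.c_nat (G.map1 f)
      rw [← c_def, ← c_def]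
      simp only [SymFunctor.comp, TwoFunctor.comp]
      rw [c_assoc, ← H.map_c, h1, H.map_c, ← c_assoc, ← c_assoc]
      · congr 1
        simpa using h2
      all_goals clear h1 h2
      all_goals simp [*]
    · have h1 := ha.isTwoNat.hc_nat x
      have h2 := hb.isTwoNat.hc_nat (G.map2 x)
      rw [← hc_def, ← hc_def]
      simp only [SymFunctor.comp, TwoFunctor.comp]
      rw [id2_c, hc_assoc, ← H.map_id2, ← H.map_hc, h1, H.map_hc, ← hc_assoc, id2_c, ← hc_assoc,
        H.map_id2]
      · congr 1
        simpa using h2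
      all_goals clear h1 h2
      all_goals simp [*]
  tensor A B := by
    have ca := ha.isTwoNat.cod_app
    have db := hb.isTwoNat.dom_app
    rw [ha.tensor, G.isStrict.map_t0, hb.tensor, H.isStrict.map_t1, t_c] <;> simp [*]
  unit := by
    rw [ha.unit, G.isStrict.map_unit, hb.unit, H.map_id1, H.isStrict.map_unit]; simp

/-- The composite of 1-cells of `sm-2Cat`. -/
def SMArrow.comp (g f : SMArrow.{u}) (h : f.cod = g.dom) : SMArrow.{u} :=
  ⟨f.dom, g.cod, g.fn.comp (h ▸ f.fn)⟩

namespace SMTrans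

/-- The source 1-cell. -/
def srcArrow (a : SMTrans.{u}) : SMArrow.{u} := ⟨a.dom, a.cod, a.src⟩
/-- The target 1-cell. -/
def tgtArrow (a : SMTrans.{u}) : SMArrow.{u} := ⟨a.dom, a.cod, a.tgt⟩

/-- The vertical composite of 2-cells of `sm-2Cat`: its component at `A` is `b_A ∘ a_A`. -/
noncomputable def vcomp (b a : SMTrans.{u}) (h : a.tgtArrow = b.srcArrow) : SMTrans.{u} where
  dom := a.dom
  cod := a.cod
  src := a.src
  tgt := cast (congrArg₂ SymFunctor (congrArg SMArrow.dom h).symm (congrArg SMArrow.cod h).symm)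
    b.tgt
  app A := (cast (congrArg (fun M : SymMonTwoCat => M.C1) (congrArg SMArrow.cod h).symm)
    (b.app (cast (congrArg (fun M : SymMonTwoCat => M.C0) (congrArg SMArrow.dom h)) A))) ⬝₁ a.app A
  isMonNat := by
    obtain ⟨M, N, F, G, a, ha⟩ := a
    obtain ⟨M', N', G', H, b, hb⟩ := b
    cases h
    exact hb.vcomp ha

/-- The horizontal composite of 2-cells of `sm-2Cat`: for `a : F → G` and `b : H → L`, its
component at `A` is `b_{G A} ∘ H a_A`. -/
noncomputable def hcomp (b a : SMTrans.{u}) (h : a.cod = b.dom) : SMTrans.{u} where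
  dom := a.dom
  cod := b.cod
  src := b.src.comp (h ▸ a.src)
  tgt := b.tgt.comp (h ▸ a.tgt)
  app A := b.app ((h ▸ a.tgt : SymFunctor a.dom b.dom).map0 A) ⬝₁
    b.src.map1 (cast (congrArg (fun M : SymMonTwoCat => M.C1) h) (a.app A))
  isMonNat := by
    obtain ⟨M, N, F, G, a, ha⟩ := a
    obtain ⟨M', N', G', H, b, hb⟩ := b
    cases h
    exact hb.hcomp ha

end SMTrans

/-- The 2-category `sm-2Cat` of small symmetric strict monoidal 2-categories, symmetric strict
monoidal 2-functors and monoidal 2-natural transformations. -/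
noncomputable def SM2Cat : TwoCat.{u + 1} where
  C0 := SymMonTwoCat.{u}
  C1 := SMArrow.{u}
  C2 := SMTrans.{u}
  dom f := f.dom
  cod f := f.cod
  src a := a.srcArrow
  tgt a := a.tgtArrow
  dom_tgt a := rfl
  cod_tgt a := rfl
  id1 M := ⟨M, M, SymFunctor.id M⟩
  id2 f := ⟨f.dom, f.cod, f.fn, f.fn, fun A => f.cod.id1 (f.fn.map0 A), IsMonNat.id f.fn⟩
  comp g f h := g.comp f h
  vcomp b a h := b.vcomp a h
  hcomp b a h := b.hcomp a h
  dom_id1 A := rfl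
  cod_id1 A := rfl
  dom_comp g f h := rfl
  cod_comp g f h := rfl
  comp_id1 f := rfl
  id1_comp f := rfl
  comp_assoc k g f h h' := by
    obtain ⟨A, B, f⟩ := f
    obtain ⟨B', C, g⟩ := g
    obtain ⟨C', D, k⟩ := k
    cases h; cases h'; rfl
  src_id2 f := rfl
  tgt_id2 f := rfl
  src_vcomp b a h := rfl
  tgt_vcomp b a h := by
    obtain ⟨M, N, F, G, a, ha⟩ := a
    obtain ⟨M', N', G', H, b, hb⟩ := b
    cases h; rfl
  vcomp_id2 a := by
    obtain ⟨M, N, F, G, a, ha⟩ := a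
    exact SMTrans.ext' rfl rfl (funext fun A => c_id (ha.isTwoNat.dom_app A))
  id2_vcomp a := by
    obtain ⟨M, N, F, G, a, ha⟩ := a
    exact SMTrans.ext' rfl rfl (funext fun A => id_c (ha.isTwoNat.cod_app A))
  vcomp_assoc c b a h h' := by
    obtain ⟨M, N, F, G, a, ha⟩ := a
    obtain ⟨M', N', G', H, b, hb⟩ := b
    obtain ⟨M'', N'', G'', H', c, hc⟩ := c
    cases h; cases h'
    exact SMTrans.ext' rfl rfl (funext fun A => c_assoc
      ((ha.isTwoNat.cod_app A).trans (hb.isTwoNat.dom_app A).symm)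
      ((hb.isTwoNat.cod_app A).trans (hc.isTwoNat.dom_app A).symm))
  src_hcomp b a h := rfl
  tgt_hcomp b a h := rfl
  hcomp_id2 a := by
    obtain ⟨M, N, F, G, a, ha⟩ := a
    refine SMTrans.ext' rfl rfl (funext fun A => ?_)
    exact (congrArg (fun x => a A ⬝₁ x) (F.map_id1 A)).trans (c_id (ha.isTwoNat.dom_app A))
  id2_hcomp a := by
    obtain ⟨M, N, F, G, a, ha⟩ := a
    exact SMTrans.ext' rfl rfl (funext fun A => id_c (ha.isTwoNat.cod_app A))
  hcomp_assoc c b a h h' := by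
    obtain ⟨M, N, F, G, a, ha⟩ := a
    obtain ⟨M', N', G', H, b, hb⟩ := b
    obtain ⟨M'', N'', G'', H', c, hc⟩ := c
    cases h; cases h'
    refine SMTrans.ext' rfl rfl (funext fun A => ?_)
    change (c (H.map0 (G.map0 A)) ⬝₁ G''.map1 (b (G.map0 A))) ⬝₁ G''.map1 (G'.map1 (a A)) =
      c (H.map0 (G.map0 A)) ⬝₁ G''.map1 (b (G.map0 A) ⬝₁ G'.map1 (a A))
    have ca := ha.isTwoNat.cod_app
    have db := hb.isTwoNat.dom_app
    have cb := hb.isTwoNat.cod_app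
    have dc := hc.isTwoNat.dom_app
    rw [G''.map_c, c_assoc] <;> simp [*]
  id2_comp g f h := by
    obtain ⟨A, B, f⟩ := f
    obtain ⟨B', C, g⟩ := g
    cases h
    refine SMTrans.ext' rfl rfl (funext fun A => ?_)
    change C.id1 (g.map0 (f.map0 A)) = C.id1 (g.map0 (f.map0 A)) ⬝₁ g.map1 (B.id1 (f.map0 A))
    rw [g.map_id1, c_id (by simp)]
  interchange b' b a' a hb ha h := by
    obtain ⟨M, N, F, G, a, pa⟩ := a
    obtain ⟨M', N', G', H, a', pa'⟩ := a'
    obtain ⟨K, L, P, Q, b, pb⟩ := b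
    obtain ⟨K', L', Q', R, b', pb'⟩ := b'
    cases h; cases ha; cases hb
    refine SMTrans.ext' rfl rfl (funext fun A => ?_)
    exact pa.interchange_aux pa' pb pb' A

end TwoDim

namespace TwoDim

open TwoCat MonTwoCat SymMonTwoCat

namespace SymFunctor

variable {M N K : SymMonTwoCat.{u}}

/-- A symmetric strict monoidal 2-functor, seen as a lax functor with `μ = 1`. -/
def lax (F : SymFunctor M N) : LaxFunctor M.toMonTwoCat N.toMonTwoCat :=
  LaxFunctor.ofStrict F.toTwoFunctor F.isStrict

theorem lax_psm (F : SymFunctor M N) {d : PsmData M.toTwoCat}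
    (hd : IsPseudomonoid M.toMonTwoCat d) : F.lax.psm d =
      ⟨F.map0 d.A, F.map1 d.m, F.map1 d.u, F.map2 d.α, F.map2 d.lam, F.map2 d.rho⟩ :=
  LaxFunctor.ofStrict_psm _ _ hd

theorem lax_cell (F : SymFunctor M N) {d d' : PsmData M.toTwoCat} {c : CellData M.toTwoCat}
    (hd : IsPseudomonoid M.toMonTwoCat d) (hc : IsOpmonoidal1 M.toMonTwoCat d d' c) :
    F.lax.cell c = ⟨F.map1 c.f, F.map2 c.φ2, F.map2 c.φ0⟩ :=
  LaxFunctor.ofStrict_cell _ _ hd hc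

theorem lax_tensor (F : SymFunctor M N) :
    F.lax.comp M.tensorLax = N.tensorLax.comp (F.lax.prod F.lax) := by
  refine LaxFunctor.ext' ?_ ?_ ?_ ?_
  · funext A; exact F.isStrict.map_t0 _ _
  · funext A; exact F.isStrict.map_t1 _ _
  · funext A; exact F.isStrict.map_t2 _ _
  · funext ⟨A, A'⟩ ⟨B, B'⟩
    change F.map1 (M.id1 A ⊗₁ M.σ A' B ⊗₁ M.id1 B') ⬝₁
        N.id1 (F.map0 (A ⊗₀ A') ⊗₀ F.map0 (B ⊗₀ B')) =
      (N.id1 (F.map0 A ⊗₀ F.map0 B) ⊗₁ N.id1 (F.map0 A' ⊗₀ F.map0 B')) ⬝₁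
      (N.id1 (F.map0 A) ⊗₁ N.σ (F.map0 A') (F.map0 B) ⊗₁ N.id1 (F.map0 B'))
    rw [F.isStrict.map_t1, F.isStrict.map_t1, F.map_σ, F.map_id1, F.map_id1, t_id1, c_id, id_c] <;>
      simp [F.isStrict.map_t0]

theorem lax_tensorPsm (F : SymFunctor M N) {d e : PsmData M.toTwoCat}
    (hd : IsPseudomonoid M.toMonTwoCat d) (he : IsPseudomonoid M.toMonTwoCat e) :
    F.lax.psm (M.tensorPsm d e) = N.tensorPsm (F.lax.psm d) (F.lax.psm e) := by
  have h := congrArg (fun G => G.psm (d.pair e)) F.lax_tensor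
  rw [LaxFunctor.comp_psm _ _ (hd.pair he), LaxFunctor.comp_psm _ _ (hd.pair he),
    LaxFunctor.prod_psm _ _ hd he] at h
  exact h

theorem lax_tensorCell (F : SymFunctor M N) {d e d' e' : PsmData M.toTwoCat}
    {x y : CellData M.toTwoCat}
    (hd : IsPseudomonoid M.toMonTwoCat d) (he : IsPseudomonoid M.toMonTwoCat e)
    (hd' : IsPseudomonoid M.toMonTwoCat d') (he' : IsPseudomonoid M.toMonTwoCat e')
    (hx : IsOpmonoidal1 M.toMonTwoCat d d' x) (hy : IsOpmonoidal1 M.toMonTwoCat e e' y) :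
    F.lax.cell (M.tensorCell x y) = N.tensorCell (F.lax.cell x) (F.lax.cell y) := by
  have h := congrArg (fun G => G.cell (x.pair y)) F.lax_tensor
  have hp := IsOpmonoidal1.pair hd hd' he he' hx hy
  rw [LaxFunctor.comp_cell _ _ (hd.pair he) hp, LaxFunctor.comp_cell _ _ (hd.pair he) hp,
    LaxFunctor.prod_cell _ _ hd he hx hy] at h
  exact h

/-- The symmetric strict monoidal 2-functor `F₀₁ : M₀₁ → N₀₁`; it applies `F` to all the data. -/
noncomputable def map01 (F : SymFunctor M N) : SymFunctor M.opmSym N.opmSym where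
  toTwoFunctor := F.lax.opm
  isStrict :=
    { map_unit := Pseudomonoid.ext <| (F.lax_psm (unitPsm_law _)).trans <| by
        have h := F.isStrict.map_unit
        have h' : F.map1 (M.id1 M.unit) = N.id1 N.unit := (F.map_id1 _).trans (congrArg _ h)
        have h'' : F.map2 (M.id2 (M.id1 M.unit)) = N.id2 (N.id1 N.unit) :=
          (F.map_id2 _).trans (congrArg _ h')
        refine PsmData.ext h h' h' h'' h'' h''
      map_t0 := fun A B => Pseudomonoid.ext (F.lax_tensorPsm A.law B.law)
      map_t1 := fun f g => Opmonoidal1.ext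
        (Pseudomonoid.ext (F.lax_tensorPsm f.dom.law g.dom.law))
        (Pseudomonoid.ext (F.lax_tensorPsm f.cod.law g.cod.law))
        (F.lax_tensorCell f.dom.law g.dom.law f.cod.law g.cod.law f.law g.law)
      map_t2 := fun f g => Opmonoidal2.ext
        (Opmonoidal1.ext (Pseudomonoid.ext (F.lax_tensorPsm f.src.dom.law g.src.dom.law))
          (Pseudomonoid.ext (F.lax_tensorPsm f.src.cod.law g.src.cod.law))
          (F.lax_tensorCell f.src.dom.law g.src.dom.law f.src.cod.law g.src.cod.law
            f.src.law g.src.law))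
        (Opmonoidal1.ext (Pseudomonoid.ext (F.lax_tensorPsm f.tgt.dom.law g.tgt.dom.law))
          (Pseudomonoid.ext (F.lax_tensorPsm f.tgt.cod.law g.tgt.cod.law))
          (F.lax_tensorCell f.tgt.dom.law g.tgt.dom.law f.tgt.cod.law g.tgt.cod.law
            f.tgt.law g.tgt.law))
        (F.isStrict.map_t2 _ _) }
  map_σ A B := by
    refine Opmonoidal1.ext (Pseudomonoid.ext (F.lax_tensorPsm A.law B.law)) (Pseudomonoid.ext ?_) ?_
    · change F.lax.psm (M.opmσ A B).cod.data = (N.opmσ (F.lax.opm.map0 A) (F.lax.opm.map0 B)).cod.data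
      exact (congrArg F.lax.psm (opmσ_cod A B)).trans
        ((F.lax_tensorPsm B.law A.law).trans (opmσ_cod (F.lax.opm.map0 A) (F.lax.opm.map0 B)).symm)
    · refine (F.lax_cell (M.opmσ A B).dom.law (M.opmσ A B).law).trans ?_
      have hl := F.lax_tensorPsm A.law B.law
      have hp : IsPseudomonoid M.toMonTwoCat (M.tensorPsm A.data B.data) := (M.opmσ A B).dom.law
      have hm : M.cod (M.tensorPsm A.data B.data).m = A.data.A ⊗₀ B.data.A := hp.cod_m
      have hu : M.cod (M.tensorPsm A.data B.data).u = A.data.A ⊗₀ B.data.A := hp.cod_u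
      rw [F.lax_psm hp] at hl
      change CellData.mk (F.map1 (M.σ A.data.A B.data.A))
        (F.map2 𝟏(M.σ A.data.A B.data.A ⬝₁ (M.tensorPsm A.data B.data).m))
        (F.map2 𝟏(M.σ A.data.A B.data.A ⬝₁ (M.tensorPsm A.data B.data).u)) =
        (N.tensorPsm (F.lax.psm A.data) (F.lax.psm B.data)).strictCell
          (N.σ (F.map0 A.data.A) (F.map0 B.data.A))
      rw [← hl, F.map_id2, F.map_id2, F.map_c, F.map_c, F.map_σ]
      · rfl
      · simp [hu]
      · simp [hm]

theorem map01_id (M : SymMonTwoCat.{u}) : (SymFunctor.id M).map01 = SymFunctor.id M.opmSym :=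
  SymFunctor.ext' <| TwoFunctor.opm_ext (fun A => (SymFunctor.id M).lax_psm A.law)
    (fun f => (SymFunctor.id M).lax_cell f.dom.law f.law) (fun _ => rfl)

theorem lax_comp (G : SymFunctor N K) (F : SymFunctor M N) :
    (G.comp F).lax = G.lax.comp F.lax := by
  refine LaxFunctor.ext' rfl rfl rfl ?_
  funext A B
  change K.id1 (G.map0 (F.map0 A) ⊗₀ G.map0 (F.map0 B)) =
    G.map1 (N.id1 (F.map0 A ⊗₀ F.map0 B)) ⬝₁ K.id1 (G.map0 (F.map0 A) ⊗₀ G.map0 (F.map0 B))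
  rw [G.map_id1, G.isStrict.map_t0, c_id]
  simp

theorem map01_comp (G : SymFunctor N K) (F : SymFunctor M N) :
    (G.comp F).map01 = G.map01.comp F.map01 := by
  refine SymFunctor.ext' <| TwoFunctor.opm_ext (fun A => ?_) (fun f => ?_) (fun _ => rfl)
  · refine (congrArg (fun L => L.psm A.data) (lax_comp G F)).trans ?_
    exact LaxFunctor.comp_psm _ _ A.law
  · refine (congrArg (fun L => L.cell f.data) (lax_comp G F)).trans ?_
    exact LaxFunctor.comp_cell _ _ f.dom.law f.law

end SymFunctor

namespace IsMonNat

variable {M N : SymMonTwoCat.{u}} {F G : SymFunctor M N} {app : M.C0 → N.C1}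

theorem lax (h : IsMonNat F G app) : IsLaxMonNat F.lax G.lax app where
  isTwoNat := h.isTwoNat
  tensor A B := by
    have e1 := h.isTwoNat.dom_app
    have e2 := h.isTwoNat.cod_app
    change app (A ⊗₀ B) ⬝₁ N.id1 _ = N.id1 _ ⬝₁ (app A ⊗₁ app B)
    rw [c_id, id_c, h.tensor] <;> simp [*, F.isStrict.map_t0]
  unit := h.unit

/-- The component `(θ_A, 1, 1)` of the monoidal 2-natural transformation `θ₀₁ : F₀₁ → G₀₁`. -/
noncomputable def app01 (h : IsMonNat F G app) (A : M.opmSym.C0) : N.opmSym.C1 :=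
  h.lax.opmApp A

theorem map01 (h : IsMonNat F G app) : IsMonNat F.map01 G.map01 h.app01 where
  isTwoNat := h.lax.opm
  tensor A B := by
    refine Opmonoidal1.ext (Pseudomonoid.ext (F.lax_tensorPsm A.law B.law))
      (Pseudomonoid.ext (G.lax_tensorPsm A.law B.law)) ?_
    refine Eq.trans ?_ (tensorCell_strict (F.lax.psm_law A.law) (F.lax.psm_law B.law)
      (h.isTwoNat.dom_app _) (h.isTwoNat.dom_app _)).symm
    rw [← F.lax_tensorPsm A.law B.law, ← h.tensor]
    rfl
  unit := by
    refine Opmonoidal1.ext F.map01.isStrict.map_unit G.map01.isStrict.map_unit ?_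
    have e : F.lax.psm (unitPsm M.toMonTwoCat) = unitPsm N.toMonTwoCat :=
      congrArg Pseudomonoid.data F.map01.isStrict.map_unit
    change (F.lax.psm (unitPsm M.toMonTwoCat)).strictCell (app M.unit) =
      (unitPsm N.toMonTwoCat).idCell
    rw [e, h.unit]
    exact strictCell_id (unitPsm_law _)

end IsMonNat

/-- The 2-endofunctor `(-)₀₁` of `sm-2Cat`. -/
noncomputable def pm01 : TwoFunctor SM2Cat.{u} SM2Cat.{u} where
  map0 M := M.opmSym
  map1 F := ⟨F.dom.opmSym, F.cod.opmSym, F.fn.map01⟩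
  map2 θ := ⟨θ.dom.opmSym, θ.cod.opmSym, θ.src.map01, θ.tgt.map01, θ.isMonNat.app01,
    θ.isMonNat.map01⟩
  dom_map _ := rfl
  cod_map _ := rfl
  src_map _ := rfl
  tgt_map _ := rfl
  map_id1 M := congrArg (SMArrow.mk _ _) (SymFunctor.map01_id M)
  map_id2 F := SMTrans.ext' rfl rfl <| funext fun A => Opmonoidal1.ext rfl rfl
    (strictCell_id (F.fn.lax.psm_law A.law))
  map_comp g f h := by
    obtain ⟨A, B, f⟩ := f
    obtain ⟨B', C, g⟩ := g
    cases h
    exact congrArg (SMArrow.mk _ _) (SymFunctor.map01_comp g f)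
  map_vcomp b a h := by
    obtain ⟨M, N, F, G, a, ha⟩ := a
    obtain ⟨M', N', G', H, b, hb⟩ := b
    cases h
    refine SMTrans.ext' rfl rfl (funext fun A => ?_)
    refine Eq.trans ?_ (c_def (M := N.opm) (f := ha.app01 A) (g := hb.app01 A) rfl).symm
    refine Opmonoidal1.ext rfl rfl ?_
    exact (strictCell_comp (F.lax.psm_law A.law) (G.lax.psm_law A.law) (ha.app01 A).law
      (hb.app01 A).law).symm
  map_hcomp b a h := by
    obtain ⟨M, N, F, G, a, ha⟩ := a
    obtain ⟨M', N', G', H, b, hb⟩ := b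
    cases h
    refine SMTrans.ext' (SymFunctor.map01_comp _ _) (SymFunctor.map01_comp _ _) (funext fun A => ?_)
    have hc : (G'.map01.map1 (ha.app01 A)).cod = (hb.app01 (G.map01.map0 A)).dom := rfl
    refine Eq.trans ?_ (c_def (M := N'.opm) (f := G'.map01.map1 (ha.app01 A))
      (g := hb.app01 (G.map01.map0 A)) hc).symm
    have e : (G'.map01.map1 (ha.app01 A)).data =
        (G'.lax.psm (F.lax.psm A.data)).strictCell (G'.map1 (a A.data.A)) := by
      refine (G'.lax_cell (F.lax.psm_law A.law) (ha.app01 A).law).trans ?_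
      have hF := F.lax.psm_law A.law
      have h1 : N.dom (a A.data.A) = F.map0 A.data.A := ha.isTwoNat.dom_app _
      rw [G'.lax_psm hF]
      change CellData.mk (G'.map1 (a A.data.A)) (G'.map2 𝟏(a A.data.A ⬝₁ (F.lax.psm A.data).m))
        (G'.map2 𝟏(a A.data.A ⬝₁ (F.lax.psm A.data).u)) = _
      rw [G'.map_id2, G'.map_id2, G'.map_c, G'.map_c]
      · rfl
      · rw [hF.cod_u, h1]; rfl
      · rw [hF.cod_m, h1]; rfl
    have l1 := (G'.map01.map1 (ha.app01 A)).law
    rw [e] at l1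
    refine Opmonoidal1.ext
      (Pseudomonoid.ext ((congrArg (fun L => L.psm A.data) (SymFunctor.lax_comp G' F)).trans
        (LaxFunctor.comp_psm _ _ A.law)))
      (Pseudomonoid.ext ((congrArg (fun L => L.psm A.data) (SymFunctor.lax_comp H G)).trans
        (LaxFunctor.comp_psm _ _ A.law))) ?_
    change _ = (hb.app01 (G.map01.map0 A)).data.opComp (G'.map01.map1 (ha.app01 A)).data
    rw [e]
    refine Eq.trans ?_ (strictCell_comp (G'.lax.psm_law (F.lax.psm_law A.law))
      (hb.app01 (G.map01.map0 A)).dom.law l1 (hb.app01 (G.map01.map0 A)).law).symm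
    exact congrArg (fun d => PsmData.strictCell d _)
      ((congrArg (fun L => L.psm A.data) (SymFunctor.lax_comp G' F)).trans
        (LaxFunctor.comp_psm _ _ A.law))

end TwoDim

namespace TwoDim

open TwoCat MonTwoCat SymMonTwoCat

theorem co_c {M : TwoCat.{u}} (g f : M.C1) : M.co.c g f = M.c g f := rfl

/-- The vertically opposite symmetric strict monoidal 2-category. -/
def SymMonTwoCat.co (M : SymMonTwoCat.{u}) : SymMonTwoCat.{u} where
  toMonTwoCat := M.toMonTwoCat.co
  σ := M.σ
  isSymmetry :=
    { isTwoNat := M.isSymmetry.isTwoNat.co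
      σ_σ := M.isSymmetry.σ_σ
      hexagon := M.isSymmetry.hexagon }

/-- The symmetric strict monoidal 2-functor `M^co → N^co` induced by `F : M → N`. -/
def SymFunctor.co {M N : SymMonTwoCat.{u}} (F : SymFunctor M N) : SymFunctor M.co N.co where
  toTwoFunctor := F.toTwoFunctor.co
  isStrict :=
    { map_unit := F.isStrict.map_unit
      map_t0 := F.isStrict.map_t0
      map_t1 := F.isStrict.map_t1
      map_t2 := F.isStrict.map_t2 }
  map_σ := F.map_σ

theorem IsMonNat.co {M N : SymMonTwoCat.{u}} {F G : SymFunctor M N} {app : M.C0 → N.C1}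
    (h : IsMonNat F G app) : IsMonNat F.co G.co app where
  isTwoNat := h.isTwoNat.co
  tensor := h.tensor
  unit := h.unit

/-- The 2-endofunctor of `sm-2Cat` that sends `M` to its vertically opposite `M^co`. It keeps the
direction of the 1-cells and of the 2-cells of `sm-2Cat`. -/
noncomputable def coF : TwoFunctor SM2Cat.{u} SM2Cat.{u} where
  map0 M := M.co
  map1 F := ⟨F.dom.co, F.cod.co, F.fn.co⟩
  map2 θ := ⟨θ.dom.co, θ.cod.co, θ.src.co, θ.tgt.co, θ.app, θ.isMonNat.co⟩
  dom_map _ := rfl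
  cod_map _ := rfl
  src_map _ := rfl
  tgt_map _ := rfl
  map_id1 M := rfl
  map_id2 F := rfl
  map_comp g f h := by
    obtain ⟨A, B, f⟩ := f
    obtain ⟨B', C, g⟩ := g
    cases h
    rfl
  map_vcomp b a h := by
    obtain ⟨M, N, F, G, a, ha⟩ := a
    obtain ⟨M', N', G', H, b, hb⟩ := b
    cases h
    rfl
  map_hcomp b a h := by
    obtain ⟨M, N, F, G, a, ha⟩ := a
    obtain ⟨M', N', G', H, b, hb⟩ := b
    cases h
    rfl

/-- The 2-endofunctor `(-)₁₀` of `sm-2Cat`, `M₁₀ = ((M^co)₀₁)^co`: pseudomonoids, monoidal 1-cells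
and monoidal 2-cells. -/
noncomputable def pm10 : TwoFunctor SM2Cat.{u} SM2Cat.{u} := coF.comp (pm01.comp coF)

end TwoDim

namespace TwoDim

open TwoCat MonTwoCat SymMonTwoCat

/-- The symmetric strict monoidal 2-category `M₀₁`. -/
noncomputable def obj01 (M : SymMonTwoCat.{u}) : SymMonTwoCat.{u} := pm01.map0 M

/-- The symmetric strict monoidal 2-category `M₁₀`. -/
noncomputable def obj10 (M : SymMonTwoCat.{u}) : SymMonTwoCat.{u} := pm10.map0 M

section Explicit

/-! The monoidal product of pseudomonoids and of opmonoidal 1-cells, in explicit form. -/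

theorem tensorPsm_eq (M : SymMonTwoCat.{u}) (d e : PsmData M.toTwoCat) :
    M.tensorPsm d e = ⟨d.A ⊗₀ e.A,
      (d.m ⊗₁ e.m) ⬝₁ (M.id1 d.A ⊗₁ M.σ e.A d.A ⊗₁ M.id1 e.A),
      d.u ⊗₁ e.u,
      (d.α ⊗₂ e.α) ⬝ₕ 𝟏((M.id1 (d.A ⊗₀ d.A) ⊗₁ M.σ (e.A ⊗₀ e.A) d.A ⊗₁ M.id1 e.A) ⬝₁
        ((M.id1 d.A ⊗₁ M.σ e.A d.A ⊗₁ M.id1 e.A) ⊗₁ M.id1 (d.A ⊗₀ e.A))),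
      d.lam ⊗₂ e.lam, d.rho ⊗₂ e.rho⟩ := rfl

theorem tensorCell_eq (M : SymMonTwoCat.{u}) (x y : CellData M.toTwoCat) :
    M.tensorCell x y = ⟨x.f ⊗₁ y.f,
      (x.φ2 ⊗₂ y.φ2) ⬝ₕ 𝟏(M.id1 (M.dom x.f) ⊗₁ M.σ (M.dom y.f) (M.dom x.f) ⊗₁
        M.id1 (M.dom y.f)),
      x.φ0 ⊗₂ y.φ0⟩ := rfl

end Explicit

end TwoDim

namespace TwoDim

open TwoCat MonTwoCat SymMonTwoCat

/-! ### Monoidal 1-cells and 2-cells, duoidal objects, `(1,1)`-oidal 1-cells and 2-cells, spelled out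
in the terms of the original 2-category -/

open Classical in
/-- The inverse of an invertible 2-cell (with a junk value on the other 2-cells). -/
noncomputable def TwoCat.inv2 {M : TwoCat.{u}} (a : M.C2) : M.C2 :=
  if h : IsInvertible a then h.choose else a

/-- `(f, φ₂, φ₀)` is a monoidal 1-cell from `d` to `d'`, with binary part
`φ₂ : m' ∘ (f ⊗ f) → f ∘ m` and nullary part `φ₀ : u' → f ∘ u`. -/
structure IsMonoidal1 (M : MonTwoCat.{u}) (d d' : PsmData M.toTwoCat)
    (c : CellData M.toTwoCat) : Prop where
  dom_f : M.dom c.f = d.A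
  cod_f : M.cod c.f = d'.A
  src_φ2 : M.src c.φ2 = d'.m ⬝₁ (c.f ⊗₁ c.f)
  tgt_φ2 : M.tgt c.φ2 = c.f ⬝₁ d.m
  src_φ0 : M.src c.φ0 = d'.u
  tgt_φ0 : M.tgt c.φ0 = c.f ⬝₁ d.u
  assoc :
    (𝟏(c.f) ⬝ₕ d.α) ⬝ᵥ
      (c.φ2 ⬝ₕ 𝟏(d.m ⊗₁ M.id1 d.A)) ⬝ᵥ
        (𝟏(d'.m) ⬝ₕ (c.φ2 ⊗₂ 𝟏(c.f))) =
    (c.φ2 ⬝ₕ 𝟏(M.id1 d.A ⊗₁ d.m)) ⬝ᵥ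
      (𝟏(d'.m) ⬝ₕ (𝟏(c.f) ⊗₂ c.φ2)) ⬝ᵥ
        (d'.α ⬝ₕ 𝟏(c.f ⊗₁ c.f ⊗₁ c.f))
  unit_left :
    (𝟏(c.f) ⬝ₕ d.lam) ⬝ᵥ
      (c.φ2 ⬝ₕ 𝟏(d.u ⊗₁ M.id1 d.A)) ⬝ᵥ
        (𝟏(d'.m) ⬝ₕ (c.φ0 ⊗₂ 𝟏(c.f))) =
    d'.lam ⬝ₕ 𝟏(c.f)
  unit_right :
    (𝟏(c.f) ⬝ₕ d.rho) ⬝ᵥ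
      (c.φ2 ⬝ₕ 𝟏(M.id1 d.A ⊗₁ d.u)) ⬝ᵥ
        (𝟏(d'.m) ⬝ₕ (𝟏(c.f) ⊗₂ c.φ0)) =
    d'.rho ⬝ₕ 𝟏(c.f)

/-- `ω : (f, φ₂, φ₀) → (g, γ₂, γ₀)` is a monoidal 2-cell between 1-cells from `d` to `d'`. -/
structure IsMonoidal2 (M : MonTwoCat.{u}) (d d' : PsmData M.toTwoCat)
    (c c' : CellData M.toTwoCat) (ω : M.C2) : Prop where
  src_ω : M.src ω = c.f
  tgt_ω : M.tgt ω = c'.f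
  binary : (ω ⬝ₕ 𝟏(d.m)) ⬝ᵥ c.φ2 = c'.φ2 ⬝ᵥ (𝟏(d'.m) ⬝ₕ (ω ⊗₂ ω))
  nullary : (ω ⬝ₕ 𝟏(d.u)) ⬝ᵥ c.φ0 = c'.φ0

/-- The composite of monoidal 1-cells (first `f`, then `g`), on the level of data. -/
noncomputable def CellData.monComp {M : MonTwoCat.{u}} (g f : CellData M.toTwoCat) :
    CellData M.toTwoCat where
  f := g.f ⬝₁ f.f
  φ2 := (𝟏(g.f) ⬝ₕ f.φ2) ⬝ᵥ (g.φ2 ⬝ₕ 𝟏(f.f ⊗₁ f.f))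
  φ0 := (𝟏(g.f) ⬝ₕ f.φ0) ⬝ᵥ g.φ0

/-- The data of a duoidal object: two pseudomonoids `v` and `h`, and four 2-cells
`ξ : m_v ∘ (m_h ⊗ m_h) → m_h ∘ (m_v ⊗ m_v) ∘ (1 σ 1)`, `ξ⁰ : u_v → m_h ∘ (u_v ⊗ u_v)`,
`ξ₀ : m_v ∘ (u_h ⊗ u_h) → u_h` and `ξ⁰₀ : u_v → u_h`, without any condition. -/
@[ext]
structure DuoData (M : TwoCat.{u}) where
  v : PsmData M
  h : PsmData M
  ξ : M.C2
  ξup : M.C2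
  ξdn : M.C2
  ξud : M.C2

/-- The multiplication `(m_h, ξ, ξ⁰)` of a duoidal object. -/
def DuoData.mul {M : TwoCat.{u}} (d : DuoData M) : CellData M := ⟨d.h.m, d.ξ, d.ξup⟩

/-- The unit `(u_h, ξ₀, ξ⁰₀)` of a duoidal object. -/
def DuoData.one {M : TwoCat.{u}} (d : DuoData M) : CellData M := ⟨d.h.u, d.ξdn, d.ξud⟩

/-- `d` is a duoidal object of `M`: `v` and `h` are pseudomonoids on the same object,
`(m_h, ξ, ξ⁰) : v ⊗ v → v` and `(u_h, ξ₀, ξ⁰₀) : I → v` are monoidal 1-cells, and `α_h`, `λ_h` and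
`ϱ_h` are monoidal 2-cells. -/
structure IsDuoidal (M : SymMonTwoCat.{u}) (d : DuoData M.toTwoCat) : Prop where
  same : d.h.A = d.v.A
  v : IsPseudomonoid M.toMonTwoCat d.v
  h : IsPseudomonoid M.toMonTwoCat d.h
  mul : IsMonoidal1 M.toMonTwoCat (M.tensorPsm d.v d.v) d.v d.mul
  one : IsMonoidal1 M.toMonTwoCat (unitPsm M.toMonTwoCat) d.v d.one
  α : IsMonoidal2 M.toMonTwoCat (M.tensorPsm d.v (M.tensorPsm d.v d.v)) d.v
    (d.mul.monComp (M.tensorCell d.mul d.v.idCell))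
    (d.mul.monComp (M.tensorCell d.v.idCell d.mul)) d.h.α
  lam : IsMonoidal2 M.toMonTwoCat d.v d.v
    (d.mul.monComp (M.tensorCell d.one d.v.idCell)) d.v.idCell d.h.lam
  rho : IsMonoidal2 M.toMonTwoCat d.v d.v
    (d.mul.monComp (M.tensorCell d.v.idCell d.one)) d.v.idCell d.h.rho

/-- The data of a `(1,1)`-oidal 1-cell: a 1-cell `f` with a monoidal structure `(φ₂, φ₀)` and an
opmonoidal structure `(φ², φ⁰)`, without any condition. -/
@[ext]
structure OidalData (M : TwoCat.{u}) where
  f : M.C1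
  φdn2 : M.C2
  φdn0 : M.C2
  φup2 : M.C2
  φup0 : M.C2

/-- The underlying monoidal 1-cell `(f, φ₂, φ₀)`. -/
def OidalData.mon {M : TwoCat.{u}} (r : OidalData M) : CellData M := ⟨r.f, r.φdn2, r.φdn0⟩

/-- The underlying opmonoidal 1-cell `(f, φ², φ⁰)`. -/
def OidalData.opm {M : TwoCat.{u}} (r : OidalData M) : CellData M := ⟨r.f, r.φup2, r.φup0⟩

/-- `r` is a `(1,1)`-oidal 1-cell from `d` to `d'`: `(f, φ₂, φ₀)` is a monoidal 1-cell,
`(f, φ², φ⁰)` is an opmonoidal 1-cell, and the 2-cells `φ²` and `φ⁰` are monoidal. -/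
structure IsOidal1 (M : SymMonTwoCat.{u}) (d d' : DuoData M.toTwoCat)
    (r : OidalData M.toTwoCat) : Prop where
  mon : IsMonoidal1 M.toMonTwoCat d.v d'.v r.mon
  opm : IsOpmonoidal1 M.toMonTwoCat d.h d'.h r.opm
  φup2 : IsMonoidal2 M.toMonTwoCat (M.tensorPsm d.v d.v) d'.v
    (r.mon.monComp d.mul) (d'.mul.monComp (M.tensorCell r.mon r.mon)) r.φup2
  φup0 : IsMonoidal2 M.toMonTwoCat (unitPsm M.toMonTwoCat) d'.v
    (r.mon.monComp d.one) d'.one r.φup0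

/-- `ω` is a `(1,1)`-oidal 2-cell from `r` to `s`: it is both monoidal and opmonoidal. -/
structure IsOidal2 (M : SymMonTwoCat.{u}) (d d' : DuoData M.toTwoCat)
    (r s : OidalData M.toTwoCat) (ω : M.C2) : Prop where
  mon : IsMonoidal2 M.toMonTwoCat d.v d'.v r.mon s.mon ω
  opm : IsOpmonoidal2 M.toMonTwoCat d.h d'.h r.opm s.opm ω

/-! ### The data in `M` that the cells of `(M₁₀)₀₁` and `(M₀₁)₁₀` consist of

A 0-cell of `M₁₀ = ((M^co)₀₁)^co` is a pseudomonoid in `M^co`; it is the pseudomonoid in `M` with the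
inverse associativity and unitality 2-cells. -/

/-- Pseudomonoid data in `M^co`, seen as pseudomonoid data in `M` by inverting the 2-cells. -/
noncomputable def PsmData.ofCo {M : TwoCat.{u}} (d : PsmData M.co) : PsmData M where
  A := d.A
  m := d.m
  u := d.u
  α := inv2 (M := M) d.α
  lam := inv2 (M := M) d.lam
  rho := inv2 (M := M) d.rho

/-- The data in `M` of a 0-cell of `(M₁₀)₀₁`. -/
noncomputable def read0 (M : SymMonTwoCat.{u}) (X : Pseudomonoid (obj10 M).toMonTwoCat) :
    DuoData M.toTwoCat :=
  let A : Pseudomonoid M.co.toMonTwoCat := X.data.A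
  let m : Opmonoidal1 M.co.toMonTwoCat := X.data.m
  let u : Opmonoidal1 M.co.toMonTwoCat := X.data.u
  let α : Opmonoidal2 M.co.toMonTwoCat := X.data.α
  let lam : Opmonoidal2 M.co.toMonTwoCat := X.data.lam
  let rho : Opmonoidal2 M.co.toMonTwoCat := X.data.rho
  { v := PsmData.ofCo (M := M.toTwoCat) A.data
    h := ⟨A.data.A, m.data.f, u.data.f, α.ω, lam.ω, rho.ω⟩
    ξ := m.data.φ2
    ξup := m.data.φ0
    ξdn := u.data.φ2
    ξud := u.data.φ0 }

/-- The data in `M` of a 0-cell of `(M₀₁)₁₀`. The binary part of its multiplication 1-cell is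
`ξ ∘ (1 σ 1) : m_v ∘ (m_h ⊗ m_h) ∘ (1 σ 1) → m_h ∘ (m_v ⊗ m_v)`, from which `ξ` is obtained by
composition with the involution `1 σ 1`. -/
noncomputable def read0' (M : SymMonTwoCat.{u}) (X : Pseudomonoid (obj01 M).co.toMonTwoCat) :
    DuoData M.toTwoCat :=
  let A : Pseudomonoid M.toMonTwoCat := X.data.A
  let m : Opmonoidal1 M.toMonTwoCat := X.data.m
  let u : Opmonoidal1 M.toMonTwoCat := X.data.u
  let α : Opmonoidal2 M.toMonTwoCat := X.data.α
  let lam : Opmonoidal2 M.toMonTwoCat := X.data.lam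
  let rho : Opmonoidal2 M.toMonTwoCat := X.data.rho
  let a : M.C0 := A.data.A
  { v := ⟨a, m.data.f, u.data.f, inv2 α.ω, inv2 lam.ω, inv2 rho.ω⟩
    h := A.data
    ξ := m.data.φ2 ⬝ₕ 𝟏(M.id1 a ⊗₁ M.σ a a ⊗₁ M.id1 a)
    ξup := u.data.φ2
    ξdn := m.data.φ0
    ξud := u.data.φ0 }

/-- The data in `M` of a 1-cell of `(M₁₀)₀₁`. -/
noncomputable def read1 (M : SymMonTwoCat.{u}) (F : Opmonoidal1 (obj10 M).toMonTwoCat) :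
    OidalData M.toTwoCat :=
  let f : Opmonoidal1 M.co.toMonTwoCat := F.data.f
  let φ2 : Opmonoidal2 M.co.toMonTwoCat := F.data.φ2
  let φ0 : Opmonoidal2 M.co.toMonTwoCat := F.data.φ0
  ⟨f.data.f, f.data.φ2, f.data.φ0, φ2.ω, φ0.ω⟩

/-- The data in `M` of a 1-cell of `(M₀₁)₁₀`. -/
noncomputable def read1' (M : SymMonTwoCat.{u}) (F : Opmonoidal1 (obj01 M).co.toMonTwoCat) :
    OidalData M.toTwoCat :=
  let f : Opmonoidal1 M.toMonTwoCat := F.data.f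
  let φ2 : Opmonoidal2 M.toMonTwoCat := F.data.φ2
  let φ0 : Opmonoidal2 M.toMonTwoCat := F.data.φ0
  ⟨f.data.f, φ2.ω, φ0.ω, f.data.φ2, f.data.φ0⟩

/-- The underlying 2-cell in `M` of a 2-cell of `(M₁₀)₀₁`. -/
noncomputable def read2 (M : SymMonTwoCat.{u}) (a : Opmonoidal2 (obj10 M).toMonTwoCat) : M.C2 :=
  let ω : Opmonoidal2 M.co.toMonTwoCat := a.ω
  ω.ω

/-- The underlying 2-cell in `M` of a 2-cell of `(M₀₁)₁₀`. -/
noncomputable def read2' (M : SymMonTwoCat.{u}) (a : Opmonoidal2 (obj01 M).co.toMonTwoCat) :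
    M.C2 :=
  let ω : Opmonoidal2 M.toMonTwoCat := a.ω
  ω.ω

/-! ### Iterating the 2-endofunctors `(-)₁₀` and `(-)₀₁` -/

/-- The composite of a word in the 2-endofunctors `(-)₁₀` (encoded by `true`) and `(-)₀₁` (encoded by
`false`) of `sm-2Cat`. The last letter of the word is applied first. -/
noncomputable def multi : List Bool → TwoFunctor SM2Cat.{u} SM2Cat.{u}
  | [] => TwoFunctor.id SM2Cat
  | true :: w => pm10.comp (multi w)
  | false :: w => pm01.comp (multi w)

/-- The value of `multi w` on `M`. -/
noncomputable def multiObj (w : List Bool) (M : SymMonTwoCat.{u}) : SymMonTwoCat.{u} :=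
  (multi w).map0 M

/-- The value of `multi w` on a symmetric strict monoidal 2-functor. -/
noncomputable def multiMap {M N : SymMonTwoCat.{u}} (F : SymFunctor M N) :
    (w : List Bool) → SymFunctor (multiObj w M) (multiObj w N)
  | [] => F
  | true :: w => (multiMap F w).co.map01.co
  | false :: w => (multiMap F w).map01

theorem multiMap_spec {M N : SymMonTwoCat.{u}} (F : SymFunctor M N) (w : List Bool) :
    (multi w).map1 ⟨M, N, F⟩ = (⟨multiObj w M, multiObj w N, multiMap F w⟩ : SMArrow.{u}) := by
  induction w with
  | nil => rfl
  | cons b w ih =>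
    cases b
    · exact congrArg pm01.map1 ih
    · exact congrArg pm10.map1 ih

/-- The word for applying first `(-)₁₀` `p` times, then `(-)₀₁` `q` times. -/
def pqWord (p q : ℕ) : List Bool := List.replicate q false ++ List.replicate p true

/-- The forgetful 2-functor `M₀₁ → M`. -/
noncomputable def forget01 (M : SymMonTwoCat.{u}) : SymFunctor M.opmSym M where
  map0 X := X.data.A
  map1 f := f.data.f
  map2 a := a.ω
  dom_map f := f.law.dom_f
  cod_map f := f.law.cod_f
  src_map a := a.law.src_ω
  tgt_map a := a.law.tgt_ω
  map_id1 _ := rfl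
  map_id2 _ := rfl
  map_comp g f h := c_def _
  map_vcomp b a h := vc_def _
  map_hcomp b a h := hc_def _
  isStrict := ⟨rfl, fun _ _ => rfl, fun _ _ => rfl, fun _ _ => rfl⟩
  map_σ _ _ := rfl

/-- The forgetful 2-functor from `multiObj w M` to `M`. -/
noncomputable def multiForget (M : SymMonTwoCat.{u}) :
    (w : List Bool) → SymFunctor (multiObj w M) M
  | [] => SymFunctor.id M
  | true :: w => (multiForget M w).comp (forget01 (multiObj w M).co).co
  | false :: w => (multiForget M w).comp (forget01 (multiObj w M))

/-- The image of pseudomonoid data under a symmetric strict monoidal 2-functor. -/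
def SymFunctor.mapPsm {M N : SymMonTwoCat.{u}} (F : SymFunctor M N) (d : PsmData M.toTwoCat) :
    PsmData N.toTwoCat :=
  ⟨F.map0 d.A, F.map1 d.m, F.map1 d.u, F.map2 d.α, F.map2 d.lam, F.map2 d.rho⟩

/-- The pseudomonoid in `M` that a 0-cell of `M₁₀` consists of. -/
noncomputable def psm10 (M : SymMonTwoCat.{u}) (X : (obj10 M).C0) : PsmData M.toTwoCat :=
  let X' : Pseudomonoid M.co.toMonTwoCat := X
  PsmData.ofCo (M := M.toTwoCat) X'.data

/-- The pseudomonoid in `M` that a 0-cell of `M₀₁` consists of. -/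
noncomputable def psm01 (M : SymMonTwoCat.{u}) (X : (obj01 M).C0) : PsmData M.toTwoCat :=
  let X' : Pseudomonoid M.toMonTwoCat := X
  X'.data

/-- The pseudomonoid structures in `M` that a 0-cell of `multiObj w M` carries: the first list holds
one pseudomonoid for each letter `(-)₁₀`, in the order of application, the second list holds one
pseudomonoid for each letter `(-)₀₁`, in the opposite order. -/
noncomputable def structures (M : SymMonTwoCat.{u}) : (w : List Bool) → (multiObj w M).C0 →
    List (PsmData M.toTwoCat) × List (PsmData M.toTwoCat)
  | [], _ => ([], [])
  | true :: w, X =>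
    let d := psm10 (multiObj w M) X
    let c := structures M w d.A
    (c.1 ++ [(multiForget M w).mapPsm d], c.2)
  | false :: w, X =>
    let d := psm01 (multiObj w M) X
    let c := structures M w d.A
    (c.1, (multiForget M w).mapPsm d :: c.2)

/-- The list of all pseudomonoid structures in `M` that a 0-cell of `multiObj w M` carries: first
those of the letters `(-)₁₀`, then those of the letters `(-)₀₁`. In this order, the multiplication
of each later structure is monoidal with respect to each earlier structure, and the multiplication of
each earlier structure is opmonoidal with respect to each later structure. -/
noncomputable def structureList (M : SymMonTwoCat.{u}) (w : List Bool) (X : (multiObj w M).C0) :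
    List (PsmData M.toTwoCat) :=
  (structures M w X).1 ++ (structures M w X).2

end TwoDim

open TwoDim

namespace TwoDim

open TwoCat MonTwoCat SymMonTwoCat

section Inverse

variable {M : TwoCat.{u}}

theorem co_hc (b a : M.C2) : M.co.hc b a = M.hc b a := by
  by_cases h : M.cod (M.src a) = M.dom (M.src b)
  · have h' : M.co.cod (M.co.src a) = M.co.dom (M.co.src b) :=
      (M.cod_tgt a).trans (h.trans (M.dom_tgt b).symm)
    exact (hc_def (M := M.co) h').trans (hc_def h).symm
  · have h' : ¬ M.co.cod (M.co.src a) = M.co.dom (M.co.src b) := fun h' =>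
      h ((M.cod_tgt a).symm.trans (h'.trans (M.dom_tgt b)))
    have e : M.co.hc b a = b := dif_neg h'
    have e' : M.hc b a = b := dif_neg h
    exact e.trans e'.symm

theorem co_vc {b a : M.C2} (h : M.tgt b = M.src a) : M.co.vc b a = M.vc a b :=
  (vc_def (M := M.co) h.symm).trans (vc_def h).symm

namespace TwoCat.IsInverse

theorem symm {a b : M.C2} (h : IsInverse a b) : IsInverse b a := by
  obtain ⟨hs, ht, h1, h2⟩ := h
  exact ⟨ht.symm, hs.symm, by rw [h2, hs], by rw [h1, ht]⟩

theorem unique {a b c : M.C2} (h : IsInverse a b) (h' : IsInverse a c) : b = c := by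
  obtain ⟨hs, ht, h1, h2⟩ := h
  obtain ⟨hs', ht', h1', h2'⟩ := h'
  have e := vc_assoc (c := c) (b := a) (a := b) ht hs'.symm
  rw [h1', h2, vc_id hs', id_vc ht] at e
  exact e

theorem co {a b : M.C2} (h : IsInverse a b) : IsInverse (M := M.co) a b := by
  obtain ⟨hs, ht, h1, h2⟩ := h
  exact ⟨ht, hs, (co_vc ht).trans h2, (co_vc hs.symm).trans h1⟩

theorem id (f : M.C1) : IsInverse (M := M) (𝟏f) (𝟏f) := by
  refine ⟨?_, ?_, ?_, ?_⟩ <;> simp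

theorem vc {a b a' b' : M.C2} (h : IsInverse a b) (h' : IsInverse a' b')
    (e : M.tgt a = M.src a') : IsInverse (a' ⬝ᵥ a) (b ⬝ᵥ b') := by
  obtain ⟨hs, ht, h1, h2⟩ := h
  obtain ⟨hs', ht', h1', h2'⟩ := h'
  refine ⟨?_, ?_, ?_, ?_⟩
  · simp [*]
  · simp [*]
  · rw [vc_assoc, ← vc_assoc (a := a), h1', id_vc, h1] <;> simp [*]
  · rw [vc_assoc, ← vc_assoc (a := b'), h2, id_vc, h2'] <;> simp [*]

theorem hc {a b a' b' : M.C2} (h : IsInverse a b) (h' : IsInverse a' b')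
    (e : M.cod (M.src a) = M.dom (M.src a')) : IsInverse (a' ⬝ₕ a) (b' ⬝ₕ b) := by
  obtain ⟨hs, ht, h1, h2⟩ := h
  obtain ⟨hs', ht', h1', h2'⟩ := h'
  refine ⟨?_, ?_, ?_, ?_⟩
  · simp [*]
  · simp [*]
  · rw [← hc_vc hs'.symm hs.symm e, h1, h1', hc_id_id, src_hc] <;> simp [*]
  · rw [← hc_vc ht' ht, h2, h2', hc_id_id, tgt_hc] <;> simp [*]

/-- Moving an invertible 2-cell on the left to the other side of an equation. -/
theorem vc_eq_iff {a b x y : M.C2} (h : IsInverse a b) (hx : M.tgt x = M.src a)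
    (hy : M.tgt y = M.tgt a) : a ⬝ᵥ x = y ↔ x = b ⬝ᵥ y := by
  obtain ⟨hs, ht, h1, h2⟩ := h
  constructor
  · rintro rfl
    rw [← vc_assoc hx hs.symm, h1, id_vc hx]
  · rintro rfl
    rw [← vc_assoc (by rw [hy, hs]) ht, h2, id_vc hy]

/-- Moving an invertible 2-cell on the right to the other side of an equation. -/
theorem eq_vc_iff {a b x y : M.C2} (h : IsInverse a b) (hx : M.src x = M.tgt a)
    (hy : M.src y = M.src a) : x ⬝ᵥ a = y ↔ x = y ⬝ᵥ b := by
  obtain ⟨hs, ht, h1, h2⟩ := h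
  constructor
  · rintro rfl
    rw [vc_assoc ht hx.symm, h2, vc_id hx]
  · rintro rfl
    rw [vc_assoc hs.symm (by rw [hy, ht]), h1, vc_id hy]

/-- Moving two invertible 2-cells to the other sides of an equation. -/
theorem vc_eq_vc_iff {a a' b b' x y : M.C2} (h : IsInverse a a') (h' : IsInverse b b')
    (hx : M.tgt x = M.src a) (hx' : M.src x = M.src b) (hy : M.src y = M.tgt b)
    (hy' : M.tgt y = M.tgt a) : a ⬝ᵥ x = y ⬝ᵥ b ↔ x ⬝ᵥ b' = a' ⬝ᵥ y := by
  have k := h'.2.1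
  rw [h.vc_eq_iff hx (by rw [tgt_vc hy.symm, hy']), ← vc_assoc hy.symm (by rw [hy', h.1]), eq_comm,
    h'.eq_vc_iff (by rw [src_vc (by rw [hy', h.1]), hy]) hx', eq_comm]

/-- Moving two invertible 2-cells to the other sides of an equation. -/
theorem vc_eq_right_iff {a a' b b' x : M.C2} (h : IsInverse a a') (h' : IsInverse b b')
    (hx : M.tgt x = M.src a) (hx' : M.src x = M.src b) (hy : M.tgt b = M.tgt a) :
    a ⬝ᵥ x = b ↔ x ⬝ᵥ b' = a' := by
  have e := h.vc_eq_vc_iff h' (y := 𝟏(M.tgt b)) hx hx' (by simp) (by simp [hy])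
  rwa [id_vc rfl, hy, vc_id h.1] at e

theorem map {N : TwoCat.{u}} (F : TwoFunctor M N) {a b : M.C2} (h : IsInverse a b) :
    IsInverse (F.map2 a) (F.map2 b) := by
  obtain ⟨hs, ht, h1, h2⟩ := h
  refine ⟨by simp [hs], by simp [ht], ?_, ?_⟩
  · rw [← F.map_vc hs.symm, h1]; simp
  · rw [← F.map_vc ht, h2]; simp

end TwoCat.IsInverse

theorem TwoCat.IsInvertible.inv2 {a : M.C2} (h : IsInvertible a) : IsInverse a (inv2 a) := by
  unfold TwoCat.inv2
  rw [dif_pos h]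
  exact h.choose_spec

theorem TwoCat.IsInverse.inv2_eq {a b : M.C2} (h : IsInverse a b) : TwoCat.inv2 a = b :=
  (TwoCat.IsInvertible.inv2 ⟨b, h⟩).unique h

theorem TwoCat.IsInvertible.inv2_inv2 {a : M.C2} (h : IsInvertible a) :
    TwoCat.inv2 (TwoCat.inv2 a) = a := h.inv2.symm.inv2_eq

theorem TwoCat.IsInvertible.co {a : M.C2} (h : IsInvertible a) : IsInvertible (M := M.co) a :=
  ⟨(TwoCat.inv2 a : M.C2), h.inv2.co⟩

theorem TwoCat.inv2_co {a : M.C2} : TwoCat.inv2 (M := M.co) a = TwoCat.inv2 a := by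
  by_cases h : IsInvertible a
  · exact h.inv2.co.inv2_eq
  · have h' : ¬ IsInvertible (M := M.co) a := fun h' => h (TwoCat.IsInvertible.co (M := M.co) h')
    have e : TwoCat.inv2 (M := M.co) a = a := dif_neg h'
    have e' : TwoCat.inv2 a = a := dif_neg h
    exact e.trans e'.symm

end Inverse

section

variable {M : MonTwoCat.{u}}

theorem TwoCat.IsInverse.t {a b a' b' : M.C2} (h : IsInverse a b) (h' : IsInverse a' b') :
    IsInverse (a ⊗₂ a') (b ⊗₂ b') := by
  obtain ⟨hs, ht, h1, h2⟩ := h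
  obtain ⟨hs', ht', h1', h2'⟩ := h'
  refine ⟨by simp [*], by simp [*], ?_, ?_⟩
  · rw [← t_vc hs.symm hs'.symm, h1, h1']; simp
  · rw [← t_vc ht ht', h2, h2']; simp

/-- Pseudomonoid data with the 2-cells inverted. -/
noncomputable def PsmData.toCo {M : TwoCat.{u}} (d : PsmData M) : PsmData M.co :=
  PsmData.ofCo (M := M.co) d

theorem PsmData.toCo_eq {M : TwoCat.{u}} (d : PsmData M) :
    d.toCo = PsmData.mk (M := M.co) d.A d.m d.u (inv2 (M := M) d.α) (inv2 (M := M) d.lam)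
      (inv2 (M := M) d.rho) :=
  PsmData.ext (M := M.co) rfl rfl rfl (inv2_co (M := M) (a := d.α))
    (inv2_co (M := M) (a := d.lam)) (inv2_co (M := M) (a := d.rho))

theorem PsmData.ofCo_toCo {M : MonTwoCat.{u}} {d : PsmData M.toTwoCat} (hd : IsPseudomonoid M d) :
    d.toCo.ofCo = d := by
  rw [PsmData.toCo_eq]
  exact PsmData.ext (M := M.toTwoCat) rfl rfl rfl (IsInvertible.inv2_inv2 (M := M.toTwoCat) hd.inv_α)
    (IsInvertible.inv2_inv2 (M := M.toTwoCat) hd.inv_lam)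
    (IsInvertible.inv2_inv2 (M := M.toTwoCat) hd.inv_rho)

theorem co_vc_congr {M : TwoCat.{u}} {b a : M.co.C2} {b' a' : M.C2} (hb : (b : M.C2) = b')
    (ha : (a : M.C2) = a') (h : M.tgt b' = M.src a') : M.co.vc b a = M.vc a' b' := by
  subst hb ha; exact co_vc h

/-- Inverting the 2-cells turns a pseudomonoid in `M` into one in `M^co`. -/
theorem IsPseudomonoid.toCo {d : PsmData M.toTwoCat} (hd : IsPseudomonoid M d) :
    IsPseudomonoid M.co d.toCo := by
  obtain ⟨dm, cm, du, cu, sα, tα, sl, tl, sr, tr, iα, il, ir, pen, tri⟩ := hd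
  have jα := iα.inv2
  have jl := il.inv2
  have jr := ir.inv2
  suffices h : ∀ α l r : M.C2, IsInverse d.α α → IsInverse d.lam l → IsInverse d.rho r →
      IsPseudomonoid M.co (PsmData.mk (M := M.toTwoCat.co) d.A d.m d.u α l r) by
    rw [PsmData.toCo_eq]; exact h (inv2 (M := M.toTwoCat) d.α) (inv2 (M := M.toTwoCat) d.lam)
      (inv2 (M := M.toTwoCat) d.rho) jα jl jr
  clear jα jl jr
  intro α l r jα jl jr
  have kα := jα
  have kl := jl
  have kr := jr
  obtain ⟨bs, bt, -, -⟩ := jα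
  obtain ⟨ls, lt, -, -⟩ := jl
  obtain ⟨rs, rt, -, -⟩ := jr
  have iA := IsInverse.id (M := M.toTwoCat) (M.id1 d.A)
  have im := IsInverse.id (M := M.toTwoCat) d.m
  have E1 : (d.m ⬝₁ (M.id1 d.A ⊗₁ d.m)) ⊗₁ M.id1 d.A =
      (d.m ⊗₁ M.id1 d.A) ⬝₁ (M.id1 d.A ⊗₁ d.m ⊗₁ M.id1 d.A) := by
    rw [← t1_assoc, ← t_c] <;> simp [*]
  have E2 : M.id1 d.A ⊗₁ (d.m ⬝₁ (d.m ⊗₁ M.id1 d.A)) =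
      (M.id1 d.A ⊗₁ d.m) ⬝₁ (M.id1 d.A ⊗₁ d.m ⊗₁ M.id1 d.A) := by
    rw [← t_c] <;> simp [*]
  have E3 : (d.m ⊗₁ M.id1 d.A) ⬝₁ (M.id1 d.A ⊗₁ M.id1 d.A ⊗₁ d.m) =
      (M.id1 d.A ⊗₁ d.m) ⬝₁ (d.m ⊗₁ M.id1 (d.A ⊗₀ d.A)) := by
    rw [← t_id1, ← t1_assoc, ← t1_assoc, ← t_c, t1_assoc, ← t1_assoc d.m, t1_assoc d.m, ← t_c] <;>
      simp [*]
  have E4 : (M.id1 d.A ⊗₁ d.m) ⬝₁ (M.id1 d.A ⊗₁ d.u ⊗₁ M.id1 d.A) =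
      M.id1 d.A ⊗₁ (d.m ⬝₁ (d.u ⊗₁ M.id1 d.A)) := by
    rw [← t_c] <;> simp [*]
  have T1 := (iA.t kα).hc im (by simp (maxDischargeDepth := 9) [*])
  have T2 := (IsInverse.id (M := M.toTwoCat) (M.id1 d.A ⊗₁ d.m ⊗₁ M.id1 d.A)).hc kα
    (by simp (maxDischargeDepth := 9) [*])
  have T3 := (kα.t iA).hc im (by simp (maxDischargeDepth := 9) [*])
  have T4 := (IsInverse.id (M := M.toTwoCat) (M.id1 d.A ⊗₁ M.id1 d.A ⊗₁ d.m)).hc kα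
    (by simp (maxDischargeDepth := 9) [*])
  have T5 := (IsInverse.id (M := M.toTwoCat) (d.m ⊗₁ M.id1 d.A ⊗₁ M.id1 d.A)).hc kα
    (by simp (maxDischargeDepth := 9) [*])
  have T6 := (iA.t kl).hc im (by simp (maxDischargeDepth := 9) [*])
  have T7 := (IsInverse.id (M := M.toTwoCat) (M.id1 d.A ⊗₁ d.u ⊗₁ M.id1 d.A)).hc kα
    (by simp (maxDischargeDepth := 9) [*])
  have T8 := (kr.t iA).hc im (by simp (maxDischargeDepth := 9) [*])
  have P := (T3.vc T2 (by simp (maxDischargeDepth := 9) [*, c_assoc])).vc T1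
    (by simp (maxDischargeDepth := 9) [*, c_assoc])
  have P' := T5.vc T4 (by simp (maxDischargeDepth := 9) [*, c_assoc])
  have Q := T7.vc T6 (by simp (maxDischargeDepth := 9) [*, c_assoc])
  rw [pen] at P
  rw [tri] at Q
  have P'' := P.unique P'
  have Q'' := Q.unique T8
  have L : M.toTwoCat.co.vc (M.toTwoCat.co.hc (𝟏(d.m)) ((𝟏(M.id1 d.A)) ⊗₂ α))
      (M.toTwoCat.co.vc (M.toTwoCat.co.hc α (𝟏(M.id1 d.A ⊗₁ d.m ⊗₁ M.id1 d.A)))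
        (M.toTwoCat.co.hc (𝟏(d.m)) (α ⊗₂ 𝟏(M.id1 d.A)))) =
      ((𝟏(d.m) ⬝ₕ (α ⊗₂ 𝟏(M.id1 d.A))) ⬝ᵥ (α ⬝ₕ 𝟏(M.id1 d.A ⊗₁ d.m ⊗₁ M.id1 d.A))) ⬝ᵥ
        (𝟏(d.m) ⬝ₕ (𝟏(M.id1 d.A) ⊗₂ α)) :=
    co_vc_congr (co_hc _ _) (co_vc_congr (co_hc _ _) (co_hc _ _)
      (by simp (maxDischargeDepth := 9) [*, c_assoc]))
      (by simp (maxDischargeDepth := 9) [*, c_assoc])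
  have L' : M.toTwoCat.co.vc (M.toTwoCat.co.hc α (𝟏(M.id1 d.A ⊗₁ M.id1 d.A ⊗₁ d.m)))
      (M.toTwoCat.co.hc α (𝟏(d.m ⊗₁ M.id1 d.A ⊗₁ M.id1 d.A))) =
      (α ⬝ₕ 𝟏(d.m ⊗₁ M.id1 d.A ⊗₁ M.id1 d.A)) ⬝ᵥ (α ⬝ₕ 𝟏(M.id1 d.A ⊗₁ M.id1 d.A ⊗₁ d.m)) :=
    co_vc_congr (co_hc _ _) (co_hc _ _) (by simp (maxDischargeDepth := 9) [*, c_assoc])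
  have K : M.toTwoCat.co.vc (M.toTwoCat.co.hc (𝟏(d.m)) (𝟏(M.id1 d.A) ⊗₂ l))
      (M.toTwoCat.co.hc α (𝟏(M.id1 d.A ⊗₁ d.u ⊗₁ M.id1 d.A))) =
      (α ⬝ₕ 𝟏(M.id1 d.A ⊗₁ d.u ⊗₁ M.id1 d.A)) ⬝ᵥ (𝟏(d.m) ⬝ₕ (𝟏(M.id1 d.A) ⊗₂ l)) :=
    co_vc_congr (co_hc _ _) (co_hc _ _) (by simp (maxDischargeDepth := 9) [*, c_assoc])
  exact IsPseudomonoid.mk (M := M.co) dm cm du cu (bt.trans sα) (bs.trans tα) (lt.trans sl)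
    (ls.trans tl) (rt.trans sr) (rs.trans tr) ⟨d.α, kα.symm.co⟩ ⟨d.lam, kl.symm.co⟩
    ⟨d.rho, kr.symm.co⟩ (L.trans (P''.trans L'.symm))
    (K.trans (Q''.trans (co_hc (M := M.toTwoCat) _ _).symm))

theorem IsPseudomonoid.ofCo {d : PsmData M.toTwoCat.co} (hd : IsPseudomonoid M.co d) :
    IsPseudomonoid M d.ofCo := IsPseudomonoid.toCo (M := M.co) hd

theorem PsmData.toCo_ofCo {M : MonTwoCat.{u}} {d : PsmData M.toTwoCat.co}
    (hd : IsPseudomonoid M.co d) : d.ofCo.toCo = d := PsmData.ofCo_toCo (M := M.co) hd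

/-- The data of an (op)monoidal 1-cell in `M`, seen in `M^co`. -/
def CellData.co {M : TwoCat.{u}} (c : CellData M) : CellData M.co := ⟨c.f, c.φ2, c.φ0⟩

/-- Monoidal 1-cells in `M` are opmonoidal 1-cells in `M^co`. -/
theorem isOpmonoidal1_co_iff {d d' : PsmData M.toTwoCat} {c : CellData M.toTwoCat}
    (hd : IsPseudomonoid M d) (hd' : IsPseudomonoid M d') :
    IsOpmonoidal1 M.co d.toCo d'.toCo c.co ↔ IsMonoidal1 M d d' c := by
  obtain ⟨dm, cm, du, cu, sα, tα, sl, tl, sr, tr, iα, il, ir, -, -⟩ := hd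
  obtain ⟨dm', cm', du', cu', sα', tα', sl', tl', sr', tr', iα', il', ir', -, -⟩ := hd'
  have jα := iα.inv2
  have jl := il.inv2
  have jr := ir.inv2
  have jα' := iα'.inv2
  have jl' := il'.inv2
  have jr' := ir'.inv2
  rw [PsmData.toCo_eq, PsmData.toCo_eq]
  suffices h : ∀ α l r α' l' r' : M.C2, IsInverse d.α α → IsInverse d.lam l → IsInverse d.rho r →
      IsInverse d'.α α' → IsInverse d'.lam l' → IsInverse d'.rho r' →
      (IsOpmonoidal1 M.co (PsmData.mk (M := M.toTwoCat.co) d.A d.m d.u α l r)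
      (PsmData.mk (M := M.toTwoCat.co) d'.A d'.m d'.u α' l' r') c.co ↔ IsMonoidal1 M d d' c) from
    h (inv2 (M := M.toTwoCat) d.α) (inv2 (M := M.toTwoCat) d.lam) (inv2 (M := M.toTwoCat) d.rho)
      (inv2 (M := M.toTwoCat) d'.α) (inv2 (M := M.toTwoCat) d'.lam) (inv2 (M := M.toTwoCat) d'.rho)
      jα jl jr jα' jl' jr'
  clear jα jl jr jα' jl' jr'
  intro α l r α' l' r' jα jl jr jα' jl' jr'
  by_cases T : (M.dom c.f = d.A ∧ M.cod c.f = d'.A ∧ M.src c.φ2 = d'.m ⬝₁ (c.f ⊗₁ c.f) ∧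
      M.tgt c.φ2 = c.f ⬝₁ d.m ∧ M.src c.φ0 = d'.u ∧ M.tgt c.φ0 = c.f ⬝₁ d.u)
  swap
  · constructor
    · intro h
      exact absurd ⟨h.dom_f, h.cod_f, h.tgt_φ2, h.src_φ2, h.tgt_φ0, h.src_φ0⟩ T
    · intro h
      exact absurd ⟨h.dom_f, h.cod_f, h.src_φ2, h.tgt_φ2, h.src_φ0, h.tgt_φ0⟩ T
  obtain ⟨df, cf, s2, t2', s0, t0'⟩ := T
  have E1 : (c.f ⬝₁ d.m) ⊗₁ c.f = (c.f ⊗₁ c.f) ⬝₁ (d.m ⊗₁ M.id1 d.A) := by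
    rw [← t_c] <;> simp [*]
  have E2 : c.f ⊗₁ (c.f ⬝₁ d.m) = (c.f ⊗₁ c.f) ⬝₁ (M.id1 d.A ⊗₁ d.m) := by
    rw [← t_c] <;> simp [*]
  have E3 : (d'.m ⬝₁ (c.f ⊗₁ c.f)) ⊗₁ c.f = (d'.m ⊗₁ M.id1 d'.A) ⬝₁ (c.f ⊗₁ c.f ⊗₁ c.f) := by
    rw [← t1_assoc c.f, ← t_c] <;> simp [*]
  have E4 : c.f ⊗₁ (d'.m ⬝₁ (c.f ⊗₁ c.f)) = (M.id1 d'.A ⊗₁ d'.m) ⬝₁ (c.f ⊗₁ c.f ⊗₁ c.f) := by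
    rw [← t_c] <;> simp [*]
  have E5 : (c.f ⬝₁ d.u) ⊗₁ c.f = (c.f ⊗₁ c.f) ⬝₁ (d.u ⊗₁ M.id1 d.A) := by
    rw [← t_c] <;> simp [*]
  have E6 : c.f ⊗₁ (c.f ⬝₁ d.u) = (c.f ⊗₁ c.f) ⬝₁ (M.id1 d.A ⊗₁ d.u) := by
    rw [← t_c] <;> simp [*]
  have E7 : d'.u ⊗₁ c.f = (d'.u ⊗₁ M.id1 d'.A) ⬝₁ c.f := by
    conv_rhs => rw [← unit_t1 c.f, ← t_c (by simp [*]) (by simp [*])]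
    simp [*]
  have E8 : c.f ⊗₁ d'.u = (M.id1 d'.A ⊗₁ d'.u) ⬝₁ c.f := by
    conv_rhs => rw [← t1_unit c.f, ← t_c (by simp [*]) (by simp [*])]
    simp [*]
  have jf := IsInverse.id (M := M.toTwoCat) c.f
  have jfff := IsInverse.id (M := M.toTwoCat) (c.f ⊗₁ c.f ⊗₁ c.f)
  have F1 := jα.hc jf (by simp (maxDischargeDepth := 9) [*])
  have F2 := jfff.hc jα' (by simp (maxDischargeDepth := 9) [*])
  have F3 := jl.hc jf (by simp (maxDischargeDepth := 9) [*])
  have F4 := jf.hc jl' (by simp (maxDischargeDepth := 9) [*])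
  have F5 := jr.hc jf (by simp (maxDischargeDepth := 9) [*])
  have F6 := jf.hc jr' (by simp (maxDischargeDepth := 9) [*])
  obtain ⟨bs, bt, -, -⟩ := jα
  obtain ⟨ls, lt, -, -⟩ := jl
  obtain ⟨rs, rt, -, -⟩ := jr
  obtain ⟨bs', bt', -, -⟩ := jα'
  obtain ⟨ls', lt', -, -⟩ := jl'
  obtain ⟨rs', rt', -, -⟩ := jr'
  have A1 := F1.vc_eq_vc_iff F2 (x := (c.φ2 ⬝ₕ 𝟏(d.m ⊗₁ M.id1 d.A)) ⬝ᵥ (𝟏(d'.m) ⬝ₕ (c.φ2 ⊗₂ 𝟏(c.f))))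
    (y := (c.φ2 ⬝ₕ 𝟏(M.id1 d.A ⊗₁ d.m)) ⬝ᵥ (𝟏(d'.m) ⬝ₕ (𝟏(c.f) ⊗₂ c.φ2)))
    (by simp (maxDischargeDepth := 9) [*, c_assoc]) (by simp (maxDischargeDepth := 9) [*, c_assoc])
    (by simp (maxDischargeDepth := 9) [*, c_assoc]) (by simp (maxDischargeDepth := 9) [*, c_assoc])
  have A2 := F3.vc_eq_right_iff F4 (x := (c.φ2 ⬝ₕ 𝟏(d.u ⊗₁ M.id1 d.A)) ⬝ᵥ (𝟏(d'.m) ⬝ₕ (c.φ0 ⊗₂ 𝟏(c.f))))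
    (by simp (maxDischargeDepth := 9) [*, c_assoc]) (by simp (maxDischargeDepth := 9) [*, c_assoc])
    (by simp (maxDischargeDepth := 9) [*, c_assoc])
  have A3 := F5.vc_eq_right_iff F6 (x := (c.φ2 ⬝ₕ 𝟏(M.id1 d.A ⊗₁ d.u)) ⬝ᵥ (𝟏(d'.m) ⬝ₕ (𝟏(c.f) ⊗₂ c.φ0)))
    (by simp (maxDischargeDepth := 9) [*, c_assoc]) (by simp (maxDischargeDepth := 9) [*, c_assoc])
    (by simp (maxDischargeDepth := 9) [*, c_assoc])
  have B1 : M.toTwoCat.co.vc (M.toTwoCat.co.hc α' (𝟏(c.f ⊗₁ c.f ⊗₁ c.f)))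
      (M.toTwoCat.co.vc (M.toTwoCat.co.hc (𝟏(d'.m)) (c.φ2 ⊗₂ 𝟏(c.f)))
        (M.toTwoCat.co.hc c.φ2 (𝟏(d.m ⊗₁ M.id1 d.A)))) =
      ((c.φ2 ⬝ₕ 𝟏(d.m ⊗₁ M.id1 d.A)) ⬝ᵥ (𝟏(d'.m) ⬝ₕ (c.φ2 ⊗₂ 𝟏(c.f)))) ⬝ᵥ
        (α' ⬝ₕ 𝟏(c.f ⊗₁ c.f ⊗₁ c.f)) :=
    co_vc_congr (co_hc _ _) (co_vc_congr (co_hc _ _) (co_hc _ _)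
      (by simp (maxDischargeDepth := 9) [*, c_assoc]))
      (by simp (maxDischargeDepth := 9) [*, c_assoc])
  have B2 : M.toTwoCat.co.vc (M.toTwoCat.co.hc (𝟏(d'.m)) (𝟏(c.f) ⊗₂ c.φ2))
      (M.toTwoCat.co.vc (M.toTwoCat.co.hc c.φ2 (𝟏(M.id1 d.A ⊗₁ d.m)))
        (M.toTwoCat.co.hc (𝟏(c.f)) α)) =
      ((𝟏(c.f) ⬝ₕ α) ⬝ᵥ (c.φ2 ⬝ₕ 𝟏(M.id1 d.A ⊗₁ d.m))) ⬝ᵥ (𝟏(d'.m) ⬝ₕ (𝟏(c.f) ⊗₂ c.φ2)) :=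
    co_vc_congr (co_hc _ _) (co_vc_congr (co_hc _ _) (co_hc _ _)
      (by simp (maxDischargeDepth := 9) [*, c_assoc]))
      (by simp (maxDischargeDepth := 9) [*, c_assoc])
  have B3 : M.toTwoCat.co.vc (M.toTwoCat.co.hc l' (𝟏(c.f)))
      (M.toTwoCat.co.vc (M.toTwoCat.co.hc (𝟏(d'.m)) (c.φ0 ⊗₂ 𝟏(c.f)))
        (M.toTwoCat.co.hc c.φ2 (𝟏(d.u ⊗₁ M.id1 d.A)))) =
      ((c.φ2 ⬝ₕ 𝟏(d.u ⊗₁ M.id1 d.A)) ⬝ᵥ (𝟏(d'.m) ⬝ₕ (c.φ0 ⊗₂ 𝟏(c.f)))) ⬝ᵥ (l' ⬝ₕ 𝟏(c.f)) :=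
    co_vc_congr (co_hc _ _) (co_vc_congr (co_hc _ _) (co_hc _ _)
      (by simp (maxDischargeDepth := 9) [*, c_assoc]))
      (by simp (maxDischargeDepth := 9) [*, c_assoc])
  have B4 : M.toTwoCat.co.vc (M.toTwoCat.co.hc r' (𝟏(c.f)))
      (M.toTwoCat.co.vc (M.toTwoCat.co.hc (𝟏(d'.m)) (𝟏(c.f) ⊗₂ c.φ0))
        (M.toTwoCat.co.hc c.φ2 (𝟏(M.id1 d.A ⊗₁ d.u)))) =
      ((c.φ2 ⬝ₕ 𝟏(M.id1 d.A ⊗₁ d.u)) ⬝ᵥ (𝟏(d'.m) ⬝ₕ (𝟏(c.f) ⊗₂ c.φ0))) ⬝ᵥ (r' ⬝ₕ 𝟏(c.f)) :=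
    co_vc_congr (co_hc _ _) (co_vc_congr (co_hc _ _) (co_hc _ _)
      (by simp (maxDischargeDepth := 9) [*, c_assoc]))
      (by simp (maxDischargeDepth := 9) [*, c_assoc])
  have K1 : (c.φ2 ⬝ₕ 𝟏(M.id1 d.A ⊗₁ d.m)) ⬝ᵥ
      (𝟏(d'.m) ⬝ₕ (𝟏(c.f) ⊗₂ c.φ2)) ⬝ᵥ (d'.α ⬝ₕ 𝟏(c.f ⊗₁ c.f ⊗₁ c.f)) =
      ((c.φ2 ⬝ₕ 𝟏(M.id1 d.A ⊗₁ d.m)) ⬝ᵥ (𝟏(d'.m) ⬝ₕ (𝟏(c.f) ⊗₂ c.φ2))) ⬝ᵥ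
        (d'.α ⬝ₕ 𝟏(c.f ⊗₁ c.f ⊗₁ c.f)) := by
    rw [vc_assoc] <;> simp (maxDischargeDepth := 9) [*, c_assoc]
  have K2 : ((𝟏(c.f) ⬝ₕ α) ⬝ᵥ (c.φ2 ⬝ₕ 𝟏(M.id1 d.A ⊗₁ d.m))) ⬝ᵥ (𝟏(d'.m) ⬝ₕ (𝟏(c.f) ⊗₂ c.φ2)) =
      (𝟏(c.f) ⬝ₕ α) ⬝ᵥ (c.φ2 ⬝ₕ 𝟏(M.id1 d.A ⊗₁ d.m)) ⬝ᵥ (𝟏(d'.m) ⬝ₕ (𝟏(c.f) ⊗₂ c.φ2)) := by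
    rw [vc_assoc] <;> simp (maxDischargeDepth := 9) [*, c_assoc]
  constructor
  · intro h
    refine ⟨df, cf, s2, t2', s0, t0', ?_, ?_, ?_⟩
    · rw [K1, A1]
      exact B1.symm.trans (h.coassoc.trans (B2.trans K2))
    · exact A2.2 (B3.symm.trans (h.counit_left.trans (co_hc (M := M.toTwoCat) _ _)))
    · exact A3.2 (B4.symm.trans (h.counit_right.trans (co_hc (M := M.toTwoCat) _ _)))
  · rintro ⟨-, -, -, -, -, -, h1, h2, h3⟩
    rw [K1, A1] at h1
    exact IsOpmonoidal1.mk (M := M.co) df cf t2' s2 t0' s0 (B1.trans (h1.trans (K2.symm.trans B2.symm)))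
      (B3.trans ((A2.1 h2).trans (co_hc (M := M.toTwoCat) _ _).symm))
      (B4.trans ((A3.1 h3).trans (co_hc (M := M.toTwoCat) _ _).symm))

end

/-- Monoidal 2-cells in `M` are opmonoidal 2-cells in `M^co`. -/
theorem isOpmonoidal2_co_iff {M : MonTwoCat.{u}} {d d' : PsmData M.toTwoCat}
    {e e' : PsmData M.toTwoCat.co} {c c' : CellData M.toTwoCat} {ω : M.C2}
    (hm : e.m = d.m) (hu : e.u = d.u) (hm' : e'.m = d'.m) (dm : M.dom d.m = d.A ⊗₀ d.A)
    (cm : M.cod d.m = d.A) (cu : M.cod d.u = d.A) (dm' : M.dom d'.m = d'.A ⊗₀ d'.A)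
    (cf : M.dom c.f = d.A) (cf' : M.cod c.f = d'.A)
    (s : M.src c.φ2 = d'.m ⬝₁ (c.f ⊗₁ c.f)) (t : M.tgt c.φ2 = c.f ⬝₁ d.m)
    (s' : M.src c'.φ2 = d'.m ⬝₁ (c'.f ⊗₁ c'.f)) (t0 : M.tgt c.φ0 = c.f ⬝₁ d.u) :
    IsOpmonoidal2 M.co e e' c'.co c.co ω ↔ IsMonoidal2 M d d' c c' ω := by
  by_cases T : M.src ω = c.f ∧ M.tgt ω = c'.f
  swap
  · exact ⟨fun h => absurd ⟨h.tgt_ω, h.src_ω⟩ T, fun h => absurd ⟨h.src_ω, h.tgt_ω⟩ T⟩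
  obtain ⟨sω, tω⟩ := T
  obtain ⟨eA, em, eu, eα, el, er⟩ := e
  obtain ⟨eA', em', eu', eα', el', er'⟩ := e'
  dsimp only at hm hu hm'
  subst hm hu hm'
  have B1 : M.toTwoCat.co.vc (M.toTwoCat.co.hc (𝟏(d'.m)) (ω ⊗₂ ω)) c'.φ2 =
      c'.φ2 ⬝ᵥ (𝟏(d'.m) ⬝ₕ (ω ⊗₂ ω)) :=
    co_vc_congr (co_hc _ _) rfl (by simp (maxDischargeDepth := 9) [*, c_assoc])
  have B2 : M.toTwoCat.co.vc c.φ2 (M.toTwoCat.co.hc ω (𝟏(d.m))) =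
      (ω ⬝ₕ 𝟏(d.m)) ⬝ᵥ c.φ2 :=
    co_vc_congr rfl (co_hc _ _) (by simp (maxDischargeDepth := 9) [*, c_assoc])
  have B3 : M.toTwoCat.co.vc c.φ0 (M.toTwoCat.co.hc ω (𝟏(d.u))) = (ω ⬝ₕ 𝟏(d.u)) ⬝ᵥ c.φ0 :=
    co_vc_congr rfl (co_hc _ _) (by simp (maxDischargeDepth := 9) [*, c_assoc])
  constructor
  · intro h
    exact ⟨sω, tω, B2.symm.trans (h.binary.symm.trans B1), B3.symm.trans h.nullary.symm⟩
  · intro h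
    exact IsOpmonoidal2.mk (M := M.co) tω sω (B1.trans (h.binary.symm.trans B2.symm))
      (h.nullary.symm.trans B3.symm)

section Reflect

variable {P M : MonTwoCat.{u}}

/-- A 2-functor that is faithful on 2-cells. -/
def TwoFunctor.LocallyFaithful {P M : TwoCat.{u}} (F : TwoFunctor P M) : Prop :=
  ∀ a b, P.src a = P.src b → P.tgt a = P.tgt b → F.map2 a = F.map2 b → a = b

/-- A strict monoidal 2-functor that is faithful on 2-cells and reflects invertible 2-cells
reflects pseudomonoids. -/
theorem IsPseudomonoid.of_map {F : TwoFunctor P.toTwoCat M.toTwoCat} (hF : IsStrictMonoidal F)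
    (ff : F.LocallyFaithful)
    (ri : ∀ a, IsInvertible (F.map2 a) → IsInvertible a) {d : PsmData P.toTwoCat}
    (dm : P.dom d.m = d.A ⊗₀ d.A) (cm : P.cod d.m = d.A) (du : P.dom d.u = P.unit)
    (cu : P.cod d.u = d.A) (sα : P.src d.α = d.m ⬝₁ (d.m ⊗₁ P.id1 d.A))
    (tα : P.tgt d.α = d.m ⬝₁ (P.id1 d.A ⊗₁ d.m)) (sl : P.src d.lam = d.m ⬝₁ (d.u ⊗₁ P.id1 d.A))
    (tl : P.tgt d.lam = P.id1 d.A) (sr : P.src d.rho = d.m ⬝₁ (P.id1 d.A ⊗₁ d.u))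
    (tr : P.tgt d.rho = P.id1 d.A)
    (h : IsPseudomonoid M ⟨F.map0 d.A, F.map1 d.m, F.map1 d.u, F.map2 d.α, F.map2 d.lam,
      F.map2 d.rho⟩) : IsPseudomonoid P d := by
  have E1 : (d.m ⬝₁ (P.id1 d.A ⊗₁ d.m)) ⊗₁ P.id1 d.A =
      (d.m ⊗₁ P.id1 d.A) ⬝₁ (P.id1 d.A ⊗₁ d.m ⊗₁ P.id1 d.A) := by
    rw [← t1_assoc, ← t_c] <;> simp [*]
  have E2 : P.id1 d.A ⊗₁ (d.m ⬝₁ (d.m ⊗₁ P.id1 d.A)) =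
      (P.id1 d.A ⊗₁ d.m) ⬝₁ (P.id1 d.A ⊗₁ d.m ⊗₁ P.id1 d.A) := by
    rw [← t_c] <;> simp [*]
  have E3 : (d.m ⊗₁ P.id1 d.A) ⬝₁ (P.id1 d.A ⊗₁ P.id1 d.A ⊗₁ d.m) =
      (P.id1 d.A ⊗₁ d.m) ⬝₁ (d.m ⊗₁ P.id1 (d.A ⊗₀ d.A)) := by
    rw [← t_id1, ← t1_assoc, ← t1_assoc, ← t_c, t1_assoc, ← t1_assoc d.m, t1_assoc d.m, ← t_c] <;>
      simp [*]
  have E4 : (P.id1 d.A ⊗₁ d.m) ⬝₁ (P.id1 d.A ⊗₁ d.u ⊗₁ P.id1 d.A) =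
      P.id1 d.A ⊗₁ (d.m ⬝₁ (d.u ⊗₁ P.id1 d.A)) := by
    rw [← t_c] <;> simp [*]
  have E5 : (d.m ⬝₁ (d.m ⊗₁ P.id1 d.A)) ⊗₁ P.id1 d.A =
      (d.m ⊗₁ P.id1 d.A) ⬝₁ (d.m ⊗₁ P.id1 (d.A ⊗₀ d.A)) := by
    rw [← t_id1, ← t1_assoc, ← t_c] <;> simp [*]
  have E6 : P.id1 d.A ⊗₁ (d.m ⬝₁ (P.id1 d.A ⊗₁ d.m)) =
      (P.id1 d.A ⊗₁ d.m) ⬝₁ (P.id1 d.A ⊗₁ P.id1 d.A ⊗₁ d.m) := by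
    rw [← t_c] <;> simp [*]
  have E7 : (d.m ⬝₁ (P.id1 d.A ⊗₁ d.u)) ⊗₁ P.id1 d.A =
      (d.m ⊗₁ P.id1 d.A) ⬝₁ (P.id1 d.A ⊗₁ d.u ⊗₁ P.id1 d.A) := by
    rw [← t1_assoc, ← t_c] <;> simp [*]
  have pen := h.pentagon
  have tri := h.triangle
  refine ⟨dm, cm, du, cu, sα, tα, sl, tl, sr, tr, ri _ h.inv_α, ri _ h.inv_lam, ri _ h.inv_rho,
    ff _ _ ?_ ?_ ?_, ff _ _ ?_ ?_ ?_⟩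
  · clear pen tri
    simp (maxDischargeDepth := 9) [*, c_assoc]
  · clear pen tri
    simp (maxDischargeDepth := 9) [*, c_assoc]
  · simp only [← F.map_id1, ← F.map_id2, ← hF.map_t1, ← hF.map_t2] at pen
    rw [← F.map_hc, ← F.map_hc, ← F.map_hc, ← F.map_hc, ← F.map_hc, ← F.map_vc, ← F.map_vc,
      ← F.map_vc] at pen
    · exact pen
    all_goals clear pen tri
    all_goals simp (maxDischargeDepth := 9) [*, c_assoc]
  · clear pen tri
    simp (maxDischargeDepth := 9) [*, c_assoc]
  · clear pen tri
    simp (maxDischargeDepth := 9) [*, c_assoc]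
  · simp only [← F.map_id1, ← F.map_id2, ← hF.map_t1, ← hF.map_t2] at tri
    rw [← F.map_hc, ← F.map_hc, ← F.map_hc, ← F.map_vc] at tri
    · exact tri
    all_goals clear pen tri
    all_goals simp (maxDischargeDepth := 9) [*, c_assoc]

/-- A strict monoidal 2-functor that is faithful on 2-cells reflects opmonoidal 1-cells. -/
theorem IsOpmonoidal1.of_map {F : TwoFunctor P.toTwoCat M.toTwoCat} (hF : IsStrictMonoidal F)
    (ff : F.LocallyFaithful) {d d' : PsmData P.toTwoCat} {c : CellData P.toTwoCat}
    (hd : IsPseudomonoid P d) (hd' : IsPseudomonoid P d')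
    (df : P.dom c.f = d.A) (cf : P.cod c.f = d'.A) (s2 : P.src c.φ2 = c.f ⬝₁ d.m)
    (t2' : P.tgt c.φ2 = d'.m ⬝₁ (c.f ⊗₁ c.f)) (s0 : P.src c.φ0 = c.f ⬝₁ d.u)
    (t0' : P.tgt c.φ0 = d'.u)
    (h : IsOpmonoidal1 M ⟨F.map0 d.A, F.map1 d.m, F.map1 d.u, F.map2 d.α, F.map2 d.lam,
      F.map2 d.rho⟩ ⟨F.map0 d'.A, F.map1 d'.m, F.map1 d'.u, F.map2 d'.α, F.map2 d'.lam,
      F.map2 d'.rho⟩ ⟨F.map1 c.f, F.map2 c.φ2, F.map2 c.φ0⟩) : IsOpmonoidal1 P d d' c := by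
  obtain ⟨dm, cm, du, cu, sα, tα, sl, tl, sr, tr, -, -, -, -, -⟩ := hd
  obtain ⟨dm', cm', du', cu', sα', tα', sl', tl', sr', tr', -, -, -, -, -⟩ := hd'
  have E1 : (c.f ⬝₁ d.m) ⊗₁ c.f = (c.f ⊗₁ c.f) ⬝₁ (d.m ⊗₁ P.id1 d.A) := by
    rw [← t_c] <;> simp [*]
  have E2 : c.f ⊗₁ (c.f ⬝₁ d.m) = (c.f ⊗₁ c.f) ⬝₁ (P.id1 d.A ⊗₁ d.m) := by
    rw [← t_c] <;> simp [*]
  have E3 : (d'.m ⬝₁ (c.f ⊗₁ c.f)) ⊗₁ c.f = (d'.m ⊗₁ P.id1 d'.A) ⬝₁ (c.f ⊗₁ c.f ⊗₁ c.f) := by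
    rw [← t1_assoc c.f, ← t_c] <;> simp [*]
  have E4 : c.f ⊗₁ (d'.m ⬝₁ (c.f ⊗₁ c.f)) = (P.id1 d'.A ⊗₁ d'.m) ⬝₁ (c.f ⊗₁ c.f ⊗₁ c.f) := by
    rw [← t_c] <;> simp [*]
  have E5 : (c.f ⬝₁ d.u) ⊗₁ c.f = (c.f ⊗₁ c.f) ⬝₁ (d.u ⊗₁ P.id1 d.A) := by
    rw [← t_c] <;> simp [*]
  have E6 : c.f ⊗₁ (c.f ⬝₁ d.u) = (c.f ⊗₁ c.f) ⬝₁ (P.id1 d.A ⊗₁ d.u) := by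
    rw [← t_c] <;> simp [*]
  have E7 : d'.u ⊗₁ c.f = (d'.u ⊗₁ P.id1 d'.A) ⬝₁ c.f := by
    conv_rhs => rw [← unit_t1 c.f, ← t_c (by simp [*]) (by simp [*])]
    simp [*]
  have E8 : c.f ⊗₁ d'.u = (P.id1 d'.A ⊗₁ d'.u) ⬝₁ c.f := by
    conv_rhs => rw [← t1_unit c.f, ← t_c (by simp [*]) (by simp [*])]
    simp [*]
  have h1 := h.coassoc
  have h2 := h.counit_left
  have h3 := h.counit_right
  simp only [← F.map_id1, ← F.map_id2, ← hF.map_t1, ← hF.map_t2] at h1 h2 h3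
  clear h
  refine ⟨df, cf, s2, t2', s0, t0', ff _ _ ?_ ?_ ?_, ff _ _ ?_ ?_ ?_, ff _ _ ?_ ?_ ?_⟩
  · clear h1 h2 h3
    simp (maxDischargeDepth := 9) [*, c_assoc]
  · clear h1 h2 h3
    simp (maxDischargeDepth := 9) [*, c_assoc]
  · rw [← F.map_hc, ← F.map_hc, ← F.map_hc, ← F.map_hc, ← F.map_hc, ← F.map_hc, ← F.map_vc,
      ← F.map_vc, ← F.map_vc, ← F.map_vc] at h1
    · exact h1
    all_goals clear h1 h2 h3
    all_goals simp (maxDischargeDepth := 9) [*, c_assoc]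
  · clear h1 h2 h3
    simp (maxDischargeDepth := 9) [*, c_assoc]
  · clear h1 h2 h3
    simp (maxDischargeDepth := 9) [*, c_assoc]
  · rw [← F.map_hc, ← F.map_hc, ← F.map_hc, ← F.map_hc, ← F.map_vc, ← F.map_vc] at h2
    · exact h2
    all_goals clear h1 h2 h3
    all_goals simp (maxDischargeDepth := 9) [*, c_assoc]
  · clear h1 h2 h3
    simp (maxDischargeDepth := 9) [*, c_assoc]
  · clear h1 h2 h3
    simp (maxDischargeDepth := 9) [*, c_assoc]
  · rw [← F.map_hc, ← F.map_hc, ← F.map_hc, ← F.map_hc, ← F.map_vc, ← F.map_vc] at h3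
    · exact h3
    all_goals clear h1 h2 h3
    all_goals simp (maxDischargeDepth := 9) [*, c_assoc]

/-- A strict monoidal 2-functor that is faithful on 2-cells reflects opmonoidal 2-cells. -/
theorem IsOpmonoidal2.of_map {F : TwoFunctor P.toTwoCat M.toTwoCat} (hF : IsStrictMonoidal F)
    (ff : F.LocallyFaithful) {d d' : PsmData P.toTwoCat} {c c' : CellData P.toTwoCat} {ω : P.C2}
    (hd : IsPseudomonoid P d) (hd' : IsPseudomonoid P d') (hc : IsOpmonoidal1 P d d' c)
    (hc' : IsOpmonoidal1 P d d' c')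
    (sω : P.src ω = c.f) (tω : P.tgt ω = c'.f)
    (h : IsOpmonoidal2 M ⟨F.map0 d.A, F.map1 d.m, F.map1 d.u, F.map2 d.α, F.map2 d.lam,
      F.map2 d.rho⟩ ⟨F.map0 d'.A, F.map1 d'.m, F.map1 d'.u, F.map2 d'.α, F.map2 d'.lam,
      F.map2 d'.rho⟩ ⟨F.map1 c.f, F.map2 c.φ2, F.map2 c.φ0⟩
      ⟨F.map1 c'.f, F.map2 c'.φ2, F.map2 c'.φ0⟩ (F.map2 ω)) : IsOpmonoidal2 P d d' c c' ω := by
  obtain ⟨dm, cm, du, cu, -⟩ := hd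
  obtain ⟨dm', cm', du', cu', -⟩ := hd'
  obtain ⟨df, cf, s2, t2', s0, t0', -⟩ := hc
  obtain ⟨df', cf', s2', t2'', s0', t0'', -⟩ := hc'
  have h1 := h.binary
  have h2 := h.nullary
  simp only [← F.map_id1, ← F.map_id2, ← hF.map_t1, ← hF.map_t2] at h1 h2
  clear h
  refine ⟨sω, tω, ff _ _ ?_ ?_ ?_, ff _ _ ?_ ?_ ?_⟩
  · clear h1 h2
    simp (maxDischargeDepth := 9) [*, c_assoc]
  · clear h1 h2
    simp (maxDischargeDepth := 9) [*, c_assoc]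
  · rw [← F.map_hc, ← F.map_hc, ← F.map_vc, ← F.map_vc] at h1
    · exact h1
    all_goals clear h1 h2
    all_goals simp (maxDischargeDepth := 9) [*, c_assoc]
  · clear h1 h2
    simp (maxDischargeDepth := 9) [*, c_assoc]
  · clear h1 h2
    simp (maxDischargeDepth := 9) [*, c_assoc]
  · rw [← F.map_hc, ← F.map_vc] at h2
    · exact h2
    all_goals clear h1 h2
    all_goals simp (maxDischargeDepth := 9) [*, c_assoc]

end Reflect

section Mon

variable (M : SymMonTwoCat.{u})

/-- The forgetful 2-functor `M₁₀ → M`. -/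
noncomputable def forget10 : SymFunctor (obj10 M) M := (forget01 M.co).co

/-- The monoidal 1-cell in `M` that a 1-cell of `M₁₀` consists of. -/
noncomputable def mon1 (F : (obj10 M).C1) : CellData M.toTwoCat :=
  let F' : Opmonoidal1 M.co.toMonTwoCat := F
  ⟨F'.data.f, F'.data.φ2, F'.data.φ0⟩

variable {M}

theorem psm10_law (A : (obj10 M).C0) : IsPseudomonoid M.toMonTwoCat (psm10 M A) :=
  IsPseudomonoid.ofCo (M := M.toMonTwoCat) (Pseudomonoid.law (M := M.co.toMonTwoCat) A)

theorem psm10_toCo (A : (obj10 M).C0) :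
    (psm10 M A).toCo = Pseudomonoid.data (M := M.co.toMonTwoCat) A :=
  PsmData.toCo_ofCo (M := M.toMonTwoCat) (Pseudomonoid.law (M := M.co.toMonTwoCat) A)

theorem psm10_inj {A B : (obj10 M).C0} (h : psm10 M A = psm10 M B) : A = B :=
  Pseudomonoid.ext (M := M.co.toMonTwoCat) <| by
    rw [← psm10_toCo A, ← psm10_toCo B, h]

theorem exists_psm10 {d : PsmData M.toTwoCat} (hd : IsPseudomonoid M.toMonTwoCat d) :
    ∃ A : (obj10 M).C0, psm10 M A = d :=
  ⟨Pseudomonoid.mk (M := M.co.toMonTwoCat) d.toCo hd.toCo, PsmData.ofCo_toCo hd⟩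

theorem mon1_law (F : (obj10 M).C1) : IsMonoidal1 M.toMonTwoCat (psm10 M ((obj10 M).dom F))
    (psm10 M ((obj10 M).cod F)) (mon1 M F) := by
  rw [← isOpmonoidal1_co_iff (psm10_law _) (psm10_law _), psm10_toCo, psm10_toCo]
  exact Opmonoidal1.law (M := M.co.toMonTwoCat) F

theorem mon1_ext {F G : (obj10 M).C1} (hd : (obj10 M).dom F = (obj10 M).dom G)
    (hc : (obj10 M).cod F = (obj10 M).cod G) (h : mon1 M F = mon1 M G) : F = G :=
  Opmonoidal1.ext (M := M.co.toMonTwoCat) hd hc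
    (CellData.ext (M := M.toTwoCat.co) (congrArg (CellData.f (M := M.toTwoCat)) h)
      (congrArg (CellData.φ2 (M := M.toTwoCat)) h) (congrArg (CellData.φ0 (M := M.toTwoCat)) h))

theorem exists_mon1 {A B : (obj10 M).C0} {c : CellData M.toTwoCat}
    (h : IsMonoidal1 M.toMonTwoCat (psm10 M A) (psm10 M B) c) :
    ∃ F : (obj10 M).C1, (obj10 M).dom F = A ∧ (obj10 M).cod F = B ∧ mon1 M F = c := by
  rw [← isOpmonoidal1_co_iff (psm10_law _) (psm10_law _), psm10_toCo, psm10_toCo] at h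
  exact ⟨Opmonoidal1.mk (M := M.co.toMonTwoCat) A B c.co h, rfl, rfl, rfl⟩

theorem forget10_law (a : (obj10 M).C2) : IsMonoidal2 M.toMonTwoCat
    (psm10 M ((obj10 M).dom ((obj10 M).src a))) (psm10 M ((obj10 M).cod ((obj10 M).src a)))
    (mon1 M ((obj10 M).src a)) (mon1 M ((obj10 M).tgt a)) ((forget10 M).map2 a) := by
  obtain ⟨dm, cm, du, cu, -⟩ := psm10_law ((obj10 M).dom ((obj10 M).src a))
  obtain ⟨dm', cm', du', cu', -⟩ := psm10_law ((obj10 M).cod ((obj10 M).src a))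
  obtain ⟨df, cf, s2, t2, s0, t0, -⟩ := mon1_law ((obj10 M).src a)
  have L := mon1_law ((obj10 M).tgt a)
  rw [(obj10 M).dom_tgt, (obj10 M).cod_tgt] at L
  have k := Opmonoidal2.law (M := M.co.toMonTwoCat) a
  rw [← Opmonoidal2.dom_eq (M := M.co.toMonTwoCat) a,
    ← Opmonoidal2.cod_eq (M := M.co.toMonTwoCat) a] at k
  exact (isOpmonoidal2_co_iff rfl rfl rfl dm cm cu dm' df cf s2 t2 L.src_φ2 t0).1 k

theorem forget10_ext {a b : (obj10 M).C2} (hs : (obj10 M).src a = (obj10 M).src b)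
    (ht : (obj10 M).tgt a = (obj10 M).tgt b) (h : (forget10 M).map2 a = (forget10 M).map2 b) :
    a = b :=
  Opmonoidal2.ext (M := M.co.toMonTwoCat) ht hs h

theorem exists_forget10 {F G : (obj10 M).C1} (hd : (obj10 M).dom G = (obj10 M).dom F)
    (hc : (obj10 M).cod G = (obj10 M).cod F) {ω : M.C2}
    (h : IsMonoidal2 M.toMonTwoCat (psm10 M ((obj10 M).dom F)) (psm10 M ((obj10 M).cod F))
      (mon1 M F) (mon1 M G) ω) :
    ∃ a : (obj10 M).C2, (obj10 M).src a = F ∧ (obj10 M).tgt a = G ∧ (forget10 M).map2 a = ω := by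
  obtain ⟨dm, cm, du, cu, -⟩ := psm10_law ((obj10 M).dom F)
  obtain ⟨dm', cm', du', cu', -⟩ := psm10_law ((obj10 M).cod F)
  obtain ⟨df, cf, s2, t2, s0, t0, -⟩ := mon1_law F
  have L := mon1_law G
  rw [hd, hc] at L
  have k := (isOpmonoidal2_co_iff (e := Pseudomonoid.data (M := M.co.toMonTwoCat) ((obj10 M).dom G))
    (e' := Pseudomonoid.data (M := M.co.toMonTwoCat) ((obj10 M).cod G))
    (congrArg (fun A => (psm10 M A).m) hd) (congrArg (fun A => (psm10 M A).u) hd)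
    (congrArg (fun A => (psm10 M A).m) hc) dm cm cu dm' df cf s2 t2 L.src_φ2 t0).2 h
  exact ⟨Opmonoidal2.mk (M := M.co.toMonTwoCat) G F hd.symm hc.symm ω k, rfl, rfl, rfl⟩

theorem forget10_faithful : (forget10 M).LocallyFaithful := fun _ _ => forget10_ext

theorem psm10_A (A : (obj10 M).C0) : (psm10 M A).A = (forget10 M).map0 A := rfl

theorem mon1_c {G F : (obj10 M).C1} (h : (obj10 M).cod F = (obj10 M).dom G) :
    mon1 M (G ⬝₁ F) = (mon1 M G).monComp (mon1 M F) := by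
  obtain ⟨dm, cm, du, cu, -⟩ := psm10_law ((obj10 M).dom F)
  obtain ⟨dm', cm', du', cu', -⟩ := psm10_law ((obj10 M).dom G)
  obtain ⟨dm'', cm'', du'', cu'', -⟩ := psm10_law ((obj10 M).cod G)
  obtain ⟨df, cf, s2, t2, s0, t0, -⟩ := mon1_law F
  obtain ⟨df', cf', s2', t2', s0', t0', -⟩ := mon1_law G
  rw [h] at cf s2 s0
  rw [c_def h]
  refine CellData.ext rfl ?_ ?_
  · exact co_vc_congr (co_hc _ _) (co_hc _ _) (by simp (maxDischargeDepth := 9) [*, c_assoc])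
  · exact co_vc_congr rfl (co_hc _ _) (by simp (maxDischargeDepth := 9) [*, c_assoc])

theorem mon1_id (A : (obj10 M).C0) : mon1 M ((obj10 M).id1 A) = (psm10 M A).idCell := rfl

theorem mon1_t (F G : (obj10 M).C1) :
    mon1 M (F ⊗₁ G) = M.tensorCell (mon1 M F) (mon1 M G) :=
  CellData.ext rfl (co_hc (M := M.toTwoCat) _ _) rfl

theorem mon1_σ (A B : (obj10 M).C0) : mon1 M ((obj10 M).σ A B) =
    (M.tensorPsm (psm10 M A) (psm10 M B)).strictCell (M.σ ((forget10 M).map0 A)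
      ((forget10 M).map0 B)) := rfl

theorem psm10_unit : psm10 M (obj10 M).unit = unitPsm M.toMonTwoCat :=
  PsmData.ext rfl rfl rfl (IsInverse.id _).inv2_eq (IsInverse.id _).inv2_eq
    (IsInverse.id _).inv2_eq

theorem psm10_t (A B : (obj10 M).C0) :
    psm10 M (A ⊗₀ B) = M.tensorPsm (psm10 M A) (psm10 M B) := by
  have hA := psm10_law A
  have hB := psm10_law B
  have kA := Pseudomonoid.law (M := M.co.toMonTwoCat) A
  have kB := Pseudomonoid.law (M := M.co.toMonTwoCat) B
  have i1 : IsInverse (M := M.toTwoCat) (Pseudomonoid.data (M := M.co.toMonTwoCat) A).α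
    (psm10 M A).α := (IsInvertible.co kA.inv_α).inv2
  have i2 : IsInverse (M := M.toTwoCat) (Pseudomonoid.data (M := M.co.toMonTwoCat) B).α
    (psm10 M B).α := (IsInvertible.co kB.inv_α).inv2
  have i3 : IsInverse (M := M.toTwoCat) (Pseudomonoid.data (M := M.co.toMonTwoCat) A).lam
    (psm10 M A).lam := (IsInvertible.co kA.inv_lam).inv2
  have i4 : IsInverse (M := M.toTwoCat) (Pseudomonoid.data (M := M.co.toMonTwoCat) B).lam
    (psm10 M B).lam := (IsInvertible.co kB.inv_lam).inv2
  have i5 : IsInverse (M := M.toTwoCat) (Pseudomonoid.data (M := M.co.toMonTwoCat) A).rho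
    (psm10 M A).rho := (IsInvertible.co kA.inv_rho).inv2
  have i6 : IsInverse (M := M.toTwoCat) (Pseudomonoid.data (M := M.co.toMonTwoCat) B).rho
    (psm10 M B).rho := (IsInvertible.co kB.inv_rho).inv2
  obtain ⟨dm, cm, du, cu, sα, tα, -⟩ := hA
  obtain ⟨dm', cm', du', cu', sα', tα', -⟩ := hB
  have i7 := (IsInverse.id (M := M.toTwoCat) ((M.id1 ((psm10 M A).A ⊗₀ (psm10 M A).A) ⊗₁
    M.σ ((psm10 M B).A ⊗₀ (psm10 M B).A) (psm10 M A).A ⊗₁ M.id1 (psm10 M B).A) ⬝₁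
    ((M.id1 (psm10 M A).A ⊗₁ M.σ (psm10 M B).A (psm10 M A).A ⊗₁ M.id1 (psm10 M B).A) ⊗₁
      M.id1 ((psm10 M A).A ⊗₀ (psm10 M B).A)))).hc (i1.t i2)
  refine PsmData.ext rfl rfl rfl ?_ (i3.t i4).inv2_eq (i5.t i6).inv2_eq
  refine Eq.trans (congrArg (inv2 (M := M.toTwoCat)) (co_hc (M := M.toTwoCat) _ _)) ?_
  refine (i7 ?_).inv2_eq
  rw [← M.dom_tgt, ← (i1.t i2).1, src_t]
  simp (maxDischargeDepth := 9) [*, c_assoc]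

end Mon

section MapPsm

variable {M N : SymMonTwoCat.{u}}

/-- The image of the data of an (op)monoidal 1-cell under a symmetric strict monoidal 2-functor. -/
def SymFunctor.mapCell (F : SymFunctor M N) (c : CellData M.toTwoCat) : CellData N.toTwoCat :=
  ⟨F.map1 c.f, F.map2 c.φ2, F.map2 c.φ0⟩

theorem SymFunctor.mapPsm_law (F : SymFunctor M N) {d : PsmData M.toTwoCat}
    (hd : IsPseudomonoid M.toMonTwoCat d) : IsPseudomonoid N.toMonTwoCat (F.mapPsm d) := by
  have h := F.lax.psm_law hd
  rwa [F.lax_psm hd] at h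

theorem SymFunctor.mapCell_law (F : SymFunctor M N) {d d' : PsmData M.toTwoCat}
    {c : CellData M.toTwoCat} (hd : IsPseudomonoid M.toMonTwoCat d)
    (hd' : IsPseudomonoid M.toMonTwoCat d') (hc : IsOpmonoidal1 M.toMonTwoCat d d' c) :
    IsOpmonoidal1 N.toMonTwoCat (F.mapPsm d) (F.mapPsm d') (F.mapCell c) := by
  have h := F.lax.cell_law hd hd' hc
  rwa [F.lax_psm hd, F.lax_psm hd', F.lax_cell hd hc] at h

theorem SymFunctor.mapCell2_law (F : SymFunctor M N) {d d' : PsmData M.toTwoCat}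
    {c c' : CellData M.toTwoCat} {ω : M.C2} (hd : IsPseudomonoid M.toMonTwoCat d)
    (hd' : IsPseudomonoid M.toMonTwoCat d') (hc : IsOpmonoidal1 M.toMonTwoCat d d' c)
    (hc' : IsOpmonoidal1 M.toMonTwoCat d d' c') (hω : IsOpmonoidal2 M.toMonTwoCat d d' c c' ω) :
    IsOpmonoidal2 N.toMonTwoCat (F.mapPsm d) (F.mapPsm d') (F.mapCell c) (F.mapCell c')
      (F.map2 ω) := by
  have h := F.lax.cell2_law hd hd' hc hc' hω
  rwa [F.lax_psm hd, F.lax_psm hd', F.lax_cell hd hc, F.lax_cell hd hc'] at h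

end MapPsm

/-- The inverse of an invertible monoidal 2-cell is monoidal. -/
theorem IsMonoidal2.inverse {M : MonTwoCat.{u}} {d d' : PsmData M.toTwoCat}
    {c c' : CellData M.toTwoCat} {ω η : M.C2} (hd : IsPseudomonoid M d)
    (hd' : IsPseudomonoid M d') (hc : IsMonoidal1 M d d' c) (hc' : IsMonoidal1 M d d' c')
    (h : IsMonoidal2 M d d' c c' ω) (hη : IsInverse ω η) : IsMonoidal2 M d d' c' c η := by
  obtain ⟨dm, cm, du, cu, -⟩ := hd
  obtain ⟨dm', cm', du', cu', -⟩ := hd'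
  obtain ⟨df, cf, s2, t2, s0, t0, -⟩ := hc
  obtain ⟨df', cf', s2', t2', s0', t0', -⟩ := hc'
  obtain ⟨sω, tω, h2, h0⟩ := h
  have k1 := (IsInverse.id (M := M.toTwoCat) d.m).hc hη (by simp (maxDischargeDepth := 9) [*])
  have k2 := (hη.t hη).hc (IsInverse.id (M := M.toTwoCat) d'.m)
    (by simp (maxDischargeDepth := 9) [*])
  have k3 := (IsInverse.id (M := M.toTwoCat) d.u).hc hη (by simp (maxDischargeDepth := 9) [*])
  obtain ⟨sη, tη, -, -⟩ := hη
  refine ⟨by simp [*], by simp [*], ?_, ?_⟩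
  · rw [k1.vc_eq_vc_iff k2] at h2
    · exact h2.symm
    all_goals clear h2 h0 k1 k2 k3
    all_goals simp (maxDischargeDepth := 9) [*, c_assoc]
  · rw [k3.vc_eq_iff] at h0
    · exact h0.symm
    all_goals clear h2 h0 k1 k2 k3
    all_goals simp (maxDischargeDepth := 9) [*, c_assoc]

section Read

variable {M : SymMonTwoCat.{u}}

theorem forget10_reflects_inv (a : (obj10 M).C2) (h : IsInvertible ((forget10 M).map2 a)) :
    IsInvertible a := by
  obtain ⟨η, hη⟩ := h
  have l1 := mon1_law ((obj10 M).src a)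
  have l2 := mon1_law ((obj10 M).tgt a)
  rw [(obj10 M).dom_tgt, (obj10 M).cod_tgt] at l2
  have k := (forget10_law a).inverse (psm10_law _) (psm10_law _) l1 l2 hη
  rw [← (obj10 M).dom_tgt, ← (obj10 M).cod_tgt] at k
  obtain ⟨b, sb, tb, rfl⟩ := exists_forget10 (F := (obj10 M).tgt a) (G := (obj10 M).src a)
    (by simp) (by simp) k
  obtain ⟨-, -, h1, h2⟩ := hη
  refine ⟨b, sb, tb, forget10_ext ?_ ?_ ?_, forget10_ext ?_ ?_ ?_⟩
  · simp [sb, tb]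
  · simp [sb, tb]
  · rw [(forget10 M).map_vc sb.symm, h1]; simp
  · simp [sb, tb]
  · simp [sb, tb]
  · rw [(forget10 M).map_vc tb, h2]; simp

variable (M)

theorem read0_eq (X : Pseudomonoid (obj10 M).toMonTwoCat) : read0 M X =
    ⟨psm10 M X.data.A, (forget10 M).mapPsm X.data, (mon1 M X.data.m).φ2, (mon1 M X.data.m).φ0,
      (mon1 M X.data.u).φ2, (mon1 M X.data.u).φ0⟩ := rfl

theorem read1_eq (F : Opmonoidal1 (obj10 M).toMonTwoCat) : read1 M F =
    ⟨(mon1 M F.data.f).f, (mon1 M F.data.f).φ2, (mon1 M F.data.f).φ0,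
      (forget10 M).map2 F.data.φ2, (forget10 M).map2 F.data.φ0⟩ := rfl

theorem read0_mul (X : Pseudomonoid (obj10 M).toMonTwoCat) :
    (read0 M X).mul = mon1 M X.data.m := rfl

theorem read0_one (X : Pseudomonoid (obj10 M).toMonTwoCat) :
    (read0 M X).one = mon1 M X.data.u := rfl

variable {M}

theorem isDuoidal_read0 (X : Pseudomonoid (obj10 M).toMonTwoCat) : IsDuoidal M (read0 M X) := by
  obtain ⟨dm, cm, du, cu, sα, tα, sl, tl, sr, tr, -⟩ := X.law
  refine ⟨rfl, psm10_law _, (forget10 M).mapPsm_law X.law, ?_, ?_, ?_, ?_, ?_⟩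
  · have h := mon1_law X.data.m
    rw [dm, cm, psm10_t] at h
    exact h
  · have h := mon1_law X.data.u
    rw [du, cu, psm10_unit] at h
    exact h
  · have h := forget10_law X.data.α
    rw [sα, tα, dom_c (by simp [*]), cod_c (by simp [*]), cm, dom_t, dm, dom_id1, t0_assoc,
      psm10_t, psm10_t, mon1_c (by simp [*]), mon1_c (by simp [*]), mon1_t, mon1_t, mon1_id] at h
    exact h
  · have h := forget10_law X.data.lam
    rw [sl, tl, dom_c (by simp [*]), cod_c (by simp [*]), cm, dom_t, du, dom_id1, unit_t0,
      mon1_c (by simp [*]), mon1_t, mon1_id] at h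
    exact h
  · have h := forget10_law X.data.rho
    rw [sr, tr, dom_c (by simp [*]), cod_c (by simp [*]), cm, dom_t, du, dom_id1, t0_unit,
      mon1_c (by simp [*]), mon1_t, mon1_id] at h
    exact h

theorem read0_injective : Function.Injective (read0 M) := by
  intro X Y h
  obtain ⟨dm, cm, du, cu, sα, tα, sl, tl, sr, tr, -⟩ := X.law
  obtain ⟨dm', cm', du', cu', sα', tα', sl', tl', sr', tr', -⟩ := Y.law
  have eA : X.data.A = Y.data.A := psm10_inj (congrArg DuoData.v h)
  have em : X.data.m = Y.data.m := mon1_ext (by rw [dm, dm', eA]) (by rw [cm, cm', eA])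
    (congrArg DuoData.mul h)
  have eu : X.data.u = Y.data.u := mon1_ext (by rw [du, du']) (by rw [cu, cu', eA])
    (congrArg DuoData.one h)
  exact Pseudomonoid.ext (PsmData.ext eA em eu
    (forget10_ext (by rw [sα, sα', em, eA]) (by rw [tα, tα', em, eA])
      (congrArg (fun d => d.h.α) h))
    (forget10_ext (by rw [sl, sl', em, eA, eu]) (by rw [tl, tl', eA])
      (congrArg (fun d => d.h.lam) h))
    (forget10_ext (by rw [sr, sr', em, eA, eu]) (by rw [tr, tr', eA])
      (congrArg (fun d => d.h.rho) h)))

theorem exists_read0 {d : DuoData M.toTwoCat} (hd : IsDuoidal M d) : ∃ X, read0 M X = d := by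
  obtain ⟨v, ⟨hA, hm, hu, hα, hl, hr⟩, ξ, ξup, ξdn, ξud⟩ := d
  obtain ⟨same, hv, hh, mul, one, α, lam, rho⟩ := hd
  dsimp only at same hv hh mul one α lam rho
  obtain ⟨A, rfl⟩ := exists_psm10 hv
  obtain rfl : hA = (forget10 M).map0 A := same
  rw [← psm10_t] at mul
  obtain ⟨m, dm, cm, em⟩ := exists_mon1 mul
  rw [← psm10_unit] at one
  obtain ⟨u, du, cu, eu⟩ := exists_mon1 one
  rw [← em] at α lam rho
  rw [← eu] at lam rho
  rw [← mon1_id, ← mon1_t, ← mon1_t, ← mon1_c (by simp [*]), ← mon1_c (by simp [*]), ← psm10_t,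
    ← psm10_t] at α
  rw [← mon1_id, ← mon1_t, ← mon1_c (by simp [*])] at lam rho
  obtain ⟨a, sa, ta, ea⟩ := exists_forget10 (F := m ⬝₁ (m ⊗₁ (obj10 M).id1 A))
    (G := m ⬝₁ ((obj10 M).id1 A ⊗₁ m)) (ω := hα) (by simp [*]) (by simp [*])
    (by rw [dom_c (by simp [*]), cod_c (by simp [*]), cm, dom_t, dm, dom_id1, t0_assoc]; exact α)
  obtain ⟨l, sl, tl, el⟩ := exists_forget10 (F := m ⬝₁ (u ⊗₁ (obj10 M).id1 A))
    (G := (obj10 M).id1 A) (ω := hl) (by simp [*]) (by simp [*])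
    (by rw [dom_c (by simp [*]), cod_c (by simp [*]), cm, dom_t, du, dom_id1, unit_t0]; exact lam)
  obtain ⟨r, sr, tr, er⟩ := exists_forget10 (F := m ⬝₁ ((obj10 M).id1 A ⊗₁ u))
    (G := (obj10 M).id1 A) (ω := hr) (by simp [*]) (by simp [*])
    (by rw [dom_c (by simp [*]), cod_c (by simp [*]), cm, dom_t, du, dom_id1, t0_unit]; exact rho)
  have emf : (forget10 M).map1 m = hm := congrArg CellData.f em
  have euf : (forget10 M).map1 u = hu := congrArg CellData.f eu
  have law : IsPseudomonoid (obj10 M).toMonTwoCat ⟨A, m, u, a, l, r⟩ := by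
    refine IsPseudomonoid.of_map (forget10 M).isStrict forget10_faithful forget10_reflects_inv dm
      cm du cu sa ta sl tl sr tr ?_
    dsimp only
    rw [emf, euf, ea, el, er]
    exact hh
  refine ⟨⟨_, law⟩, ?_⟩
  rw [read0_eq]
  refine DuoData.ext rfl (PsmData.ext rfl emf euf ea el er) ?_ ?_ ?_ ?_
  · exact congrArg CellData.φ2 em
  · exact congrArg CellData.φ0 em
  · exact congrArg CellData.φ2 eu
  · exact congrArg CellData.φ0 eu

theorem bijOn_read0 : Set.BijOn (read0 M) Set.univ {d | IsDuoidal M d} :=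
  ⟨fun X _ => isDuoidal_read0 X, read0_injective.injOn, fun _ hd =>
    (exists_read0 hd).imp fun _ h => ⟨trivial, h⟩⟩

theorem isOidal1_read1 (F : Opmonoidal1 (obj10 M).toMonTwoCat) :
    IsOidal1 M (read0 M F.dom) (read0 M F.cod) (read1 M F) := by
  obtain ⟨dm, cm, du, cu, -⟩ := F.dom.law
  obtain ⟨dm', cm', du', cu', -⟩ := F.cod.law
  obtain ⟨df, cf, s2, t2, s0, t0, -⟩ := F.law
  refine ⟨?_, (forget10 M).mapCell_law F.dom.law F.cod.law F.law, ?_, ?_⟩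
  · have h := mon1_law F.data.f
    rw [df, cf] at h
    exact h
  · have h := forget10_law F.data.φ2
    rw [s2, t2, dom_c (by simp [*]), cod_c (by simp [*]), cf, dm, psm10_t, mon1_c (by simp [*]),
      mon1_c (by simp [*]), mon1_t] at h
    exact h
  · have h := forget10_law F.data.φ0
    rw [s0, t0, dom_c (by simp [*]), cod_c (by simp [*]), cf, du, psm10_unit,
      mon1_c (by simp [*])] at h
    exact h

theorem read1_ext {F G : Opmonoidal1 (obj10 M).toMonTwoCat} (hd : F.dom = G.dom)
    (hc : F.cod = G.cod) (h : read1 M F = read1 M G) : F = G := by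
  obtain ⟨df, cf, s2, t2, s0, t0, -⟩ := F.law
  obtain ⟨df', cf', s2', t2', s0', t0', -⟩ := G.law
  have ef : F.data.f = G.data.f := mon1_ext (by rw [df, df', hd]) (by rw [cf, cf', hc])
    (congrArg OidalData.mon h)
  exact Opmonoidal1.ext hd hc (CellData.ext ef
    (forget10_ext (by rw [s2, s2', ef, hd]) (by rw [t2, t2', ef, hc]) (congrArg OidalData.φup2 h))
    (forget10_ext (by rw [s0, s0', ef, hd]) (by rw [t0, t0', hc]) (congrArg OidalData.φup0 h)))

theorem exists_read1 {X Y : Pseudomonoid (obj10 M).toMonTwoCat} {r : OidalData M.toTwoCat}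
    (hr : IsOidal1 M (read0 M X) (read0 M Y) r) :
    ∃ F : Opmonoidal1 (obj10 M).toMonTwoCat, F.dom = X ∧ F.cod = Y ∧ read1 M F = r := by
  obtain ⟨dm, cm, du, cu, -⟩ := X.law
  obtain ⟨dm', cm', du', cu', -⟩ := Y.law
  obtain ⟨rf, dn2, dn0, up2, up0⟩ := r
  obtain ⟨mon, opm, h2, h0⟩ := hr
  dsimp only at h2 h0
  obtain ⟨f, df, cf, ef⟩ := exists_mon1 (A := X.data.A) (B := Y.data.A) mon
  rw [← ef, read0_mul, read0_mul, ← mon1_t, ← mon1_c (by simp [*]), ← mon1_c (by simp [*])] at h2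
  rw [← ef, read0_one, read0_one, ← mon1_c (by simp [*])] at h0
  obtain ⟨a, sa, ta, ea⟩ := exists_forget10 (F := f ⬝₁ X.data.m)
    (G := Y.data.m ⬝₁ (f ⊗₁ f)) (ω := up2) (by simp [*]) (by simp [*])
    (by rw [dom_c (by simp [*]), cod_c (by simp [*]), cf, dm, psm10_t]; exact h2)
  obtain ⟨b, sb, tb, eb⟩ := exists_forget10 (F := f ⬝₁ X.data.u)
    (G := Y.data.u) (ω := up0) (by simp [*]) (by simp [*])
    (by rw [dom_c (by simp [*]), cod_c (by simp [*]), cf, du, psm10_unit]; exact h0)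
  have eff : (forget10 M).map1 f = rf := congrArg CellData.f ef
  have law : IsOpmonoidal1 (obj10 M).toMonTwoCat X.data Y.data ⟨f, a, b⟩ := by
    refine IsOpmonoidal1.of_map (forget10 M).isStrict forget10_faithful X.law Y.law df cf sa ta sb
      tb ?_
    dsimp only
    rw [eff, ea, eb]
    exact opm
  refine ⟨⟨X, Y, _, law⟩, rfl, rfl, ?_⟩
  rw [read1_eq]
  exact OidalData.ext eff (congrArg CellData.φ2 ef) (congrArg CellData.φ0 ef) ea eb

theorem bijOn_read1 (X Y : Pseudomonoid (obj10 M).toMonTwoCat) :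
    Set.BijOn (read1 M) {F | F.dom = X ∧ F.cod = Y} {r | IsOidal1 M (read0 M X) (read0 M Y) r} := by
  refine ⟨?_, ?_, ?_⟩
  · rintro F ⟨rfl, rfl⟩
    exact isOidal1_read1 F
  · rintro F ⟨rfl, rfl⟩ G ⟨hd, hc⟩ h
    exact read1_ext hd.symm hc.symm h
  · intro r hr
    obtain ⟨F, hd, hc, h⟩ := exists_read1 hr
    exact ⟨F, ⟨hd, hc⟩, h⟩

theorem isOidal2_read2 (a : Opmonoidal2 (obj10 M).toMonTwoCat) :
    IsOidal2 M (read0 M a.src.dom) (read0 M a.src.cod) (read1 M a.src) (read1 M a.tgt)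
      (read2 M a) := by
  obtain ⟨df, cf, -⟩ := a.src.law
  refine ⟨?_, (forget10 M).mapCell2_law a.src.dom.law a.src.cod.law a.src.law a.law_tgt a.law⟩
  have h := forget10_law a.ω
  rw [a.law.src_ω, a.law.tgt_ω, df, cf] at h
  exact h

theorem read2_ext {a b : Opmonoidal2 (obj10 M).toMonTwoCat} (hs : a.src = b.src)
    (ht : a.tgt = b.tgt) (h : read2 M a = read2 M b) : a = b :=
  Opmonoidal2.ext hs ht (forget10_ext (by rw [a.law.src_ω, b.law.src_ω, hs])
    (by rw [a.law.tgt_ω, b.law.tgt_ω, ht]) h)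

theorem exists_read2 {F G : Opmonoidal1 (obj10 M).toMonTwoCat} (hd : G.dom = F.dom)
    (hc : G.cod = F.cod) {ω : M.C2}
    (h : IsOidal2 M (read0 M F.dom) (read0 M F.cod) (read1 M F) (read1 M G) ω) :
    ∃ a : Opmonoidal2 (obj10 M).toMonTwoCat, a.src = F ∧ a.tgt = G ∧ read2 M a = ω := by
  obtain ⟨df, cf, -⟩ := F.law
  have LG := G.law
  rw [hd, hc] at LG
  obtain ⟨mon, opm⟩ := h
  obtain ⟨a, sa, ta, rfl⟩ := exists_forget10 (F := F.data.f) (G := G.data.f) (ω := ω)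
    (by rw [LG.dom_f, df]) (by rw [LG.cod_f, cf]) (by rw [df, cf]; exact mon)
  have law : IsOpmonoidal2 (obj10 M).toMonTwoCat F.dom.data F.cod.data F.data G.data a :=
    IsOpmonoidal2.of_map (forget10 M).isStrict forget10_faithful F.dom.law F.cod.law F.law LG sa
      ta opm
  exact ⟨⟨F, G, hd, hc, a, law⟩, rfl, rfl, rfl⟩

theorem bijOn_read2 (X Y : Pseudomonoid (obj10 M).toMonTwoCat)
    (F G : Opmonoidal1 (obj10 M).toMonTwoCat) (hF : F.dom = X) (hF' : F.cod = Y)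
    (hG : G.dom = X) (hG' : G.cod = Y) :
    Set.BijOn (read2 M) {a | a.src = F ∧ a.tgt = G}
      {ω | IsOidal2 M (read0 M X) (read0 M Y) (read1 M F) (read1 M G) ω} := by
  subst hF hF'
  refine ⟨?_, ?_, ?_⟩
  · rintro a ⟨rfl, rfl⟩
    exact isOidal2_read2 a
  · rintro a ⟨rfl, rfl⟩ b ⟨hs, ht⟩ h
    exact read2_ext hs.symm ht.symm h
  · intro ω hω
    obtain ⟨a, hs, ht, h⟩ := exists_read2 hG hG' hω
    exact ⟨a, ⟨hs, ht⟩, h⟩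

end Read

section Coherence

variable {M : SymMonTwoCat.{u}}

/-- The 1-cell `1 σ 1 : A A A A → A A A A`. -/
noncomputable def SymMonTwoCat.mid (M : SymMonTwoCat.{u}) (A : M.C0) : M.C1 :=
  M.id1 A ⊗₁ M.σ A A ⊗₁ M.id1 A

/-- The 1-cell `A₁ A₂ A₃ A₄ A₅ A₆ → A₁ A₃ A₅ A₂ A₄ A₆` that mediates between the two
multiplications of six factors. -/
noncomputable def SymMonTwoCat.mid3 (M : SymMonTwoCat.{u}) (A : M.C0) : M.C1 :=
  (M.id1 (A ⊗₀ A) ⊗₁ M.mid A) ⬝₁ (M.id1 A ⊗₁ M.σ (A ⊗₀ A) A ⊗₁ M.id1 (A ⊗₀ A))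

@[simp] theorem dom_mid (A : M.C0) : M.dom (M.mid A) = A ⊗₀ A ⊗₀ A ⊗₀ A := by simp [mid]
@[simp] theorem cod_mid (A : M.C0) : M.cod (M.mid A) = A ⊗₀ A ⊗₀ A ⊗₀ A := by simp [mid]

@[simp] theorem mid_mid (A : M.C0) : M.mid A ⬝₁ M.mid A = M.id1 (A ⊗₀ A ⊗₀ A ⊗₀ A) := by
  unfold mid
  rw [← t_c, ← t_c, σ_σ] <;> simp

@[simp] theorem dom_mid3 (A : M.C0) : M.dom (M.mid3 A) = A ⊗₀ A ⊗₀ A ⊗₀ A ⊗₀ A ⊗₀ A := by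
  unfold mid3
  rw [dom_c] <;> simp
@[simp] theorem cod_mid3 (A : M.C0) : M.cod (M.mid3 A) = A ⊗₀ A ⊗₀ A ⊗₀ A ⊗₀ A ⊗₀ A := by
  unfold mid3
  rw [cod_c] <;> simp

theorem mid3_eq (A : M.C0) : M.mid3 A = (M.mid A ⊗₁ M.id1 (A ⊗₀ A)) ⬝₁
    (M.id1 (A ⊗₀ A) ⊗₁ M.σ A (A ⊗₀ A) ⊗₁ M.id1 A) := by
  have h := M.middle_assoc A A A A A A
  unfold mid3 mid
  have e1 : (M.id1 A ⊗₁ M.σ A A ⊗₁ M.id1 A) ⊗₁ M.id1 (A ⊗₀ A) =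
      M.id1 A ⊗₁ M.σ A A ⊗₁ M.id1 (A ⊗₀ A ⊗₀ A) := by
    simp only [t1_assoc, t_id1]
  have e2 : M.id1 (A ⊗₀ A) ⊗₁ (M.id1 A ⊗₁ M.σ A A ⊗₁ M.id1 A) =
      M.id1 (A ⊗₀ A ⊗₀ A) ⊗₁ M.σ A A ⊗₁ M.id1 A := by
    rw [← t1_assoc, t_id1, t0_assoc]
  rw [e1, e2]
  exact h.symm

theorem mid_t_mid (A B : M.C0) : (M.mid A ⊗₁ M.id1 B) ⬝₁ (M.mid A ⊗₁ M.id1 B) =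
    M.id1 (A ⊗₀ A ⊗₀ A ⊗₀ A ⊗₀ B) := by
  rw [← t_c, mid_mid] <;> simp

theorem t_mid_mid (A B : M.C0) : (M.id1 B ⊗₁ M.mid A) ⬝₁ (M.id1 B ⊗₁ M.mid A) =
    M.id1 (B ⊗₀ A ⊗₀ A ⊗₀ A ⊗₀ A) := by
  rw [← t_c, mid_mid] <;> simp

theorem t_σ_σ_t (A B C D : M.C0) : (M.id1 C ⊗₁ M.σ B A ⊗₁ M.id1 D) ⬝₁
    (M.id1 C ⊗₁ M.σ A B ⊗₁ M.id1 D) = M.id1 (C ⊗₀ A ⊗₀ B ⊗₀ D) := by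
  rw [← t_c, ← t_c, σ_σ] <;> simp

theorem mid3_inv_left (A : M.C0) : ((M.id1 (A ⊗₀ A) ⊗₁ M.σ (A ⊗₀ A) A ⊗₁ M.id1 A) ⬝₁
    (M.mid A ⊗₁ M.id1 (A ⊗₀ A))) ⬝₁ M.mid3 A = M.id1 (A ⊗₀ A ⊗₀ A ⊗₀ A ⊗₀ A ⊗₀ A) := by
  rw [mid3_eq, c_assoc, ← c_assoc (k := M.mid A ⊗₁ M.id1 (A ⊗₀ A)), mid_t_mid, id_c, t_σ_σ_t] <;>
    simp

theorem mid3_inv_right (A : M.C0) : M.mid3 A ⬝₁ ((M.id1 (A ⊗₀ A) ⊗₁ M.σ (A ⊗₀ A) A ⊗₁ M.id1 A) ⬝₁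
    (M.mid A ⊗₁ M.id1 (A ⊗₀ A))) = M.id1 (A ⊗₀ A ⊗₀ A ⊗₀ A ⊗₀ A ⊗₀ A) := by
  have h := t_σ_σ_t (M := M) (A ⊗₀ A) A (A ⊗₀ A) A
  rw [mid3_eq, c_assoc, ← c_assoc (g := M.id1 (A ⊗₀ A) ⊗₁ M.σ (A ⊗₀ A) A ⊗₁ M.id1 A), h, id_c,
    mid_t_mid] <;> simp

/-- Naturality of `1 σ 1` on a pair of 1-cells, each of them next to an identity. -/
theorem mid_nat_left {f : M.C1} {A B : M.C0} (hf : M.dom f = B) (hf' : M.cod f = A) :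
    (f ⊗₁ f ⊗₁ M.id1 (A ⊗₀ A)) ⬝₁ (M.id1 B ⊗₁ M.σ A B ⊗₁ M.id1 A) =
      M.mid A ⬝₁ (f ⊗₁ M.id1 A ⊗₁ f ⊗₁ M.id1 A) := by
  have e := M.σ_nat1 (f := M.id1 A) (g := f) (M.dom_id1 A) hf (M.cod_id1 A) hf'
  unfold mid
  rw [← t_id1 A A, ← t1_assoc f (M.id1 A) (M.id1 A), ← t_c, ← t_c, ← t1_assoc (M.id1 A) f,
    ← t_c, ← t_c, e] <;> simp [*]

theorem mid_nat_right {f : M.C1} {A B : M.C0} (hf : M.dom f = B) (hf' : M.cod f = A) :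
    (M.id1 (A ⊗₀ A) ⊗₁ f ⊗₁ f) ⬝₁ (M.id1 A ⊗₁ M.σ B A ⊗₁ M.id1 B) =
      M.mid A ⬝₁ (M.id1 A ⊗₁ f ⊗₁ M.id1 A ⊗₁ f) := by
  have e := M.σ_nat1 (g := M.id1 A) (f := f) hf (M.dom_id1 A) hf' (M.cod_id1 A)
  unfold mid
  rw [← t_id1 A A, t1_assoc, ← t1_assoc (M.id1 A) f, ← t_c, ← t_c, ← t1_assoc f (M.id1 A) f,
    ← t_c, ← t_c, e] <;> simp [*]

end Coherence

section Whisker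

variable {M : TwoCat.{u}}

/-- Whiskering with an invertible 1-cell is injective on 2-cells. -/
theorem whisk_inj {a b : M.C2} {f g : M.C1} {A B : M.C0} (hf : M.dom f = A) (hf' : M.cod f = B)
    (hg : M.dom g = B) (hg' : M.cod g = A) (h : f ⬝₁ g = M.id1 B) (ha : M.dom (M.src a) = B)
    (hb : M.dom (M.src b) = B) : a ⬝ₕ 𝟏f = b ⬝ₕ 𝟏f ↔ a = b := by
  constructor
  · intro e
    have e' := congrArg (fun x => x ⬝ₕ 𝟏g) e
    rwa [hc_assoc (by simp [*]) (by simp [*]), hc_assoc (by simp [*]) (by simp [*]),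
      hc_id_id (by simp [*]), h, hc_id ha, hc_id hb] at e'
  · rintro rfl
    rfl

theorem whisk_vc3 {c b a : M.C2} {f : M.C1} (h : M.tgt a = M.src b) (h' : M.tgt b = M.src c)
    (hf : M.cod f = M.dom (M.src a)) :
    (c ⬝ᵥ b ⬝ᵥ a) ⬝ₕ 𝟏f = (c ⬝ₕ 𝟏f) ⬝ᵥ (b ⬝ₕ 𝟏f) ⬝ᵥ (a ⬝ₕ 𝟏f) := by
  rw [whisk_vc (by simp [*]) (by simp [*]), whisk_vc h hf]

end Whisker

/-- The cells of the duoidal data `d` have the right domains and codomains, and its two parts are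
pseudomonoids. -/
structure DuoTyped (M : SymMonTwoCat.{u}) (d : DuoData M.toTwoCat) : Prop where
  same : d.h.A = d.v.A
  v : IsPseudomonoid M.toMonTwoCat d.v
  h : IsPseudomonoid M.toMonTwoCat d.h
  src_ξ : M.src d.ξ = d.v.m ⬝₁ (d.h.m ⊗₁ d.h.m)
  tgt_ξ : M.tgt d.ξ = d.h.m ⬝₁ (d.v.m ⊗₁ d.v.m) ⬝₁ M.mid d.v.A
  src_ξup : M.src d.ξup = d.v.u
  tgt_ξup : M.tgt d.ξup = d.h.m ⬝₁ (d.v.u ⊗₁ d.v.u)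
  src_ξdn : M.src d.ξdn = d.v.m ⬝₁ (d.h.u ⊗₁ d.h.u)
  tgt_ξdn : M.tgt d.ξdn = d.h.u
  src_ξud : M.src d.ξud = d.v.u
  tgt_ξud : M.tgt d.ξud = d.h.u

/-- The multiplication of `v` as an opmonoidal 1-cell with respect to `h`. -/
noncomputable def SymMonTwoCat.opMul (M : SymMonTwoCat.{u}) (d : DuoData M.toTwoCat) :
    CellData M.toTwoCat := ⟨d.v.m, d.ξ ⬝ₕ 𝟏(M.mid d.v.A), d.ξdn⟩

/-- The unit of `v` as an opmonoidal 1-cell with respect to `h`. -/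
def DuoData.opOne {M : TwoCat.{u}} (d : DuoData M) : CellData M := ⟨d.v.u, d.ξup, d.ξud⟩

variable {M : SymMonTwoCat.{u}}

theorem IsDuoidal.typed {d : DuoData M.toTwoCat} (hd : IsDuoidal M d) : DuoTyped M d where
  same := hd.same
  v := hd.v
  h := hd.h
  src_ξ := hd.mul.src_φ2
  tgt_ξ := hd.mul.tgt_φ2
  src_ξup := hd.mul.src_φ0
  tgt_ξup := hd.mul.tgt_φ0
  src_ξdn := hd.one.src_φ2
  tgt_ξdn := hd.one.tgt_φ2.trans (c_id hd.h.dom_u)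
  src_ξud := hd.one.src_φ0
  tgt_ξud := hd.one.tgt_φ0.trans (c_id hd.h.dom_u)

section Braid

variable {A : M.C0} {m n : M.C1} {α ξ : M.C2}

theorem whisk_mid3_left (dm : M.dom m = A ⊗₀ A) (cm : M.cod m = A) :
    (((m ⊗₁ m) ⬝₁ M.mid A) ⊗₁ M.id1 (A ⊗₀ A)) ⬝₁ M.mid3 A =
      M.mid A ⬝₁ (m ⊗₁ M.id1 A ⊗₁ m ⊗₁ M.id1 A) := by
  rw [← mid_nat_left dm cm, mid3_eq, ← c_assoc, ← t1_assoc m m]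
  · congr 1
    rw [show ((m ⊗₁ m) ⬝₁ M.mid A) ⊗₁ M.id1 (A ⊗₀ A) =
      ((m ⊗₁ m) ⊗₁ M.id1 (A ⊗₀ A)) ⬝₁ (M.mid A ⊗₁ M.id1 (A ⊗₀ A)) by
        rw [← t_c, c_id] <;> simp [*], c_assoc, mid_t_mid, c_id] <;> simp [*]
  all_goals simp [*]

theorem whisk_mid3_right (dm : M.dom m = A ⊗₀ A) (cm : M.cod m = A) :
    (M.id1 (A ⊗₀ A) ⊗₁ ((m ⊗₁ m) ⬝₁ M.mid A)) ⬝₁ M.mid3 A =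
      M.mid A ⬝₁ (M.id1 A ⊗₁ m ⊗₁ M.id1 A ⊗₁ m) := by
  rw [← mid_nat_right dm cm, mid3, ← c_assoc]
  · congr 1
    rw [show M.id1 (A ⊗₀ A) ⊗₁ ((m ⊗₁ m) ⬝₁ M.mid A) =
      (M.id1 (A ⊗₀ A) ⊗₁ (m ⊗₁ m)) ⬝₁ (M.id1 (A ⊗₀ A) ⊗₁ M.mid A) by
        rw [← t_c, c_id] <;> simp [*], c_assoc, t_mid_mid, c_id] <;> simp [*]
  all_goals simp [*]

theorem hc_mid3_left (dn : M.dom n = A ⊗₀ A) (dξ : M.dom (M.src ξ) = A ⊗₀ A ⊗₀ A ⊗₀ A) :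
    (ξ ⊗₂ 𝟏n) ⬝ₕ 𝟏(M.mid3 A) =
      ((ξ ⬝ₕ 𝟏(M.mid A)) ⊗₂ 𝟏n) ⬝ₕ 𝟏(M.id1 (A ⊗₀ A) ⊗₁ M.σ A (A ⊗₀ A) ⊗₁ M.id1 A) := by
  rw [mid3_eq, ← hc_id_id, ← hc_assoc, ← t_id2, ← t_hc, hc_id] <;> simp [*]

theorem hc_mid3_right (dn : M.dom n = A ⊗₀ A) (dξ : M.dom (M.src ξ) = A ⊗₀ A ⊗₀ A ⊗₀ A) :
    (𝟏n ⊗₂ ξ) ⬝ₕ 𝟏(M.mid3 A) =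
      (𝟏n ⊗₂ (ξ ⬝ₕ 𝟏(M.mid A))) ⬝ₕ 𝟏(M.id1 A ⊗₁ M.σ (A ⊗₀ A) A ⊗₁ M.id1 (A ⊗₀ A)) := by
  rw [mid3, ← hc_id_id, ← hc_assoc, ← t_id2, ← t_hc, hc_id] <;> simp [*]

theorem t_c_mid3 (dn : M.dom n = A ⊗₀ A) : (n ⊗₁ n ⊗₁ n) ⬝₁ M.mid3 A =
    (n ⊗₁ ((n ⊗₁ n) ⬝₁ M.mid A)) ⬝₁ (M.id1 A ⊗₁ M.σ (A ⊗₀ A) A ⊗₁ M.id1 (A ⊗₀ A)) := by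
  rw [mid3, ← c_assoc, ← t_c, c_id] <;> simp [*]

end Braid

theorem mul_assoc_iff {d : DuoData M.toTwoCat} (hd : DuoTyped M d) :
    (𝟏(d.h.m) ⬝ₕ (M.tensorPsm d.v d.v).α) ⬝ᵥ
      (d.ξ ⬝ₕ 𝟏((M.tensorPsm d.v d.v).m ⊗₁ M.id1 (d.v.A ⊗₀ d.v.A))) ⬝ᵥ
        (𝟏(d.v.m) ⬝ₕ (d.ξ ⊗₂ 𝟏(d.h.m))) =
    (d.ξ ⬝ₕ 𝟏(M.id1 (d.v.A ⊗₀ d.v.A) ⊗₁ (M.tensorPsm d.v d.v).m)) ⬝ᵥ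
      (𝟏(d.v.m) ⬝ₕ (𝟏(d.h.m) ⊗₂ d.ξ)) ⬝ᵥ (d.v.α ⬝ₕ 𝟏(d.h.m ⊗₁ d.h.m ⊗₁ d.h.m)) ↔
    (𝟏(d.h.m) ⬝ₕ (d.v.α ⊗₂ d.v.α)) ⬝ᵥ
      ((M.opMul d).opComp (M.tensorCell (M.opMul d) d.h.idCell)).φ2 =
    ((M.opMul d).opComp (M.tensorCell d.h.idCell (M.opMul d))).φ2 ⬝ᵥ
      (d.v.α ⬝ₕ 𝟏((M.tensorPsm d.h (M.tensorPsm d.h d.h)).m)) := by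
  obtain ⟨⟨A, m, u, α, l, r⟩, ⟨A', n, w, β, k, q⟩, ξ, ξup, ξdn, ξud⟩ := d
  obtain ⟨same, hv, hh, sξ, tξ, -, -, -, -, -, -⟩ := hd
  dsimp only at same hv hh sξ tξ
  subst same
  obtain ⟨dm, cm, -, -, sα, tα, -, -, -, -, -, -, -, -, -⟩ := hv
  obtain ⟨dn, cn, -, -, -, -, -, -, -, -, -, -, -, -, -⟩ := hh
  dsimp only at dm cm sα tα dn cn
  simp only [opMul, CellData.opComp, tensorCell_eq, tensorPsm_eq, PsmData.idCell, dm, M.dom_id1]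
  rw [show M.id1 A' ⊗₁ M.σ A' A' ⊗₁ M.id1 A' = M.mid A' from rfl]
  have i1 := mid3_inv_left (M := M) A'
  have i2 := mid3_inv_right (M := M) A'
  have A2 := whisk_mid3_left dm cm
  have B2 := whisk_mid3_right dm cm
  have ed : M.dom (M.src ξ) = A' ⊗₀ A' ⊗₀ A' ⊗₀ A' := by rw [sξ]; simp [*]
  have A3 := hc_mid3_left dn ed
  have B3 := hc_mid3_right dn ed
  have C := t_c_mid3 dn
  have d3 := dom_mid3 (M := M) A'
  have c3 := cod_mid3 (M := M) A'
  have hSd := dom_mid (M := M) A'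
  have hSc := cod_mid (M := M) A'
  have SS := mid_mid (M := M) A'
  have N1 := mid_nat_left dm cm
  have N2 := mid_nat_right dm cm
  generalize M.mid3 A' = P at *
  generalize M.mid A' = S at *
  generalize hQ : (M.id1 (A' ⊗₀ A') ⊗₁ M.σ (A' ⊗₀ A') A' ⊗₁ M.id1 A') ⬝₁ (S ⊗₁ M.id1 (A' ⊗₀ A')) = Q at *
  have hQd : M.dom Q = A' ⊗₀ A' ⊗₀ A' ⊗₀ A' ⊗₀ A' ⊗₀ A' := by rw [← hQ]; simp [hSd, hSc]
  have hQc : M.cod Q = A' ⊗₀ A' ⊗₀ A' ⊗₀ A' ⊗₀ A' ⊗₀ A' := by rw [← hQ]; simp [hSd, hSc]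
  clear hQ
  have F1 : ((m ⊗₁ m) ⬝₁ S) ⊗₁ M.id1 (A' ⊗₀ A') =
      S ⬝₁ (m ⊗₁ M.id1 A' ⊗₁ m ⊗₁ M.id1 A') ⬝₁ Q := by
    rw [← c_assoc, ← A2, c_assoc, i2, c_id] <;> simp [*]
  have F2 : M.id1 (A' ⊗₀ A') ⊗₁ ((m ⊗₁ m) ⬝₁ S) =
      S ⬝₁ (M.id1 A' ⊗₁ m ⊗₁ M.id1 A' ⊗₁ m) ⬝₁ Q := by
    rw [← c_assoc, ← B2, c_assoc, i2, c_id] <;> simp [*]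
  have F3 : (m ⬝₁ (m ⊗₁ M.id1 A')) ⊗₁ (m ⬝₁ (m ⊗₁ M.id1 A')) =
    (m ⊗₁ m) ⬝₁ (m ⊗₁ M.id1 A' ⊗₁ m ⊗₁ M.id1 A') := by rw [← t1_assoc m, ← t_c] <;> simp [*]
  have F4 : (m ⬝₁ (M.id1 A' ⊗₁ m)) ⊗₁ (m ⬝₁ (M.id1 A' ⊗₁ m)) =
    (m ⊗₁ m) ⬝₁ (M.id1 A' ⊗₁ m ⊗₁ M.id1 A' ⊗₁ m) := by rw [← t1_assoc (M.id1 A') m, ← t_c] <;> simp [*]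
  have G1 : (m ⬝₁ (n ⊗₁ n)) ⊗₁ n = (m ⊗₁ M.id1 A') ⬝₁ (n ⊗₁ n ⊗₁ n) := by
    rw [← t1_assoc n, ← t_c, id_c] <;> simp [*]
  have G2 : n ⊗₁ (m ⬝₁ (n ⊗₁ n)) = (M.id1 A' ⊗₁ m) ⬝₁ (n ⊗₁ n ⊗₁ n) := by
    rw [← t_c, id_c] <;> simp [*]
  have G3 : (n ⬝₁ (m ⊗₁ m) ⬝₁ S) ⊗₁ n = (n ⊗₁ n) ⬝₁ (((m ⊗₁ m) ⬝₁ S) ⊗₁ M.id1 (A' ⊗₀ A')) := by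
    rw [← t_c, c_id] <;> simp [*]
  have G4 : n ⊗₁ (n ⬝₁ (m ⊗₁ m) ⬝₁ S) = (n ⊗₁ n) ⬝₁ (M.id1 (A' ⊗₀ A') ⊗₁ ((m ⊗₁ m) ⬝₁ S)) := by
    rw [← t_c, c_id] <;> simp [*]
  have G5 : n ⊗₁ (m ⬝₁ (n ⊗₁ n) ⬝₁ S) = (M.id1 A' ⊗₁ m) ⬝₁ (n ⊗₁ ((n ⊗₁ n) ⬝₁ S)) := by
    rw [← t_c, id_c] <;> simp [*]
  have G6 : (n ⊗₁ (n ⬝₁ (m ⊗₁ m))) ⬝₁ (M.id1 A' ⊗₁ M.σ (A' ⊗₀ A') A' ⊗₁ M.id1 (A' ⊗₀ A')) =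
      (n ⊗₁ n) ⬝₁ S ⬝₁ (M.id1 A' ⊗₁ m ⊗₁ M.id1 A' ⊗₁ m) := by
    rw [← N2, ← c_assoc, ← t_c (g := n) (g' := n), c_id] <;> simp [*]
  have SX : ∀ x, M.cod x = A' ⊗₀ A' ⊗₀ A' ⊗₀ A' → S ⬝₁ S ⬝₁ x = x := by
    intro x hx
    rw [← c_assoc, SS, id_c hx] <;> simp [*]
  clear N1 N2
  rw [← whisk_inj (f := P) (A := A' ⊗₀ A' ⊗₀ A' ⊗₀ A' ⊗₀ A' ⊗₀ A') d3 c3 hQd hQc i2]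
  · rw [whisk_vc3, whisk_vc3, hc_assoc (c := 𝟏n), hc_assoc (c := α ⊗₂ α), hc_id_id, i1, hc_id,
      hc_assoc (c := ξ), hc_id_id, A2, hc_assoc (c := 𝟏m), A3, hc_assoc (c := ξ), hc_id_id, B2,
      hc_assoc (c := 𝟏m), B3, hc_assoc (c := α), hc_id_id, C, hc_assoc (c := ξ), hc_id_id,
      hc_assoc (c := ξ), hc_id_id]
    · simp only [t1_assoc]
      rw [vc_assoc]
      all_goals clear A2 B2 A3 B3 i1 i2 F1 F2
      · simp (maxDischargeDepth := 9) [*, c_assoc]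
      · simp (maxDischargeDepth := 9) [*, c_assoc]
    all_goals clear A2 B2 A3 B3 C i1 i2
    all_goals simp (maxDischargeDepth := 9) [*, c_assoc]
  all_goals clear A2 B2 A3 B3 C i1 i2
  all_goals simp (maxDischargeDepth := 9) [*, c_assoc]

theorem mid_c_left {u : M.C1} {A : M.C0} (du : M.dom u = M.unit) (cu : M.cod u = A) :
    M.mid A ⬝₁ (u ⊗₁ M.id1 A ⊗₁ u ⊗₁ M.id1 A) = u ⊗₁ u ⊗₁ M.id1 (A ⊗₀ A) := by
  have e := M.σ_nat1 (f := M.id1 A) (g := u) (M.dom_id1 A) du (M.cod_id1 A) cu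
  rw [σ_unit_right, c_id (by simp [*])] at e
  rw [mid, ← t1_assoc (M.id1 A) u, ← t_c, ← t_c, e] <;> simp [*]

theorem mid_c_right {u : M.C1} {A : M.C0} (du : M.dom u = M.unit) (cu : M.cod u = A) :
    M.mid A ⬝₁ (M.id1 A ⊗₁ u ⊗₁ M.id1 A ⊗₁ u) = M.id1 (A ⊗₀ A) ⊗₁ u ⊗₁ u := by
  have e := M.σ_nat1 (f := u) (g := M.id1 A) du (M.dom_id1 A) cu (M.cod_id1 A)
  rw [σ_unit_left, c_id (by simp [*])] at e
  rw [mid, ← t1_assoc u (M.id1 A), ← t_c, ← t_c, e] <;> simp [*]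
  rw [← t1_assoc, t_id1]

theorem mul_unit_left_iff {d : DuoData M.toTwoCat} (hd : DuoTyped M d) :
    (𝟏(d.h.m) ⬝ₕ (M.tensorPsm d.v d.v).lam) ⬝ᵥ
      (d.ξ ⬝ₕ 𝟏((M.tensorPsm d.v d.v).u ⊗₁ M.id1 (d.v.A ⊗₀ d.v.A))) ⬝ᵥ
        (𝟏(d.v.m) ⬝ₕ (d.ξup ⊗₂ 𝟏(d.h.m))) = d.v.lam ⬝ₕ 𝟏(d.h.m) ↔
    (𝟏(d.h.m) ⬝ₕ (d.v.lam ⊗₂ d.v.lam)) ⬝ᵥ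
      ((M.opMul d).opComp (M.tensorCell d.opOne d.h.idCell)).φ2 =
    d.h.idCell.φ2 ⬝ᵥ (d.v.lam ⬝ₕ 𝟏(d.h.m)) := by
  obtain ⟨⟨A, m, u, α, l, r⟩, ⟨A', n, w, β, k, q⟩, ξ, ξup, ξdn, ξud⟩ := d
  obtain ⟨same, hv, hh, sξ, tξ, s0, t0, -, -, -, -⟩ := hd
  dsimp only at same hv hh sξ tξ s0 t0
  subst same
  obtain ⟨dm, cm, du, cu, -, -, sl, tl, -, -, -, -, -, -, -⟩ := hv
  obtain ⟨dn, cn, -, -, -, -, -, -, -, -, -, -, -, -, -⟩ := hh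
  dsimp only at dm cm du cu sl tl dn cn
  simp only [opMul, DuoData.opOne, CellData.opComp, tensorCell_eq, tensorPsm_eq, PsmData.idCell, dm,
    du, M.dom_id1]
  have e := mid_c_left du cu
  rw [hc_assoc (c := ξ), hc_id_id, t1_assoc u _ (u ⊗₁ _), e, σ_unit_right, id_vc] <;>
    simp (maxDischargeDepth := 9) [*, c_assoc]

theorem mul_unit_right_iff {d : DuoData M.toTwoCat} (hd : DuoTyped M d) :
    (𝟏(d.h.m) ⬝ₕ (M.tensorPsm d.v d.v).rho) ⬝ᵥ
      (d.ξ ⬝ₕ 𝟏(M.id1 (d.v.A ⊗₀ d.v.A) ⊗₁ (M.tensorPsm d.v d.v).u)) ⬝ᵥ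
        (𝟏(d.v.m) ⬝ₕ (𝟏(d.h.m) ⊗₂ d.ξup)) = d.v.rho ⬝ₕ 𝟏(d.h.m) ↔
    (𝟏(d.h.m) ⬝ₕ (d.v.rho ⊗₂ d.v.rho)) ⬝ᵥ
      ((M.opMul d).opComp (M.tensorCell d.h.idCell d.opOne)).φ2 =
    d.h.idCell.φ2 ⬝ᵥ (d.v.rho ⬝ₕ 𝟏(d.h.m)) := by
  obtain ⟨⟨A, m, u, α, l, r⟩, ⟨A', n, w, β, k, q⟩, ξ, ξup, ξdn, ξud⟩ := d
  obtain ⟨same, hv, hh, sξ, tξ, s0, t0, -, -, -, -⟩ := hd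
  dsimp only at same hv hh sξ tξ s0 t0
  subst same
  obtain ⟨dm, cm, du, cu, -, -, -, -, sl, tl, -, -, -, -, -⟩ := hv
  obtain ⟨dn, cn, -, -, -, -, -, -, -, -, -, -, -, -, -⟩ := hh
  dsimp only at dm cm du cu sl tl dn cn
  simp only [opMul, DuoData.opOne, CellData.opComp, tensorCell_eq, tensorPsm_eq, PsmData.idCell, dm,
    du, M.dom_id1]
  have e := mid_c_right du cu
  rw [hc_assoc (c := ξ), hc_id_id, t1_assoc _ u (_ ⊗₁ u), e, σ_unit_left, id_vc] <;>
    simp (maxDischargeDepth := 9) [*, c_assoc]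

theorem one_assoc_iff {d : DuoData M.toTwoCat} (hd : DuoTyped M d) :
    (𝟏(d.h.u) ⬝ₕ (unitPsm M.toMonTwoCat).α) ⬝ᵥ
      (d.ξdn ⬝ₕ 𝟏((unitPsm M.toMonTwoCat).m ⊗₁ M.id1 M.unit)) ⬝ᵥ
        (𝟏(d.v.m) ⬝ₕ (d.ξdn ⊗₂ 𝟏(d.h.u))) =
    (d.ξdn ⬝ₕ 𝟏(M.id1 M.unit ⊗₁ (unitPsm M.toMonTwoCat).m)) ⬝ᵥ
      (𝟏(d.v.m) ⬝ₕ (𝟏(d.h.u) ⊗₂ d.ξdn)) ⬝ᵥ (d.v.α ⬝ₕ 𝟏(d.h.u ⊗₁ d.h.u ⊗₁ d.h.u)) ↔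
    ((M.opMul d).opComp (M.tensorCell (M.opMul d) d.h.idCell)).φ0 =
    ((M.opMul d).opComp (M.tensorCell d.h.idCell (M.opMul d))).φ0 ⬝ᵥ
      (d.v.α ⬝ₕ 𝟏((M.tensorPsm d.h (M.tensorPsm d.h d.h)).u)) := by
  obtain ⟨⟨A, m, u, α, l, r⟩, ⟨A', n, w, β, k, q⟩, ξ, ξup, ξdn, ξud⟩ := d
  obtain ⟨same, hv, hh, -, -, -, -, sξ, tξ, -, -⟩ := hd
  dsimp only at same hv hh sξ tξ
  subst same
  obtain ⟨dm, cm, -, -, sα, tα, -, -, -, -, -, -, -, -, -⟩ := hv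
  obtain ⟨-, -, dw, cw, -, -, -, -, -, -, -, -, -, -, -⟩ := hh
  dsimp only at dm cm sα tα dw cw
  have e1 : (m ⬝₁ (w ⊗₁ w)) ⊗₁ w = (m ⊗₁ M.id1 A') ⬝₁ (w ⊗₁ w ⊗₁ w) := by
    rw [← t1_assoc w, ← t_c, id_c] <;> simp [*]
  have e2 : w ⊗₁ (m ⬝₁ (w ⊗₁ w)) = (M.id1 A' ⊗₁ m) ⬝₁ (w ⊗₁ w ⊗₁ w) := by
    rw [← t_c, id_c] <;> simp [*]
  simp only [opMul, CellData.opComp, tensorCell_eq, tensorPsm_eq, PsmData.idCell, unitPsm]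
  rw [t_id1, t0_unit, hc_id, hc_id (a := ξdn), id_vc, vc_assoc] <;>
    simp (maxDischargeDepth := 9) [*, c_assoc]

theorem one_unit_left_iff {d : DuoData M.toTwoCat} (hd : DuoTyped M d) :
    (𝟏(d.h.u) ⬝ₕ (unitPsm M.toMonTwoCat).lam) ⬝ᵥ
      (d.ξdn ⬝ₕ 𝟏((unitPsm M.toMonTwoCat).u ⊗₁ M.id1 M.unit)) ⬝ᵥ
        (𝟏(d.v.m) ⬝ₕ (d.ξud ⊗₂ 𝟏(d.h.u))) = d.v.lam ⬝ₕ 𝟏(d.h.u) ↔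
    ((M.opMul d).opComp (M.tensorCell d.opOne d.h.idCell)).φ0 =
      d.h.idCell.φ0 ⬝ᵥ (d.v.lam ⬝ₕ 𝟏(d.h.u)) := by
  obtain ⟨⟨A, m, u, α, l, r⟩, ⟨A', n, w, β, k, q⟩, ξ, ξup, ξdn, ξud⟩ := d
  obtain ⟨same, hv, hh, -, -, -, -, sξ, tξ, s0, t0⟩ := hd
  dsimp only at same hv hh sξ tξ s0 t0
  subst same
  obtain ⟨dm, cm, du, cu, -, -, sl, tl, -, -, -, -, -, -, -⟩ := hv
  obtain ⟨-, -, dw, cw, -, -, -, -, -, -, -, -, -, -, -⟩ := hh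
  dsimp only at dm cm du cu sl tl dw cw
  simp only [opMul, DuoData.opOne, CellData.opComp, tensorCell_eq, tensorPsm_eq, PsmData.idCell,
    unitPsm]
  rw [t_id1, t0_unit, hc_id, hc_id (a := ξdn), id_vc, id_vc] <;>
    simp (maxDischargeDepth := 9) [*, c_assoc]

theorem one_unit_right_iff {d : DuoData M.toTwoCat} (hd : DuoTyped M d) :
    (𝟏(d.h.u) ⬝ₕ (unitPsm M.toMonTwoCat).rho) ⬝ᵥ
      (d.ξdn ⬝ₕ 𝟏(M.id1 M.unit ⊗₁ (unitPsm M.toMonTwoCat).u)) ⬝ᵥ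
        (𝟏(d.v.m) ⬝ₕ (𝟏(d.h.u) ⊗₂ d.ξud)) = d.v.rho ⬝ₕ 𝟏(d.h.u) ↔
    ((M.opMul d).opComp (M.tensorCell d.h.idCell d.opOne)).φ0 =
      d.h.idCell.φ0 ⬝ᵥ (d.v.rho ⬝ₕ 𝟏(d.h.u)) := by
  obtain ⟨⟨A, m, u, α, l, r⟩, ⟨A', n, w, β, k, q⟩, ξ, ξup, ξdn, ξud⟩ := d
  obtain ⟨same, hv, hh, -, -, -, -, sξ, tξ, s0, t0⟩ := hd
  dsimp only at same hv hh sξ tξ s0 t0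
  subst same
  obtain ⟨dm, cm, du, cu, -, -, -, -, sl, tl, -, -, -, -, -⟩ := hv
  obtain ⟨-, -, dw, cw, -, -, -, -, -, -, -, -, -, -, -⟩ := hh
  dsimp only at dm cm du cu sl tl dw cw
  simp only [opMul, DuoData.opOne, CellData.opComp, tensorCell_eq, tensorPsm_eq, PsmData.idCell,
    unitPsm]
  rw [t_id1, t0_unit, hc_id, hc_id (a := ξdn), id_vc, id_vc] <;>
    simp (maxDischargeDepth := 9) [*, c_assoc]

/-- The multiplication and the unit of `h` are monoidal with respect to `v` if and only if the
associativity and unitality cells of `v` are opmonoidal with respect to `h`. -/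
theorem monoidal_iff_opmonoidal {d : DuoData M.toTwoCat} (hd : DuoTyped M d) :
    (IsMonoidal1 M.toMonTwoCat (M.tensorPsm d.v d.v) d.v d.mul ∧
      IsMonoidal1 M.toMonTwoCat (unitPsm M.toMonTwoCat) d.v d.one) ↔
    (IsOpmonoidal2 M.toMonTwoCat (M.tensorPsm d.h (M.tensorPsm d.h d.h)) d.h
        ((M.opMul d).opComp (M.tensorCell (M.opMul d) d.h.idCell))
        ((M.opMul d).opComp (M.tensorCell d.h.idCell (M.opMul d))) d.v.α ∧
      IsOpmonoidal2 M.toMonTwoCat d.h d.h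
        ((M.opMul d).opComp (M.tensorCell d.opOne d.h.idCell)) d.h.idCell d.v.lam ∧
      IsOpmonoidal2 M.toMonTwoCat d.h d.h
        ((M.opMul d).opComp (M.tensorCell d.h.idCell d.opOne)) d.h.idCell d.v.rho) := by
  have e := hd.same
  constructor
  · rintro ⟨h1, h2⟩
    exact ⟨⟨hd.v.src_α.trans (by rw [← e]; rfl), hd.v.tgt_α.trans (by rw [← e]; rfl),
        (mul_assoc_iff hd).1 h1.assoc, (one_assoc_iff hd).1 h2.assoc⟩,
      ⟨hd.v.src_lam.trans (by rw [← e]; rfl), hd.v.tgt_lam.trans (by rw [← e]; rfl),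
        (mul_unit_left_iff hd).1 h1.unit_left, (one_unit_left_iff hd).1 h2.unit_left⟩,
      ⟨hd.v.src_rho.trans (by rw [← e]; rfl), hd.v.tgt_rho.trans (by rw [← e]; rfl),
        (mul_unit_right_iff hd).1 h1.unit_right, (one_unit_right_iff hd).1 h2.unit_right⟩⟩
  · rintro ⟨h1, h2, h3⟩
    exact ⟨⟨hd.h.dom_m.trans (by rw [e]; rfl), hd.h.cod_m.trans e, hd.src_ξ, hd.tgt_ξ, hd.src_ξup,
        hd.tgt_ξup, (mul_assoc_iff hd).2 h1.binary, (mul_unit_left_iff hd).2 h2.binary,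
        (mul_unit_right_iff hd).2 h3.binary⟩,
      ⟨hd.h.dom_u, hd.h.cod_u.trans e, hd.src_ξdn, hd.tgt_ξdn.trans (c_id hd.h.dom_u).symm,
        hd.src_ξud, hd.tgt_ξud.trans (c_id hd.h.dom_u).symm, (one_assoc_iff hd).2 h1.nullary,
        (one_unit_left_iff hd).2 h2.nullary, (one_unit_right_iff hd).2 h3.nullary⟩⟩

/-- The duoidal data in `M` that corresponds to duoidal data in `M^co`: the two pseudomonoids
exchange their roles. -/
noncomputable def DuoData.dual (M : SymMonTwoCat.{u}) (d : DuoData M.toTwoCat.co) :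
    DuoData M.toTwoCat :=
  ⟨d.h.ofCo, d.v.ofCo, M.hc d.ξ (M.id2 (M.mid d.v.A)), d.ξdn, d.ξup, d.ξud⟩

/-- The data in `M` of a `(1,1)`-oidal 1-cell that corresponds to such data in `M^co`. -/
def OidalData.dual {M : TwoCat.{u}} (r : OidalData M.co) : OidalData M :=
  ⟨r.f, r.φup2, r.φup0, r.φdn2, r.φdn0⟩

theorem dual_dual {M : SymMonTwoCat.{u}} {d : DuoData M.toTwoCat} (hd : DuoTyped M d) :
    DuoData.dual M (DuoData.dual M.co d) = d := by
  refine DuoData.ext (PsmData.ofCo_toCo hd.v) (PsmData.ofCo_toCo hd.h) ?_ rfl rfl rfl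
  have e : DuoData.ξ (DuoData.dual M.co d) = d.ξ ⬝ₕ 𝟏(M.mid d.v.A) := co_hc (M := M.toTwoCat) _ _
  have e' : (DuoData.dual M (DuoData.dual M.co d)).ξ =
    (d.ξ ⬝ₕ 𝟏(M.mid d.v.A)) ⬝ₕ 𝟏(M.mid d.h.A) := congrArg (fun x => M.hc x _) e
  rw [e', hd.same]
  have k : M.dom (M.src d.ξ) = d.v.A ⊗₀ d.v.A ⊗₀ d.v.A ⊗₀ d.v.A := by
    rw [hd.src_ξ, ← hd.same]
    have h1 := hd.v.dom_m
    rw [← hd.same] at h1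
    obtain ⟨dm, cm, -⟩ := hd.h
    simp [*]
  rw [hc_assoc, hc_id_id, mid_mid, hc_id k] <;> simp [*]

section

variable {M : SymMonTwoCat.{u}}

theorem read0'_eq (X : Pseudomonoid (obj01 M).co.toMonTwoCat) :
    read0' M X = DuoData.dual M (read0 M.co X) :=
  DuoData.ext rfl (PsmData.ofCo_toCo (Pseudomonoid.law (M := M.toMonTwoCat) X.data.A)).symm rfl
    rfl rfl rfl

/-- The duoidal data in `M` that a pseudomonoid in `M₀₁` consists of. -/
noncomputable def duo01 (M : SymMonTwoCat.{u}) (d : PsmData (obj01 M).toTwoCat) :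
    DuoData M.toTwoCat :=
  ⟨(forget01 M).mapPsm d, psm01 M d.A,
    M.hc (CellData.φ2 (Opmonoidal1.data (M := M.toMonTwoCat) d.m))
      (M.id2 (M.mid ((forget01 M).map0 d.A))),
    (Opmonoidal1.data (M := M.toMonTwoCat) d.u).φ2, (Opmonoidal1.data (M := M.toMonTwoCat) d.m).φ0,
    (Opmonoidal1.data (M := M.toMonTwoCat) d.u).φ0⟩

theorem opm_law {F : (obj01 M).C1} {A B : (obj01 M).C0} (hd : (obj01 M).dom F = A)
    (hc : (obj01 M).cod F = B) : IsOpmonoidal1 M.toMonTwoCat (psm01 M A) (psm01 M B)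
      (Opmonoidal1.data (M := M.toMonTwoCat) F) := by
  subst hd hc
  exact Opmonoidal1.law (M := M.toMonTwoCat) F

theorem opm2_law {a : (obj01 M).C2} {A B : (obj01 M).C0} {F G : (obj01 M).C1}
    (hF : (obj01 M).src a = F) (hG : (obj01 M).tgt a = G) (hd : (obj01 M).dom F = A)
    (hc : (obj01 M).cod F = B) : IsOpmonoidal2 M.toMonTwoCat (psm01 M A) (psm01 M B)
      (Opmonoidal1.data (M := M.toMonTwoCat) F) (Opmonoidal1.data (M := M.toMonTwoCat) G)
      ((forget01 M).map2 a) := by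
  subst hF hG hd hc
  exact Opmonoidal2.law (M := M.toMonTwoCat) a

theorem opm_c {G F : (obj01 M).C1} (h : (obj01 M).cod F = (obj01 M).dom G) :
    Opmonoidal1.data (M := M.toMonTwoCat) (G ⬝₁ F) =
      (Opmonoidal1.data (M := M.toMonTwoCat) G).opComp
        (Opmonoidal1.data (M := M.toMonTwoCat) F) := by
  rw [c_def h]
  rfl

theorem read0'_eq_duo01 (X : Pseudomonoid (obj01 M).co.toMonTwoCat) :
    read0' M X = duo01 M X.data.ofCo := by
  obtain ⟨-, -, -, -, -, -, -, -, -, -, iα, il, ir, -⟩ := X.law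
  have e : ∀ a : (obj01 M).C2, IsInvertible (M := (obj01 M).toTwoCat.co) a →
      inv2 ((forget01 M).map2 a) = (forget01 M).map2 (inv2 a) := fun a ha =>
    (IsInverse.map (forget01 M).toTwoFunctor (IsInvertible.co (M := (obj01 M).toTwoCat.co) ha).inv2).inv2_eq
  exact DuoData.ext (PsmData.ext rfl rfl rfl (e _ iα) (e _ il) (e _ ir)) rfl rfl rfl rfl rfl

theorem dom_src_duo01 {d : PsmData (obj01 M).toTwoCat}
    (hd : IsPseudomonoid (obj01 M).toMonTwoCat d) :
    M.dom (M.src (Opmonoidal1.data (M := M.toMonTwoCat) d.m).φ2) = (psm01 M d.A).A ⊗₀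
      (psm01 M d.A).A ⊗₀ (psm01 M d.A).A ⊗₀ (psm01 M d.A).A := by
  obtain ⟨df, cf, sm, tm, sm0, tm0, -⟩ := opm_law hd.dom_m hd.cod_m
  obtain ⟨dm, cm, du, cu, -⟩ : IsPseudomonoid M.toMonTwoCat (psm01 M d.A) :=
    Pseudomonoid.law (M := M.toMonTwoCat) d.A
  rw [sm, show psm01 M (d.A ⊗₀ d.A) = M.tensorPsm (psm01 M d.A) (psm01 M d.A) from rfl,
    tensorPsm_eq]
  rw [show psm01 M (d.A ⊗₀ d.A) = M.tensorPsm (psm01 M d.A) (psm01 M d.A) from rfl,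
    tensorPsm_eq] at df
  simp [*]

theorem typed_duo01 {d : PsmData (obj01 M).toTwoCat}
    (hd : IsPseudomonoid (obj01 M).toMonTwoCat d) : DuoTyped M (duo01 M d) := by
  obtain ⟨df, cf, sm, tm, sm0, tm0, -⟩ := opm_law hd.dom_m hd.cod_m
  obtain ⟨df', cf', su, tu, su0, tu0, -⟩ := opm_law hd.dom_u hd.cod_u
  have lA : IsPseudomonoid M.toMonTwoCat (psm01 M d.A) :=
    Pseudomonoid.law (M := M.toMonTwoCat) d.A
  have lA' := lA
  have k := dom_src_duo01 hd
  obtain ⟨dm, cm, du, cu, -⟩ := lA'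
  rw [show psm01 M (d.A ⊗₀ d.A) = M.tensorPsm (psm01 M d.A) (psm01 M d.A) from rfl,
    tensorPsm_eq] at df sm sm0
  rw [show psm01 M (obj01 M).unit = unitPsm M.toMonTwoCat from rfl, unitPsm] at df' su su0
  dsimp only at df df' sm sm0 su su0
  refine ⟨rfl, (forget01 M).mapPsm_law hd, lA, ?_, ?_, su.trans (c_id df'), tu, sm0, tm0,
    su0.trans (c_id df'), tu0⟩
  · refine (src_hc ?_).trans ?_
    · rw [src_id2, k]; exact cod_mid _
    · rw [src_id2, sm]
      change (_ ⬝₁ _ ⬝₁ M.mid (psm01 M d.A).A) ⬝₁ M.mid (psm01 M d.A).A = _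
      rw [c_assoc, c_assoc, mid_mid, c_id]
      · rfl
      all_goals simp [*]
  · refine (tgt_hc ?_).trans ?_
    · rw [src_id2, k]; exact cod_mid _
    · rw [tgt_id2, tm]
      change (_ ⬝₁ _) ⬝₁ M.mid (psm01 M d.A).A = _
      rw [c_assoc]
      · rfl
      all_goals simp [*]

theorem opMul_duo01 {d : PsmData (obj01 M).toTwoCat}
    (hd : IsPseudomonoid (obj01 M).toMonTwoCat d) :
    M.opMul (duo01 M d) = Opmonoidal1.data (M := M.toMonTwoCat) d.m := by
  have k := dom_src_duo01 hd
  refine CellData.ext rfl ?_ rfl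
  change (_ ⬝ₕ 𝟏(M.mid (psm01 M d.A).A)) ⬝ₕ 𝟏(M.mid (psm01 M d.A).A) = _
  rw [hc_assoc, hc_id_id, mid_mid, hc_id k] <;> simp [*]

theorem opmonoidal_duo01 {d : PsmData (obj01 M).toTwoCat}
    (hd : IsPseudomonoid (obj01 M).toMonTwoCat d) :
    IsMonoidal1 M.toMonTwoCat (M.tensorPsm (duo01 M d).v (duo01 M d).v) (duo01 M d).v
        (duo01 M d).mul ∧
      IsMonoidal1 M.toMonTwoCat (unitPsm M.toMonTwoCat) (duo01 M d).v (duo01 M d).one := by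
  rw [monoidal_iff_opmonoidal (typed_duo01 hd), opMul_duo01 hd]
  obtain ⟨dm, cm, du, cu, sα, tα, sl, tl, sr, tr, -⟩ := hd
  have l1 := opm2_law sα tα (A := d.A ⊗₀ d.A ⊗₀ d.A) (B := d.A) (by simp [*]) (by simp [*])
  have l2 := opm2_law sl tl (A := d.A) (B := d.A) (by simp [*]) (by simp [*])
  have l3 := opm2_law sr tr (A := d.A) (B := d.A) (by simp [*]) (by simp [*])
  rw [opm_c (by simp [*]), opm_c (by simp [*])] at l1
  rw [opm_c (by simp [*])] at l2 l3
  exact ⟨l1, l2, l3⟩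

/-- The inverse of an opmonoidal 2-cell of `M^co` is a monoidal 2-cell of `M`. -/
theorem monoidal2_of_opmonoidal2_co {F G : (obj10 M).C1} {A B : (obj10 M).C0}
    (hF : (obj10 M).dom F = A) (hF' : (obj10 M).cod F = B) (hG : (obj10 M).dom G = A)
    (hG' : (obj10 M).cod G = B) {ω η : M.C2}
    (h : IsOpmonoidal2 M.co.toMonTwoCat (Pseudomonoid.data (M := M.co.toMonTwoCat) A)
      (Pseudomonoid.data (M := M.co.toMonTwoCat) B) (Opmonoidal1.data (M := M.co.toMonTwoCat) F)
      (Opmonoidal1.data (M := M.co.toMonTwoCat) G) ω) (hη : IsInverse ω η) :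
    IsMonoidal2 M.toMonTwoCat (psm10 M A) (psm10 M B) (mon1 M F) (mon1 M G) η := by
  subst hF hF'
  let b : (obj10 M).C2 := Opmonoidal2.mk (M := M.co.toMonTwoCat) F G hG hG' ω h
  have k : IsMonoidal2 M.toMonTwoCat (psm10 M ((obj10 M).dom G)) (psm10 M ((obj10 M).cod G))
    (mon1 M G) (mon1 M F) ω := forget10_law b
  have lG := mon1_law G
  rw [hG, hG'] at k lG
  exact k.inverse (psm10_law _) (psm10_law _) lG (mon1_law F) hη

theorem isDuoidal_read0' (X : Pseudomonoid (obj01 M).co.toMonTwoCat) :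
    IsDuoidal M (read0' M X) := by
  have hX : IsPseudomonoid (obj01 M).toMonTwoCat X.data.ofCo :=
    IsPseudomonoid.ofCo (M := (obj01 M).toMonTwoCat) X.law
  have T := typed_duo01 hX
  obtain ⟨hm, ho⟩ := opmonoidal_duo01 hX
  rw [← read0'_eq_duo01] at T hm ho
  have D : IsDuoidal M.co (read0 M.co X) := isDuoidal_read0 (M := M.co) X
  obtain ⟨l1, l2, l3⟩ := (monoidal_iff_opmonoidal D.typed).1 ⟨D.mul, D.one⟩
  have e := read0'_eq X
  have iα := (IsInvertible.co D.v.inv_α).inv2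
  have il := (IsInvertible.co D.v.inv_lam).inv2
  have ir := (IsInvertible.co D.v.inv_rho).inv2
  have lh := D.h
  rw [e] at T hm ho ⊢
  generalize read0 M.co X = d at *
  let V : (obj10 M).C0 := Pseudomonoid.mk (M := M.co.toMonTwoCat) d.h lh
  have hV : psm10 M V = (DuoData.dual M d).v := rfl
  rw [← hV, ← psm10_t] at hm
  rw [← hV, ← psm10_unit] at ho
  obtain ⟨F, dF, cF, eF⟩ := exists_mon1 hm
  obtain ⟨U, dU, cU, eU⟩ := exists_mon1 ho
  have kF : Opmonoidal1.data (M := M.co.toMonTwoCat) F = M.co.opMul d := by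
    have e2 : (mon1 M F).φ2 = M.co.hc d.ξ (M.id2 (M.mid d.v.A)) :=
      (congrArg CellData.φ2 eF).trans (co_hc (M := M.toTwoCat) _ _).symm
    exact CellData.ext (M := M.toTwoCat.co) (congrArg (CellData.f (M := M.toTwoCat)) eF) e2
      (congrArg (CellData.φ0 (M := M.toTwoCat)) eF)
  have kU : Opmonoidal1.data (M := M.co.toMonTwoCat) U = d.opOne :=
    CellData.ext (M := M.toTwoCat.co) (congrArg (CellData.f (M := M.toTwoCat)) eU)
      (congrArg (CellData.φ2 (M := M.toTwoCat)) eU) (congrArg (CellData.φ0 (M := M.toTwoCat)) eU)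
  have kc : ∀ {G F : (obj10 M).C1}, (obj10 M).cod F = (obj10 M).dom G →
      Opmonoidal1.data (M := M.co.toMonTwoCat) (G ⬝₁ F) =
      (Opmonoidal1.data (M := M.co.toMonTwoCat) G).opComp
        (Opmonoidal1.data (M := M.co.toMonTwoCat) F) := fun h => opm_c (M := M.co) h
  have kt : ∀ G F : (obj10 M).C1, Opmonoidal1.data (M := M.co.toMonTwoCat) (G ⊗₁ F) =
      M.co.tensorCell (Opmonoidal1.data (M := M.co.toMonTwoCat) G)
        (Opmonoidal1.data (M := M.co.toMonTwoCat) F) := fun _ _ => rfl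
  have ki : Opmonoidal1.data (M := M.co.toMonTwoCat) ((obj10 M).id1 V) = d.h.idCell := rfl
  rw [← kF, ← ki, ← kt, ← kt, ← kc (by simp [*]), ← kc (by simp [*])] at l1
  rw [← kF, ← kU, ← ki, ← kt, ← kc (by simp [*])] at l2 l3
  have m1 := monoidal2_of_opmonoidal2_co (A := V ⊗₀ V ⊗₀ V) (B := V) (by simp [*]) (by simp [*])
    (by simp [*]) (by simp [*]) l1 iα
  have m2 := monoidal2_of_opmonoidal2_co (A := V) (B := V) (by simp [*]) (by simp [*])
    (by simp [*]) (by simp [*]) l2 il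
  have m3 := monoidal2_of_opmonoidal2_co (A := V) (B := V) (by simp [*]) (by simp [*])
    (by simp [*]) (by simp [*]) l3 ir
  rw [mon1_c (by simp [*]), mon1_c (by simp [*]), mon1_t, mon1_t, mon1_id, psm10_t, psm10_t,
    eF] at m1
  rw [mon1_c (by simp [*]), mon1_t, mon1_id, eF, eU] at m2 m3
  rw [psm10_t] at hm
  rw [psm10_unit] at ho
  exact ⟨T.same, T.v, T.h, hm, ho, m1, m2, m3⟩

end

section

variable {M : SymMonTwoCat.{u}}

theorem injective_read0' : Function.Injective (read0' M) := by
  intro X Y h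
  rw [read0'_eq, read0'_eq] at h
  have k := congrArg (DuoData.dual M.co) h
  have e := fun X => dual_dual (M := M.co) (isDuoidal_read0 (M := M.co) X).typed
  exact read0_injective (M := M.co) ((e X).symm.trans (k.trans (e Y)))

theorem exists_read0' {d : DuoData M.toTwoCat} (hd : IsDuoidal M d) : ∃ X, read0' M X = d := by
  obtain ⟨Y, rfl⟩ := exists_read0 hd
  have h := isDuoidal_read0' (M := M.co) Y
  obtain ⟨X, hX⟩ : ∃ X : Pseudomonoid (obj01 M).co.toMonTwoCat, read0 M.co X = read0' M.co Y :=
    exists_read0 (M := M.co) h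
  refine ⟨X, ?_⟩
  rw [read0'_eq, hX, read0'_eq (M := M.co) Y]
  exact dual_dual hd.typed

theorem bijOn_read0' : Set.BijOn (read0' M) Set.univ {d | IsDuoidal M d} :=
  ⟨fun X _ => isDuoidal_read0' X, injective_read0'.injOn, fun _ hd =>
    (exists_read0' hd).imp fun _ h => ⟨trivial, h⟩⟩

theorem mid_t {f : M.C1} {A B : M.C0} (df : M.dom f = A) (cf : M.cod f = B) :
    (f ⊗₁ f ⊗₁ f ⊗₁ f) ⬝₁ M.mid A = M.mid B ⬝₁ (f ⊗₁ f ⊗₁ f ⊗₁ f) := by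
  have e := M.σ_nat1 (f := f) (g := f) df df cf cf
  unfold mid
  rw [← t1_assoc f f f, ← t_c, ← t_c, ← t_c, ← t_c, e] <;> simp [*]

theorem oidal1_binary {e e' : DuoData M.toTwoCat} {r : OidalData M.toTwoCat} (he : DuoTyped M e)
    (he' : DuoTyped M e') (hm : IsMonoidal1 M.toMonTwoCat e.v e'.v r.mon)
    (ho : IsOpmonoidal1 M.toMonTwoCat e.h e'.h r.opm)
    (h : IsOpmonoidal2 M.toMonTwoCat (M.tensorPsm e.h e.h) e'.h
      ((M.opMul e').opComp (M.tensorCell r.opm r.opm)) (r.opm.opComp (M.opMul e)) r.φdn2) :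
    (r.φup2 ⬝ₕ 𝟏((M.tensorPsm e.v e.v).m)) ⬝ᵥ (r.mon.monComp e.mul).φ2 =
      (e'.mul.monComp (M.tensorCell r.mon r.mon)).φ2 ⬝ᵥ (𝟏(e'.v.m) ⬝ₕ (r.φup2 ⊗₂ r.φup2)) := by
  obtain ⟨⟨A, m, u, α, l, q⟩, ⟨A1, n, w, β, k, p⟩, ξ, ξup, ξdn, ξud⟩ := e
  obtain ⟨⟨B, m', u', α', l', q'⟩, ⟨B1, n', w', β', k', p'⟩, ξ', ξup', ξdn', ξud'⟩ := e'
  obtain ⟨f, φ2, φ0, γ2, γ0⟩ := r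
  have h2 := h.binary
  clear h
  obtain ⟨same, hv, hh, sξ, tξ, -, -, -, -, -, -⟩ := he
  obtain ⟨same', hv', hh', sξ', tξ', -, -, -, -, -, -⟩ := he'
  dsimp only at same same'
  subst same same'
  obtain ⟨dm, cm, -, -, -, -, -, -, -, -, -, -, -, -, -⟩ := hv
  obtain ⟨dn, cn, -, -, -, -, -, -, -, -, -, -, -, -, -⟩ := hh
  obtain ⟨dm', cm', -, -, -, -, -, -, -, -, -, -, -, -, -⟩ := hv'
  obtain ⟨dn', cn', -, -, -, -, -, -, -, -, -, -, -, -, -⟩ := hh'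
  obtain ⟨df, cf, sφ, tφ, -, -, -, -, -⟩ := hm
  obtain ⟨-, -, sγ, tγ, -, -, -, -, -⟩ := ho
  dsimp only [OidalData.mon, OidalData.opm] at *
  simp only [opMul, CellData.opComp, CellData.monComp, tensorCell_eq, tensorPsm_eq, DuoData.mul, df]
    at h2 ⊢
  have F := mid_t df cf
  have SS := mid_mid (M := M) A1
  have SS' := mid_mid (M := M) B1
  have dS := dom_mid (M := M) A1
  have cS := cod_mid (M := M) A1
  have dS' := dom_mid (M := M) B1
  have cS' := cod_mid (M := M) B1
  rw [show M.id1 A1 ⊗₁ M.σ A1 A1 ⊗₁ M.id1 A1 = M.mid A1 from rfl] at *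
  generalize M.mid A1 = S at *
  generalize M.mid B1 = S' at *
  have SX : ∀ x, M.cod x = A1 ⊗₀ A1 ⊗₀ A1 ⊗₀ A1 → S ⬝₁ S ⬝₁ x = x := by
    intro x hx
    rw [← c_assoc, SS, id_c hx] <;> simp [*]
  have SX' : ∀ x, M.cod x = B1 ⊗₀ B1 ⊗₀ B1 ⊗₀ B1 → S' ⬝₁ S' ⬝₁ x = x := by
    intro x hx
    rw [← c_assoc, SS', id_c hx] <;> simp [*]
  have F1 : (f ⬝₁ m) ⊗₁ (f ⬝₁ m) = (f ⊗₁ f) ⬝₁ (m ⊗₁ m) := by rw [← t_c] <;> simp [*]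
  have F2 : (f ⬝₁ n) ⊗₁ (f ⬝₁ n) = (f ⊗₁ f) ⬝₁ (n ⊗₁ n) := by rw [← t_c] <;> simp [*]
  have F3 : (m' ⬝₁ (f ⊗₁ f)) ⊗₁ (m' ⬝₁ (f ⊗₁ f)) = (m' ⊗₁ m') ⬝₁ (f ⊗₁ f ⊗₁ f ⊗₁ f) := by
    rw [← t1_assoc f f (f ⊗₁ f), ← t_c] <;> simp [*]
  have F4 : (n' ⬝₁ (f ⊗₁ f)) ⊗₁ (n' ⬝₁ (f ⊗₁ f)) = (n' ⊗₁ n') ⬝₁ (f ⊗₁ f ⊗₁ f ⊗₁ f) := by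
    rw [← t1_assoc f f (f ⊗₁ f), ← t_c] <;> simp [*]
  rw [← whisk_inj (f := S) (A := A1 ⊗₀ A1 ⊗₀ A1 ⊗₀ A1) dS cS dS cS SS] at h2
  · have K1 : ((ξ' ⬝ₕ 𝟏S') ⬝ₕ 𝟏((f ⊗₁ f) ⊗₁ f ⊗₁ f)) ⬝ₕ 𝟏S = ξ' ⬝ₕ 𝟏((f ⊗₁ f) ⊗₁ f ⊗₁ f) := by
      rw [hc_assoc, hc_id_id, t1_assoc, F, hc_assoc, hc_id_id, SX'] <;> simp [*]
    have K2 : (𝟏m' ⬝ₕ (γ2 ⊗₂ γ2) ⬝ₕ 𝟏S) ⬝ₕ 𝟏S = 𝟏m' ⬝ₕ (γ2 ⊗₂ γ2) := by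
      rw [hc_assoc, hc_assoc, hc_id_id, SS, hc_id] <;> simp [*]
    have K3 : (𝟏f ⬝ₕ ξ ⬝ₕ 𝟏S) ⬝ₕ 𝟏S = 𝟏f ⬝ₕ ξ := by
      rw [hc_assoc, hc_assoc, hc_id_id, SS, hc_id] <;> simp [*]
    have K4 : (φ2 ⬝ₕ 𝟏((n ⊗₁ n) ⬝₁ S)) ⬝ₕ 𝟏S = φ2 ⬝ₕ 𝟏(n ⊗₁ n) := by
      rw [hc_assoc, hc_id_id, c_assoc, SS, c_id] <;> simp [*]
    have K5 : (γ2 ⬝ₕ 𝟏(m ⊗₁ m)) ⬝ₕ 𝟏S = γ2 ⬝ₕ 𝟏((m ⊗₁ m) ⬝₁ S) := by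
      rw [hc_assoc, hc_id_id] <;> simp [*]
    have K6 : (𝟏n' ⬝ₕ (φ2 ⊗₂ φ2)) ⬝ₕ 𝟏S = 𝟏n' ⬝ₕ (φ2 ⊗₂ φ2) ⬝ₕ 𝟏S := by
      rw [hc_assoc] <;> simp [*]
    rw [vc_assoc (c := γ2 ⬝ₕ _), whisk_vc3, whisk_vc3, K1, K2, K3, K4, K5, K6] at h2
    · rw [h2.symm, vc_assoc]
      all_goals clear h2 K1 K2 K3 K4 K5 K6
      all_goals simp (maxDischargeDepth := 9) [*, c_assoc]
    all_goals clear h2 K1 K2 K3 K4 K5 K6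
    all_goals simp (maxDischargeDepth := 9) [*, c_assoc]
  all_goals clear h2
  all_goals simp (maxDischargeDepth := 9) [*, c_assoc]

theorem oidal1_nullary {e e' : DuoData M.toTwoCat} {r : OidalData M.toTwoCat} (he : DuoTyped M e)
    (he' : DuoTyped M e') (hm : IsMonoidal1 M.toMonTwoCat e.v e'.v r.mon)
    (ho : IsOpmonoidal1 M.toMonTwoCat e.h e'.h r.opm)
    (h2 : IsOpmonoidal2 M.toMonTwoCat (M.tensorPsm e.h e.h) e'.h
      ((M.opMul e').opComp (M.tensorCell r.opm r.opm)) (r.opm.opComp (M.opMul e)) r.φdn2)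
    (h0 : IsOpmonoidal2 M.toMonTwoCat (unitPsm M.toMonTwoCat) e'.h e'.opOne
      (r.opm.opComp e.opOne) r.φdn0) :
    (r.φup2 ⬝ₕ 𝟏((M.tensorPsm e.v e.v).u)) ⬝ᵥ (r.mon.monComp e.mul).φ0 =
        (e'.mul.monComp (M.tensorCell r.mon r.mon)).φ0 ∧
      (r.φup0 ⬝ₕ 𝟏((unitPsm M.toMonTwoCat).m)) ⬝ᵥ (r.mon.monComp e.one).φ2 =
        e'.one.φ2 ⬝ᵥ (𝟏(e'.v.m) ⬝ₕ (r.φup0 ⊗₂ r.φup0)) ∧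
      (r.φup0 ⬝ₕ 𝟏((unitPsm M.toMonTwoCat).u)) ⬝ᵥ (r.mon.monComp e.one).φ0 = e'.one.φ0 := by
  obtain ⟨⟨A, m, u, α, l, q⟩, ⟨A1, n, w, β, k, p⟩, ξ, ξup, ξdn, ξud⟩ := e
  obtain ⟨⟨B, m', u', α', l', q'⟩, ⟨B1, n', w', β', k', p'⟩, ξ', ξup', ξdn', ξud'⟩ := e'
  obtain ⟨f, φ2, φ0, γ2, γ0⟩ := r
  have e1 := h2.nullary
  have e2 := h0.binary
  have e3 := h0.nullary
  clear h2 h0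
  obtain ⟨same, hv, hh, -, -, s1, t1, s2, t2, s3, t3⟩ := he
  obtain ⟨same', hv', hh', -, -, s1', t1', s2', t2', s3', t3'⟩ := he'
  dsimp only at same same'
  subst same same'
  obtain ⟨dm, cm, du, cu, -, -, -, -, -, -, -, -, -, -, -⟩ := hv
  obtain ⟨dn, cn, dw, cw, -, -, -, -, -, -, -, -, -, -, -⟩ := hh
  obtain ⟨dm', cm', du', cu', -, -, -, -, -, -, -, -, -, -, -⟩ := hv'
  obtain ⟨dn', cn', dw', cw', -, -, -, -, -, -, -, -, -, -, -⟩ := hh'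
  obtain ⟨df, cf, sφ, tφ, sφ0, tφ0, -, -, -⟩ := hm
  obtain ⟨-, -, sγ, tγ, sγ0, tγ0, -, -, -⟩ := ho
  dsimp only [OidalData.mon, OidalData.opm] at *
  have F1 : (f ⬝₁ u) ⊗₁ (f ⬝₁ u) = (f ⊗₁ f) ⬝₁ (u ⊗₁ u) := by rw [← t_c] <;> simp [*]
  have F2 : (f ⬝₁ w) ⊗₁ (f ⬝₁ w) = (f ⊗₁ f) ⬝₁ (w ⊗₁ w) := by rw [← t_c] <;> simp [*]
  simp only [opMul, DuoData.opOne, CellData.opComp, CellData.monComp, tensorCell_eq, tensorPsm_eq,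
    DuoData.mul, DuoData.one, unitPsm, df] at e1 e2 e3 ⊢
  refine ⟨?_, ?_, ?_⟩
  · rw [vc_assoc, hc_id] at e2
    · exact e2.symm
    all_goals clear e1 e2 e3
    all_goals simp (maxDischargeDepth := 9) [*, c_assoc]
  · rw [vc_assoc] at e1
    · rw [hc_id]
      · exact e1.symm
      clear e1 e2 e3
      simp (maxDischargeDepth := 9) [*, c_assoc]
    all_goals clear e1 e2 e3
    all_goals simp (maxDischargeDepth := 9) [*, c_assoc]
  · rw [vc_assoc, hc_id] at e3
    · rw [hc_id]
      · exact e3.symm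
      clear e1 e2 e3
      simp (maxDischargeDepth := 9) [*, c_assoc]
    all_goals clear e1 e2 e3
    all_goals simp (maxDischargeDepth := 9) [*, c_assoc]

end

section

variable {M : SymMonTwoCat.{u}}

theorem read0'_v (X : Pseudomonoid (obj01 M).co.toMonTwoCat) :
    (read0' M X).v = PsmData.ofCo (M := M.toTwoCat) ((forget01 M).co.mapPsm X.data) := by
  rw [read0'_eq]
  rfl

theorem toCo_read0'_v (X : Pseudomonoid (obj01 M).co.toMonTwoCat) :
    (read0' M X).v.toCo = (forget01 M).co.mapPsm X.data := by
  rw [read0'_v]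
  exact PsmData.toCo_ofCo (M := M.toMonTwoCat) ((forget01 M).co.mapPsm_law X.law)

theorem isOidal1_read1' (F : Opmonoidal1 (obj01 M).co.toMonTwoCat) :
    IsOidal1 M (read0' M F.dom) (read0' M F.cod) (read1' M F) := by
  have T := (isDuoidal_read0' F.dom).typed
  have T' := (isDuoidal_read0' F.cod).typed
  have mon : IsMonoidal1 M.toMonTwoCat (read0' M F.dom).v (read0' M F.cod).v (read1' M F).mon := by
    rw [← isOpmonoidal1_co_iff T.v T'.v, toCo_read0'_v, toCo_read0'_v]
    exact (forget01 M).co.mapCell_law F.dom.law F.cod.law F.law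
  have law := F.law
  have hX := IsPseudomonoid.ofCo (M := (obj01 M).toMonTwoCat) F.dom.law
  have hY := IsPseudomonoid.ofCo (M := (obj01 M).toMonTwoCat) F.cod.law
  have opm : IsOpmonoidal1 M.toMonTwoCat (read0' M F.dom).h (read0' M F.cod).h (read1' M F).opm :=
    opm_law (M := M) (F := F.data.f) law.dom_f law.cod_f
  have eX := opMul_duo01 hX
  have eY := opMul_duo01 hY
  rw [← read0'_eq_duo01] at eX eY
  obtain ⟨df, cf, s2, t2, s0, t0, -⟩ := law
  obtain ⟨dm, cm, du, cu, -⟩ := hX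
  obtain ⟨dm', cm', du', cu', -⟩ := hY
  let f : (obj01 M).C1 := F.data.f
  let m : (obj01 M).C1 := F.dom.data.m
  let u : (obj01 M).C1 := F.dom.data.u
  let m' : (obj01 M).C1 := F.cod.data.m
  let u' : (obj01 M).C1 := F.cod.data.u
  let A : (obj01 M).C0 := F.dom.data.A
  let B : (obj01 M).C0 := F.cod.data.A
  have df' : (obj01 M).dom f = A := df
  have cf' : (obj01 M).cod f = B := cf
  have t2' : (obj01 M).src F.data.φ2 = m' ⬝₁ (f ⊗₁ f) := t2
  have s2' : (obj01 M).tgt F.data.φ2 = f ⬝₁ m := s2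
  have t0' : (obj01 M).src F.data.φ0 = u' := t0
  have s0' : (obj01 M).tgt F.data.φ0 = f ⬝₁ u := s0
  have dm1 : (obj01 M).dom m = A ⊗₀ A := dm
  have cm1 : (obj01 M).cod m = A := cm
  have dm1' : (obj01 M).dom m' = B ⊗₀ B := dm'
  have cm1' : (obj01 M).cod m' = B := cm'
  have du1 : (obj01 M).dom u = (obj01 M).unit := du
  have cu1 : (obj01 M).cod u = A := cu
  have du1' : (obj01 M).dom u' = (obj01 M).unit := du'
  have cu1' : (obj01 M).cod u' = B := cu'
  have h2 := opm2_law t2' s2' (A := A ⊗₀ A) (B := B) (by simp [*]) (by simp [*])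
  have h0 := opm2_law t0' s0' (A := (obj01 M).unit) (B := B) (by simp [*]) (by simp [*])
  rw [opm_c (by simp [*]), opm_c (by simp [*])] at h2
  rw [opm_c (by simp [*])] at h0
  have g2 : IsOpmonoidal2 M.toMonTwoCat (M.tensorPsm (read0' M F.dom).h (read0' M F.dom).h)
      (read0' M F.cod).h
      ((M.opMul (read0' M F.cod)).opComp (M.tensorCell (read1' M F).opm (read1' M F).opm))
      ((read1' M F).opm.opComp (M.opMul (read0' M F.dom))) (read1' M F).φdn2 := by
    rw [eX, eY]
    exact h2
  have g0 : IsOpmonoidal2 M.toMonTwoCat (unitPsm M.toMonTwoCat) (read0' M F.cod).h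
      (read0' M F.cod).opOne ((read1' M F).opm.opComp (read0' M F.dom).opOne)
      (read1' M F).φdn0 := h0
  obtain ⟨n1, n2, n3⟩ := oidal1_nullary T T' mon opm g2 g0
  exact ⟨mon, opm, ⟨opm.src_φ2, opm.tgt_φ2, oidal1_binary T T' mon opm g2, n1⟩,
    ⟨opm.src_φ0, opm.tgt_φ0, n2, n3⟩⟩

theorem read1'_ext {F G : Opmonoidal1 (obj01 M).co.toMonTwoCat} (hd : F.dom = G.dom)
    (hc : F.cod = G.cod) (h : read1' M F = read1' M G) : F = G :=
  read1_ext (M := M.co) hd hc (congrArg (OidalData.dual (M := M.toTwoCat.co)) h)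

theorem exists_read1' {X Y : Pseudomonoid (obj01 M).co.toMonTwoCat} {r : OidalData M.toTwoCat}
    (hr : IsOidal1 M (read0' M X) (read0' M Y) r) :
    ∃ F : Opmonoidal1 (obj01 M).co.toMonTwoCat, F.dom = X ∧ F.cod = Y ∧ read1' M F = r := by
  obtain ⟨P, hP⟩ := exists_read0 (isDuoidal_read0' X)
  obtain ⟨Q, hQ⟩ := exists_read0 (isDuoidal_read0' Y)
  rw [← hP, ← hQ] at hr
  obtain ⟨G, rfl, rfl, rfl⟩ := exists_read1 hr
  have h := isOidal1_read1' (M := M.co) G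
  have eX : read0' M.co G.dom = read0 M.co X := by
    refine (read0'_eq (M := M.co) G.dom).trans ?_
    refine (congrArg (DuoData.dual M.co) (hP.trans (read0'_eq X))).trans ?_
    exact dual_dual (M := M.co) (isDuoidal_read0 (M := M.co) X).typed
  have eY : read0' M.co G.cod = read0 M.co Y := by
    refine (read0'_eq (M := M.co) G.cod).trans ?_
    refine (congrArg (DuoData.dual M.co) (hQ.trans (read0'_eq Y))).trans ?_
    exact dual_dual (M := M.co) (isDuoidal_read0 (M := M.co) Y).typed
  obtain ⟨F, hd, hc, h⟩ := exists_read1 (M := M.co) (X := X) (Y := Y)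
    (r := read1' M.co G) (eX ▸ eY ▸ h)
  exact ⟨F, hd, hc, congrArg (OidalData.dual (M := M.toTwoCat)) h⟩

theorem bijOn_read1' (X Y : Pseudomonoid (obj01 M).co.toMonTwoCat) :
    Set.BijOn (read1' M) {F | F.dom = X ∧ F.cod = Y}
      {r | IsOidal1 M (read0' M X) (read0' M Y) r} := by
  refine ⟨?_, ?_, ?_⟩
  · rintro F ⟨rfl, rfl⟩
    exact isOidal1_read1' F
  · rintro F ⟨rfl, rfl⟩ G ⟨hd, hc⟩ h
    exact read1'_ext hd.symm hc.symm h
  · intro r hr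
    obtain ⟨F, hd, hc, h⟩ := exists_read1' hr
    exact ⟨F, ⟨hd, hc⟩, h⟩

theorem isOidal2_read2' (a : Opmonoidal2 (obj01 M).co.toMonTwoCat) :
    IsOidal2 M (read0' M a.src.dom) (read0' M a.src.cod) (read1' M a.tgt) (read1' M a.src)
      (read2' M a) := by
  have T := (isDuoidal_read0' a.src.dom).typed
  have T' := (isDuoidal_read0' a.src.cod).typed
  have h1 := (isOidal1_read1' a.src).mon
  have h2 := (isOidal1_read1' a.tgt).mon
  rw [a.dom_eq, a.cod_eq] at h2
  have law := a.law
  obtain ⟨df, cf, -⟩ := a.law_tgt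
  refine ⟨?_, opm2_law (M := M) (a := a.ω) law.tgt_ω law.src_ω df cf⟩
  have k := (forget01 M).co.mapCell2_law a.src.dom.law a.src.cod.law a.src.law a.law_tgt law
  obtain ⟨dm, cm, du, cu, -⟩ := T.v
  obtain ⟨dm', cm', du', cu', -⟩ := T'.v
  exact (isOpmonoidal2_co_iff (d := (read0' M a.src.dom).v) (d' := (read0' M a.src.cod).v)
    (c := (read1' M a.tgt).mon) (c' := (read1' M a.src).mon) rfl rfl rfl dm cm cu dm' h2.dom_f
    h2.cod_f h2.src_φ2 h2.tgt_φ2 h1.src_φ2 h2.tgt_φ0).1 k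

theorem read2'_ext {a b : Opmonoidal2 (obj01 M).co.toMonTwoCat} (hs : a.src = b.src)
    (ht : a.tgt = b.tgt) (h : read2' M a = read2' M b) : a = b := read2_ext (M := M.co) hs ht h

theorem dual_read0' (X : Pseudomonoid (obj01 M).co.toMonTwoCat) :
    DuoData.dual M.co (read0' M X) = read0 M.co X :=
  (congrArg (DuoData.dual M.co) (read0'_eq X)).trans
    (dual_dual (M := M.co) (isDuoidal_read0 (M := M.co) X).typed)

theorem exists_read2' {F G : Opmonoidal1 (obj01 M).co.toMonTwoCat} (hd : G.dom = F.dom)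
    (hc : G.cod = F.cod) {ω : M.C2}
    (h : IsOidal2 M (read0' M F.dom) (read0' M F.cod) (read1' M F) (read1' M G) ω) :
    ∃ a : Opmonoidal2 (obj01 M).co.toMonTwoCat, a.tgt = F ∧ a.src = G ∧ read2' M a = ω := by
  obtain ⟨P, hP⟩ := exists_read0 (isDuoidal_read0' F.dom)
  obtain ⟨Q, hQ⟩ := exists_read0 (isDuoidal_read0' F.cod)
  have oF := isOidal1_read1' F
  have oG := isOidal1_read1' G
  rw [hd, hc] at oG
  rw [← hP, ← hQ] at h oF oG
  obtain ⟨F1, dF1, cF1, eF⟩ := exists_read1 oF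
  obtain ⟨G1, dG1, cG1, eG⟩ := exists_read1 oG
  rw [← eF, ← eG, ← dF1, ← cF1] at h
  obtain ⟨b, sb, tb, rfl⟩ := exists_read2 (dG1.trans dF1.symm) (cG1.trans cF1.symm) h
  have k := isOidal2_read2' (M := M.co) b
  have e1 : read0' M.co b.src.dom = read0 M.co G.dom := by
    refine (read0'_eq (M := M.co) b.src.dom).trans ?_
    rw [hd, ← dual_read0']
    exact congrArg (DuoData.dual M.co) (by rw [← hP, sb, dF1]; rfl)
  have e2 : read0' M.co b.src.cod = read0 M.co G.cod := by
    refine (read0'_eq (M := M.co) b.src.cod).trans ?_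
    rw [hc, ← dual_read0']
    exact congrArg (DuoData.dual M.co) (by rw [← hQ, sb, cF1]; rfl)
  have e3 : read1' M.co b.tgt = read1 M.co G :=
    congrArg (OidalData.dual (M := M.toTwoCat.co)) ((congrArg (read1 M) tb).trans eG)
  have e4 : read1' M.co b.src = read1 M.co F :=
    congrArg (OidalData.dual (M := M.toTwoCat.co)) ((congrArg (read1 M) sb).trans eF)
  rw [e1, e2, e3, e4] at k
  obtain ⟨a, sa, ta, ha⟩ := exists_read2 (M := M.co) (F := G) (G := F) hd.symm hc.symm k
  exact ⟨a, ta, sa, ha⟩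

theorem bijOn_read2' (X Y : Pseudomonoid (obj01 M).co.toMonTwoCat)
    (F G : Opmonoidal1 (obj01 M).co.toMonTwoCat) (hF : F.dom = X) (hF' : F.cod = Y)
    (hG : G.dom = X) (hG' : G.cod = Y) :
    Set.BijOn (read2' M) {a | a.tgt = F ∧ a.src = G}
      {ω | IsOidal2 M (read0' M X) (read0' M Y) (read1' M F) (read1' M G) ω} := by
  subst hF hF'
  refine ⟨?_, ?_, ?_⟩
  · rintro a ⟨rfl, rfl⟩
    rw [a.dom_eq, a.cod_eq]
    exact isOidal2_read2' a
  · rintro a ⟨rfl, rfl⟩ b ⟨ht, hs⟩ h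
    exact read2'_ext hs.symm ht.symm h
  · intro ω hω
    obtain ⟨a, ht, hs, h⟩ := exists_read2' hG hG' hω
    exact ⟨a, ⟨ht, hs⟩, h⟩

end

section Coherence

variable {M : SymMonTwoCat.{u}}

/-- The 1-cell `1 σ 1 : A B A' B' → A A' B B'`. -/
noncomputable def SymMonTwoCat.mid4 (M : SymMonTwoCat.{u}) (A B A' B' : M.C0) : M.C1 :=
  M.id1 A ⊗₁ M.σ B A' ⊗₁ M.id1 B'

@[simp] theorem dom_mid4 (A B A' B' : M.C0) :
    M.dom (M.mid4 A B A' B') = A ⊗₀ B ⊗₀ A' ⊗₀ B' := by simp [mid4]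
@[simp] theorem cod_mid4 (A B A' B' : M.C0) :
    M.cod (M.mid4 A B A' B') = A ⊗₀ A' ⊗₀ B ⊗₀ B' := by simp [mid4]

theorem mid4_nat {f g f' g' : M.C1} {A B A' B' C D C' D' : M.C0} (hf : M.dom f = A)
    (hg : M.dom g = B) (hf' : M.dom f' = A') (hg' : M.dom g' = B') (kf : M.cod f = C)
    (kg : M.cod g = D) (kf' : M.cod f' = C') (kg' : M.cod g' = D') :
    (f ⊗₁ f' ⊗₁ g ⊗₁ g') ⬝₁ M.mid4 A B A' B' =
      M.mid4 C D C' D' ⬝₁ (f ⊗₁ g ⊗₁ f' ⊗₁ g') := by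
  have e := M.σ_nat1 hg hf' kg kf'
  unfold mid4
  rw [← t1_assoc f' g, ← t1_assoc g f', ← t_c, ← t_c, ← t_c, ← t_c, e] <;> simp [*]

theorem mid4_assoc (A B A' B' C D : M.C0) :
    M.mid4 (A ⊗₀ A') (B ⊗₀ B') C D ⬝₁ (M.mid4 A B A' B' ⊗₁ M.id1 (C ⊗₀ D)) =
      M.mid4 A B (A' ⊗₀ C) (B' ⊗₀ D) ⬝₁ (M.id1 (A ⊗₀ B) ⊗₁ M.mid4 A' B' C D) :=
  M.middle_coherence A B A' B' C D

/-- The 1-cell `A B A B A B A B → A A A A B B B B`. -/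
noncomputable def SymMonTwoCat.mid8 (M : SymMonTwoCat.{u}) (A B : M.C0) : M.C1 :=
  M.mid4 (A ⊗₀ A) (B ⊗₀ B) (A ⊗₀ A) (B ⊗₀ B) ⬝₁ (M.mid4 A B A B ⊗₁ M.mid4 A B A B)

theorem mid8_eq (A B : M.C0) : M.mid8 A B =
    (M.mid4 A B (A ⊗₀ A ⊗₀ A) (B ⊗₀ B ⊗₀ B) ⬝₁
      (M.id1 (A ⊗₀ B) ⊗₁ M.mid4 (A ⊗₀ A) (B ⊗₀ B) A B)) ⬝₁
      (M.id1 (A ⊗₀ B) ⊗₁ M.mid4 A B A B ⊗₁ M.id1 (A ⊗₀ B)) := by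
  have e1 := mid4_assoc A B A B (A ⊗₀ A) (B ⊗₀ B)
  have e2 := mid4_assoc A B A B A B
  unfold mid8
  have e3 : M.mid4 A B A B ⊗₁ M.mid4 A B A B =
      (M.mid4 A B A B ⊗₁ M.id1 ((A ⊗₀ A) ⊗₀ B ⊗₀ B)) ⬝₁
        (M.id1 (A ⊗₀ B ⊗₀ A ⊗₀ B) ⊗₁ M.mid4 A B A B) := by
    rw [← t_c] <;> simp
  have e4 : M.id1 (A ⊗₀ B ⊗₀ A ⊗₀ B) ⊗₁ M.mid4 A B A B =
      M.id1 (A ⊗₀ B) ⊗₁ M.id1 (A ⊗₀ B) ⊗₁ M.mid4 A B A B := by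
    rw [← t1_assoc, t_id1, t0_assoc]
  rw [e3, ← c_assoc, e1, c_assoc, c_assoc, e4, ← t_c (g := M.id1 (A ⊗₀ B)) (f := M.id1 (A ⊗₀ B)),
    ← t_c (g := M.id1 (A ⊗₀ B)) (f := M.id1 (A ⊗₀ B)), e2] <;> simp

theorem mid8_mid (A B : M.C0) :
    M.mid8 A B ⬝₁ M.mid (A ⊗₀ B) = (M.mid A ⊗₁ M.mid B) ⬝₁ M.mid8 A B := by
  have e : M.mid4 A B A B ⬝₁ M.σ (A ⊗₀ B) (A ⊗₀ B) =
      (M.σ A A ⊗₁ M.σ B B) ⬝₁ M.mid4 A B A B := by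
    have h := M.σ_middle A B A B
    have k := t_σ_σ_t (M := M) B A A B
    have k' := t_σ_σ_t (M := M) A B A B
    have e1 : M.mid4 A B A B ⬝₁ M.σ (A ⊗₀ B) (A ⊗₀ B) =
        M.mid4 A B A B ⬝₁ (M.σ (A ⊗₀ B) (A ⊗₀ B) ⬝₁ (M.id1 A ⊗₁ M.σ A B ⊗₁ M.id1 B)) ⬝₁
          M.mid4 A B A B := by
      unfold mid4
      rw [c_assoc, k, c_id (f := M.σ (A ⊗₀ B) (A ⊗₀ B))] <;> simp
    rw [e1, h, ← c_assoc, ← c_assoc]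
    · unfold mid4
      rw [k', id_c] <;> simp
    all_goals simp
  have n1 := mid4_nat (M := M) (f := M.id1 A) (g := M.id1 B) (f' := M.σ A A ⊗₁ M.id1 A)
    (g' := M.σ B B ⊗₁ M.id1 B) (A := A) (B := B) (A' := A ⊗₀ A ⊗₀ A) (B' := B ⊗₀ B ⊗₀ B) (C := A)
    (D := B) (C' := A ⊗₀ A ⊗₀ A) (D' := B ⊗₀ B ⊗₀ B) (by simp) (by simp) (by simp) (by simp)
    (by simp) (by simp) (by simp) (by simp)
  have n2 := mid4_nat (M := M) (f := M.σ A A) (g := M.σ B B) (f' := M.id1 A)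
    (g' := M.id1 B) (A := A ⊗₀ A) (B := B ⊗₀ B) (A' := A) (B' := B) (C := A ⊗₀ A)
    (D := B ⊗₀ B) (C' := A) (D' := B) (by simp) (by simp) (by simp) (by simp)
    (by simp) (by simp) (by simp) (by simp)
  have m1 : M.mid A ⊗₁ M.mid B =
      M.id1 A ⊗₁ (M.σ A A ⊗₁ M.id1 A) ⊗₁ M.id1 B ⊗₁ (M.σ B B ⊗₁ M.id1 B) := by
    simp only [mid, t1_assoc]
  have m2 : M.id1 A ⊗₁ M.id1 B ⊗₁ (M.σ A A ⊗₁ M.id1 A) ⊗₁ M.σ B B ⊗₁ M.id1 B =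
      M.id1 (A ⊗₀ B) ⊗₁ (M.σ A A ⊗₁ M.id1 A ⊗₁ M.σ B B ⊗₁ M.id1 B) := by
    rw [← t_id1]; simp only [t1_assoc]
  have m3 : M.id1 (A ⊗₀ B) ⊗₁ (M.σ A A ⊗₁ M.σ B B ⊗₁ M.id1 A ⊗₁ M.id1 B) =
      M.id1 (A ⊗₀ B) ⊗₁ (M.σ A A ⊗₁ M.σ B B) ⊗₁ M.id1 (A ⊗₀ B) := by
    rw [← t_id1 A B]; simp only [t1_assoc]
  have m4 : (M.id1 (A ⊗₀ B) ⊗₁ M.mid4 A B A B ⊗₁ M.id1 (A ⊗₀ B)) ⬝₁ M.mid (A ⊗₀ B) =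
      (M.id1 (A ⊗₀ B) ⊗₁ (M.σ A A ⊗₁ M.σ B B) ⊗₁ M.id1 (A ⊗₀ B)) ⬝₁
        (M.id1 (A ⊗₀ B) ⊗₁ M.mid4 A B A B ⊗₁ M.id1 (A ⊗₀ B)) := by
    unfold mid
    rw [← t_c, ← t_c, e, t_c, t_c] <;> simp
  rw [mid8_eq, c_assoc, m4, m1, c_assoc, c_assoc (k := M.mid4 A B _ _), ← c_assoc (g := M.mid4 A B _ _), n1, m2, c_assoc,
    ← c_assoc (f := _ ⊗₁ M.mid4 A B A B ⊗₁ _), ← m3,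
    ← t_c (g := M.id1 (A ⊗₀ B)) (f := M.id1 (A ⊗₀ B)), ← n2, t_c, c_assoc] <;> simp

end Coherence

/-- A correspondence between the cells of two symmetric strict monoidal 2-categories that is
compatible with all the operations and that is the graph of a map. -/
structure Corr (K L : SymMonTwoCat.{u}) where
  R0 : K.C0 → L.C0 → Prop
  R1 : K.C1 → L.C1 → Prop
  R2 : K.C2 → L.C2 → Prop
  ex0 : ∀ X, ∃ Y, R0 X Y
  ex1 : ∀ f, ∃ g, R1 f g
  ex2 : ∀ a, ∃ b, R2 a b
  uniq0 : ∀ {X Y Y'}, R0 X Y → R0 X Y' → Y = Y'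
  uniq1 : ∀ {f g g'}, R1 f g → R1 f g' → g = g'
  uniq2 : ∀ {a b b'}, R2 a b → R2 a b' → b = b'
  dom : ∀ {f g}, R1 f g → R0 (K.dom f) (L.dom g)
  cod : ∀ {f g}, R1 f g → R0 (K.cod f) (L.cod g)
  src : ∀ {a b}, R2 a b → R1 (K.src a) (L.src b)
  tgt : ∀ {a b}, R2 a b → R1 (K.tgt a) (L.tgt b)
  id1 : ∀ {X Y}, R0 X Y → R1 (K.id1 X) (L.id1 Y)
  id2 : ∀ {f g}, R1 f g → R2 (K.id2 f) (L.id2 g)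
  comp : ∀ {f g f' g'} (h : K.cod f = K.dom g) (h' : L.cod f' = L.dom g'), R1 g g' → R1 f f' →
    R1 (g ⬝₁ f) (g' ⬝₁ f')
  vcomp : ∀ {a b a' b'} (h : K.tgt a = K.src b) (h' : L.tgt a' = L.src b'), R2 b b' → R2 a a' →
    R2 (b ⬝ᵥ a) (b' ⬝ᵥ a')
  hcomp : ∀ {a b a' b'} (h : K.cod (K.src a) = K.dom (K.src b))
    (h' : L.cod (L.src a') = L.dom (L.src b')), R2 b b' → R2 a a' → R2 (b ⬝ₕ a) (b' ⬝ₕ a')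
  unit : R0 K.unit L.unit
  t0 : ∀ {X Y X' Y'}, R0 X X' → R0 Y Y' → R0 (X ⊗₀ Y) (X' ⊗₀ Y')
  t1 : ∀ {X Y X' Y'}, R1 X X' → R1 Y Y' → R1 (X ⊗₁ Y) (X' ⊗₁ Y')
  t2 : ∀ {X Y X' Y'}, R2 X X' → R2 Y Y' → R2 (X ⊗₂ Y) (X' ⊗₂ Y')
  σ : ∀ {X Y X' Y'}, R0 X X' → R0 Y Y' → R1 (K.σ X Y) (L.σ X' Y')

namespace Corr

variable {K L : SymMonTwoCat.{u}} (R : Corr K L)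

/-- The symmetric strict monoidal 2-functor with the given graph. -/
noncomputable def functor : SymFunctor K L where
  map0 X := (R.ex0 X).choose
  map1 f := (R.ex1 f).choose
  map2 a := (R.ex2 a).choose
  dom_map f := R.uniq0 (R.dom (R.ex1 f).choose_spec) (R.ex0 _).choose_spec
  cod_map f := R.uniq0 (R.cod (R.ex1 f).choose_spec) (R.ex0 _).choose_spec
  src_map a := R.uniq1 (R.src (R.ex2 a).choose_spec) (R.ex1 _).choose_spec
  tgt_map a := R.uniq1 (R.tgt (R.ex2 a).choose_spec) (R.ex1 _).choose_spec
  map_id1 X := R.uniq1 (R.ex1 _).choose_spec (R.id1 (R.ex0 X).choose_spec)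
  map_id2 f := R.uniq2 (R.ex2 _).choose_spec (R.id2 (R.ex1 f).choose_spec)
  map_comp g f h := by
    have h' : L.cod (R.ex1 f).choose = L.dom (R.ex1 g).choose :=
      R.uniq0 (R.cod (R.ex1 f).choose_spec) (h ▸ R.dom (R.ex1 g).choose_spec)
    have k := R.comp h h' (R.ex1 g).choose_spec (R.ex1 f).choose_spec
    rw [c_def h, c_def h'] at k
    exact R.uniq1 (R.ex1 _).choose_spec k
  map_vcomp g f h := by
    have h' : L.tgt (R.ex2 f).choose = L.src (R.ex2 g).choose :=
      R.uniq1 (R.tgt (R.ex2 f).choose_spec) (h ▸ R.src (R.ex2 g).choose_spec)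
    have k := R.vcomp h h' (R.ex2 g).choose_spec (R.ex2 f).choose_spec
    rw [vc_def h, vc_def h'] at k
    exact R.uniq2 (R.ex2 _).choose_spec k
  map_hcomp g f h := by
    have h' : L.cod (L.src (R.ex2 f).choose) = L.dom (L.src (R.ex2 g).choose) :=
      R.uniq0 (R.cod (R.src (R.ex2 f).choose_spec)) (h ▸ R.dom (R.src (R.ex2 g).choose_spec))
    have k := R.hcomp h h' (R.ex2 g).choose_spec (R.ex2 f).choose_spec
    rw [hc_def h, hc_def h'] at k
    exact R.uniq2 (R.ex2 _).choose_spec k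
  isStrict :=
    { map_unit := R.uniq0 (R.ex0 _).choose_spec R.unit
      map_t0 := fun X Y => R.uniq0 (R.ex0 _).choose_spec
        (R.t0 (R.ex0 X).choose_spec (R.ex0 Y).choose_spec)
      map_t1 := fun X Y => R.uniq1 (R.ex1 _).choose_spec
        (R.t1 (R.ex1 X).choose_spec (R.ex1 Y).choose_spec)
      map_t2 := fun X Y => R.uniq2 (R.ex2 _).choose_spec
        (R.t2 (R.ex2 X).choose_spec (R.ex2 Y).choose_spec) }
  map_σ X Y := R.uniq1 (R.ex1 _).choose_spec (R.σ (R.ex0 X).choose_spec (R.ex0 Y).choose_spec)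

theorem functor_map0 (X : K.C0) : R.R0 X (R.functor.map0 X) := (R.ex0 X).choose_spec
theorem functor_map1 (f : K.C1) : R.R1 f (R.functor.map1 f) := (R.ex1 f).choose_spec
theorem functor_map2 (a : K.C2) : R.R2 a (R.functor.map2 a) := (R.ex2 a).choose_spec

end Corr

section

variable {M N : SymMonTwoCat.{u}}

/-- The monoidal product of duoidal data. -/
noncomputable def DuoData.tensor (M : SymMonTwoCat.{u}) (d e : DuoData M.toTwoCat) :
    DuoData M.toTwoCat :=
  ⟨M.tensorPsm d.v e.v, M.tensorPsm d.h e.h, (d.ξ ⊗₂ e.ξ) ⬝ₕ 𝟏(M.mid8 d.v.A e.v.A),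
    d.ξup ⊗₂ e.ξup, d.ξdn ⊗₂ e.ξdn, d.ξud ⊗₂ e.ξud⟩

/-- The duoidal data of the unit object. -/
def DuoData.unit (M : SymMonTwoCat.{u}) : DuoData M.toTwoCat :=
  ⟨unitPsm M.toMonTwoCat, unitPsm M.toMonTwoCat, 𝟏(M.id1 M.unit), 𝟏(M.id1 M.unit),
    𝟏(M.id1 M.unit), 𝟏(M.id1 M.unit)⟩

theorem SymFunctor.mapPsm_t (F : SymFunctor M N) {d e : PsmData M.toTwoCat}
    (hd : IsPseudomonoid M.toMonTwoCat d) (he : IsPseudomonoid M.toMonTwoCat e)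
    (hde : IsPseudomonoid M.toMonTwoCat (M.tensorPsm d e)) :
    F.mapPsm (M.tensorPsm d e) = N.tensorPsm (F.mapPsm d) (F.mapPsm e) := by
  have h := F.lax_tensorPsm hd he
  rwa [F.lax_psm hd, F.lax_psm he, F.lax_psm hde] at h

theorem SymFunctor.mapPsm_unit (F : SymFunctor M N) :
    F.mapPsm (unitPsm M.toMonTwoCat) = unitPsm N.toMonTwoCat := by
  have h : F.map0 M.unit = N.unit := F.isStrict.map_unit
  simp [SymFunctor.mapPsm, unitPsm, h]

theorem monComp_strictCell {K : MonTwoCat.{u}} {d d' d'' : PsmData K.toTwoCat}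
    {g : CellData K.toTwoCat} {f : K.C1} (hd : IsPseudomonoid K d) (hd' : IsPseudomonoid K d')
    (hg : IsMonoidal1 K d' d'' g) (hf : IsMonoidal1 K d d' (d.strictCell f)) :
    g.monComp (d.strictCell f) = ⟨g.f ⬝₁ f, g.φ2 ⬝ₕ 𝟏(f ⊗₁ f), g.φ0⟩ := by
  obtain ⟨dm, cm, du, cu, -⟩ := hd
  obtain ⟨dm', cm', du', cu', -⟩ := hd'
  obtain ⟨df, cf, s2, t2, s0, t0, -⟩ := hf
  obtain ⟨dg, cg, s2', t2', s0', t0', -⟩ := hg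
  simp only [PsmData.strictCell, src_id2] at df cf s2 s0
  have h : K.dom (K.src g.φ2) = d'.A ⊗₀ d'.A := by
    rw [← K.dom_tgt, t2', dom_c, dm']
    rw [cm', dg]
  rw [s2'] at h
  refine CellData.ext rfl ?_ ?_ <;> simp only [PsmData.strictCell, CellData.monComp]
  · rw [hc_id_id, id_vc]
    · rw [tgt_hc, t2', s2, tgt_id2, c_assoc]
      all_goals clear s2 s0
      all_goals simp [*]
    · clear s2 s0
      simp [*]
  · rw [hc_id_id, id_vc]
    · rw [t0', s0]
    · clear s2 s0
      simp [*]

theorem SymFunctor.mapCell_opComp (F : SymFunctor M N) {d d' d'' : PsmData M.toTwoCat}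
    {g f : CellData M.toTwoCat} (hd : IsPseudomonoid M.toMonTwoCat d)
    (hd' : IsPseudomonoid M.toMonTwoCat d') (hd'' : IsPseudomonoid M.toMonTwoCat d'')
    (hg : IsOpmonoidal1 M.toMonTwoCat d' d'' g) (hf : IsOpmonoidal1 M.toMonTwoCat d d' f) :
    F.mapCell (g.opComp f) = (F.mapCell g).opComp (F.mapCell f) := by
  have h := F.lax.cell_comp hd hd' hg hf
  rwa [F.lax_cell hd hf, F.lax_cell hd' hg, F.lax_cell hd (hg.comp hd hd' hd'' hf)] at h

theorem tensorPsm_assoc {d e k : PsmData M.toTwoCat} (hd : IsPseudomonoid M.toMonTwoCat d)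
    (he : IsPseudomonoid M.toMonTwoCat e) (hk : IsPseudomonoid M.toMonTwoCat k) :
    M.tensorPsm (M.tensorPsm d e) k = M.tensorPsm d (M.tensorPsm e k) :=
  tensor_psm_assoc hd he hk

theorem tensorPsm_law {d e : PsmData M.toTwoCat} (hd : IsPseudomonoid M.toMonTwoCat d)
    (he : IsPseudomonoid M.toMonTwoCat e) : IsPseudomonoid M.toMonTwoCat (M.tensorPsm d e) :=
  M.tensorLax.psm_law (hd.pair he)

theorem tensorCell_law {d e d' e' : PsmData M.toTwoCat} {x y : CellData M.toTwoCat}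
    (hd : IsPseudomonoid M.toMonTwoCat d) (he : IsPseudomonoid M.toMonTwoCat e)
    (hd' : IsPseudomonoid M.toMonTwoCat d') (he' : IsPseudomonoid M.toMonTwoCat e')
    (hx : IsOpmonoidal1 M.toMonTwoCat d d' x) (hy : IsOpmonoidal1 M.toMonTwoCat e e' y) :
    IsOpmonoidal1 M.toMonTwoCat (M.tensorPsm d e) (M.tensorPsm d' e') (M.tensorCell x y) :=
  M.tensorLax.cell_law (hd.pair he) (hd'.pair he') (.pair hd hd' he he' hx hy)

theorem SymFunctor.mapCell_t (F : SymFunctor M N) {d e d' e' : PsmData M.toTwoCat}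
    {x y : CellData M.toTwoCat} (hd : IsPseudomonoid M.toMonTwoCat d)
    (he : IsPseudomonoid M.toMonTwoCat e) (hd' : IsPseudomonoid M.toMonTwoCat d')
    (he' : IsPseudomonoid M.toMonTwoCat e') (hx : IsOpmonoidal1 M.toMonTwoCat d d' x)
    (hy : IsOpmonoidal1 M.toMonTwoCat e e' y) :
    F.mapCell (M.tensorCell x y) = N.tensorCell (F.mapCell x) (F.mapCell y) := by
  have h := F.lax_tensorCell hd he hd' he' hx hy
  rwa [F.lax_cell hd hx, F.lax_cell he hy,
    F.lax_cell (tensorPsm_law hd he) (tensorCell_law hd he hd' he' hx hy)] at h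

theorem SymFunctor.mapCell_strictCell (F : SymFunctor M N) {d : PsmData M.toTwoCat} {f : M.C1}
    (hd : IsPseudomonoid M.toMonTwoCat d) (hf : M.dom f = d.A) :
    F.mapCell (d.strictCell f) = (F.mapPsm d).strictCell (F.map1 f) := by
  obtain ⟨dm, cm, du, cu, -⟩ := hd
  refine CellData.ext rfl ?_ ?_
  · change F.map2 (𝟏(f ⬝₁ d.m)) = 𝟏(F.map1 f ⬝₁ F.map1 d.m)
    rw [F.map_id2, F.map_c (by simp [*])]
  · change F.map2 (𝟏(f ⬝₁ d.u)) = 𝟏(F.map1 f ⬝₁ F.map1 d.u)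
    rw [F.map_id2, F.map_c (by simp [*])]

theorem SymFunctor.mapCell_idCell (F : SymFunctor M N) (d : PsmData M.toTwoCat) :
    F.mapCell d.idCell = (F.mapPsm d).idCell :=
  CellData.ext (F.map_id1 _) (F.map_id2 _) (F.map_id2 _)

/-- The composite of `(1,1)`-oidal 1-cells (first `f`, then `g`), on the level of data. -/
noncomputable def OidalData.comp (M : SymMonTwoCat.{u}) (g f : OidalData M.toTwoCat) :
    OidalData M.toTwoCat :=
  ⟨g.f ⬝₁ f.f, (g.mon.monComp f.mon).φ2, (g.mon.monComp f.mon).φ0, (g.opm.opComp f.opm).φ2,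
    (g.opm.opComp f.opm).φ0⟩

/-- The monoidal product of `(1,1)`-oidal 1-cells, on the level of data. -/
noncomputable def OidalData.tensor (M : SymMonTwoCat.{u}) (f g : OidalData M.toTwoCat) :
    OidalData M.toTwoCat :=
  ⟨f.f ⊗₁ g.f, (M.tensorCell f.mon g.mon).φ2, (M.tensorCell f.mon g.mon).φ0,
    (M.tensorCell f.opm g.opm).φ2, (M.tensorCell f.opm g.opm).φ0⟩

/-- A 1-cell with identity 2-cells as its `(1,1)`-oidal structure. -/
noncomputable def DuoData.strict (d : DuoData M.toTwoCat) (f : M.C1) : OidalData M.toTwoCat :=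
  ⟨f, 𝟏(f ⬝₁ d.v.m), 𝟏(f ⬝₁ d.v.u), 𝟏(f ⬝₁ d.h.m), 𝟏(f ⬝₁ d.h.u)⟩

/-- The identity `(1,1)`-oidal 1-cell, on the level of data. -/
def DuoData.idOidal (d : DuoData M.toTwoCat) : OidalData M.toTwoCat :=
  ⟨M.id1 d.v.A, 𝟏 d.v.m, 𝟏 d.v.u, 𝟏 d.h.m, 𝟏 d.h.u⟩

theorem OidalData.ext_cell {r s : OidalData M.toTwoCat} (hm : r.mon = s.mon)
    (ho : r.opm = s.opm) : r = s :=
  OidalData.ext (congrArg CellData.f hm) (congrArg CellData.φ2 hm) (congrArg CellData.φ0 hm)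
    (congrArg CellData.φ2 ho) (congrArg CellData.φ0 ho)

section Read

theorem read0_unit : read0 M (obj01 (obj10 M)).unit = DuoData.unit M := by
  have h := (forget10 M).mapPsm_unit
  exact DuoData.ext psm10_unit h rfl rfl rfl rfl

theorem read0_t (X Y : (obj01 (obj10 M)).C0) :
    read0 M (X ⊗₀ Y) = DuoData.tensor M (read0 M X) (read0 M Y) := by
  have hX : IsPseudomonoid (obj10 M).toMonTwoCat X.data := X.law
  have hY : IsPseudomonoid (obj10 M).toMonTwoCat Y.data := Y.law
  have hXY := tensorPsm_law hX hY
  have h := (forget10 M).mapPsm_t hX hY hXY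
  have e : mon1 M ((obj10 M).tensorPsm X.data Y.data).m = 
      ⟨((mon1 M X.data.m).f ⊗₁ (mon1 M Y.data.m).f) ⬝₁
        M.mid4 (psm10 M X.data.A).A (psm10 M Y.data.A).A (psm10 M X.data.A).A (psm10 M Y.data.A).A,
      ((mon1 M X.data.m).φ2 ⊗₂ (mon1 M Y.data.m).φ2) ⬝ₕ 𝟏(M.mid8 (psm10 M X.data.A).A (psm10 M Y.data.A).A),
      (mon1 M X.data.m).φ0 ⊗₂ (mon1 M Y.data.m).φ0⟩ := by
    let A : (obj10 M).C0 := X.data.A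
    let B : (obj10 M).C0 := Y.data.A
    let m : (obj10 M).C1 := X.data.m
    let n : (obj10 M).C1 := Y.data.m
    have lA : IsPseudomonoid M.toMonTwoCat (psm10 M A) := psm10_law A
    have lB : IsPseudomonoid M.toMonTwoCat (psm10 M B) := psm10_law B
    have dm : (obj10 M).dom m = A ⊗₀ A := hX.dom_m
    have dn : (obj10 M).dom n = B ⊗₀ B := hY.dom_m
    have cm : (obj10 M).cod m = A := hX.cod_m
    have cn : (obj10 M).cod n = B := hY.cod_m
    have lm := mon1_law m
    have ln := mon1_law n
    have lmn := mon1_law (m ⊗₁ n)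
    have ls := mon1_law ((obj10 M).id1 A ⊗₁ (obj10 M).σ B A ⊗₁ (obj10 M).id1 B)
    have ds : (obj10 M).dom ((obj10 M).id1 A ⊗₁ (obj10 M).σ B A ⊗₁ (obj10 M).id1 B) =
        A ⊗₀ B ⊗₀ A ⊗₀ B := by simp
    have cs : (obj10 M).cod ((obj10 M).id1 A ⊗₁ (obj10 M).σ B A ⊗₁ (obj10 M).id1 B) =
        (obj10 M).dom (m ⊗₁ n) := by simp [*]
    rw [ds, cs] at ls
    have es : mon1 M ((obj10 M).id1 A ⊗₁ (obj10 M).σ B A ⊗₁ (obj10 M).id1 B) =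
        (psm10 M (A ⊗₀ B ⊗₀ A ⊗₀ B)).strictCell
          (M.mid4 (psm10 M A).A (psm10 M B).A (psm10 M A).A (psm10 M B).A) := by
      have t := tensorPsm_law lB lA
      rw [mon1_t, mon1_t, mon1_σ, mon1_id, mon1_id, ← strictCell_id lA, ← strictCell_id lB, ← psm10_A,
        ← psm10_A,
        tensorCell_strict t lB (dom_σ _ _) (M.dom_id1 _),
        tensorCell_strict lA (tensorPsm_law t lB) (M.dom_id1 _) ?_, psm10_t, psm10_t, psm10_t,
        ← tensorPsm_assoc lB lA lB]
      · rfl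
      · refine (M.tensor.dom_map (M.σ (psm10 M B).A (psm10 M A).A, M.id1 (psm10 M B).A)).trans ?_
        exact congrArg₂ M.t0 (dom_σ _ _) (M.dom_id1 _)
    have e1 : mon1 M ((obj10 M).tensorPsm X.data Y.data).m =
        mon1 M ((m ⊗₁ n) ⬝₁ ((obj10 M).id1 A ⊗₁ (obj10 M).σ B A ⊗₁ (obj10 M).id1 B)) := rfl
    rw [e1, mon1_c (by simp [*]), es]
    rw [es] at ls
    rw [monComp_strictCell (psm10_law _) (psm10_law _) lmn ls, mon1_t]
    obtain ⟨df, cf, -, t2, -⟩ := lm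
    obtain ⟨df', cf', -, t2', -⟩ := ln
    rw [dm, psm10_t] at df t2
    rw [dn, psm10_t] at df' t2'
    have dA := lA.dom_m
    have dB := lB.dom_m
    have cA := lA.cod_m
    have cB := lB.cod_m
    have d2 : M.dom (M.src (mon1 M m).φ2) = ((psm10 M A).A ⊗₀ (psm10 M A).A) ⊗₀
        ((psm10 M A).A ⊗₀ (psm10 M A).A) := by
      rw [← M.dom_tgt, t2, tensorPsm_eq]
      rw [tensorPsm_eq] at df
      simp [*]
    have d2' : M.dom (M.src (mon1 M n).φ2) = ((psm10 M B).A ⊗₀ (psm10 M B).A) ⊗₀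
        ((psm10 M B).A ⊗₀ (psm10 M B).A) := by
      rw [← M.dom_tgt, t2', tensorPsm_eq]
      rw [tensorPsm_eq] at df'
      simp [*]
    refine CellData.ext rfl ?_ rfl
    change (((mon1 M m).φ2 ⊗₂ (mon1 M n).φ2) ⬝ₕ 𝟏(M.mid4 (M.dom (mon1 M m).f)
      (M.dom (mon1 M n).f) (M.dom (mon1 M m).f) (M.dom (mon1 M n).f))) ⬝ₕ
        𝟏(M.mid4 _ _ _ _ ⊗₁ M.mid4 _ _ _ _) = _
    rw [df, df']
    change (((mon1 M m).φ2 ⊗₂ (mon1 M n).φ2) ⬝ₕ 𝟏(M.mid4 ((psm10 M A).A ⊗₀ (psm10 M A).A)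
      ((psm10 M B).A ⊗₀ (psm10 M B).A) ((psm10 M A).A ⊗₀ (psm10 M A).A)
      ((psm10 M B).A ⊗₀ (psm10 M B).A))) ⬝ₕ _ = _
    rw [hc_assoc, hc_id_id]
    · rfl
    · simp
    · simp
    · simp [d2, d2']
  refine DuoData.ext (psm10_t _ _) h (congrArg CellData.φ2 e) (congrArg CellData.φ0 e) ?_ ?_
  · have lu := mon1_law (M := M) X.data.u
    have lv := mon1_law (M := M) Y.data.u
    refine (congrArg CellData.φ2 (mon1_t X.data.u Y.data.u)).trans ?_
    have du : M.dom (mon1 M X.data.u).f = M.unit := lu.dom_f.trans (congrArg (fun A => (psm10 M A).A) hX.dom_u)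
    have dv : M.dom (mon1 M Y.data.u).f = M.unit := lv.dom_f.trans (congrArg (fun A => (psm10 M A).A) hY.dom_u)
    have tu := lu.tgt_φ2
    have tv := lv.tgt_φ2
    rw [show (obj10 M).dom X.data.u = (obj10 M).unit from hX.dom_u, psm10_unit] at tu
    rw [show (obj10 M).dom Y.data.u = (obj10 M).unit from hY.dom_u, psm10_unit] at tv
    have su : M.dom (M.src (mon1 M X.data.u).φ2) = M.unit := by
      rw [← M.dom_tgt, tu]; simp [unitPsm, du]
    have sv : M.dom (M.src (mon1 M Y.data.u).φ2) = M.unit := by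
      rw [← M.dom_tgt, tv]; simp [unitPsm, dv]
    rw [tensorCell_eq, du, dv]
    simp [su, sv]
    rfl
  · exact congrArg CellData.φ0 (mon1_t X.data.u Y.data.u)

theorem read1_id (X : (obj01 (obj10 M)).C0) :
    read1 M ((obj01 (obj10 M)).id1 X) = (read0 M X).idOidal :=
  OidalData.ext_cell (mon1_id X.data.A) ((forget10 M).mapCell_idCell X.data)

theorem read1_c {G F : (obj01 (obj10 M)).C1}
    (h : (obj01 (obj10 M)).cod F = (obj01 (obj10 M)).dom G) :
    read1 M (G ⬝₁ F) = OidalData.comp M (read1 M G) (read1 M F) := by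
  have e : (Opmonoidal1.data (M := (obj10 M).toMonTwoCat) (G ⬝₁ F)) = _ := opm_c (M := obj10 M) h
  have lF := opm_law (M := obj10 M) (F := F) rfl h
  have lG := opm_law (M := obj10 M) (F := G) rfl rfl
  refine OidalData.ext_cell ?_ ?_
  · refine (congrArg (fun c => mon1 M (CellData.f c)) e).trans ?_
    exact mon1_c (lF.cod_f.trans lG.dom_f.symm)
  · refine (congrArg (forget10 M).mapCell e).trans ?_
    exact (forget10 M).mapCell_opComp F.dom.law G.dom.law G.cod.law lG lF

theorem read1_t (F G : (obj01 (obj10 M)).C1) :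
    read1 M (F ⊗₁ G) = OidalData.tensor M (read1 M F) (read1 M G) :=
  OidalData.ext_cell (mon1_t F.data.f G.data.f)
    ((forget10 M).mapCell_t F.dom.law G.dom.law F.cod.law G.cod.law F.law G.law)

theorem read1_σ (X Y : (obj01 (obj10 M)).C0) : read1 M ((obj01 (obj10 M)).σ X Y) =
    (DuoData.tensor M (read0 M X) (read0 M Y)).strict (M.σ (read0 M X).v.A (read0 M Y).v.A) := by
  have hX : IsPseudomonoid (obj10 M).toMonTwoCat X.data := X.law
  have hY : IsPseudomonoid (obj10 M).toMonTwoCat Y.data := Y.law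
  have h := (forget10 M).mapPsm_t hX hY (tensorPsm_law hX hY)
  refine OidalData.ext_cell (mon1_σ X.data.A Y.data.A) ?_
  refine ((forget10 M).mapCell_strictCell (f := (obj10 M).σ X.data.A Y.data.A)
    (tensorPsm_law hX hY) (by simp; rfl)).trans ?_
  rw [h, (forget10 M).map_σ]
  rfl

end Read

end

section

variable {M N : SymMonTwoCat.{u}}

theorem SymFunctor.mapCell_monComp (F : SymFunctor M N) {d d' d'' : PsmData M.toTwoCat}
    {g f : CellData M.toTwoCat} (hd : IsPseudomonoid M.toMonTwoCat d)
    (hd' : IsPseudomonoid M.toMonTwoCat d') (hd'' : IsPseudomonoid M.toMonTwoCat d'')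
    (hg : IsMonoidal1 M.toMonTwoCat d' d'' g) (hf : IsMonoidal1 M.toMonTwoCat d d' f) :
    F.mapCell (g.monComp f) = (F.mapCell g).monComp (F.mapCell f) := by
  obtain ⟨dm, cm, du, cu, -⟩ := hd
  obtain ⟨dm', cm', du', cu', -⟩ := hd'
  obtain ⟨dm'', cm'', du'', cu'', -⟩ := hd''
  obtain ⟨df, cf, s2, t2', s0, t0', -⟩ := hf
  obtain ⟨df', cf', s2', t2'', s0', t0'', -⟩ := hg
  refine CellData.ext ?_ ?_ ?_ <;> simp only [SymFunctor.mapCell, CellData.monComp]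
  · rw [F.map_c]; simp [*]
  · rw [F.map_vc, F.map_hc, F.map_hc, F.map_id2, F.map_id2, F.isStrict.map_t1]
    all_goals simp (maxDischargeDepth := 9) [*, c_assoc]
  · rw [F.map_vc, F.map_hc, F.map_id2]
    all_goals simp (maxDischargeDepth := 9) [*, c_assoc]

theorem SymFunctor.mapCell_t_mon (F : SymFunctor M N) {d e d' e' : PsmData M.toTwoCat}
    {x y : CellData M.toTwoCat} (hd : IsPseudomonoid M.toMonTwoCat d)
    (he : IsPseudomonoid M.toMonTwoCat e) (hx : IsMonoidal1 M.toMonTwoCat d d' x)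
    (hy : IsMonoidal1 M.toMonTwoCat e e' y) :
    F.mapCell (M.tensorCell x y) = N.tensorCell (F.mapCell x) (F.mapCell y) := by
  obtain ⟨dm, cm, -⟩ := hd
  obtain ⟨dm', cm', -⟩ := he
  obtain ⟨dx, cx, s2, t2, -⟩ := hx
  obtain ⟨dy, cy, s2', t2', -⟩ := hy
  have hx2 : M.dom (M.src x.φ2) = d.A ⊗₀ d.A := by rw [← M.dom_tgt, t2]; simp [*]
  have hy2 : M.dom (M.src y.φ2) = e.A ⊗₀ e.A := by rw [← M.dom_tgt, t2']; simp [*]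
  rw [tensorCell_eq, tensorCell_eq]
  refine CellData.ext (F.isStrict.map_t1 _ _) ?_ (F.isStrict.map_t2 _ _)
  simp only [SymFunctor.mapCell]
  rw [F.map_hc, F.isStrict.map_t2, F.map_id2, F.isStrict.map_t1, F.isStrict.map_t1, F.map_id1,
    F.map_id1, F.map_σ, F.dom_map, F.dom_map]
  clear s2 s2'
  simp [*]

section Read

theorem read1'_id (X : (obj10 (obj01 M)).C0) :
    read1' M ((obj10 (obj01 M)).id1 X) = (read0' M X).idOidal :=
  rfl

theorem read1'_c {G F : (obj10 (obj01 M)).C1}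
    (h : (obj10 (obj01 M)).cod F = (obj10 (obj01 M)).dom G) :
    read1' M (G ⬝₁ F) = OidalData.comp M (read1' M G) (read1' M F) := by
  have lF := mon1_law F
  have lG := mon1_law G
  rw [h] at lF
  refine OidalData.ext_cell ?_ ?_
  · exact (congrArg (forget01 M).mapCell (mon1_c h)).trans
      ((forget01 M).mapCell_monComp (psm10_law _) (psm10_law _) (psm10_law _) lG lF)
  · refine (congrArg (fun c : CellData (obj01 M).toTwoCat =>
      Opmonoidal1.data (M := M.toMonTwoCat) c.f) (mon1_c h)).trans ?_
    exact opm_c (lF.cod_f.trans lG.dom_f.symm)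

theorem read1'_t (F G : (obj10 (obj01 M)).C1) :
    read1' M (F ⊗₁ G) = OidalData.tensor M (read1' M F) (read1' M G) := by
  refine OidalData.ext_cell ?_ rfl
  exact (congrArg (forget01 M).mapCell (mon1_t F G)).trans
    ((forget01 M).mapCell_t_mon (psm10_law _) (psm10_law _) (mon1_law F) (mon1_law G))

theorem read0'_v_psm10 (X : (obj10 (obj01 M)).C0) :
    (read0' M X).v = (forget01 M).mapPsm (psm10 (obj01 M) X) :=
  congrArg DuoData.v (read0'_eq_duo01 X)

theorem read0'_unit : read0' M (obj10 (obj01 M)).unit = DuoData.unit M := by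
  refine DuoData.ext ?_ rfl ?_ rfl rfl rfl
  · exact (read0'_v_psm10 _).trans ((congrArg (forget01 M).mapPsm psm10_unit).trans
      (forget01 M).mapPsm_unit)
  · change 𝟏(M.id1 M.unit) ⬝ₕ 𝟏(M.id1 M.unit ⊗₁ M.σ M.unit M.unit ⊗₁ M.id1 M.unit) = 𝟏(M.id1 M.unit)
    simp

theorem read0'_t (X Y : (obj10 (obj01 M)).C0) :
    read0' M (X ⊗₀ Y) = DuoData.tensor M (read0' M X) (read0' M Y) := by
  have hX := psm10_law X
  have hY := psm10_law Y
  have e : read0' M (X ⊗₀ Y) = DuoData.dual M (DuoData.tensor M.co (read0 M.co X) (read0 M.co Y)) :=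
    (read0'_eq _).trans (congrArg (DuoData.dual M) (read0_t (M := M.co) X Y))
  refine DuoData.ext ?_ rfl ?_ ((congrArg DuoData.ξup e).trans rfl)
    ((congrArg DuoData.ξdn e).trans rfl) rfl
  · refine (read0'_v_psm10 _).trans ((congrArg (forget01 M).mapPsm (psm10_t X Y)).trans
      (((forget01 M).mapPsm_t hX hY (tensorPsm_law hX hY)).trans ?_))
    rw [← read0'_v_psm10, ← read0'_v_psm10]
    rfl
  · have kX := dom_src_duo01 hX
    have kY := dom_src_duo01 hY
    refine (congrArg DuoData.ξ e).trans ?_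
    let A : M.C0 := (psm01 M (psm10 (obj01 M) X).A).A
    let B : M.C0 := (psm01 M (psm10 (obj01 M) Y).A).A
    let x : M.C2 := (Opmonoidal1.data (M := M.toMonTwoCat) (psm10 (obj01 M) X).m).φ2
    let y : M.C2 := (Opmonoidal1.data (M := M.toMonTwoCat) (psm10 (obj01 M) Y).m).φ2
    have kx : M.dom (M.src x) = A ⊗₀ A ⊗₀ A ⊗₀ A := kX
    have ky : M.dom (M.src y) = B ⊗₀ B ⊗₀ B ⊗₀ B := kY
    have e1 : (DuoData.dual M (DuoData.tensor M.co (read0 M.co X) (read0 M.co Y))).ξ =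
        ((x ⊗₂ y) ⬝ₕ 𝟏(M.mid8 A B)) ⬝ₕ 𝟏(M.mid (A ⊗₀ B)) :=
      congrArg (fun z => M.hc z _) (co_hc (M := M.toTwoCat) _ _)
    have e2 : (DuoData.tensor M (read0' M X) (read0' M Y)).ξ =
        ((x ⬝ₕ 𝟏(M.mid A)) ⊗₂ (y ⬝ₕ 𝟏(M.mid B))) ⬝ₕ 𝟏(M.mid8 A B) := rfl
    rw [e1, e2]
    clear_value x y A B
    have e3 := mid8_mid (M := M) A B
    have d8 : M.dom (M.mid8 A B) = (A ⊗₀ B) ⊗₀ (A ⊗₀ B) ⊗₀ (A ⊗₀ B) ⊗₀ (A ⊗₀ B) := by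
      simp [mid8]
    have c8 : M.cod (M.mid8 A B) = (A ⊗₀ A ⊗₀ A ⊗₀ A) ⊗₀ B ⊗₀ B ⊗₀ B ⊗₀ B := by
      simp [mid8]
    rw [hc_assoc, hc_id_id, e3, t_hc, t_id2, hc_assoc, hc_id_id]
    all_goals simp [*]

theorem read1'_σ (X Y : (obj10 (obj01 M)).C0) : read1' M ((obj10 (obj01 M)).σ X Y) =
    (DuoData.tensor M (read0' M X) (read0' M Y)).strict
      (M.σ (read0' M X).v.A (read0' M Y).v.A) := by
  have hX := psm10_law X
  have hY := psm10_law Y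
  refine OidalData.ext_cell ?_ rfl
  refine (congrArg (forget01 M).mapCell (mon1_σ X Y)).trans
    (((forget01 M).mapCell_strictCell (tensorPsm_law hX hY) ?_).trans ?_)
  · exact dom_σ (M := obj01 M) _ _
  · rw [(forget01 M).mapPsm_t hX hY (tensorPsm_law hX hY), ← read0'_v_psm10, ← read0'_v_psm10]
    rfl

end Read

end

/-- An identification of the cells of `K` with the duoidal objects, the `(1,1)`-oidal 1-cells and the
`(1,1)`-oidal 2-cells of `M` that is compatible with all the operations. -/
structure Reading (K M : SymMonTwoCat.{u}) where
  r0 : K.C0 → DuoData M.toTwoCat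
  r1 : K.C1 → OidalData M.toTwoCat
  r2 : K.C2 → M.C2
  law0 : ∀ X, IsDuoidal M (r0 X)
  law1 : ∀ f, IsOidal1 M (r0 (K.dom f)) (r0 (K.cod f)) (r1 f)
  law2 : ∀ a, IsOidal2 M (r0 (K.dom (K.src a))) (r0 (K.cod (K.src a))) (r1 (K.src a))
    (r1 (K.tgt a)) (r2 a)
  ext0 : ∀ {X Y}, r0 X = r0 Y → X = Y
  ext1 : ∀ {f g}, K.dom f = K.dom g → K.cod f = K.cod g → r1 f = r1 g → f = g
  ext2 : ∀ {a b}, K.src a = K.src b → K.tgt a = K.tgt b → r2 a = r2 b → a = b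
  surj0 : ∀ {d}, IsDuoidal M d → ∃ X, r0 X = d
  surj1 : ∀ {X Y r}, IsOidal1 M (r0 X) (r0 Y) r → ∃ f, K.dom f = X ∧ K.cod f = Y ∧ r1 f = r
  surj2 : ∀ {f g ω}, K.dom g = K.dom f → K.cod g = K.cod f →
    IsOidal2 M (r0 (K.dom f)) (r0 (K.cod f)) (r1 f) (r1 g) ω →
    ∃ a, K.src a = f ∧ K.tgt a = g ∧ r2 a = ω
  unit : r0 K.unit = DuoData.unit M
  t0 : ∀ X Y, r0 (X ⊗₀ Y) = DuoData.tensor M (r0 X) (r0 Y)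
  id1 : ∀ X, r1 (K.id1 X) = (r0 X).idOidal
  comp : ∀ {f g}, K.cod f = K.dom g → r1 (g ⬝₁ f) = OidalData.comp M (r1 g) (r1 f)
  t1 : ∀ f g, r1 (f ⊗₁ g) = OidalData.tensor M (r1 f) (r1 g)
  σ : ∀ X Y, r1 (K.σ X Y) = (DuoData.tensor M (r0 X) (r0 Y)).strict (M.σ (r0 X).v.A (r0 Y).v.A)
  id2 : ∀ f, r2 (K.id2 f) = M.id2 (r1 f).f
  vcomp : ∀ {a b}, K.tgt a = K.src b → r2 (b ⬝ᵥ a) = r2 b ⬝ᵥ r2 a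
  hcomp : ∀ {a b}, K.cod (K.src a) = K.dom (K.src b) → r2 (b ⬝ₕ a) = r2 b ⬝ₕ r2 a
  t2 : ∀ a b, r2 (a ⊗₂ b) = r2 a ⊗₂ r2 b

namespace Reading

variable {K L M : SymMonTwoCat.{u}}

/-- The correspondence between the cells of `K` and `L` that are identified with the same data in
`M`. -/
def corr (P : Reading K M) (Q : Reading L M) : Corr K L where
  R0 X Y := Q.r0 Y = P.r0 X
  R1 f g := Q.r0 (L.dom g) = P.r0 (K.dom f) ∧ Q.r0 (L.cod g) = P.r0 (K.cod f) ∧ Q.r1 g = P.r1 f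
  R2 a b := (Q.r0 (L.dom (L.src b)) = P.r0 (K.dom (K.src a)) ∧
      Q.r0 (L.cod (L.src b)) = P.r0 (K.cod (K.src a)) ∧ Q.r1 (L.src b) = P.r1 (K.src a)) ∧
    Q.r1 (L.tgt b) = P.r1 (K.tgt a) ∧ Q.r2 b = P.r2 a
  ex0 X := Q.surj0 (P.law0 X)
  ex1 f := by
    obtain ⟨X, hX⟩ := Q.surj0 (P.law0 (K.dom f))
    obtain ⟨Y, hY⟩ := Q.surj0 (P.law0 (K.cod f))
    have h := P.law1 f
    rw [← hX, ← hY] at h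
    obtain ⟨g, rfl, rfl, e⟩ := Q.surj1 h
    exact ⟨g, hX, hY, e⟩
  ex2 a := by
    obtain ⟨X, hX⟩ := Q.surj0 (P.law0 (K.dom (K.src a)))
    obtain ⟨Y, hY⟩ := Q.surj0 (P.law0 (K.cod (K.src a)))
    have h := P.law1 (K.src a)
    have h' := P.law1 (K.tgt a)
    have h2 := P.law2 a
    rw [K.dom_tgt, K.cod_tgt] at h'
    rw [← hX, ← hY] at h h' h2
    obtain ⟨f, df, cf, ef⟩ := Q.surj1 h
    obtain ⟨g, dg, cg, eg⟩ := Q.surj1 h'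
    rw [← ef, ← eg, ← df, ← cf] at h2
    obtain ⟨b, rfl, rfl, e⟩ := Q.surj2 (dg.trans df.symm) (cg.trans cf.symm) h2
    exact ⟨b, ⟨by rw [df, hX], by rw [cf, hY], ef⟩, eg, e⟩
  uniq0 h h' := Q.ext0 (h.trans h'.symm)
  uniq1 h h' := Q.ext1 (Q.ext0 (h.1.trans h'.1.symm)) (Q.ext0 (h.2.1.trans h'.2.1.symm))
    (h.2.2.trans h'.2.2.symm)
  uniq2 {a b b'} h h' := by
    obtain ⟨⟨h1, h2, h3⟩, h4, h5⟩ := h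
    obtain ⟨⟨k1, k2, k3⟩, k4, k5⟩ := h'
    have e1 := Q.ext0 (h1.trans k1.symm)
    have e2 := Q.ext0 (h2.trans k2.symm)
    refine Q.ext2 (Q.ext1 e1 e2 (h3.trans k3.symm))
      (Q.ext1 ?_ ?_ (h4.trans k4.symm)) (h5.trans k5.symm)
    · rw [L.dom_tgt, L.dom_tgt, e1]
    · rw [L.cod_tgt, L.cod_tgt, e2]
  dom h := h.1
  cod h := h.2.1
  src h := h.1
  tgt h := by simpa using ⟨h.1.1, h.1.2.1, h.2.1⟩
  id1 h := by simp [P.id1, Q.id1, h]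
  id2 h := by simp [P.id2, Q.id2, h]
  comp h h' := by
    rintro ⟨h1, h2, h3⟩ ⟨k1, k2, k3⟩
    simp [*, P.comp h, Q.comp h']
  vcomp h h' := by
    rintro ⟨⟨h1, h2, h3⟩, h4, h5⟩ ⟨⟨k1, k2, k3⟩, k4, k5⟩
    rw [P.vcomp h, Q.vcomp h', src_vc h, src_vc h', tgt_vc h, tgt_vc h', h5, k5]
    exact ⟨⟨k1, k2, k3⟩, h4, rfl⟩
  hcomp {a b a' b'} h h' := by
    rintro ⟨⟨h1, h2, h3⟩, h4, h5⟩ ⟨⟨k1, k2, k3⟩, k4, k5⟩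
    have g : K.cod (K.tgt a) = K.dom (K.tgt b) := by simpa using h
    have g' : L.cod (L.tgt a') = L.dom (L.tgt b') := by simpa using h'
    rw [P.hcomp h, Q.hcomp h', src_hc h, src_hc h', tgt_hc h, tgt_hc h', h5, k5, dom_c h, dom_c h',
      cod_c h, cod_c h', P.comp h, Q.comp h', P.comp g, Q.comp g', h3, h4, k3, k4]
    exact ⟨⟨k1, h2, rfl⟩, rfl, rfl⟩
  unit := Q.unit.trans P.unit.symm
  t0 h h' := by rw [P.t0, Q.t0, h, h']
  t1 := by
    rintro f g f' g' ⟨h1, h2, h3⟩ ⟨k1, k2, k3⟩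
    simp [P.t0, Q.t0, P.t1, Q.t1, *]
  t2 := by
    rintro a b a' b' ⟨⟨h1, h2, h3⟩, h4, h5⟩ ⟨⟨k1, k2, k3⟩, k4, k5⟩
    simp [P.t0, Q.t0, P.t1, Q.t1, P.t2, Q.t2, *]
  σ h h' := by simp [P.t0, Q.t0, P.σ, Q.σ, *]

/-- The symmetric strict monoidal 2-functor that keeps the data in `M`. -/
noncomputable def functor (P : Reading K M) (Q : Reading L M) : SymFunctor K L :=
  (P.corr Q).functor

variable (P : Reading K M) (Q : Reading L M)

@[simp] theorem functor_r0 (X : K.C0) : Q.r0 ((P.functor Q).map0 X) = P.r0 X :=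
  (P.corr Q).functor_map0 X
@[simp] theorem functor_r1 (f : K.C1) : Q.r1 ((P.functor Q).map1 f) = P.r1 f :=
  ((P.corr Q).functor_map1 f).2.2
@[simp] theorem functor_r2 (a : K.C2) : Q.r2 ((P.functor Q).map2 a) = P.r2 a :=
  ((P.corr Q).functor_map2 a).2.2

theorem hom_ext {F G : SymFunctor K L} (h0 : ∀ X, Q.r0 (F.map0 X) = Q.r0 (G.map0 X))
    (h1 : ∀ f, Q.r1 (F.map1 f) = Q.r1 (G.map1 f)) (h2 : ∀ a, Q.r2 (F.map2 a) = Q.r2 (G.map2 a)) :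
    F = G := by
  have e0 := fun X => Q.ext0 (h0 X)
  have e1 := fun f => Q.ext1 (f := F.map1 f) (g := G.map1 f) (by simp [e0]) (by simp [e0]) (h1 f)
  exact SymFunctor.ext' (TwoFunctor.ext (funext e0) (funext e1)
    (funext fun a => Q.ext2 (by simp [e1]) (by simp [e1]) (h2 a)))

theorem functor_comp_functor : (Q.functor P).comp (P.functor Q) = SymFunctor.id K :=
  P.hom_ext (fun X => (Q.functor_r0 P _).trans (P.functor_r0 Q X))
    (fun X => (Q.functor_r1 P _).trans (P.functor_r1 Q X))
    (fun X => (Q.functor_r2 P _).trans (P.functor_r2 Q X))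

end Reading

section

variable (M : SymMonTwoCat.{u})

/-- The identification of the cells of `(M₁₀)₀₁`. -/
noncomputable def reading : Reading (obj01 (obj10 M)) M where
  r0 := read0 M
  r1 := read1 M
  r2 := read2 M
  law0 := isDuoidal_read0
  law1 := isOidal1_read1
  law2 := isOidal2_read2
  ext0 h := read0_injective h
  ext1 hd hc h := read1_ext hd hc h
  ext2 hs ht h := read2_ext hs ht h
  surj0 h := exists_read0 h
  surj1 h := exists_read1 h
  surj2 hd hc h := exists_read2 hd hc h
  unit := read0_unit
  t0 := read0_t
  id1 := read1_id
  comp h := read1_c h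
  t1 := read1_t
  σ := read1_σ
  id2 f := ((forget10 M).comp (forget01 (obj10 M))).map_id2 f
  vcomp h := ((forget10 M).comp (forget01 (obj10 M))).map_vc h
  hcomp h := ((forget10 M).comp (forget01 (obj10 M))).map_hc h
  t2 a b := ((forget10 M).comp (forget01 (obj10 M))).isStrict.map_t2 a b

/-- The identification of the cells of `(M₀₁)₁₀`. -/
noncomputable def reading' : Reading (obj10 (obj01 M)) M where
  r0 := read0' M
  r1 := read1' M
  r2 := read2' M
  law0 := isDuoidal_read0'
  law1 := isOidal1_read1'
  law2 a := by
    rw [← (obj10 (obj01 M)).dom_tgt, ← (obj10 (obj01 M)).cod_tgt]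
    exact isOidal2_read2' (M := M) a
  ext0 h := injective_read0' h
  ext1 hd hc h := read1'_ext hd hc h
  ext2 hs ht h := read2'_ext ht hs h
  surj0 h := exists_read0' h
  surj1 h := exists_read1' h
  surj2 hd hc h := exists_read2' hd hc h
  unit := read0'_unit
  t0 := read0'_t
  id1 := read1'_id
  comp h := read1'_c h
  t1 := read1'_t
  σ := read1'_σ
  id2 f := ((forget01 M).comp (forget10 (obj01 M))).map_id2 f
  vcomp h := ((forget01 M).comp (forget10 (obj01 M))).map_vc h
  hcomp h := ((forget01 M).comp (forget10 (obj01 M))).map_hc h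
  t2 a b := ((forget01 M).comp (forget10 (obj01 M))).isStrict.map_t2 a b

end

section

variable {M N : SymMonTwoCat.{u}}

namespace SymFunctor

/-- The image of duoidal data under a symmetric strict monoidal 2-functor. -/
def mapDuo (F : SymFunctor M N) (d : DuoData M.toTwoCat) : DuoData N.toTwoCat :=
  ⟨F.mapPsm d.v, F.mapPsm d.h, F.map2 d.ξ, F.map2 d.ξup, F.map2 d.ξdn, F.map2 d.ξud⟩

/-- The image of the data of a `(1,1)`-oidal 1-cell under a symmetric strict monoidal 2-functor. -/
def mapOidal (F : SymFunctor M N) (r : OidalData M.toTwoCat) : OidalData N.toTwoCat :=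
  ⟨F.map1 r.f, F.map2 r.φdn2, F.map2 r.φdn0, F.map2 r.φup2, F.map2 r.φup0⟩

/-- The value of `(-)₁₀` on a symmetric strict monoidal 2-functor. -/
noncomputable def map10 (F : SymFunctor M N) : SymFunctor (obj10 M) (obj10 N) := F.co.map01.co

/-- The value of `(-)₀₁` on a symmetric strict monoidal 2-functor. -/
noncomputable def obj01Map (F : SymFunctor M N) : SymFunctor (obj01 M) (obj01 N) := F.map01

variable (F : SymFunctor M N)

theorem psm01_map (A : (obj01 M).C0) : psm01 N (F.obj01Map.map0 A) = F.mapPsm (psm01 M A) :=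
  F.lax_psm (Pseudomonoid.law (M := M.toMonTwoCat) A)

theorem opm_map (f : (obj01 M).C1) : Opmonoidal1.data (M := N.toMonTwoCat) (F.obj01Map.map1 f) =
    F.mapCell (Opmonoidal1.data (M := M.toMonTwoCat) f) :=
  F.lax_cell (Pseudomonoid.law (M := M.toMonTwoCat) _) (Opmonoidal1.law (M := M.toMonTwoCat) f)

theorem psm10_map (A : (obj10 M).C0) : psm10 N (F.map10.map0 A) = F.mapPsm (psm10 M A) := by
  have h := Pseudomonoid.law (M := M.co.toMonTwoCat) A
  have e := F.co.psm01_map A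
  have i1 := (IsInverse.map F.toTwoFunctor (IsInvertible.co h.inv_α).inv2).inv2_eq
  have i2 := (IsInverse.map F.toTwoFunctor (IsInvertible.co h.inv_lam).inv2).inv2_eq
  have i3 := (IsInverse.map F.toTwoFunctor (IsInvertible.co h.inv_rho).inv2).inv2_eq
  refine (congrArg (PsmData.ofCo (M := N.toTwoCat)) e).trans ?_
  exact PsmData.ext rfl rfl rfl i1 i2 i3

theorem mon1_map (f : (obj10 M).C1) : mon1 N (F.map10.map1 f) = F.mapCell (mon1 M f) := by
  have e := F.co.opm_map f
  exact CellData.ext (congrArg (CellData.f (M := N.toTwoCat.co)) e)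
    (congrArg (CellData.φ2 (M := N.toTwoCat.co)) e) (congrArg (CellData.φ0 (M := N.toTwoCat.co)) e)

theorem read0_map (X : (obj01 (obj10 M)).C0) :
    read0 N (F.map10.obj01Map.map0 X) = F.mapDuo (read0 M X) := by
  have e : Pseudomonoid.data (M := (obj10 N).toMonTwoCat) (F.map10.obj01Map.map0 X) =
    F.map10.mapPsm X.data := F.map10.psm01_map X
  have e1 := F.mon1_map X.data.m
  have e2 := F.mon1_map X.data.u
  refine DuoData.ext ?_ ?_ ?_ ?_ ?_ ?_
  · exact (congrArg (fun d => psm10 N (PsmData.A d)) e).trans (F.psm10_map _)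
  · exact congrArg (forget10 N).mapPsm e
  · exact (congrArg (fun d => (mon1 N (PsmData.m d)).φ2) e).trans (congrArg CellData.φ2 e1)
  · exact (congrArg (fun d => (mon1 N (PsmData.m d)).φ0) e).trans (congrArg CellData.φ0 e1)
  · exact (congrArg (fun d => (mon1 N (PsmData.u d)).φ2) e).trans (congrArg CellData.φ2 e2)
  · exact (congrArg (fun d => (mon1 N (PsmData.u d)).φ0) e).trans (congrArg CellData.φ0 e2)

theorem read1_map (f : (obj01 (obj10 M)).C1) :
    read1 N (F.map10.obj01Map.map1 f) = F.mapOidal (read1 M f) := by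
  have e := F.map10.opm_map f
  refine OidalData.ext_cell ?_ (congrArg (forget10 N).mapCell e)
  exact (congrArg (fun c => mon1 N (CellData.f c)) e).trans (F.mon1_map _)

theorem read2_map (a : (obj01 (obj10 M)).C2) :
    read2 N (F.map10.obj01Map.map2 a) = F.map2 (read2 M a) := rfl

theorem duo01_map {d : PsmData (obj01 M).toTwoCat}
    (hd : IsPseudomonoid (obj01 M).toMonTwoCat d) :
    duo01 N (F.obj01Map.mapPsm d) = F.mapDuo (duo01 M d) := by
  have e1 := F.opm_map d.m
  have e2 := F.opm_map d.u
  refine DuoData.ext rfl (F.psm01_map _) ?_ (congrArg CellData.φ2 e2) (congrArg CellData.φ0 e1)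
    (congrArg CellData.φ0 e2)
  refine (congrArg (fun c => N.hc (CellData.φ2 c) _) e1).trans ?_
  have k := dom_src_duo01 hd
  refine Eq.trans ?_ (F.map_hc ?_).symm
  · refine congrArg (N.hc _) ?_
    refine Eq.trans ?_ (F.map_id2 _).symm
    unfold SymMonTwoCat.mid
    rw [F.isStrict.map_t1, F.isStrict.map_t1, F.map_id1, F.map_σ]
    rfl
  · rw [src_id2, k]
    exact cod_mid _

theorem read0'_map (X : (obj10 (obj01 M)).C0) :
    read0' N (F.obj01Map.map10.map0 X) = F.mapDuo (read0' M X) := by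
  refine (read0'_eq_duo01 _).trans ?_
  refine (congrArg (duo01 N) (F.obj01Map.psm10_map X)).trans ?_
  exact (F.duo01_map (psm10_law X)).trans (congrArg F.mapDuo (read0'_eq_duo01 X)).symm

theorem read1'_map (f : (obj10 (obj01 M)).C1) :
    read1' N (F.obj01Map.map10.map1 f) = F.mapOidal (read1' M f) := by
  have e := F.obj01Map.mon1_map f
  refine OidalData.ext_cell (congrArg (forget01 N).mapCell e) ?_
  exact (congrArg (fun c : CellData (obj01 N).toTwoCat =>
      Opmonoidal1.data (M := N.toMonTwoCat) c.f) e).trans (F.opm_map _)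

theorem read2'_map (a : (obj10 (obj01 M)).C2) :
    read2' N (F.obj01Map.map10.map2 a) = F.map2 (read2' M a) := rfl

end SymFunctor

/-- The value of `(-)₁₀` on a monoidal 2-natural transformation. -/
noncomputable def IsMonNat.app10 {F G : SymFunctor M N} {θ : M.C0 → N.C1} (h : IsMonNat F G θ)
    (A : (obj10 M).C0) : (obj10 N).C1 := h.co.app01 A

theorem IsMonNat.map10 {F G : SymFunctor M N} {θ : M.C0 → N.C1} (h : IsMonNat F G θ) :
    IsMonNat F.map10 G.map10 h.app10 := h.co.map01.co

theorem IsMonNat.obj01Map {F G : SymFunctor M N} {θ : M.C0 → N.C1} (h : IsMonNat F G θ) :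
    IsMonNat F.obj01Map G.obj01Map h.app01 := h.map01

theorem read1_app {F G : SymFunctor M N} {θ : M.C0 → N.C1} (h : IsMonNat F G θ)
    (X : (obj01 (obj10 M)).C0) : read1 N (h.map10.app01 X) =
      (read0 N (F.map10.obj01Map.map0 X)).strict (θ (read0 M X).v.A) := by
  refine OidalData.ext_cell rfl ?_
  exact (forget10 N).mapCell_strictCell (F.map10.lax.psm_law X.law) (h.map10.isTwoNat.dom_app _)

theorem read1'_app {F G : SymFunctor M N} {θ : M.C0 → N.C1} (h : IsMonNat F G θ)
    (X : (obj10 (obj01 M)).C0) : read1' N (h.obj01Map.app10 X) =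
      (read0' N (F.obj01Map.map10.map0 X)).strict (θ (read0' M X).v.A) := by
  refine OidalData.ext_cell ?_ rfl
  refine ((forget01 N).mapCell_strictCell (psm10_law (F.obj01Map.map10.map0 X))
    (h.obj01Map.isTwoNat.dom_app _)).trans ?_
  rw [← read0'_v_psm10]
  rfl

end

section

variable (M : SymMonTwoCat.{u})

/-- The isomorphism from `(M₁₀)₀₁` to `(M₀₁)₁₀`. -/
noncomputable def swap : SymFunctor (obj01 (obj10 M)) (obj10 (obj01 M)) :=
  (reading M).functor (reading' M)

/-- The isomorphism from `(M₀₁)₁₀` to `(M₁₀)₀₁`. -/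
noncomputable def swapInv : SymFunctor (obj10 (obj01 M)) (obj01 (obj10 M)) :=
  (reading' M).functor (reading M)

theorem swap_read0 (X : (obj01 (obj10 M)).C0) : read0' M ((swap M).map0 X) = read0 M X :=
  (reading M).functor_r0 (reading' M) X
theorem swap_read1 (X : (obj01 (obj10 M)).C1) : read1' M ((swap M).map1 X) = read1 M X :=
  (reading M).functor_r1 (reading' M) X
theorem swap_read2 (X : (obj01 (obj10 M)).C2) : read2' M ((swap M).map2 X) = read2 M X :=
  (reading M).functor_r2 (reading' M) X

theorem swapInv_swap : (swapInv M).comp (swap M) = SymFunctor.id _ :=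
  (reading M).functor_comp_functor (reading' M)

theorem swap_swapInv : (swap M).comp (swapInv M) = SymFunctor.id _ :=
  (reading' M).functor_comp_functor (reading M)

variable {M} {N : SymMonTwoCat.{u}}

theorem swap_nat (F : SymFunctor M N) :
    (swap N).comp F.map10.obj01Map = F.obj01Map.map10.comp (swap M) := by
  refine (reading' N).hom_ext (fun X => ?_) (fun X => ?_) (fun X => ?_)
  · exact (swap_read0 N _).trans ((F.read0_map X).trans
      ((congrArg F.mapDuo (swap_read0 M X)).symm.trans (F.read0'_map _).symm))
  · exact (swap_read1 N _).trans ((F.read1_map X).trans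
      ((congrArg F.mapOidal (swap_read1 M X)).symm.trans (F.read1'_map _).symm))
  · exact (swap_read2 N _).trans ((F.read2_map X).trans
      ((congrArg F.map2 (swap_read2 M X)).symm.trans (F.read2'_map _).symm))

theorem swap_app {F G : SymFunctor M N} {θ : M.C0 → N.C1} (h : IsMonNat F G θ)
    (X : (obj01 (obj10 M)).C0) :
    (swap N).map1 (h.map10.app01 X) = h.obj01Map.app10 ((swap M).map0 X) := by
  have e := fun F : SymFunctor M N => congrArg (fun H => H.map0 X) (swap_nat F)
  refine (reading' N).ext1 ?_ ?_ ?_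
  · exact ((swap N).dom_map _).trans ((congrArg (swap N).map0 (h.map10.obj01Map.isTwoNat.dom_app X)).trans
      ((e F).trans (h.obj01Map.map10.isTwoNat.dom_app _).symm))
  · exact ((swap N).cod_map _).trans ((congrArg (swap N).map0 (h.map10.obj01Map.isTwoNat.cod_app X)).trans
      ((e G).trans (h.obj01Map.map10.isTwoNat.cod_app _).symm))
  · refine (swap_read1 N _).trans ((read1_app h X).trans (Eq.trans ?_ (read1'_app h _).symm))
    rw [swap_read0, F.read0_map, F.read0'_map, swap_read0]

end

section

theorem IsTwoNat.of_total {M N : TwoCat.{u}} {F G : TwoFunctor M N} {app : M.C0 → N.C1}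
    (hd : ∀ A, N.dom (app A) = F.map0 A) (hc : ∀ A, N.cod (app A) = G.map0 A)
    (h1 : ∀ f, app (M.cod f) ⬝₁ F.map1 f = G.map1 f ⬝₁ app (M.dom f))
    (h2 : ∀ a, 𝟏(app (M.cod (M.src a))) ⬝ₕ F.map2 a = G.map2 a ⬝ₕ 𝟏(app (M.dom (M.src a)))) :
    IsTwoNat F G app where
  dom_app := hd
  cod_app := hc
  nat1 f := by rw [← c_def, ← c_def, h1]
  nat2 a := by rw [← hc_def, ← hc_def, h2]

theorem IsTwoNat.vcomp {M N : TwoCat.{u}} {F G H : TwoFunctor M N} {a b : M.C0 → N.C1}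
    (hb : IsTwoNat G H b) (ha : IsTwoNat F G a) : IsTwoNat F H fun A => b A ⬝₁ a A := by
  have da := ha.dom_app
  have ca := ha.cod_app
  have db := hb.dom_app
  have cb := hb.cod_app
  refine .of_total (by simp [*]) (by simp [*]) (fun f => ?_) (fun x => ?_)
  · rw [c_assoc, ha.c_nat, ← c_assoc, hb.c_nat, c_assoc] <;> simp [*]
  · rw [id2_c, hc_assoc, ha.hc_nat, ← hc_assoc, hb.hc_nat, hc_assoc, id2_c] <;> simp [*]

theorem IsTwoNat.whiskerLeft {M N K : TwoCat.{u}} {F G : TwoFunctor M N} {a : M.C0 → N.C1}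
    (ha : IsTwoNat F G a) (H : TwoFunctor N K) :
    IsTwoNat (H.comp F) (H.comp G) fun A => H.map1 (a A) := by
  have da := ha.dom_app
  have ca := ha.cod_app
  refine .of_total (fun A => by simp [da, TwoFunctor.comp]) (fun A => by simp [ca, TwoFunctor.comp])
    (fun f => ?_) (fun x => ?_)
  · change H.map1 _ ⬝₁ H.map1 (F.map1 f) = H.map1 (G.map1 f) ⬝₁ H.map1 _
    rw [← H.map_c, ← H.map_c, ha.c_nat] <;> simp [*]
  · change 𝟏(H.map1 _) ⬝ₕ H.map2 (F.map2 x) = H.map2 (G.map2 x) ⬝ₕ 𝟏(H.map1 _)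
    rw [← H.map_id2, ← H.map_id2, ← H.map_hc, ← H.map_hc, ha.hc_nat] <;> simp [*]

namespace TwoNatIso

variable {M N K : TwoCat.{u}} {F G H : TwoFunctor M N}

theorem inv_app_c (Θ : TwoNatIso F G) (A : M.C0) : Θ.inv.app A ⬝₁ Θ.app A = N.id1 (F.map0 A) := 
  (c_def ((Θ.isTwoNat.cod_app A).trans (Θ.inv.isTwoNat.dom_app A).symm)).trans (Θ.inv_app A)

theorem app_inv_c (Θ : TwoNatIso F G) (A : M.C0) : Θ.app A ⬝₁ Θ.inv.app A = N.id1 (G.map0 A) := 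
  (c_def ((Θ.inv.isTwoNat.cod_app A).trans (Θ.isTwoNat.dom_app A).symm)).trans (Θ.app_inv A)

/-- The identity 2-natural isomorphism. -/
def refl (F : TwoFunctor M N) : TwoNatIso F F :=
  have h : IsTwoNat F F fun A => N.id1 (F.map0 A) := .of_total (by simp) (by simp)
    (fun f => by rw [id_c (by simp), c_id (by simp)])
    (fun a => by rw [id_hc (by simp), hc_id (by simp)])
  ⟨⟨_, h⟩, ⟨_, h⟩, fun A => by rw [← c_def, c_id (by simp)], fun A => by rw [← c_def, c_id (by simp)]⟩

/-- The inverse of a 2-natural isomorphism. -/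
def symm (Θ : TwoNatIso F G) : TwoNatIso G F :=
  ⟨Θ.inv, Θ.toTwoNatTrans, Θ.app_inv, Θ.inv_app⟩

/-- The composite of 2-natural isomorphisms. -/
noncomputable def trans (Θ : TwoNatIso F G) (Ψ : TwoNatIso G H) : TwoNatIso F H :=
  ⟨⟨_, Ψ.isTwoNat.vcomp Θ.isTwoNat⟩, ⟨_, Θ.inv.isTwoNat.vcomp Ψ.inv.isTwoNat⟩,
    fun A => by
      have d1 := Θ.isTwoNat.dom_app A
      have c1 := Θ.isTwoNat.cod_app A
      have d2 := Θ.inv.isTwoNat.dom_app A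
      have c2 := Θ.inv.isTwoNat.cod_app A
      have d3 := Ψ.isTwoNat.dom_app A
      have c3 := Ψ.isTwoNat.cod_app A
      have d4 := Ψ.inv.isTwoNat.dom_app A
      have c4 := Ψ.inv.isTwoNat.cod_app A
      rw [← c_def, c_assoc, ← c_assoc (g := Ψ.app A), Ψ.inv_app_c, id_c, Θ.inv_app_c] <;> simp [*],
    fun A => by
      have d1 := Θ.isTwoNat.dom_app A
      have c1 := Θ.isTwoNat.cod_app A
      have d2 := Θ.inv.isTwoNat.dom_app A
      have c2 := Θ.inv.isTwoNat.cod_app A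
      have d3 := Ψ.isTwoNat.dom_app A
      have c3 := Ψ.isTwoNat.cod_app A
      have d4 := Ψ.inv.isTwoNat.dom_app A
      have c4 := Ψ.inv.isTwoNat.cod_app A
      rw [← c_def, c_assoc, ← c_assoc (g := Θ.inv.app A), Θ.app_inv_c, id_c, Ψ.app_inv_c] <;>
        simp [*]⟩

/-- Whiskering of a 2-natural isomorphism with a 2-functor out of its codomain. -/
def whiskerLeft (Θ : TwoNatIso F G) (P : TwoFunctor N K) : TwoNatIso (P.comp F) (P.comp G) :=
  ⟨⟨_, Θ.isTwoNat.whiskerLeft P⟩, ⟨_, Θ.inv.isTwoNat.whiskerLeft P⟩,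
    fun A => by rw [← P.map_comp _ _ ((Θ.isTwoNat.cod_app A).trans (Θ.inv.isTwoNat.dom_app A).symm), Θ.inv_app, P.map_id1]; rfl,
    fun A => by rw [← P.map_comp _ _ ((Θ.inv.isTwoNat.cod_app A).trans (Θ.isTwoNat.dom_app A).symm), Θ.app_inv, P.map_id1]; rfl⟩

/-- Whiskering of a 2-natural isomorphism with a 2-functor into its domain. -/
def whiskerRight (Θ : TwoNatIso F G) (P : TwoFunctor K M) : TwoNatIso (F.comp P) (G.comp P) :=
  ⟨⟨_, Θ.isTwoNat.whisker P⟩, ⟨_, Θ.inv.isTwoNat.whisker P⟩,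
    fun A => Θ.inv_app _, fun A => Θ.app_inv _⟩

end TwoNatIso

end

theorem id_c_eq_c_id {K : TwoCat.{u}} {p q r : K.C1} {A B : K.C0} (h : p = q) (hd : K.dom q = B)
    (hc : K.cod q = A) (hr : r = K.id1 B) : K.id1 A ⬝₁ p = q ⬝₁ r := by
  rw [h, hr, c_id hd, id_c hc]

theorem swapInv_nat {M N : SymMonTwoCat.{u}} (F : SymFunctor M N) :
    (swapInv N).comp F.obj01Map.map10 = F.map10.obj01Map.comp (swapInv M) := by
  have h := congrArg (fun H => ((swapInv N).comp H).comp (swapInv M)) (swap_nat F)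
  have e1 : ((swapInv N).comp ((swap N).comp F.map10.obj01Map)).comp (swapInv M) =
      ((swapInv N).comp (swap N)).comp (F.map10.obj01Map.comp (swapInv M)) := rfl
  have e2 : ((swapInv N).comp (F.obj01Map.map10.comp (swap M))).comp (swapInv M) =
      ((swapInv N).comp F.obj01Map.map10).comp ((swap M).comp (swapInv M)) := rfl
  rw [swapInv_swap] at e1
  rw [swap_swapInv] at e2
  exact e2.symm.trans (h.symm.trans e1)

theorem swap_nat2 {M N : SymMonTwoCat.{u}} {F G : SymFunctor M N} {θ : M.C0 → N.C1}
    (h : IsMonNat F G θ) (X : (obj01 (obj10 M)).C0) :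
    (obj10 (obj01 N)).id1 ((swap N).map0 (G.map10.obj01Map.map0 X)) ⬝₁
      (swap N).map1 (h.map10.app01 X) = h.obj01Map.app10 ((swap M).map0 X) ⬝₁
        F.obj01Map.map10.map1 ((obj10 (obj01 M)).id1 ((swap M).map0 X)) := by
  exact id_c_eq_c_id (swap_app h X) (h.obj01Map.map10.isTwoNat.dom_app _)
    ((h.obj01Map.map10.isTwoNat.cod_app _).trans (congrArg (fun H => H.map0 X) (swap_nat G)).symm)
    (F.obj01Map.map10.map_id1 _)

theorem swapInv_nat2 {M N : SymMonTwoCat.{u}} {F G : SymFunctor M N} {θ : M.C0 → N.C1}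
    (h : IsMonNat F G θ) (X : (obj10 (obj01 M)).C0) :
    (obj01 (obj10 N)).id1 ((swapInv N).map0 (G.obj01Map.map10.map0 X)) ⬝₁
      (swapInv N).map1 (h.obj01Map.app10 X) = h.map10.app01 ((swapInv M).map0 X) ⬝₁
        F.map10.obj01Map.map1 ((obj01 (obj10 M)).id1 ((swapInv M).map0 X)) := by
  have k1 : (swap M).map0 ((swapInv M).map0 X) = X :=
    congrArg (fun H => H.map0 X) (swap_swapInv M)
  have k2 : (swapInv N).map1 ((swap N).map1 (h.map10.app01 ((swapInv M).map0 X))) =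
      h.map10.app01 ((swapInv M).map0 X) :=
    congrArg (fun H => H.map1 (h.map10.app01 ((swapInv M).map0 X))) (swapInv_swap N)
  have k := k2.symm.trans (congrArg (swapInv N).map1 (swap_app h ((swapInv M).map0 X)))
  rw [k1] at k
  exact id_c_eq_c_id k.symm (h.map10.obj01Map.isTwoNat.dom_app _)
    ((h.map10.obj01Map.isTwoNat.cod_app _).trans (congrArg (fun H => H.map0 X) (swapInv_nat G)).symm)
    (F.map10.obj01Map.map_id1 _)

theorem isTwoNat_swap : IsTwoNat (pm01.{u}.comp pm10.{u}) (pm10.{u}.comp pm01.{u})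
    fun M => (⟨obj01 (obj10 M), obj10 (obj01 M), swap M⟩ : SMArrow.{u}) where
  dom_app M := rfl
  cod_app M := rfl
  nat1 f := congrArg (SMArrow.mk _ _) (swap_nat f.fn)
  nat2 a := SMTrans.ext' (swap_nat a.src) (swap_nat a.tgt) (funext (swap_nat2 a.isMonNat))

theorem isTwoNat_swapInv : IsTwoNat (pm10.{u}.comp pm01.{u}) (pm01.{u}.comp pm10.{u})
    fun M => (⟨obj10 (obj01 M), obj01 (obj10 M), swapInv M⟩ : SMArrow.{u}) where
  dom_app M := rfl
  cod_app M := rfl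
  nat1 f := congrArg (SMArrow.mk _ _) (swapInv_nat f.fn)
  nat2 a := SMTrans.ext' (swapInv_nat a.src) (swapInv_nat a.tgt)
    (funext (swapInv_nat2 a.isMonNat))

/-- The 2-natural isomorphism `(M₁₀)₀₁ ≅ (M₀₁)₁₀`. -/
noncomputable def swapIso : TwoNatIso (pm01.{u}.comp pm10.{u}) (pm10.{u}.comp pm01.{u}) :=
  ⟨⟨_, isTwoNat_swap⟩, ⟨_, isTwoNat_swapInv⟩, fun M => congrArg (SMArrow.mk _ _) (swapInv_swap M),
    fun M => congrArg (SMArrow.mk _ _) (swap_swapInv M)⟩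

/-- The 2-functors given by two words are 2-naturally isomorphic, compatibly with the forgetful
2-functors and with the underlying pseudomonoid structures of the 0-cells. -/
def WordIso (w w' : List Bool) : Prop :=
  ∃ (Θ : TwoNatIso (multi.{u} w) (multi.{u} w'))
    (θ : ∀ M : SymMonTwoCat.{u}, SymFunctor (multiObj w M) (multiObj w' M))
    (η : ∀ M : SymMonTwoCat.{u}, SymFunctor (multiObj w' M) (multiObj w M)),
    ∀ M : SymMonTwoCat.{u},
      Θ.app M = (⟨multiObj w M, multiObj w' M, θ M⟩ : SMArrow.{u}) ∧
      Θ.inv.app M = (⟨multiObj w' M, multiObj w M, η M⟩ : SMArrow.{u}) ∧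
      (multiForget M w').comp (θ M) = multiForget M w ∧
      ∀ X, structures M w' ((θ M).map0 X) = structures M w X

theorem SMArrow.c_mk {M N K : SymMonTwoCat.{u}} (G : SymFunctor N K) (F : SymFunctor M N) :
    SM2Cat.c (⟨N, K, G⟩ : SMArrow.{u}) (⟨M, N, F⟩ : SMArrow.{u}) =
      (⟨M, K, G.comp F⟩ : SMArrow.{u}) :=
  c_def (M := SM2Cat.{u}) (g := (⟨N, K, G⟩ : SMArrow.{u})) (f := (⟨M, N, F⟩ : SMArrow.{u})) rfl

theorem SMArrow.mk_inj {M N : SymMonTwoCat.{u}} {F G : SymFunctor M N}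
    (h : (⟨M, N, F⟩ : SMArrow.{u}) = ⟨M, N, G⟩) : F = G := by
  cases h
  rfl

theorem inverse_of_app {P Q : TwoFunctor SM2Cat.{u} SM2Cat.{u}} (Θ : TwoNatIso P Q)
    {M : SymMonTwoCat.{u}} {θ : SymFunctor (P.map0 M) (Q.map0 M)}
    {η : SymFunctor (Q.map0 M) (P.map0 M)} (h : Θ.app M = (⟨_, _, θ⟩ : SMArrow.{u}))
    (h' : Θ.inv.app M = (⟨_, _, η⟩ : SMArrow.{u})) :
    η.comp θ = SymFunctor.id _ ∧ θ.comp η = SymFunctor.id _ := by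
  have e := Θ.inv_app_c M
  have e' := Θ.app_inv_c M
  rw [h, h'] at e e'
  exact ⟨SMArrow.mk_inj ((SMArrow.c_mk η θ).symm.trans e),
    SMArrow.mk_inj ((SMArrow.c_mk θ η).symm.trans e')⟩

namespace WordIso

theorem refl (w : List Bool) : WordIso.{u} w w :=
  ⟨.refl _, fun M => SymFunctor.id _, fun M => SymFunctor.id _,
    fun M => ⟨rfl, rfl, rfl, fun _ => rfl⟩⟩

theorem symm {w w' : List Bool} (h : WordIso.{u} w w') : WordIso.{u} w' w := by
  obtain ⟨Θ, θ, η, h⟩ := h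
  refine ⟨Θ.symm, η, θ, fun M => ?_⟩
  obtain ⟨h1, h2, h3, h4⟩ := h M
  obtain ⟨-, e⟩ := inverse_of_app Θ h1 h2
  refine ⟨h2, h1, ?_, fun X => ?_⟩
  · rw [← h3]
    exact congrArg (multiForget M w').comp e
  · rw [← h4]
    exact congrArg (structures M w') (congrArg (fun F => F.map0 X) e)

theorem trans {w w' w'' : List Bool} (h : WordIso.{u} w w') (h' : WordIso.{u} w' w'') :
    WordIso.{u} w w'' := by
  obtain ⟨Θ, θ, η, h⟩ := h
  obtain ⟨Θ', θ', η', h'⟩ := h'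
  refine ⟨Θ.trans Θ', fun M => (θ' M).comp (θ M), fun M => (η M).comp (η' M), fun M => ?_⟩
  obtain ⟨h1, h2, h3, h4⟩ := h M
  obtain ⟨k1, k2, k3, k4⟩ := h' M
  refine ⟨?_, ?_, ?_, fun X => (k4 _).trans (h4 X)⟩
  · exact (congrArg₂ SM2Cat.c k1 h1).trans (SMArrow.c_mk _ _)
  · exact (congrArg₂ SM2Cat.c h2 k2).trans (SMArrow.c_mk _ _)
  · rw [← h3, ← k3]
    rfl

theorem cons (b : Bool) {w w' : List Bool} (h : WordIso.{u} w w') :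
    WordIso.{u} (b :: w) (b :: w') := by
  obtain ⟨Θ, θ, η, h⟩ := h
  cases b
  · refine ⟨Θ.whiskerLeft pm01, fun M => (θ M).obj01Map, fun M => (η M).obj01Map, fun M => ?_⟩
    obtain ⟨h1, h2, h3, h4⟩ := h M
    refine ⟨congrArg pm01.map1 h1, congrArg pm01.map1 h2, ?_, fun X => ?_⟩
    · exact congrArg (fun H : SymFunctor (multiObj w M) M => H.comp (forget01 _)) h3
    · have e := (θ M).psm01_map X
      have e2 := h4 (psm01 (multiObj w M) X).A
      change ((structures M w' (psm01 (multiObj w' M) ((θ M).obj01Map.map0 X)).A).1,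
        (multiForget M w').mapPsm (psm01 (multiObj w' M) ((θ M).obj01Map.map0 X)) ::
        (structures M w' (psm01 (multiObj w' M) ((θ M).obj01Map.map0 X)).A).2) = _
      rw [e]
      change ((structures M w' ((θ M).map0 (psm01 (multiObj w M) X).A)).1,
        ((multiForget M w').comp (θ M)).mapPsm (psm01 (multiObj w M) X) ::
        (structures M w' ((θ M).map0 (psm01 (multiObj w M) X).A)).2) = _
      rw [e2, h3]
      rfl
  · refine ⟨Θ.whiskerLeft pm10, fun M => (θ M).map10, fun M => (η M).map10, fun M => ?_⟩
    obtain ⟨h1, h2, h3, h4⟩ := h M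
    refine ⟨congrArg pm10.map1 h1, congrArg pm10.map1 h2, ?_, fun X => ?_⟩
    · exact congrArg (fun H : SymFunctor (multiObj w M) M => H.comp (forget10 _)) h3
    · have e := (θ M).psm10_map X
      have e2 := h4 (psm10 (multiObj w M) X).A
      change ((structures M w' (psm10 (multiObj w' M) ((θ M).map10.map0 X)).A).1 ++
        [(multiForget M w').mapPsm (psm10 (multiObj w' M) ((θ M).map10.map0 X))],
        (structures M w' (psm10 (multiObj w' M) ((θ M).map10.map0 X)).A).2) = _
      rw [e]
      change ((structures M w' ((θ M).map0 (psm10 (multiObj w M) X).A)).1 ++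
        [((multiForget M w').comp (θ M)).mapPsm (psm10 (multiObj w M) X)],
        (structures M w' ((θ M).map0 (psm10 (multiObj w M) X).A)).2) = _
      rw [e2, h3]
      rfl

end WordIso

theorem forget_swap (K : SymMonTwoCat.{u}) :
    ((forget01 K).comp (forget10 (obj01 K))).comp (swap K) =
      (forget10 K).comp (forget01 (obj10 K)) :=
  SymFunctor.ext' (TwoFunctor.ext (funext fun X => congrArg (fun d => d.v.A) (swap_read0 K X))
    (funext fun X => congrArg OidalData.f (swap_read1 K X)) (funext fun X => swap_read2 K X))

theorem structures_false_true (M : SymMonTwoCat.{u}) (w : List Bool)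
    (X : (multiObj (false :: true :: w) M).C0) : structures M (false :: true :: w) X =
      ((structures M w (read0 (multiObj w M) X).v.A).1 ++
        [(multiForget M w).mapPsm (read0 (multiObj w M) X).v],
        (multiForget M w).mapPsm (read0 (multiObj w M) X).h ::
          (structures M w (read0 (multiObj w M) X).v.A).2) := rfl

theorem structures_true_false (M : SymMonTwoCat.{u}) (w : List Bool)
    (X : (multiObj (true :: false :: w) M).C0) : structures M (true :: false :: w) X =
      ((structures M w (read0' (multiObj w M) X).v.A).1 ++
        [(multiForget M w).mapPsm (read0' (multiObj w M) X).v],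
        (multiForget M w).mapPsm (read0' (multiObj w M) X).h ::
          (structures M w (read0' (multiObj w M) X).v.A).2) := by
  have e := read0'_v_psm10 (M := multiObj w M) X
  rw [e]
  rfl

namespace WordIso

theorem swap (w : List Bool) : WordIso.{u} (false :: true :: w) (true :: false :: w) :=
  ⟨swapIso.whiskerRight (multi w), fun M => TwoDim.swap (multiObj w M),
    fun M => swapInv (multiObj w M), fun M => ⟨rfl, rfl,
      congrArg (multiForget M w).comp (forget_swap (multiObj w M)), fun X => by
        rw [structures_true_false, structures_false_true]
        have e := swap_read0 (multiObj w M) X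
        exact congrArg (fun d : DuoData (multiObj w M).toTwoCat =>
          ((structures M w d.v.A).1 ++ [(multiForget M w).mapPsm d.v],
            (multiForget M w).mapPsm d.h :: (structures M w d.v.A).2)) e⟩⟩

theorem of_perm {w w' : List Bool} (h : w.Perm w') : WordIso.{u} w w' := by
  induction h with
  | nil => exact refl _
  | cons b _ ih => exact ih.cons b
  | swap a b w =>
    cases a <;> cases b
    · exact refl _
    · exact (swap w).symm
    · exact swap w
    · exact refl _
  | trans _ _ ih ih' => exact ih.trans ih'

end WordIso

/-- The 0-cells that two words give are in a natural bijection that preserves the underlying data. -/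
def ZeroCellIso (w w' : List Bool) : Prop :=
  ∃ e : ∀ M : SymMonTwoCat.{u}, (multiObj w M).C0 ≃ (multiObj w' M).C0,
    (∀ M X, (multiForget M w').map0 (e M X) = (multiForget M w).map0 X) ∧
    (∀ M X, structureList M w' (e M X) = structureList M w X) ∧
    ∀ (M N : SymMonTwoCat.{u}) (F : SymFunctor M N) X,
      e N ((multiMap F w).map0 X) = (multiMap F w').map0 (e M X)

namespace ZeroCellIso

theorem refl (w : List Bool) : ZeroCellIso.{u} w w :=
  ⟨fun _ => .refl _, fun _ _ => rfl, fun _ _ => rfl, fun _ _ _ _ => rfl⟩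

theorem symm {w w' : List Bool} (h : ZeroCellIso.{u} w w') : ZeroCellIso.{u} w' w := by
  obtain ⟨e, h1, h2, h3⟩ := h
  refine ⟨fun M => (e M).symm, fun M X => ?_, fun M X => ?_, fun M N F X => ?_⟩
  · rw [← h1, Equiv.apply_symm_apply]
  · rw [← h2, Equiv.apply_symm_apply]
  · rw [Equiv.symm_apply_eq, h3, Equiv.apply_symm_apply]

theorem trans {w w' w'' : List Bool} (h : ZeroCellIso.{u} w w') (h' : ZeroCellIso.{u} w' w'') :
    ZeroCellIso.{u} w w'' := by
  obtain ⟨e, h1, h2, h3⟩ := h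
  obtain ⟨e', h1', h2', h3'⟩ := h'
  refine ⟨fun M => (e M).trans (e' M), fun M X => ?_, fun M X => ?_, fun M N F X => ?_⟩
  · rw [Equiv.trans_apply, h1', h1]
  · rw [Equiv.trans_apply, h2', h2]
  · rw [Equiv.trans_apply, h3, h3', Equiv.trans_apply]

theorem of_wordIso {w w' : List Bool} (h : WordIso.{u} w w') : ZeroCellIso.{u} w w' := by
  obtain ⟨Θ, θ, η, h⟩ := h
  refine ⟨fun M => ⟨(θ M).map0, (η M).map0, fun X => ?_, fun X => ?_⟩, fun M X => ?_, fun M X => ?_,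
    fun M N F X => ?_⟩
  · exact congrArg (fun H => H.map0 X) (inverse_of_app Θ (h M).1 (h M).2.1).1
  · exact congrArg (fun H => H.map0 X) (inverse_of_app Θ (h M).1 (h M).2.1).2
  · exact congrArg (fun H => H.map0 X) (h M).2.2.1
  · exact congrArg (fun c => c.1 ++ c.2) ((h M).2.2.2 X)
  · have n := Θ.isTwoNat.c_nat (⟨M, N, F⟩ : SMArrow.{u})
    rw [multiMap_spec, multiMap_spec] at n
    have e1 : Θ.app (SM2Cat.dom (⟨M, N, F⟩ : SMArrow.{u})) =
      (⟨multiObj w M, multiObj w' M, θ M⟩ : SMArrow.{u}) := (h M).1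
    have e2 : Θ.app (SM2Cat.cod (⟨M, N, F⟩ : SMArrow.{u})) =
      (⟨multiObj w N, multiObj w' N, θ N⟩ : SMArrow.{u}) := (h N).1
    rw [e1, e2, SMArrow.c_mk, SMArrow.c_mk] at n
    exact congrArg (fun H => H.map0 X) (SMArrow.mk_inj n)

theorem true_false (w : List Bool) : ZeroCellIso.{u} (true :: w) (false :: w) := by
  have b : ∀ K : SymMonTwoCat.{u}, Function.Bijective
      (fun X : (obj10 K).C0 => (⟨psm10 K X, psm10_law X⟩ : Pseudomonoid K.toMonTwoCat)) := fun K =>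
    ⟨fun X Y h => psm10_inj (congrArg Pseudomonoid.data h), fun Y => by
      obtain ⟨X, hX⟩ := exists_psm10 Y.law
      exact ⟨X, Pseudomonoid.ext hX⟩⟩
  refine ⟨fun M => Equiv.ofBijective _ (b (multiObj w M)), fun M X => rfl, fun M X => ?_,
    fun M N F X => ?_⟩
  · exact (List.append_cons _ _ _)
  · exact Pseudomonoid.ext (((multiMap F w).psm10_map X).trans
      ((multiMap F w).psm01_map (⟨psm10 _ X, psm10_law X⟩ : Pseudomonoid _)).symm)

theorem of_perm_true {w v : List Bool} (h : w.Perm (true :: v)) : ZeroCellIso.{u} w (false :: v) :=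
  (of_wordIso (.of_perm h)).trans (true_false v)

end ZeroCellIso

theorem perm_pqWord {w : List Bool} {p q : ℕ} (hp : w.count true = p) (hq : w.count false = q) :
    w.Perm (pqWord p q) := by
  rw [List.perm_iff_count]
  rintro (_ | _) <;> simp [pqWord, List.count_replicate, hp, hq]

theorem pqWord_succ_perm (p q : ℕ) : (pqWord (p + 1) q).Perm (true :: pqWord p q) :=
  (perm_pqWord (by simp [pqWord, List.count_replicate])
    (by simp [pqWord, List.count_replicate])).symm

theorem zeroCellIso_pqWord (p q : ℕ) : ZeroCellIso.{u} (pqWord p q) (pqWord 0 (p + q)) := by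
  induction p generalizing q with
  | zero => rw [Nat.zero_add]; exact .refl _
  | succ p ih =>
    have h := ih (q + 1)
    rw [show p + 1 + q = p + (q + 1) by omega]
    exact (ZeroCellIso.of_perm_true (pqWord_succ_perm p q)).trans h

end TwoDim

theorem mainTheorem8 :
    -- The 2-endofunctors `(-)₀₁` and `(-)₁₀` of `sm-2Cat` commute up to a 2-natural isomorphism, whose
    -- components leave the underlying data in `M` of the 0-, 1- and 2-cells unchanged.
    (∃ (Φ : TwoNatIso (pm01.{u}.comp pm10.{u}) (pm10.{u}.comp pm01.{u}))
      (φ : ∀ M : SymMonTwoCat.{u}, SymFunctor (obj01 (obj10 M)) (obj10 (obj01 M))),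
      ∀ M : SymMonTwoCat.{u},
        Φ.app M = (⟨obj01 (obj10 M), obj10 (obj01 M), φ M⟩ : SMArrow.{u}) ∧
        (∀ X, read0' M ((φ M).map0 X) = read0 M X) ∧
        (∀ F, read1' M ((φ M).map1 F) = read1 M F) ∧
        (∀ a, read2' M ((φ M).map2 a) = read2 M a)) ∧
    -- The 0-cells of both composites are the duoidal objects, their 1-cells are the `(1,1)`-oidal
    -- 1-cells, and their 2-cells are the `(1,1)`-oidal 2-cells.
    (∀ M : SymMonTwoCat.{u},
      Set.BijOn (read0 M) Set.univ {d | IsDuoidal M d} ∧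
      Set.BijOn (read0' M) Set.univ {d | IsDuoidal M d} ∧
      (∀ X Y : (obj01 (obj10 M)).C0, Set.BijOn (read1 M)
        {F | (obj01 (obj10 M)).dom F = X ∧ (obj01 (obj10 M)).cod F = Y}
        {r | IsOidal1 M (read0 M X) (read0 M Y) r}) ∧
      (∀ X Y : (obj10 (obj01 M)).C0, Set.BijOn (read1' M)
        {F | (obj10 (obj01 M)).dom F = X ∧ (obj10 (obj01 M)).cod F = Y}
        {r | IsOidal1 M (read0' M X) (read0' M Y) r}) ∧
      (∀ (X Y : (obj01 (obj10 M)).C0) (F G : (obj01 (obj10 M)).C1),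
        (obj01 (obj10 M)).dom F = X → (obj01 (obj10 M)).cod F = Y →
        (obj01 (obj10 M)).dom G = X → (obj01 (obj10 M)).cod G = Y →
        Set.BijOn (read2 M) {a | (obj01 (obj10 M)).src a = F ∧ (obj01 (obj10 M)).tgt a = G}
          {ω | IsOidal2 M (read0 M X) (read0 M Y) (read1 M F) (read1 M G) ω}) ∧
      (∀ (X Y : (obj10 (obj01 M)).C0) (F G : (obj10 (obj01 M)).C1),
        (obj10 (obj01 M)).dom F = X → (obj10 (obj01 M)).cod F = Y →
        (obj10 (obj01 M)).dom G = X → (obj10 (obj01 M)).cod G = Y →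
        Set.BijOn (read2' M) {a | (obj10 (obj01 M)).src a = F ∧ (obj10 (obj01 M)).tgt a = G}
          {ω | IsOidal2 M (read0' M X) (read0' M Y) (read1' M F) (read1' M G) ω})) ∧
    -- `(-)_{p q}` is well defined: every word with `p` letters `(-)₁₀` and `q` letters `(-)₀₁` gives
    -- the same 2-functor up to a 2-natural isomorphism, compatible with the forgetful 2-functors to
    -- `M` and with the underlying pseudomonoid structures of the 0-cells.
    multi.{u} (pqWord 0 0) = TwoFunctor.id SM2Cat.{u} ∧
    (∀ (p q : ℕ) (w : List Bool), w.count true = p → w.count false = q →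
      ∃ (Θ : TwoNatIso (multi.{u} w) (multi.{u} (pqWord p q)))
        (θ : ∀ M : SymMonTwoCat.{u}, SymFunctor (multiObj w M) (multiObj (pqWord p q) M)),
        ∀ M : SymMonTwoCat.{u},
          Θ.app M = (⟨multiObj w M, multiObj (pqWord p q) M, θ M⟩ : SMArrow.{u}) ∧
          (multiForget M (pqWord p q)).comp (θ M) = multiForget M w ∧
          ∀ X, structures M (pqWord p q) ((θ M).map0 X) = structures M w X) ∧
    -- The 0-cells of `N₁₀` and of `N₀₁` are the pseudomonoids in `N`.
    (∀ N : SymMonTwoCat.{u}, Set.BijOn (psm10 N) Set.univ {d | IsPseudomonoid N.toMonTwoCat d} ∧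
      Set.BijOn (psm01 N) Set.univ {d | IsPseudomonoid N.toMonTwoCat d}) ∧
    -- The 0-cells of `M_{p+1, q}` and of `M_{p, q+1}` are the pseudomonoids in `M_{p q}`.
    (∀ (p q : ℕ) (w : List Bool), w = pqWord (p + 1) q ∨ w = pqWord p (q + 1) →
      ∃ e : ∀ M : SymMonTwoCat.{u}, (multiObj w M).C0 ≃ (obj01 (multiObj (pqWord p q) M)).C0,
        (∀ M X, (multiForget M (pqWord p q)).map0 (psm01 _ (e M X)).A =
          (multiForget M w).map0 X) ∧
        (∀ M X, structureList M (false :: pqWord p q) (e M X) = structureList M w X) ∧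
        ∀ (M N : SymMonTwoCat.{u}) (F : SymFunctor M N) X,
          e N ((multiMap F w).map0 X) = (multiMap F (pqWord p q)).map01.map0 (e M X)) ∧
    -- The 0-cells of `M_{p q}` only depend on `p + q`.
    (∀ p q p' q' : ℕ, p + q = p' + q' →
      ∃ e : ∀ M : SymMonTwoCat.{u},
          (multiObj (pqWord p q) M).C0 ≃ (multiObj (pqWord p' q') M).C0,
        (∀ M X, (multiForget M (pqWord p' q')).map0 (e M X) =
          (multiForget M (pqWord p q)).map0 X) ∧
        (∀ M X, structureList M (pqWord p' q') (e M X) = structureList M (pqWord p q) X) ∧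
        ∀ (M N : SymMonTwoCat.{u}) (F : SymFunctor M N) X,
          e N ((multiMap F (pqWord p q)).map0 X) =
            (multiMap F (pqWord p' q')).map0 (e M X)) := by
  refine ⟨⟨swapIso, swap, fun M => ⟨rfl, swap_read0 M, swap_read1 M, swap_read2 M⟩⟩,
    fun M => ⟨bijOn_read0, bijOn_read0', bijOn_read1, bijOn_read1', bijOn_read2, bijOn_read2'⟩,
    rfl, ?_, fun N => ⟨⟨fun X _ => psm10_law X, fun X _ Y _ h => psm10_inj h, fun d hd => ?_⟩,
      fun X _ => Pseudomonoid.law (M := N.toMonTwoCat) X, fun X _ Y _ h => Pseudomonoid.ext h,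
      fun d hd => ⟨(⟨d, hd⟩ : Pseudomonoid N.toMonTwoCat), trivial, rfl⟩⟩, ?_, ?_⟩
  · intro p q w hp hq
    obtain ⟨Θ, θ, η, h⟩ := WordIso.of_perm (perm_pqWord hp hq)
    exact ⟨Θ, θ, fun M => ⟨(h M).1, (h M).2.2.1, (h M).2.2.2⟩⟩
  · obtain ⟨X, hX⟩ := exists_psm10 hd
    exact ⟨X, trivial, hX⟩
  · rintro p q w (rfl | rfl)
    · exact ZeroCellIso.of_perm_true (pqWord_succ_perm p q)
    · exact ZeroCellIso.refl (pqWord p (q + 1))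
  · intro p q p' q' h
    have k := zeroCellIso_pqWord p' q'
    rw [← h] at k
    exact (zeroCellIso_pqWord p q).trans k.symm
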